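/- Notation. On $\mathbb T^2=(\mathbb R/2\pi\mathbb Z)^2$ let $e_n(x)=\frac1{2\pi}e^{in\cdot x}$, $n\in\mathbb Z^2$, $\langle n\rangle=(1+|n|^2)^{1/2}$, $\|f\|_{H^s}=\|\langle n\rangle^s\widehat f(n)\|_{\ell^2}$, $\|f\|_{W^{s,\infty}}=\|\mathcal F^{-1}(\langle n\rangle^s\widehat f)\|_{L^\infty}$ and $\mathcal H^s=H^s\times H^{s-1}$. Let $$S(t)(u_0,u_1)=\cos(t\langle\nabla\rangle)u_0+\tfrac{\sin(t\langle\nabla\rangle)}{\langle\nabla\rangle}u_1,\qquad \mathcal I(F)(t)=\int_0^t\tfrac{\sin((t-t')\langle\nabla\rangle)}{\langle\nabla\rangle}F(t')\,dt'.$$ Let $W=\sum_n\beta_ne_n$ be a cylindrical Wiener process on $L^2(\mathbb T^2)$: the $\beta_n$ are complex Brownian motions with $\mathbb E|\beta_n(t)|^2=t$, mutually independent up to the condition $\beta_{-n}=\overline{\beta_n}$. For $\alpha\in\mathbb R$ let $$\Psi(t)=\sum_{n}e_n\int_0^t\frac{\sin((t-t')\langle n\rangle)}{\langle n\rangle^{1-\alpha}}\,d\beta_n(t')$$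 be the stochastic convolution, $\Psi_N=\pi_N\Psi$ its restriction to the frequencies $|n|\le N$, $\sigma_N(t)=\mathbb E[\Psi_N(x,t)^2]$, $\Psi^{\diamond2}=\lim_{N\to\infty}(\Psi_N^2-\sigma_N)$ the Wick power, and $Y=\mathcal I(\Psi^{\diamond2})$ the second order term. Put $s_\alpha=1-2\alpha+\min(\alpha,\frac14)$. Theorem. Let $\frac13\le\alpha<\frac5{12}$ and $s>\alpha$. For every $\sigma>\alpha$ sufficiently close to $\alpha$ (depending only on $\alpha,s$) and every sufficiently small $\varepsilon>0$ (depending only on $\alpha,s,\sigma$) the following holds. (1) Almost surely, for every $T>0$, as $N\to\infty$ we have $\Psi_N\to\Psi$ in $C([0,T];W^{-\alpha-\varepsilon,\infty})$, $\Psi_N^2-\sigma_N\to\Psi^{\diamond2}$ in $C([0,T];W^{-2\alpha-\varepsilon,\infty})$ and $\mathcal I(\Psi_N^2-\sigma_N)\to Y$ in $C([0,T];W^{s_\alpha-\varepsilon,\infty})$. Hence, for every $(u_0,u_1)\in\mathcal H^s$, the enhanced data set $\Xi=(u_0,u_1,\Psi,Y)$ almost surely belongs, for every $T>0$, to $$\mathcal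 X^{s,\varepsilon}_T=\mathcal H^s\times C([0,T];W^{-\alpha-\varepsilon,\infty})\times C([0,T];W^{s_\alpha-\varepsilon,\infty}).$$ (2) For every $(u_0,u_1)\in\mathcal H^s$ there is an almost surely positive stopping time $T=T(\omega)$ (for the filtration generated by the $\beta_n$, augmented by null events) such that, almost surely, there is a unique $v\in C([0,T];H^\sigma)$ with $$v(t)=S(t)(u_0,u_1)-\mathcal I(v^2+2v\Psi)(t)-Y(t),\qquad 0\le t\le T.$$ (3) The solution depends continuously on the enhanced data: let $T>0$, $\Xi=(u_0,u_1,Z,Y)\in\mathcal X^{s,\varepsilon}_T$ be arbitrary (deterministic), and let $v\in C([0,T];H^\sigma)$ solve $v=S(t)(u_0,u_1)-\mathcal I(v^2+2vZ)-Y$ on $[0,T]$. Then for every $\delta>0$ there is $\eta>0$ such that for every $\Xi'\in\mathcal X^{s,\varepsilon}_T$ at distance less than $\eta$ from $\Xi$, the equation with data $\Xi'$ has a unique solution $v'\in C([0,T];H^\sigma)$, and $\sup_{0\le t\le T}\|v'(t)-v(t)\|_{H^\sigma}<\delta$. -/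

import Mathlib

open MeasureTheory ProbabilityTheory Filter Topology Set
open scoped ENNReal NNReal

noncomputable section

namespace RoughWave

/-! ### Periodic distributions and function spaces on `𝕋² = (ℝ / 2πℤ)²` -/

/-- Spatial frequencies `n ∈ ℤ²`. -/
abbrev Freq : Type := ℤ × ℤ

/-- A distribution on `𝕋²`, given by its Fourier coefficients `n ↦ f̂(n)` with respect to the
orthonormal basis `e_n(x) = (2π)⁻¹ exp(i n·x)`.  The spaces `H^s` and `W^{s,∞}` below are cut out
by the finiteness of their norms, which forces polynomial growth of the coefficients. -/
abbrev Distr : Type := Freq → ℂ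

/-- `|n|²` (Euclidean). -/
def normSq (n : Freq) : ℝ := (n.1 : ℝ) ^ 2 + (n.2 : ℝ) ^ 2

/-- The Japanese bracket `⟨n⟩ = (1 + |n|²)^{1/2}`. -/
def jb (n : Freq) : ℝ := Real.sqrt (1 + normSq n)

/-- The norm `‖f‖_{H^s} = ‖⟨n⟩^s f̂(n)‖_{ℓ²}`, with value `∞` if `f ∉ H^s(𝕋²)`. -/
def hsNorm (s : ℝ) (f : Distr) : ℝ≥0∞ :=
  (∑' n : Freq, ENNReal.ofReal ((jb n ^ s * ‖f n‖) ^ 2)) ^ (1 / 2 : ℝ)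

instance instFactTwoPiPos : Fact (0 < 2 * Real.pi) := ⟨Real.two_pi_pos⟩

/-- The torus `(ℝ / 2πℤ)²`, with Lebesgue measure of total mass `(2π)²`. -/
abbrev Torus : Type := AddCircle (2 * Real.pi) × AddCircle (2 * Real.pi)

/-- `e_n(x) = (2π)⁻¹ exp(i n·x)`. -/
def basisFun (n : Freq) (x : Torus) : ℂ :=
  (2 * (Real.pi : ℂ))⁻¹ * (fourier n.1 x.1 * fourier n.2 x.2)

/-- The Fourier coefficient `∫_{𝕋²} g(x) conj(e_n(x)) dx`. -/
def torusCoeff (g : Torus → ℂ) (n : Freq) : ℂ :=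
  ∫ x : Torus, g x * (starRingEnd ℂ) (basisFun n x)

/-- The norm `‖f‖_{W^{s,∞}} = ‖ℱ⁻¹(⟨n⟩^s f̂(n))‖_{L^∞}`.  The function `g ∈ L^∞(𝕋²)` with Fourier
coefficients `⟨n⟩^s f̂(n)` is unique up to null sets; the value is `∞` if there is none. -/
def wInfNorm (s : ℝ) (f : Distr) : ℝ≥0∞ :=
  ⨅ (g : Torus → ℂ) (_ : MemLp g ∞ volume)
    (_ : ∀ n : Freq, torusCoeff g n = ((jb n ^ s : ℝ) : ℂ) * f n), eLpNorm g ∞ volume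

/-- `f ∈ C([0,T]; X)`, where `X` is the space on which the extended norm `N` is finite. -/
def ContIn (N : Distr → ℝ≥0∞) (T : ℝ) (f : ℝ → Distr) : Prop :=
  ∀ t ∈ Icc (0 : ℝ) T, N (f t) < ∞ ∧
    Tendsto (fun t' => N (f t' - f t)) (𝓝[Icc (0 : ℝ) T] t) (𝓝 0)

/-- The norm `sup_{0 ≤ t ≤ T} N (f t)` of `C([0,T]; X)`. -/
def supNorm (N : Distr → ℝ≥0∞) (T : ℝ) (f : ℝ → Distr) : ℝ≥0∞ :=
  ⨆ t ∈ Icc (0 : ℝ) T, N (f t)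

/-- The product `f g` on the Fourier side: as `e_k e_m = (2π)⁻¹ e_{k+m}`,
`(f g)^(n) = (2π)⁻¹ ∑_k f̂(k) ĝ(n - k)`.  The series converges absolutely for
`f ∈ H^a`, `g ∈ H^{-b}` with `a ≥ b`, in particular for `f ∈ H^a`, `g ∈ W^{-b,∞}`. -/
def mul (f g : Distr) : Distr :=
  fun n => (2 * (Real.pi : ℂ))⁻¹ * ∑' k : Freq, f k * g (n - k)

/-- The frequency projector `π_N` onto `|n| ≤ N`. -/
def proj (N : ℕ) (f : Distr) : Distr :=
  fun n => open Classical in if normSq n ≤ (N : ℝ) ^ 2 then f n else 0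

/-! ### The linear wave equation -/

/-- `S(t)(u₀,u₁) = cos(t⟨∇⟩) u₀ + (sin(t⟨∇⟩)/⟨∇⟩) u₁`. -/
def waveProp (t : ℝ) (u₀ u₁ : Distr) : Distr :=
  fun n => (Real.cos (t * jb n) : ℂ) * u₀ n + ((Real.sin (t * jb n) / jb n : ℝ) : ℂ) * u₁ n

/-- `ℐ(F)(t) = ∫_0^t (sin((t-t')⟨∇⟩)/⟨∇⟩) F(t') dt'`. -/
def duhamel (F : ℝ → Distr) (t : ℝ) : Distr :=
  fun n => ∫ t' in (0 : ℝ)..t, ((Real.sin ((t - t') * jb n) / jb n : ℝ) : ℂ) * F t' n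

/-! ### The cylindrical Wiener process -/

/-- Representatives of the pairs `{n, -n}`, `n ∈ ℤ² ∖ {0}`. -/
abbrev PosFreq : Type := {n : Freq // 0 < n.1 ∨ (n.1 = 0 ∧ 0 < n.2)}

/-- The real processes underlying `(β_n)`: `β_0`, and `√2 Re β_n`, `√2 Im β_n` for `n` in the
half-lattice. -/
def realProc {Ω : Type*} (β : Freq → ℝ≥0 → Ω → ℂ) :
    Option (PosFreq × Bool) → ℝ≥0 → Ω → ℝ
  | none, t, ω => (β 0 t ω).re
  | some (n, false), t, ω => Real.sqrt 2 * (β n.1 t ω).re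
  | some (n, true), t, ω => Real.sqrt 2 * (β n.1 t ω).im

/-- `W(t) = ∑_n β_n(t) e_n` is a (real-valued) cylindrical Wiener process on `L²(𝕋²)`: the `β_n` are
complex Brownian motions with `E|β_n(t)|² = t`, mutually independent up to the condition
`β_{-n} = conj β_n`; in particular `β_0` is real. -/
structure IsCylindricalWiener {Ω : Type*} [MeasurableSpace Ω] (P : Measure Ω)
    (β : Freq → ℝ≥0 → Ω → ℂ) : Prop where
  measurable : ∀ n t, Measurable (β n t)
  conj_symm : ∀ᵐ ω ∂P, ∀ n t, β (-n) t ω = (starRingEnd ℂ) (β n t ω)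
  brownian : ∀ i, IsBrownianReal (realProc β i) P
  indep : iIndepFun (fun i ω t => realProc β i t ω) P

/-- The filtration generated by the noise, augmented by the `P`-null events. -/
def noiseFiltration {Ω : Type*} [m : MeasurableSpace Ω] (P : Measure Ω)
    (β : Freq → ℝ≥0 → Ω → ℂ) (hβ : ∀ n t, Measurable (β n t)) : Filtration ℝ≥0 m where
  seq t := (⨆ (s : ℝ≥0) (_ : s ≤ t) (n : Freq), MeasurableSpace.comap (β n s) inferInstance) ⊔
    MeasurableSpace.generateFrom {A : Set Ω | MeasurableSet A ∧ P A = 0}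
  mono' := by
    intro a b hab
    refine sup_le_sup_right ?_ _
    exact iSup_le fun s => iSup_le fun hs => le_iSup_of_le s (le_iSup_of_le (hs.trans hab) le_rfl)
  le' := by
    intro t
    refine sup_le ?_ (MeasurableSpace.generateFrom_le fun A hA => hA.1)
    exact iSup_le fun s => iSup_le fun _ => iSup_le fun n => (hβ n s).comap_le

/-- The Wiener integral `∫_0^t f(t') db(t')` of a `C¹` deterministic function `f` along a path `b`,
defined by integration by parts (Paley–Wiener); for continuous `b` it is the Riemann–Stieltjes
integral. -/
def wienerInt (f : ℝ → ℝ) (b : ℝ → ℂ) (t : ℝ) : ℂ :=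
  (f t : ℂ) * b t - (f 0 : ℂ) * b 0 - ∫ t' in (0 : ℝ)..t, ((deriv f t' : ℝ) : ℂ) * b t'

/-! ### The stochastic objects -/

section Stochastic

variable {Ω : Type*} (α : ℝ) (β : Freq → ℝ≥0 → Ω → ℂ)

/-- The stochastic convolution
`Ψ(t) = ∑_n e_n ∫_0^t sin((t-t')⟨n⟩) / ⟨n⟩^{1-α} dβ_n(t')`. -/
def stochConv (ω : Ω) (t : ℝ) : Distr :=
  fun n => wienerInt (fun t' => Real.sin ((t - t') * jb n) / jb n ^ (1 - α))
    (fun t' => β n t'.toNNReal ω) t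

/-- The truncated stochastic convolution `Ψ_N = π_N Ψ`. -/
def stochConvTrunc (N : ℕ) (ω : Ω) (t : ℝ) : Distr := proj N (stochConv α β ω t)

/-- `σ_N(t) = E[Ψ_N(x,t)²]
  = (4π²)⁻¹ ∑_{|n| ≤ N} ∫_0^t (sin((t-t')⟨n⟩) / ⟨n⟩^{1-α})² dt'`. -/
def sigmaN (N : ℕ) (t : ℝ) : ℝ :=
  (4 * Real.pi ^ 2)⁻¹ * ∑' n : Freq, open Classical in
    if normSq n ≤ (N : ℝ) ^ 2 then
      ∫ t' in (0 : ℝ)..t, (Real.sin ((t - t') * jb n) / jb n ^ (1 - α)) ^ 2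
    else 0

/-- The constant function `c` on `𝕋²` (its zeroth Fourier coefficient is `2π c`). -/
def constDistr (c : ℝ) : Distr := fun n => if n = 0 then 2 * (Real.pi : ℂ) * (c : ℂ) else 0

/-- The truncated Wick power `Ψ_N² - σ_N`. -/
def wickTrunc (N : ℕ) (ω : Ω) (t : ℝ) : Distr :=
  mul (stochConvTrunc α β N ω t) (stochConvTrunc α β N ω t) - constDistr (sigmaN α N t)

/-- The Wick power of `Ψ`: the limit of `Ψ_N² - σ_N` as `N → ∞`. -/
def wick (ω : Ω) (t : ℝ) : Distr :=
  fun n => limUnder atTop (fun N : ℕ => wickTrunc α β N ω t n)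

/-- The truncated second order term `ℐ(Ψ_N² - σ_N)`. -/
def secondOrderTrunc (N : ℕ) (ω : Ω) : ℝ → Distr := duhamel (wickTrunc α β N ω)

/-- The second order term: the Duhamel integral of the Wick power. -/
def secondOrder (ω : Ω) : ℝ → Distr := duhamel (wick α β ω)

end Stochastic

/-! ### Enhanced data and solutions -/

/-- `s_α = 1 - 2α + min(α, 1/4)`. -/
def sAlpha (α : ℝ) : ℝ := 1 - 2 * α + min α (1 / 4)

/-- A tuple `Ξ = (u₀, u₁, Z, Y)`; `Z` takes the place of the stochastic convolution and `Y` of the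
second order term. -/
structure EnhancedData where
  u₀ : Distr
  u₁ : Distr
  Z : ℝ → Distr
  Y : ℝ → Distr

/-- `Ξ ∈ 𝒳_T^{s,ε} = H^s × H^{s-1} × C([0,T]; W^{-α-ε,∞}) × C([0,T]; W^{s_α-ε,∞})`. -/
structure EnhancedData.InClass (Ξ : EnhancedData) (α s ε T : ℝ) : Prop where
  u₀_mem : hsNorm s Ξ.u₀ < ∞
  u₁_mem : hsNorm (s - 1) Ξ.u₁ < ∞
  Z_mem : ContIn (wInfNorm (-α - ε)) T Ξ.Z
  Y_mem : ContIn (wInfNorm (sAlpha α - ε)) T Ξ.Y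

/-- The distance in `𝒳_T^{s,ε}`. -/
def enhancedDist (α s ε T : ℝ) (Ξ Ξ' : EnhancedData) : ℝ≥0∞ :=
  hsNorm s (Ξ.u₀ - Ξ'.u₀) + hsNorm (s - 1) (Ξ.u₁ - Ξ'.u₁) +
    supNorm (wInfNorm (-α - ε)) T (Ξ.Z - Ξ'.Z) +
    supNorm (wInfNorm (sAlpha α - ε)) T (Ξ.Y - Ξ'.Y)

/-- `v ∈ C([0,T]; H^σ)` and `v = S(t)(u₀,u₁) - ℐ(v² + 2 v Z) - Y` on `[0,T]`. -/
def IsSolution (σ T : ℝ) (Ξ : EnhancedData) (v : ℝ → Distr) : Prop :=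
  ContIn (hsNorm σ) T v ∧
    ∀ t ∈ Icc (0 : ℝ) T,
      v t = waveProp t Ξ.u₀ Ξ.u₁
        - duhamel (fun t' => mul (v t') (v t') + (2 : ℂ) • mul (v t') (Ξ.Z t')) t
        - Ξ.Y t

/-- `v` is a solution on `[0,T]`, and the only one in the whole space `C([0,T]; H^σ)`. -/
def IsUniqueSolution (σ T : ℝ) (Ξ : EnhancedData) (v : ℝ → Distr) : Prop :=
  IsSolution σ T Ξ v ∧ ∀ w, IsSolution σ T Ξ w → ∀ t ∈ Icc (0 : ℝ) T, w t = v t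

/-- The random enhanced data set `Ξ(ω)`: initial data, stochastic convolution, second order
term. -/
def randomData {Ω : Type*} (α : ℝ) (β : Freq → ℝ≥0 → Ω → ℂ) (u₀ u₁ : Distr) (ω : Ω) :
    EnhancedData where
  u₀ := u₀
  u₁ := u₁
  Z := stochConv α β ω
  Y := secondOrder α β ω

end RoughWave

end

open MeasureTheory ProbabilityTheory Filter Topology Set
open scoped ENNReal NNReal

noncomputable section

namespace RoughWave

/-! ### The Japanese bracket -/

lemma normSq_nonneg (n : Freq) : 0 ≤ normSq n := by unfold normSq; positivity

lemma jb_sq (n : Freq) : jb n ^ 2 = 1 + normSq n :=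
  Real.sq_sqrt (by have := normSq_nonneg n; linarith)

lemma one_le_jb (n : Freq) : 1 ≤ jb n :=
  Real.one_le_sqrt.2 (by have := normSq_nonneg n; linarith)

lemma jb_pos (n : Freq) : 0 < jb n := zero_lt_one.trans_le (one_le_jb n)

lemma jb_neg (n : Freq) : jb (-n) = jb n := by simp [jb, normSq]

lemma jb_zero : jb 0 = 1 := by simp [jb, normSq]

lemma jb_rpow_pos (n : Freq) (s : ℝ) : 0 < jb n ^ s := Real.rpow_pos_of_pos (jb_pos n) s

lemma jb_rpow_le (n : Freq) {s t : ℝ} (h : s ≤ t) : jb n ^ s ≤ jb n ^ t :=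
  Real.rpow_le_rpow_of_exponent_le (one_le_jb n) h

/-- The Japanese bracket on `ℝ²`. -/
def jbR (x : ℝ × ℝ) : ℝ := Real.sqrt (1 + (x.1 ^ 2 + x.2 ^ 2))

lemma jbR_sq (x : ℝ × ℝ) : jbR x ^ 2 = 1 + (x.1 ^ 2 + x.2 ^ 2) := Real.sq_sqrt (by positivity)

lemma one_le_jbR (x : ℝ × ℝ) : 1 ≤ jbR x :=
  Real.one_le_sqrt.2 (by nlinarith [sq_nonneg x.1, sq_nonneg x.2])

lemma jbR_pos (x : ℝ × ℝ) : 0 < jbR x := zero_lt_one.trans_le (one_le_jbR x)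

lemma jb_eq_jbR (n : Freq) : jb n = jbR ((n.1 : ℝ), (n.2 : ℝ)) := rfl

lemma abs_fst_le_jb (n : Freq) : |(n.1 : ℝ)| ≤ jb n :=
  Real.abs_le_sqrt (by unfold normSq; nlinarith [sq_nonneg (n.2 : ℝ)])

lemma abs_snd_le_jb (n : Freq) : |(n.2 : ℝ)| ≤ jb n :=
  Real.abs_le_sqrt (by unfold normSq; nlinarith [sq_nonneg (n.1 : ℝ)])

lemma jbR_add_le (x y : ℝ × ℝ) : jbR (x + y) ≤ jbR x + Real.sqrt (y.1 ^ 2 + y.2 ^ 2) := by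
  have hx := jbR_pos x
  have hy := Real.sqrt_nonneg (y.1 ^ 2 + y.2 ^ 2)
  have hy2 : Real.sqrt (y.1 ^ 2 + y.2 ^ 2) ^ 2 = y.1 ^ 2 + y.2 ^ 2 := Real.sq_sqrt (by positivity)
  refine Real.sqrt_le_iff.2 ⟨by positivity, ?_⟩
  have hx2 := jbR_sq x
  have key : x.1 * y.1 + x.2 * y.2 ≤ jbR x * Real.sqrt (y.1 ^ 2 + y.2 ^ 2) := by
    refine le_of_abs_le (abs_le_of_sq_le_sq ?_ (by positivity))
    rw [mul_pow, hx2, hy2]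
    nlinarith [sq_nonneg (x.1 * y.2 - x.2 * y.1), sq_nonneg y.1, sq_nonneg y.2]
  simp only [Prod.fst_add, Prod.snd_add]
  nlinarith

lemma jb_add_le (m n : Freq) : jb (m + n) ≤ jb m + jb n := by
  have h := jbR_add_le ((m.1 : ℝ), (m.2 : ℝ)) ((n.1 : ℝ), (n.2 : ℝ))
  have h2 : Real.sqrt ((n.1 : ℝ) ^ 2 + (n.2 : ℝ) ^ 2) ≤ jb n :=
    Real.sqrt_le_sqrt (by simp [normSq])
  have h3 : jb (m + n) = jbR (((m.1 : ℝ), (m.2 : ℝ)) + ((n.1 : ℝ), (n.2 : ℝ))) := by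
    simp [jb_eq_jbR]
  rw [h3]; exact h.trans (add_le_add le_rfl h2)

lemma summable_jb_rpow {r : ℝ} (hr : r < -2) : Summable fun n : Freq => jb n ^ r := by
  have h1 : Summable fun k : ℤ => (1 + (k : ℝ) ^ 2) ^ (r / 4) := by
    have h0 : Summable fun k : ℤ => |(k : ℝ)| ^ (r / 2) := by
      have := Real.summable_abs_int_rpow (b := -(r / 2)) (by linarith)
      simpa using this
    refine Summable.of_norm_bounded_eventually h0 ?_
    have : ∀ᶠ k : ℤ in cofinite, k ≠ 0 := by
      simpa using (Set.finite_singleton (0 : ℤ)).compl_mem_cofinite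
    filter_upwards [this] with k hk
    have hk' : (0 : ℝ) < |(k : ℝ)| := by positivity
    rw [Real.norm_of_nonneg (by positivity)]
    have : |(k : ℝ)| ^ (r / 2) = (|(k : ℝ)| ^ 2) ^ (r / 4) := by
      rw [← Real.rpow_natCast, ← Real.rpow_mul hk'.le]; congr 1; push_cast; ring
    rw [this, sq_abs]
    exact Real.rpow_le_rpow_of_nonpos (by positivity) (by linarith) (by linarith)
  refine Summable.of_nonneg_of_le (fun n => (jb_rpow_pos n r).le) (fun n => ?_)
    (h1.mul_of_nonneg h1 (fun _ => by positivity) (fun _ => by positivity))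
  have e : jb n ^ r = (jb n ^ 2) ^ (r / 4) * (jb n ^ 2) ^ (r / 4) := by
    rw [← Real.rpow_natCast, ← Real.rpow_mul (jb_pos n).le, ← Real.rpow_add (jb_pos n)]
    congr 1; push_cast; ring
  rw [e, jb_sq]
  unfold normSq
  gcongr ?_ * ?_
  · exact Real.rpow_le_rpow_of_nonpos (by positivity) (by nlinarith [sq_nonneg (n.2 : ℝ)])
      (by linarith)
  · exact Real.rpow_le_rpow_of_nonpos (by positivity) (by nlinarith [sq_nonneg (n.1 : ℝ)])
      (by linarith)

/-! ### The Sobolev norms `H^s` -/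

/-- The coefficients `⟨n⟩^s f̂(n)`. -/
def wt (s : ℝ) (f : Distr) : Freq → ℂ := fun n => ((jb n ^ s : ℝ) : ℂ) * f n

lemma norm_wt (s : ℝ) (f : Distr) (n : Freq) : ‖wt s f n‖ = jb n ^ s * ‖f n‖ := by
  simp [wt, abs_of_pos (jb_rpow_pos n s)]

lemma wt_add (s : ℝ) (f g : Distr) : wt s (f + g) = wt s f + wt s g := by
  ext n; simp [wt, mul_add]

lemma wt_smul (s : ℝ) (c : ℂ) (f : Distr) : wt s (c • f) = c • wt s f := by
  ext n; simp [wt]; ring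

lemma hsNorm_sq (s : ℝ) (f : Distr) :
    hsNorm s f ^ 2 = ∑' n : Freq, ENNReal.ofReal ((jb n ^ s * ‖f n‖) ^ 2) := by
  rw [hsNorm, ← ENNReal.rpow_natCast, ← ENNReal.rpow_mul]; norm_num

lemma hsNorm_eq_eLpNorm (s : ℝ) (f : Distr) : hsNorm s f = eLpNorm (wt s f) 2 Measure.count := by
  rw [eLpNorm_eq_lintegral_rpow_enorm_toReal (by norm_num) (by norm_num), lintegral_count]
  simp only [hsNorm, ENNReal.toReal_ofNat]
  congr 2; ext n
  rw [← ofReal_norm, norm_wt, ENNReal.ofReal_rpow_of_nonneg (by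
    have := jb_rpow_pos n s; positivity) (by norm_num)]
  norm_num

lemma hsNorm_add_le (s : ℝ) (f g : Distr) : hsNorm s (f + g) ≤ hsNorm s f + hsNorm s g := by
  simp only [hsNorm_eq_eLpNorm, wt_add]
  exact eLpNorm_add_le .of_discrete .of_discrete (by norm_num)

lemma hsNorm_smul (s : ℝ) (c : ℂ) (f : Distr) : hsNorm s (c • f) = ‖c‖ₑ * hsNorm s f := by
  simp only [hsNorm_eq_eLpNorm, wt_smul, eLpNorm_const_smul]

lemma hsNorm_neg (s : ℝ) (f : Distr) : hsNorm s (-f) = hsNorm s f := by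
  have := hsNorm_smul s (-1) f
  simpa using this

lemma hsNorm_zero (s : ℝ) : hsNorm s 0 = 0 := by simp [hsNorm]

lemma hsNorm_mono {s t : ℝ} (h : s ≤ t) (f : Distr) : hsNorm s f ≤ hsNorm t f := by
  unfold hsNorm
  refine ENNReal.rpow_le_rpow (ENNReal.tsum_le_tsum fun n => ENNReal.ofReal_le_ofReal ?_)
    (by norm_num)
  have := jb_rpow_pos n s
  exact pow_le_pow_left₀ (by positivity)
    (mul_le_mul_of_nonneg_right (jb_rpow_le n h) (norm_nonneg _)) 2

lemma ofReal_coeff_le_hsNorm (s : ℝ) (f : Distr) (n : Freq) :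
    ENNReal.ofReal (jb n ^ s * ‖f n‖) ≤ hsNorm s f := by
  rw [← norm_wt, ofReal_norm, hsNorm_eq_eLpNorm]
  exact enorm_le_eLpNorm_count _ n (by norm_num)

/-! ### Fourier analysis on the torus -/

@[fun_prop]
lemma continuous_basisFun (n : Freq) : Continuous (basisFun n) := by
  unfold basisFun; fun_prop

lemma norm_fourier_apply (k : ℤ) (x : AddCircle (2 * Real.pi)) : ‖(fourier k x : ℂ)‖ = 1 := by
  rw [fourier_apply]; exact Circle.norm_coe _

lemma conj_two_pi_inv : (starRingEnd ℂ) (2 * (Real.pi : ℂ))⁻¹ = (2 * (Real.pi : ℂ))⁻¹ := by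
  simp [map_ofNat]

lemma norm_basisFun (n : Freq) (x : Torus) : ‖basisFun n x‖ = (2 * Real.pi)⁻¹ := by
  rw [basisFun, norm_mul, norm_mul, norm_fourier_apply, norm_fourier_apply]
  simp [abs_of_pos Real.pi_pos]

lemma integral_fourier (k : ℤ) :
    ∫ x : AddCircle (2 * Real.pi), fourier k x = if k = 0 then 2 * (Real.pi : ℂ) else 0 := by
  split_ifs with h
  · subst h
    simp [Real.pi_pos.le, Measure.real, AddCircle.measure_univ]
  · have h1 := integral_eq_zero_of_add_right_eq_neg (μ := AddCircle.haarAddCircle)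
      (fourier_add_half_inv_index h Real.two_pi_pos)
    rw [AddCircle.integral_haarAddCircle] at h1
    simpa [Real.pi_ne_zero] using h1

lemma basisFun_mul_conj (k n : Freq) (x : Torus) :
    basisFun k x * (starRingEnd ℂ) (basisFun n x)
      = (2 * (Real.pi : ℂ))⁻¹ ^ 2 * (fourier (k.1 - n.1) x.1 * fourier (k.2 - n.2) x.2) := by
  simp only [basisFun, map_mul, ← fourier_neg, sub_eq_add_neg, fourier_add, conj_two_pi_inv]
  ring

lemma conj_basisFun_mul (k n : Freq) (x : Torus) :
    basisFun k x * (starRingEnd ℂ) (basisFun n x)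
      = (2 * (Real.pi : ℂ))⁻¹ * (starRingEnd ℂ) (basisFun (n - k) x) := by
  rw [basisFun_mul_conj]
  simp only [basisFun, map_mul, ← fourier_neg, Prod.fst_sub, Prod.snd_sub, neg_sub,
    conj_two_pi_inv]
  ring

lemma integral_basisFun_mul_conj (k n : Freq) :
    ∫ x : Torus, basisFun k x * (starRingEnd ℂ) (basisFun n x) = if k = n then 1 else 0 := by
  simp_rw [basisFun_mul_conj]
  have hpi : (Real.pi : ℂ) ≠ 0 := by exact_mod_cast Real.pi_ne_zero
  rw [integral_const_mul, Measure.volume_eq_prod,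
    integral_prod_mul (μ := volume) (ν := volume) (fun x => (fourier (k.1 - n.1) x : ℂ))
      (fun x => (fourier (k.2 - n.2) x : ℂ)),
    integral_fourier, integral_fourier]
  simp only [sub_eq_zero, Prod.ext_iff]
  by_cases h1 : k.1 = n.1 <;> by_cases h2 : k.2 = n.2 <;> simp [h1, h2]
  field_simp

lemma memLp_basisFun (n : Freq) (p : ℝ≥0∞) : MemLp (basisFun n) p (volume : Measure Torus) :=
  MemLp.of_bound (continuous_basisFun n).aestronglyMeasurable (2 * Real.pi)⁻¹
    (.of_forall fun x => (norm_basisFun n x).le)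

/-- `e_n` as an element of `L²(𝕋²)`. -/
def basisL2 (n : Freq) : Lp ℂ 2 (volume : Measure Torus) := (memLp_basisFun n 2).toLp _

lemma inner_basisL2 (n : Freq) {g : Torus → ℂ} (hg : MemLp g 2 volume) :
    inner ℂ (basisL2 n) (hg.toLp g) = torusCoeff g n := by
  rw [L2.inner_def, torusCoeff]
  refine integral_congr_ae ?_
  filter_upwards [hg.coeFn_toLp, (memLp_basisFun n 2).coeFn_toLp] with x h1 h2
  rw [h1, basisL2, h2]; simp

lemma orthonormal_basisL2 : Orthonormal ℂ basisL2 := by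
  classical
  rw [orthonormal_iff_ite]
  intro i j
  rw [basisL2, basisL2, ← basisL2, inner_basisL2, torusCoeff, integral_basisFun_mul_conj]
  simp [eq_comm]

lemma tsum_torusCoeff_sq_le {g : Torus → ℂ} (hg : MemLp g 2 volume) :
    ∑' n, ENNReal.ofReal (‖torusCoeff g n‖ ^ 2) ≤ eLpNorm g 2 volume ^ 2 := by
  have h := orthonormal_basisL2.tsum_inner_products_le (hg.toLp g)
  have hs := orthonormal_basisL2.inner_products_summable (hg.toLp g)
  simp only [inner_basisL2] at h hs
  rw [← ENNReal.ofReal_tsum_of_nonneg (fun _ => by positivity) hs]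
  refine (ENNReal.ofReal_le_ofReal h).trans ?_
  rw [Lp.norm_toLp, ← ENNReal.toReal_pow, ENNReal.ofReal_toReal]
  exact ENNReal.pow_ne_top hg.eLpNorm_ne_top

lemma volume_torus_univ : (volume : Measure Torus) univ = ENNReal.ofReal (2 * Real.pi) ^ 2 := by
  rw [Measure.volume_eq_prod, ← univ_prod_univ, Measure.prod_prod, AddCircle.measure_univ, sq]

lemma eLpNorm_two_le_top {g : Torus → ℂ} (hg : AEStronglyMeasurable g volume) :
    eLpNorm g 2 volume ≤ ENNReal.ofReal (2 * Real.pi) * eLpNorm g ∞ volume := by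
  have := eLpNorm_le_eLpNorm_mul_rpow_measure_univ (p := 2) (q := ∞) (μ := volume) (by simp) hg
  rw [volume_torus_univ] at this
  refine this.trans (le_of_eq ?_)
  rw [mul_comm, ← ENNReal.rpow_natCast, ← ENNReal.rpow_mul]
  norm_num

lemma memLp_sum_basisFun (f : Freq → ℂ) (B : Finset Freq) :
    MemLp (∑ k ∈ B, f k • basisFun k) 2 (volume : Measure Torus) :=
  memLp_finsetSum' B fun k _ => (memLp_basisFun k 2).const_smul (f k)

lemma toLp_sum_basisFun (f : Freq → ℂ) (B : Finset Freq) :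
    (memLp_sum_basisFun f B).toLp _ = ∑ k ∈ B, f k • basisL2 k := by
  induction B using Finset.cons_induction with
  | empty => exact MemLp.toLp_zero _
  | cons k B hk ih =>
    simp only [Finset.sum_cons]
    rw [← ih]
    exact MemLp.toLp_add ((memLp_basisFun k 2).const_smul (f k)) (memLp_sum_basisFun f B)

/-- Multiplication by a bounded function, on the Fourier side, acting on trigonometric
polynomials. -/
lemma toeplitz_sum_le {G : Torus → ℂ} (hG : MemLp G ∞ volume) (f : Freq → ℂ) (B : Finset Freq) :
    ∑' n, ENNReal.ofReal (‖∑ k ∈ B, f k * torusCoeff G (n - k)‖ ^ 2)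
      ≤ ENNReal.ofReal (2 * Real.pi) ^ 2 * eLpNorm G ∞ volume ^ 2 *
        ENNReal.ofReal (∑ k ∈ B, ‖f k‖ ^ 2) := by
  set P : Torus → ℂ := fun x => ∑ k ∈ B, f k * basisFun k x with hP
  have hPc : Continuous P := by fun_prop
  have hP2 : MemLp P 2 volume := by
    convert memLp_sum_basisFun f B using 1; ext x; simp [hP]
  have hPn : eLpNorm P 2 volume ^ 2 ≤ ENNReal.ofReal (∑ k ∈ B, ‖f k‖ ^ 2) := by
    have e : hP2.toLp P = ∑ k ∈ B, f k • basisL2 k := by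
      have h := memLp_sum_basisFun f B
      have e1 : hP2.toLp P = h.toLp _ := by congr 1; ext x; simp [hP]
      rw [e1, toLp_sum_basisFun]
    have h1 : ‖hP2.toLp P‖ ^ 2 = ∑ k ∈ B, ‖f k‖ ^ 2 := by
      have := orthonormal_basisL2.inner_sum f f B
      rw [← e, inner_self_eq_norm_sq_to_K] at this
      have h2 : ((‖hP2.toLp P‖ ^ 2 : ℝ) : ℂ) = ((∑ k ∈ B, ‖f k‖ ^ 2 : ℝ) : ℂ) := by
        push_cast
        rw [← Complex.coe_algebraMap] at *
        simpa [RCLike.conj_mul] using this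
      exact_mod_cast h2
    rw [← h1, Lp.norm_toLp, ← ENNReal.toReal_pow, ENNReal.ofReal_toReal]
    exact ENNReal.pow_ne_top hP2.eLpNorm_ne_top
  have hGP : MemLp (fun x => G x * P x) 2 volume := hP2.mul' hG
  have hc : ∀ n, torusCoeff (fun x => G x * P x) n
      = (2 * (Real.pi : ℂ))⁻¹ * ∑ k ∈ B, f k * torusCoeff G (n - k) := by
    intro n
    have hG1 : Integrable G volume := hG.integrable (by simp)
    simp only [torusCoeff, hP, Finset.mul_sum, Finset.sum_mul]
    rw [integral_finsetSum]
    · refine Finset.sum_congr rfl fun k _ => ?_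
      rw [← mul_assoc, ← integral_const_mul]
      refine integral_congr_ae (.of_forall fun x => ?_)
      have := conj_basisFun_mul k n x
      simp only
      calc _ = G x * f k * (basisFun k x * (starRingEnd ℂ) (basisFun n x)) := by ring
        _ = _ := by rw [this]; ring
    · intro k _
      have hb : Integrable (fun x => (f k * (basisFun k x * (starRingEnd ℂ) (basisFun n x))) * G x)
          volume := by
        refine hG1.bdd_mul (c := ‖f k‖ * ((2 * Real.pi)⁻¹ * (2 * Real.pi)⁻¹)) ?_ ?_
        · refine Continuous.aestronglyMeasurable ?_
          have := continuous_basisFun n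
          fun_prop
        · refine .of_forall fun x => ?_
          simp only [norm_mul, norm_basisFun, RCLike.norm_conj]; exact le_rfl
      refine hb.congr (.of_forall fun x => ?_)
      simp only; ring
  have hB := tsum_torusCoeff_sq_le hGP
  have hnorm : eLpNorm (fun x => G x * P x) 2 volume ≤ eLpNorm G ∞ volume * eLpNorm P 2 volume :=
    eLpNorm_smul_le_mul_eLpNorm (p := ∞) (q := 2) (r := 2) (f := P) (φ := G) hP2.1 hG.1
  have h2pi : ∀ n, ENNReal.ofReal (‖∑ k ∈ B, f k * torusCoeff G (n - k)‖ ^ 2)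
      = ENNReal.ofReal (2 * Real.pi) ^ 2 *
        ENNReal.ofReal (‖torusCoeff (fun x => G x * P x) n‖ ^ 2) := by
    intro n
    rw [hc, ← ENNReal.ofReal_pow (by positivity), ← ENNReal.ofReal_mul (by positivity)]
    congr 1
    have : (Real.pi) ≠ 0 := Real.pi_ne_zero
    simp only [norm_mul, norm_inv, Complex.norm_ofNat, Complex.norm_real, Real.norm_eq_abs,
      abs_of_pos Real.pi_pos]
    field_simp
  simp_rw [h2pi]
  rw [ENNReal.tsum_mul_left, mul_assoc]
  gcongr
  calc _ ≤ (eLpNorm G ∞ volume * eLpNorm P 2 volume) ^ 2 := hB.trans (by gcongr)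
    _ ≤ _ := by rw [mul_pow]; gcongr

/-! ### The norms `W^{s,∞}` -/

lemma integrable_mul_conj_basisFun {g : Torus → ℂ} (hg : MemLp g ∞ volume) (n : Freq) :
    Integrable (fun x => g x * (starRingEnd ℂ) (basisFun n x)) volume := by
  have hb : Integrable (fun x => (starRingEnd ℂ) (basisFun n x) * g x) volume := by
    refine (hg.integrable (by simp)).bdd_mul (c := (2 * Real.pi)⁻¹) ?_ ?_
    · exact (Complex.continuous_conj.comp (continuous_basisFun n)).aestronglyMeasurable
    · exact .of_forall fun x => by rw [RCLike.norm_conj, norm_basisFun]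
  exact hb.congr (.of_forall fun x => mul_comm _ _)

lemma torusCoeff_add {g h : Torus → ℂ} (hg : MemLp g ∞ volume) (hh : MemLp h ∞ volume) (n : Freq) :
    torusCoeff (g + h) n = torusCoeff g n + torusCoeff h n := by
  simp only [torusCoeff, Pi.add_apply, add_mul]
  exact integral_add (integrable_mul_conj_basisFun hg n) (integrable_mul_conj_basisFun hh n)

lemma torusCoeff_neg (g : Torus → ℂ) (n : Freq) : torusCoeff (-g) n = -torusCoeff g n := by
  simp [torusCoeff, integral_neg]

lemma wInfNorm_le {s : ℝ} {f : Distr} {g : Torus → ℂ} (hg : MemLp g ∞ volume)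
    (h : ∀ n, torusCoeff g n = wt s f n) : wInfNorm s f ≤ eLpNorm g ∞ volume :=
  iInf_le_of_le g (iInf_le_of_le hg (iInf_le _ h))

lemma exists_of_wInfNorm_lt {s : ℝ} {f : Distr} {c : ℝ≥0∞} (h : wInfNorm s f < c) :
    ∃ g : Torus → ℂ, MemLp g ∞ volume ∧ (∀ n, torusCoeff g n = wt s f n) ∧
      eLpNorm g ∞ volume < c := by
  simp only [wInfNorm, iInf_lt_iff] at h
  obtain ⟨g, hg, hc, hlt⟩ := h
  exact ⟨g, hg, hc, hlt⟩

lemma le_wInfNorm {s : ℝ} {f : Distr} {c : ℝ≥0∞}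
    (h : ∀ g : Torus → ℂ, MemLp g ∞ volume → (∀ n, torusCoeff g n = wt s f n) →
      c ≤ eLpNorm g ∞ volume) : c ≤ wInfNorm s f :=
  le_iInf fun g => le_iInf fun hg => le_iInf fun hc => h g hg hc

lemma wInfNorm_add_le (s : ℝ) (f g : Distr) :
    wInfNorm s (f + g) ≤ wInfNorm s f + wInfNorm s g := by
  refine ENNReal.le_of_forall_pos_le_add fun ε hε htop => ?_
  have hε2 : ((ε / 2 : ℝ≥0) : ℝ≥0∞) ≠ 0 := by
    rw [ENNReal.coe_ne_zero]; exact (half_pos hε).ne'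
  obtain ⟨u, hu, huc, hult⟩ := exists_of_wInfNorm_lt
    (ENNReal.lt_add_right (ENNReal.add_lt_top.1 htop).1.ne hε2)
  obtain ⟨v, hv, hvc, hvlt⟩ := exists_of_wInfNorm_lt
    (ENNReal.lt_add_right (ENNReal.add_lt_top.1 htop).2.ne hε2)
  calc wInfNorm s (f + g) ≤ eLpNorm (u + v) ∞ volume :=
        wInfNorm_le (hu.add hv) fun n => by
          rw [torusCoeff_add hu hv, huc, hvc, wt_add]; rfl
    _ ≤ eLpNorm u ∞ volume + eLpNorm v ∞ volume := eLpNorm_add_le hu.1 hv.1 le_top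
    _ ≤ (wInfNorm s f + (ε / 2 : ℝ≥0)) + (wInfNorm s g + (ε / 2 : ℝ≥0)) :=
        add_le_add hult.le hvlt.le
    _ = wInfNorm s f + wInfNorm s g + ((ε / 2 : ℝ≥0) + (ε / 2 : ℝ≥0) : ℝ≥0) := by
        push_cast; ring
    _ = _ := by rw [add_halves]

lemma wInfNorm_neg (s : ℝ) (f : Distr) : wInfNorm s (-f) = wInfNorm s f := by
  have key : ∀ f : Distr, wInfNorm s (-f) ≤ wInfNorm s f := by
    intro f
    refine le_wInfNorm fun g hg hc => ?_
    rw [← eLpNorm_neg g]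
    exact wInfNorm_le hg.neg fun n => by rw [torusCoeff_neg, hc]; simp [wt]
  refine le_antisymm (key f) ?_
  conv_lhs => rw [← neg_neg f]
  exact key (-f)

lemma hsNorm_le_wInfNorm (s : ℝ) (f : Distr) :
    hsNorm s f ≤ ENNReal.ofReal (2 * Real.pi) * wInfNorm s f := by
  have h0 : ENNReal.ofReal (2 * Real.pi) ≠ 0 := by simp [Real.pi_pos]
  rw [mul_comm, ← ENNReal.div_le_iff_le_mul (.inl h0) (.inl ENNReal.ofReal_ne_top)]
  refine le_wInfNorm fun g hg hc => ?_
  rw [ENNReal.div_le_iff_le_mul (.inl h0) (.inl ENNReal.ofReal_ne_top), mul_comm]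
  refine le_trans ?_ (eLpNorm_two_le_top hg.1)
  have h := tsum_torusCoeff_sq_le (hg.mono_exponent (p := 2) le_top)
  simp only [hc, norm_wt] at h
  rw [← hsNorm_sq] at h
  exact (ENNReal.pow_le_pow_left_iff two_ne_zero).1 h

lemma ofReal_coeff_le_wInfNorm (s : ℝ) (f : Distr) (n : Freq) :
    ENNReal.ofReal (jb n ^ s * ‖f n‖) ≤ ENNReal.ofReal (2 * Real.pi) * wInfNorm s f :=
  (ofReal_coeff_le_hsNorm s f n).trans (hsNorm_le_wInfNorm s f)

/-- A distribution whose weighted Fourier series is, in the sense of Fourier coefficients, a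
pointwise limit of uniformly bounded continuous functions. -/
lemma wInfNorm_le_of_tendsto {s B : ℝ} {f : Distr} {F : ℕ → Torus → ℂ} (hF : ∀ j, Continuous (F j))
    (hB : ∀ j x, ‖F j x‖ ≤ B) (hlim : ∀ x, ∃ l, Tendsto (F · x) atTop (𝓝 l))
    (hc : ∀ n, Tendsto (fun j => torusCoeff (F j) n) atTop (𝓝 (wt s f n))) :
    wInfNorm s f ≤ ENNReal.ofReal B := by
  choose G hG using hlim
  have hGm : AEStronglyMeasurable G (volume : Measure Torus) :=
    aestronglyMeasurable_of_tendsto_ae atTop (fun j => (hF j).aestronglyMeasurable) (.of_forall hG)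
  have hGB : ∀ x, ‖G x‖ ≤ B := fun x =>
    le_of_tendsto (hG x).norm (.of_forall fun j => hB j x)
  have hGL : MemLp G ∞ (volume : Measure Torus) := memLp_top_of_bound hGm B (.of_forall hGB)
  refine (wInfNorm_le hGL fun n => ?_).trans ?_
  · refine tendsto_nhds_unique ?_ (hc n)
    refine tendsto_integral_of_dominated_convergence (fun _ => B * (2 * Real.pi)⁻¹)
      (fun j => ?_) (integrable_const _) (fun j => .of_forall fun x => ?_)
      (.of_forall fun x => (hG x).mul_const _)
    · exact ((hF j).mul (Complex.continuous_conj.comp (continuous_basisFun n))).aestronglyMeasurable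
    · rw [norm_mul, RCLike.norm_conj, norm_basisFun]
      exact mul_le_mul_of_nonneg_right (hB j x) (by positivity)
  · rw [eLpNorm_exponent_top]
    exact eLpNormEssSup_le_of_ae_bound (.of_forall hGB)

/-- The trigonometric polynomial `∑_{n ∈ S} c_n e_n`. -/
def trigSum (S : Finset Freq) (c : Freq → ℂ) (x : Torus) : ℂ := ∑ n ∈ S, c n * basisFun n x

@[fun_prop]
lemma continuous_trigSum (S : Finset Freq) (c : Freq → ℂ) : Continuous (trigSum S c) := by
  unfold trigSum; fun_prop

lemma torusCoeff_trigSum (S : Finset Freq) (c : Freq → ℂ) (n : Freq) :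
    torusCoeff (trigSum S c) n = if n ∈ S then c n else 0 := by
  classical
  have hi : ∀ k ∈ S, Integrable (fun x => c k * (basisFun k x * (starRingEnd ℂ) (basisFun n x)))
      (volume : Measure Torus) := fun k _ =>
    (integrable_mul_conj_basisFun (memLp_basisFun k ∞) n).const_mul (c k)
  simp only [torusCoeff, trigSum, Finset.sum_mul, mul_assoc]
  rw [integral_finsetSum _ hi]
  simp only [integral_const_mul, integral_basisFun_mul_conj]
  simp

lemma wInfNorm_zero (s : ℝ) : wInfNorm s 0 = 0 := by
  have h : wInfNorm s 0 ≤ ENNReal.ofReal 0 :=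
    wInfNorm_le_of_tendsto (F := fun _ _ => 0) (fun _ => continuous_const) (by simp)
      (fun x => ⟨0, tendsto_const_nhds⟩) (fun n => by simp [torusCoeff, wt])
  simpa using h

lemma wInfNorm_le_of_trigSum {s B : ℝ} {f : Distr} {S : Finset Freq} (hS : ∀ n ∉ S, f n = 0)
    (hB : ∀ x, ‖trigSum S (wt s f) x‖ ≤ B) : wInfNorm s f ≤ ENNReal.ofReal B := by
  refine wInfNorm_le_of_tendsto (F := fun _ => trigSum S (wt s f))
    (fun _ => continuous_trigSum S _) (fun _ => hB) (fun x => ⟨_, tendsto_const_nhds⟩) fun n => ?_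
  rw [torusCoeff_trigSum]
  split_ifs with h
  · exact tendsto_const_nhds
  · simp [wt, hS n h]

/-! ### Products in `H^s` -/

section Convolution

lemma tsum_mul_sq_le {ι : Type*} (a b : ι → ℝ≥0∞) :
    (∑' k, a k * b k) ^ 2 ≤ (∑' k, a k ^ 2) * ∑' k, b k ^ 2 := by
  let _ : MeasurableSpace ι := ⊤
  have h := ENNReal.lintegral_mul_le_Lp_mul_Lq (Measure.count : Measure ι)
    Real.HolderConjugate.two_two (f := a) (g := b)
    measurable_from_top.aemeasurable measurable_from_top.aemeasurable
  simp only [lintegral_count, Pi.mul_apply, ENNReal.rpow_two] at h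
  calc _ ≤ ((∑' k, a k ^ 2) ^ (1 / 2 : ℝ) * (∑' k, b k ^ 2) ^ (1 / 2 : ℝ)) ^ 2 := by gcongr
    _ = _ := by
      rw [mul_pow, ← ENNReal.rpow_natCast, ← ENNReal.rpow_natCast, ← ENNReal.rpow_mul,
        ← ENNReal.rpow_mul]
      norm_num

lemma tsum_mul_sub_sq_le (a b : Freq → ℝ≥0∞) (n : Freq) :
    (∑' k, a k * b (n - k)) ^ 2 ≤ (∑' k, a k ^ 2) * ∑' k, b k ^ 2 := by
  refine (tsum_mul_sq_le a fun k => b (n - k)).trans (le_of_eq ?_)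
  rw [← (Equiv.subLeft n).tsum_eq fun k => b k ^ 2]
  rfl

lemma tsum_conv_sq_le (p q : Freq → ℝ≥0∞) :
    ∑' n, (∑' k, p k * q (n - k)) ^ 2 ≤ (∑' k, p k) ^ 2 * ∑' k, q k ^ 2 := by
  have h1 : ∀ n, (∑' k, p k * q (n - k)) ^ 2 ≤ (∑' k, p k) * ∑' k, p k * q (n - k) ^ 2 := by
    intro n
    have h := tsum_mul_sq_le (fun k => p k ^ (1 / 2 : ℝ)) (fun k => p k ^ (1 / 2 : ℝ) * q (n - k))
    have e : ∀ k, (p k ^ (1 / 2 : ℝ)) ^ 2 = p k := fun k => by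
      rw [← ENNReal.rpow_natCast, ← ENNReal.rpow_mul]; norm_num
    simp only [← mul_assoc, mul_pow, e] at h
    simp only [← sq, e] at h
    exact h
  calc _ ≤ ∑' n, (∑' k, p k) * ∑' k, p k * q (n - k) ^ 2 := ENNReal.tsum_le_tsum h1
    _ = (∑' k, p k) * ∑' k, ∑' n, p k * q (n - k) ^ 2 := by
      rw [ENNReal.tsum_mul_left, ENNReal.tsum_comm]
    _ = (∑' k, p k) * ∑' k, p k * ∑' n, q n ^ 2 := by
      congr 2; ext k
      rw [ENNReal.tsum_mul_left, ← (Equiv.subRight k).tsum_eq fun n => q n ^ 2]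
      rfl
    _ = _ := by rw [ENNReal.tsum_mul_right]; ring

lemma tsum_conv_comm (p q : Freq → ℝ≥0∞) (n : Freq) :
    ∑' k, p k * q (n - k) = ∑' k, q k * p (n - k) := by
  rw [← (Equiv.subLeft n).tsum_eq]; simp [mul_comm]

end Convolution

lemma hsNorm_sq_enorm (s : ℝ) (f : Distr) : hsNorm s f ^ 2 = ∑' n, ‖wt s f n‖ₑ ^ 2 := by
  rw [hsNorm_sq]; congr 1; ext n
  rw [← norm_wt, ENNReal.ofReal_pow (norm_nonneg _), ofReal_norm]

lemma enorm_eq_wt (s : ℝ) (f : Distr) (n : Freq) :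
    ‖f n‖ₑ = ENNReal.ofReal (jb n ^ (-s)) * ‖wt s f n‖ₑ := by
  rw [← ofReal_norm, ← ofReal_norm, norm_wt, ← ENNReal.ofReal_mul (jb_rpow_pos _ _).le, ← mul_assoc,
    ← Real.rpow_add (jb_pos n)]
  simp

lemma enorm_wt (s : ℝ) (f : Distr) (n : Freq) :
    ‖wt s f n‖ₑ = ENNReal.ofReal (jb n ^ s) * ‖f n‖ₑ := by
  rw [← ofReal_norm, ← ofReal_norm, norm_wt, ← ENNReal.ofReal_mul (jb_rpow_pos _ _).le]

lemma enorm_mul_le (f g : Distr) (n : Freq) : ‖mul f g n‖ₑ ≤ ∑' k, ‖f k‖ₑ * ‖g (n - k)‖ₑ := by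
  rw [mul, enorm_mul]
  calc _ ≤ 1 * ‖∑' k, f k * g (n - k)‖ₑ := by
        gcongr
        rw [← ofReal_norm, ENNReal.ofReal_le_one]
        simp only [norm_inv, norm_mul, Complex.norm_ofNat, Complex.norm_real, Real.norm_eq_abs,
          abs_of_pos Real.pi_pos]
        exact inv_le_one_of_one_le₀ (by have := Real.pi_gt_three; linarith)
    _ ≤ _ := by
        rw [one_mul]
        refine enorm_tsum_le_tsum_enorm.trans (le_of_eq ?_)
        simp [enorm_mul]

/-- The series defining the product of `f ∈ H^a` and `g ∈ H^{-a}` converges absolutely. -/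
lemma summable_mul {a : ℝ} (ha : 0 ≤ a) {f g : Distr} (hf : hsNorm a f < ∞)
    (hg : hsNorm (-a) g < ∞) (n : Freq) : Summable fun k => f k * g (n - k) := by
  refine Summable.of_norm ?_
  have key : ∑' k, ‖f k * g (n - k)‖ₑ < ∞ := by
    have h1 : ∀ k, ‖f k * g (n - k)‖ₑ ≤
        ENNReal.ofReal ((2 * jb n) ^ a) * (‖wt a f k‖ₑ * ‖wt (-a) g (n - k)‖ₑ) := by
      intro k
      rw [enorm_mul, enorm_eq_wt a f, enorm_eq_wt (-a) g, neg_neg]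
      have hj : jb (n - k) ≤ 2 * jb n * jb k := by
        have h2 := jb_add_le n (-k)
        rw [jb_neg, ← sub_eq_add_neg] at h2
        nlinarith [one_le_jb n, one_le_jb k]
      have : jb k ^ (-a) * jb (n - k) ^ a ≤ (2 * jb n) ^ a := by
        calc _ ≤ jb k ^ (-a) * (2 * jb n * jb k) ^ a := by
              have := jb_pos k
              gcongr
              exact (jb_pos _).le
          _ = (2 * jb n) ^ a * (jb k ^ (-a) * jb k ^ a) := by
              rw [Real.mul_rpow (by have := jb_pos n; positivity) (jb_pos k).le]; ring
          _ = _ := by rw [← Real.rpow_add (jb_pos k)]; simp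
      calc _ = ENNReal.ofReal (jb k ^ (-a) * jb (n - k) ^ a) *
            (‖wt a f k‖ₑ * ‖wt (-a) g (n - k)‖ₑ) := by
            rw [ENNReal.ofReal_mul (jb_rpow_pos _ _).le]; ring
        _ ≤ _ := by gcongr
    refine (ENNReal.tsum_le_tsum h1).trans_lt ?_
    rw [ENNReal.tsum_mul_left]
    refine ENNReal.mul_lt_top ENNReal.ofReal_lt_top ?_
    have h3 := tsum_mul_sub_sq_le (fun k => ‖wt a f k‖ₑ) (fun k => ‖wt (-a) g k‖ₑ) n
    rw [← hsNorm_sq_enorm, ← hsNorm_sq_enorm] at h3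
    have h4 : (∑' k, ‖wt a f k‖ₑ * ‖wt (-a) g (n - k)‖ₑ) ^ 2 < ∞ :=
      h3.trans_lt (ENNReal.mul_lt_top (ENNReal.pow_lt_top hf) (ENNReal.pow_lt_top hg))
    exact (ENNReal.pow_lt_top_iff.1 h4).resolve_right (by norm_num)
  have := ENNReal.summable_toReal key.ne
  simpa using this

lemma mul_comm' (f g : Distr) : mul f g = mul g f := by
  ext n
  simp only [mul]
  rw [← (Equiv.subLeft n).tsum_eq]
  simp [mul_comm]

lemma mul_sub_right {f g h : Distr} (hg : ∀ n, Summable fun k => f k * g (n - k))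
    (hh : ∀ n, Summable fun k => f k * h (n - k)) : mul f (g - h) = mul f g - mul f h := by
  ext n
  simp only [mul, Pi.sub_apply, mul_sub]
  rw [(hg n).tsum_sub (hh n), mul_sub]

lemma mul_add_right {f g h : Distr} (hg : ∀ n, Summable fun k => f k * g (n - k))
    (hh : ∀ n, Summable fun k => f k * h (n - k)) : mul f (g + h) = mul f g + mul f h := by
  ext n
  simp only [mul, Pi.add_apply, mul_add]
  rw [(hg n).tsum_add (hh n), mul_add]

/-- `⟨n⟩^{-b} ⟨k⟩^{-σ} ⟨m⟩^{-σ}` is controlled by the smallest of the three brackets. -/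
lemma weight_le {x y z b σ : ℝ} (hx : 1 ≤ x) (hy : 1 ≤ y) (hz : 1 ≤ z) (hb : 0 ≤ b) (hσ : 0 ≤ σ) :
    x ^ (-b) * (y ^ (-σ) * z ^ (-σ)) ≤
      x ^ (-(b + 2 * σ)) + y ^ (-(b + 2 * σ)) + z ^ (-(b + 2 * σ)) := by
  have key : ∀ w : ℝ, 1 ≤ w → w ≤ x → w ≤ y → w ≤ z →
      x ^ (-b) * (y ^ (-σ) * z ^ (-σ)) ≤ w ^ (-(b + 2 * σ)) := by
    intro w hw h1 h2 h3
    have hw0 : 0 < w := by linarith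
    have e : w ^ (-(b + 2 * σ)) = w ^ (-b) * (w ^ (-σ) * w ^ (-σ)) := by
      rw [← Real.rpow_add hw0, ← Real.rpow_add hw0]; congr 1; ring
    rw [e]
    have := Real.rpow_le_rpow_of_nonpos hw0 h1 (neg_nonpos.2 hb)
    have := Real.rpow_le_rpow_of_nonpos hw0 h2 (neg_nonpos.2 hσ)
    have := Real.rpow_le_rpow_of_nonpos hw0 h3 (neg_nonpos.2 hσ)
    gcongr
  have hx' : 0 ≤ x ^ (-(b + 2 * σ)) := by positivity
  have hy' : 0 ≤ y ^ (-(b + 2 * σ)) := by positivity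
  have hz' : 0 ≤ z ^ (-(b + 2 * σ)) := by positivity
  rcases le_total x y with h1 | h1 <;> rcases le_total x z with h2 | h2 <;>
    rcases le_total y z with h3 | h3
  · linarith [key x hx le_rfl h1 h2]
  · linarith [key x hx le_rfl h1 h2]
  · linarith [key z hz h2 (h2.trans h1) le_rfl]
  · linarith [key z hz h2 (h2.trans h1) le_rfl]
  · linarith [key y hy h1 le_rfl (h1.trans h2)]
  · linarith [key y hy h1 le_rfl (h1.trans h2)]
  · linarith [key y hy h1 le_rfl h3]
  · linarith [key z hz h2 h3 le_rfl]

/-- The product estimate `H^σ · H^σ ⊂ H^{σ-1}` for `0 < σ ≤ 1`. -/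
lemma exists_hsNorm_mul_le {σ : ℝ} (hσ : 0 < σ) (hσ1 : σ ≤ 1) : ∃ C : ℝ≥0, ∀ f g : Distr,
    hsNorm (σ - 1) (mul f g) ≤ C * hsNorm σ f * hsNorm σ g := by
  set w : Freq → ℝ≥0∞ := fun n => ENNReal.ofReal (jb n ^ (-(1 + σ))) with hw
  have hwsum : ∑' n, w n ^ 2 < ∞ := by
    have e : ∀ n, w n ^ 2 = ENNReal.ofReal (jb n ^ (-(2 + 2 * σ))) := fun n => by
      rw [hw, ← ENNReal.ofReal_pow (jb_rpow_pos _ _).le, ← Real.rpow_natCast,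
        ← Real.rpow_mul (jb_pos n).le]
      congr 2; push_cast; ring
    simp_rw [e]
    exact (summable_jb_rpow (by linarith)).tsum_ofReal_lt_top
  set W := ∑' n, w n ^ 2 with hW
  refine ⟨(9 * W).toNNReal ⊔ 1, fun f g => ?_⟩
  set F : Freq → ℝ≥0∞ := fun n => ‖wt σ f n‖ₑ with hF
  set G : Freq → ℝ≥0∞ := fun n => ‖wt σ g n‖ₑ with hG
  have hFn : hsNorm σ f ^ 2 = ∑' n, F n ^ 2 := hsNorm_sq_enorm σ f
  have hGn : hsNorm σ g ^ 2 = ∑' n, G n ^ 2 := hsNorm_sq_enorm σ g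
  have pt : ∀ n, ‖wt (σ - 1) (mul f g) n‖ₑ ≤ w n * (∑' k, F k * G (n - k)) +
      (∑' k, (w k * F k) * G (n - k)) + ∑' k, F k * (w (n - k) * G (n - k)) := by
    intro n
    rw [enorm_wt]
    calc _ ≤ ENNReal.ofReal (jb n ^ (σ - 1)) * ∑' k, ‖f k‖ₑ * ‖g (n - k)‖ₑ := by
          gcongr; exact enorm_mul_le f g n
      _ = ∑' k, ENNReal.ofReal (jb n ^ (-(1 - σ)) * (jb k ^ (-σ) * jb (n - k) ^ (-σ))) *
            (F k * G (n - k)) := by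
          rw [← ENNReal.tsum_mul_left]
          congr 1; ext k
          rw [enorm_eq_wt σ f, enorm_eq_wt σ g, ENNReal.ofReal_mul (jb_rpow_pos _ _).le,
            ENNReal.ofReal_mul (jb_rpow_pos _ _).le, neg_sub]
          ring
      _ ≤ ∑' k, (w n + w k + w (n - k)) * (F k * G (n - k)) := by
          refine ENNReal.tsum_le_tsum fun k => ?_
          gcongr
          rw [hw, ← ENNReal.ofReal_add (jb_rpow_pos _ _).le (jb_rpow_pos _ _).le,
            ← ENNReal.ofReal_add (by have := jb_rpow_pos n (-(1 + σ));
                                     have := jb_rpow_pos k (-(1 + σ)); positivity)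
              (jb_rpow_pos _ _).le]
          refine ENNReal.ofReal_le_ofReal ?_
          have := weight_le (b := 1 - σ) (one_le_jb n) (one_le_jb k) (one_le_jb (n - k))
            (by linarith) hσ.le
          convert this using 4 <;> ring_nf
      _ = _ := by
          simp only [add_mul]
          rw [ENNReal.tsum_add, ENNReal.tsum_add, ENNReal.tsum_mul_left]
          congr 2
          · congr 1; ext k; ring
          · ext k; ring
  have hwF : (∑' k, w k * F k) ^ 2 ≤ W * hsNorm σ f ^ 2 := by
    rw [hFn]; exact tsum_mul_sq_le w F
  have hwG : (∑' k, w k * G k) ^ 2 ≤ W * hsNorm σ g ^ 2 := by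
    rw [hGn]; exact tsum_mul_sq_le w G
  have b1 : ∑' n, (w n * (∑' k, F k * G (n - k))) ^ 2 ≤ W * hsNorm σ f ^ 2 * hsNorm σ g ^ 2 := by
    calc _ ≤ ∑' n, w n ^ 2 * (hsNorm σ f ^ 2 * hsNorm σ g ^ 2) := by
          refine ENNReal.tsum_le_tsum fun n => ?_
          rw [mul_pow, hFn, hGn]
          gcongr
          exact tsum_mul_sub_sq_le F G n
      _ = _ := by rw [ENNReal.tsum_mul_right]; ring
  have b2 : ∑' n, (∑' k, (w k * F k) * G (n - k)) ^ 2 ≤ W * hsNorm σ f ^ 2 * hsNorm σ g ^ 2 := by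
    refine (tsum_conv_sq_le (fun k => w k * F k) G).trans ?_
    rw [← hGn]; gcongr
  have b3 : ∑' n, (∑' k, F k * (w (n - k) * G (n - k))) ^ 2 ≤
      W * hsNorm σ f ^ 2 * hsNorm σ g ^ 2 := by
    simp_rw [tsum_conv_comm F fun k => w k * G k]
    refine (tsum_conv_sq_le (fun k => w k * G k) F).trans ?_
    rw [← hFn]
    calc _ ≤ W * hsNorm σ g ^ 2 * hsNorm σ f ^ 2 := by gcongr
      _ = _ := by ring
  have sq3 : ∀ a b c : ℝ≥0∞, (a + b + c) ^ 2 ≤ 3 * (a ^ 2 + b ^ 2 + c ^ 2) := by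
    intro a b c
    by_cases ha : a = ∞
    · simp [ha]
    by_cases hb : b = ∞
    · simp [hb]
    by_cases hc : c = ∞
    · simp [hc]
    lift a to ℝ≥0 using ha
    lift b to ℝ≥0 using hb
    lift c to ℝ≥0 using hc
    norm_cast
    rw [← NNReal.coe_le_coe]
    push_cast
    nlinarith [sq_nonneg ((a : ℝ) - b), sq_nonneg ((a : ℝ) - c), sq_nonneg ((b : ℝ) - c)]
  have main : hsNorm (σ - 1) (mul f g) ^ 2 ≤ 9 * W * (hsNorm σ f ^ 2 * hsNorm σ g ^ 2) := by
    rw [hsNorm_sq_enorm]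
    calc _ ≤ ∑' n, 3 * ((w n * (∑' k, F k * G (n - k))) ^ 2 +
          (∑' k, (w k * F k) * G (n - k)) ^ 2 + (∑' k, F k * (w (n - k) * G (n - k))) ^ 2) := by
          refine ENNReal.tsum_le_tsum fun n => (sq3 _ _ _).trans' ?_
          gcongr
          exact pt n
      _ ≤ 3 * (W * hsNorm σ f ^ 2 * hsNorm σ g ^ 2 + W * hsNorm σ f ^ 2 * hsNorm σ g ^ 2 +
          W * hsNorm σ f ^ 2 * hsNorm σ g ^ 2) := by
          rw [ENNReal.tsum_mul_left, ENNReal.tsum_add, ENNReal.tsum_add]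
          gcongr
      _ = _ := by ring
  have hC : (9 * W) ≤ (((9 * W).toNNReal ⊔ 1 : ℝ≥0) : ℝ≥0∞) ^ 2 := by
    have h9 : 9 * W ≠ ∞ := ENNReal.mul_ne_top (by norm_num) hwsum.ne
    conv_lhs => rw [← ENNReal.coe_toNNReal h9]
    norm_cast
    exact le_max_left _ _ |>.trans (le_self_pow₀ (le_max_right _ _) two_ne_zero)
  refine (ENNReal.pow_le_pow_left_iff two_ne_zero).1 (main.trans ?_)
  rw [mul_pow, mul_pow, mul_assoc (_ ^ 2)]
  exact mul_le_mul_left hC _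

/-! ### Products of `H^τ` and `W^{-a,∞}` -/

section WeightedToeplitz

/-- The matrix `Ĝ(n-k) m(n-k)` tested against finitely supported sequences. -/
def toepForm (G : Torus → ℂ) (A B : Finset Freq) (m : Freq → ℂ) (h f : Freq → ℂ) : ℂ :=
  ∑ n ∈ A, ∑ k ∈ B, h n * f k * (m (n - k) * torusCoeff G (n - k))

/-- The weighted `ℓ²` norm on a finite set of frequencies. -/
def l2w (τ : ℝ) (A : Finset Freq) (h : Freq → ℂ) : ℝ :=
  Real.sqrt (∑ n ∈ A, (jb n ^ τ * ‖h n‖) ^ 2)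

lemma l2w_nonneg (τ : ℝ) (A : Finset Freq) (h : Freq → ℂ) : 0 ≤ l2w τ A h := Real.sqrt_nonneg _

lemma l2w_mono_of_le {τ τ' c : ℝ} (hc : 0 ≤ c) {A : Finset Freq} {h h' : Freq → ℂ}
    (hh : ∀ n ∈ A, jb n ^ τ * ‖h n‖ ≤ c * (jb n ^ τ' * ‖h' n‖)) : l2w τ A h ≤ c * l2w τ' A h' := by
  unfold l2w
  rw [← Real.sqrt_sq hc, ← Real.sqrt_mul (sq_nonneg c), Finset.mul_sum]
  refine Real.sqrt_le_sqrt (Finset.sum_le_sum fun n hn => ?_)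
  rw [← mul_pow]
  have := jb_rpow_pos n τ
  exact pow_le_pow_left₀ (by positivity) (hh n hn) 2

/-- The operator norm of multiplication by `G` on the Fourier side. -/
def toepNorm (G : Torus → ℂ) : ℝ := 2 * Real.pi * (eLpNorm G ∞ volume).toReal

lemma toepNorm_nonneg (G : Torus → ℂ) : 0 ≤ toepNorm G := by
  unfold toepNorm; have := Real.pi_pos; positivity

variable {G : Torus → ℂ} {A B : Finset Freq} {h f : Freq → ℂ}

lemma norm_toepForm_one_le (hG : MemLp G ∞ volume) (A B : Finset Freq) (h f : Freq → ℂ) :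
    ‖toepForm G A B (fun _ => 1) h f‖ ≤ toepNorm G * (l2w 0 A h * l2w 0 B f) := by
  set P : Freq → ℂ := fun n => ∑ k ∈ B, f k * torusCoeff G (n - k) with hP
  have e : toepForm G A B (fun _ => 1) h f = ∑ n ∈ A, h n * P n := by
    simp [toepForm, hP, Finset.mul_sum, mul_assoc]
  have h1 : ∑ n ∈ A, ‖P n‖ ^ 2 ≤ (toepNorm G * l2w 0 B f) ^ 2 := by
    have h2 := (ENNReal.sum_le_tsum A).trans (toeplitz_sum_le hG f B)
    rw [← ENNReal.ofReal_sum_of_nonneg (fun _ _ => by positivity)] at h2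
    have h3 : ENNReal.ofReal (2 * Real.pi) ^ 2 * eLpNorm G ∞ volume ^ 2 *
        ENNReal.ofReal (∑ k ∈ B, ‖f k‖ ^ 2) = ENNReal.ofReal ((toepNorm G * l2w 0 B f) ^ 2) := by
      have hpi : 0 ≤ 2 * Real.pi := by positivity
      rw [mul_pow, toepNorm, mul_pow, l2w, Real.sq_sqrt (Finset.sum_nonneg fun _ _ => sq_nonneg _),
        ENNReal.ofReal_mul (mul_nonneg (sq_nonneg _) (sq_nonneg _)),
        ENNReal.ofReal_mul (sq_nonneg _), ENNReal.ofReal_pow hpi, ENNReal.ofReal_pow ENNReal.toReal_nonneg,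
        ENNReal.ofReal_toReal hG.eLpNorm_ne_top]
      simp
    rw [h3] at h2
    exact (ENNReal.ofReal_le_ofReal_iff (sq_nonneg _)).1 h2
  rw [e]
  calc _ ≤ ∑ n ∈ A, ‖h n‖ * ‖P n‖ := (norm_sum_le _ _).trans (by simp)
    _ ≤ Real.sqrt (∑ n ∈ A, ‖h n‖ ^ 2) * Real.sqrt (∑ n ∈ A, ‖P n‖ ^ 2) :=
        Real.sum_mul_le_sqrt_mul_sqrt _ _ _
    _ ≤ l2w 0 A h * (toepNorm G * l2w 0 B f) := by
        gcongr
        · exact l2w_nonneg _ _ _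
        · simp [l2w]
        · exact (Real.sqrt_le_sqrt h1).trans_eq
            (Real.sqrt_sq (mul_nonneg (toepNorm_nonneg G) (l2w_nonneg _ _ _)))
    _ = _ := by ring

lemma norm_exp_sub_one_le_rpow {θ τ : ℝ} (hτ : 0 ≤ τ) (hτ1 : τ ≤ 1) :
    ‖Complex.exp (Complex.I * θ) - 1‖ ≤ 2 * |θ| ^ τ := by
  rcases le_total |θ| 1 with h1 | h1
  · calc _ ≤ ‖θ‖ := Real.norm_exp_I_mul_ofReal_sub_one_le
      _ ≤ |θ| ^ τ := by
          rcases (abs_nonneg θ).eq_or_lt with h0 | h0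
          · rw [Real.norm_eq_abs, ← h0]; exact Real.rpow_nonneg le_rfl _
          · calc ‖θ‖ = |θ| ^ (1 : ℝ) := by simp
              _ ≤ _ := Real.rpow_le_rpow_of_exponent_ge h0 h1 hτ1
      _ ≤ _ := by have : 0 ≤ |θ| ^ τ := by positivity
                  linarith
  · calc _ ≤ ‖Complex.exp (Complex.I * θ)‖ + ‖(1 : ℂ)‖ := norm_sub_le _ _
      _ = 2 := by rw [mul_comm, Complex.norm_exp_ofReal_mul_I]; norm_num
      _ ≤ _ := by have := Real.one_le_rpow h1 hτ; linarith

/-- The pairing `n · y`. -/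
def dotR (n : Freq) (y : ℝ × ℝ) : ℝ := n.1 * y.1 + n.2 * y.2

lemma abs_dotR_le (n : Freq) (y : ℝ × ℝ) : |dotR n y| ≤ jb n * (|y.1| + |y.2|) := by
  unfold dotR
  calc _ ≤ |(n.1 : ℝ) * y.1| + |(n.2 : ℝ) * y.2| := abs_add_le _ _
    _ = |(n.1 : ℝ)| * |y.1| + |(n.2 : ℝ)| * |y.2| := by rw [abs_mul, abs_mul]
    _ ≤ jb n * |y.1| + jb n * |y.2| := by
        gcongr
        · exact abs_fst_le_jb n
        · exact abs_snd_le_jb n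
    _ = _ := by ring

lemma toepForm_add (m m' : Freq → ℂ) :
    toepForm G A B (fun n => m n + m' n) h f = toepForm G A B m h f + toepForm G A B m' h f := by
  simp only [toepForm, ← Finset.sum_add_distrib]
  refine Finset.sum_congr rfl fun n _ => Finset.sum_congr rfl fun k _ => ?_
  ring

lemma toepForm_const_mul (c : ℂ) (m : Freq → ℂ) :
    toepForm G A B (fun n => c * m n) h f = c * toepForm G A B m h f := by
  simp only [toepForm, Finset.mul_sum]
  refine Finset.sum_congr rfl fun n _ => Finset.sum_congr rfl fun k _ => ?_
  ring

lemma toepForm_integral {X : Type*} [MeasurableSpace X] {μ : Measure X} {m : X → Freq → ℂ}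
    (hm : ∀ n, Integrable (fun x => m x n) μ) :
    toepForm G A B (fun n => ∫ x, m x n ∂μ) h f = ∫ x, toepForm G A B (m x) h f ∂μ := by
  have hi : ∀ n k, Integrable (fun x => h n * f k * (m x (n - k) * torusCoeff G (n - k))) μ :=
    fun n k => ((hm (n - k)).mul_const _).const_mul _
  simp only [toepForm]
  rw [integral_finsetSum _ fun n _ => integrable_finsetSum _ fun k _ => hi n k]
  refine Finset.sum_congr rfl fun n _ => ?_
  rw [integral_finsetSum _ fun k _ => hi n k]
  refine Finset.sum_congr rfl fun k _ => ?_
  rw [integral_const_mul, integral_mul_const]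

lemma norm_toepForm_one_sub_exp_le (hG : MemLp G ∞ volume) {τ : ℝ} (hτ : 0 ≤ τ) (hτ1 : τ ≤ 1)
    (A B : Finset Freq) (h f : Freq → ℂ) (y : ℝ × ℝ) :
    ‖toepForm G A B (fun n => 1 - Complex.exp (Complex.I * (dotR n y : ℝ))) h f‖
      ≤ 8 * toepNorm G * (|y.1| + |y.2|) ^ τ * (l2w τ A h * l2w τ B f) := by
  set Y := |y.1| + |y.2| with hY
  have hY0 : 0 ≤ Y := by positivity
  set E : Freq → ℂ := fun n => Complex.exp (Complex.I * (dotR n y : ℝ)) - 1 with hE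
  set E' : Freq → ℂ := fun n => Complex.exp (Complex.I * (dotR (-n) y : ℝ)) - 1 with hE'
  have e : toepForm G A B (fun n => 1 - Complex.exp (Complex.I * (dotR n y : ℝ))) h f
      = -(toepForm G A B (fun _ => 1) (fun n => E n * h n) (fun n => E' n * f n) +
          toepForm G A B (fun _ => 1) (fun n => E n * h n) f +
          toepForm G A B (fun _ => 1) h (fun n => E' n * f n)) := by
    simp only [toepForm, ← Finset.sum_add_distrib, ← Finset.sum_neg_distrib]
    refine Finset.sum_congr rfl fun n _ => Finset.sum_congr rfl fun k _ => ?_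
    have : Complex.exp (Complex.I * (dotR (n - k) y : ℝ)) = (E n + 1) * (E' k + 1) := by
      simp only [hE, hE', sub_add_cancel, ← Complex.exp_add]
      congr 1
      simp only [dotR, Prod.fst_sub, Prod.snd_sub, Prod.fst_neg, Prod.snd_neg]
      push_cast; ring
    rw [this]; ring
  have bE : ∀ n, ‖Complex.exp (Complex.I * (dotR n y : ℝ)) - 1‖ ≤ 2 * Y ^ τ * jb n ^ τ := by
    intro n
    refine (norm_exp_sub_one_le_rpow hτ hτ1).trans ?_
    rw [mul_assoc, mul_comm (Y ^ τ), ← Real.mul_rpow (jb_pos n).le hY0]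
    gcongr
    exact abs_dotR_le n y
  have bE2 : ∀ n, ‖Complex.exp (Complex.I * (dotR n y : ℝ)) - 1‖ ≤ 2 := by
    intro n
    calc _ ≤ ‖Complex.exp (Complex.I * (dotR n y : ℝ))‖ + ‖(1 : ℂ)‖ := norm_sub_le _ _
      _ = 2 := by rw [mul_comm, Complex.norm_exp_ofReal_mul_I]; norm_num
  have c0 : ∀ (S : Finset Freq) (g : Freq → ℂ), l2w 0 S g ≤ l2w τ S g := by
    intro S g
    have := l2w_mono_of_le (τ := 0) (τ' := τ) (c := 1) zero_le_one (A := S) (h := g) (h' := g)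
      fun n _ => by
        rw [one_mul]; exact mul_le_mul_of_nonneg_right (jb_rpow_le n hτ) (norm_nonneg _)
    simpa using this
  have c1 : l2w 0 A (fun n => E n * h n) ≤ 2 * Y ^ τ * l2w τ A h := by
    refine l2w_mono_of_le (by positivity) fun n _ => ?_
    rw [norm_mul, Real.rpow_zero, one_mul, ← mul_assoc]
    exact mul_le_mul_of_nonneg_right (bE n) (norm_nonneg _)
  have c2 : l2w 0 B (fun n => E' n * f n) ≤ 2 * Y ^ τ * l2w τ B f := by
    refine l2w_mono_of_le (by positivity) fun n _ => ?_
    rw [norm_mul, Real.rpow_zero, one_mul, ← mul_assoc, ← jb_neg n]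
    exact mul_le_mul_of_nonneg_right (bE (-n)) (norm_nonneg _)
  have c3 : l2w 0 B (fun n => E' n * f n) ≤ 2 * l2w τ B f := by
    refine (l2w_mono_of_le (τ' := 0) zero_le_two fun n _ => ?_).trans
      (mul_le_mul_of_nonneg_left (c0 B f) zero_le_two)
    rw [norm_mul, Real.rpow_zero, one_mul, one_mul]
    exact mul_le_mul_of_nonneg_right (bE2 (-n)) (norm_nonneg _)
  have hM := toepNorm_nonneg G
  have hh := l2w_nonneg τ A h
  have hf := l2w_nonneg τ B f
  have hYτ : 0 ≤ Y ^ τ := by positivity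
  have t1 := norm_toepForm_one_le hG A B (fun n => E n * h n) (fun n => E' n * f n)
  have t2 := norm_toepForm_one_le hG A B (fun n => E n * h n) f
  have t3 := norm_toepForm_one_le hG A B h (fun n => E' n * f n)
  have u1 : l2w 0 A (fun n => E n * h n) * l2w 0 B (fun n => E' n * f n) ≤
      2 * Y ^ τ * l2w τ A h * (2 * l2w τ B f) :=
    mul_le_mul c1 c3 (l2w_nonneg _ _ _) (by positivity)
  have u2 : l2w 0 A (fun n => E n * h n) * l2w 0 B f ≤ 2 * Y ^ τ * l2w τ A h * l2w τ B f :=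
    mul_le_mul c1 (c0 B f) (l2w_nonneg _ _ _) (by positivity)
  have u3 : l2w 0 A h * l2w 0 B (fun n => E' n * f n) ≤ l2w τ A h * (2 * Y ^ τ * l2w τ B f) :=
    mul_le_mul (c0 A h) c2 (l2w_nonneg _ _ _) hh
  rw [e, norm_neg]
  refine (norm_add₃_le.trans (add_le_add (add_le_add t1 t2) t3)).trans ?_
  have v1 := mul_le_mul_of_nonneg_left u1 hM
  have v2 := mul_le_mul_of_nonneg_left u2 hM
  have v3 := mul_le_mul_of_nonneg_left u3 hM
  linarith

lemma rpow_le_one_add_sq {z τ : ℝ} (hz : 0 ≤ z) (hτ : 0 ≤ τ) (hτ2 : τ ≤ 2) :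
    z ^ τ ≤ 1 + z ^ 2 := by
  rcases le_total z 1 with h1 | h1
  · have := Real.rpow_le_one hz h1 hτ
    nlinarith
  · have := Real.rpow_le_rpow_of_exponent_le h1 hτ2
    rw [Real.rpow_two] at this
    linarith

lemma integral_sq_gaussianReal (v : ℝ≥0) : ∫ x, x ^ 2 ∂(gaussianReal 0 v) = v := by
  have h := variance_fun_id_gaussianReal (μ := 0) (v := v)
  rw [variance_eq_integral (by fun_prop)] at h
  simpa [integral_id_gaussianReal] using h

lemma integrable_sq_gaussianReal (v : ℝ≥0) : Integrable (fun x => x ^ 2) (gaussianReal 0 v) :=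
  (memLp_id_gaussianReal' (μ := 0) (v := v) 2 (by norm_num)).integrable_sq

/-- The heat multiplier as a Gaussian average of characters. -/
lemma integral_exp_dotR_gaussian {t : ℝ} (ht : 0 < t) (n : Freq) :
    ∫ y, Complex.exp (Complex.I * (dotR n y : ℝ))
      ∂((gaussianReal 0 (2 * t).toNNReal).prod (gaussianReal 0 (2 * t).toNNReal))
      = Complex.exp (-(t * normSq n : ℝ)) := by
  have h1 : ∀ k : ℤ, ∫ x, Complex.exp ((k : ℝ) * x * Complex.I) ∂(gaussianReal 0 (2 * t).toNNReal)
      = Complex.exp (-(t * (k : ℝ) ^ 2 : ℝ)) := by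
    intro k
    rw [← charFun_apply_real, charFun_gaussianReal]
    congr 1
    have : (((2 * t).toNNReal : ℝ) : ℂ) = 2 * t := by
      rw [Real.coe_toNNReal _ (by positivity)]; push_cast; ring
    rw [this]; push_cast; ring
  have e : ∀ y : ℝ × ℝ, Complex.exp (Complex.I * (dotR n y : ℝ)) =
      Complex.exp ((n.1 : ℝ) * y.1 * Complex.I) * Complex.exp ((n.2 : ℝ) * y.2 * Complex.I) := by
    intro y
    rw [← Complex.exp_add]; congr 1; simp only [dotR]; push_cast; ring
  simp_rw [e]
  rw [integral_prod_mul (fun x : ℝ => Complex.exp ((n.1 : ℝ) * x * Complex.I))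
    (fun x : ℝ => Complex.exp ((n.2 : ℝ) * x * Complex.I)), h1, h1, ← Complex.exp_add]
  congr 1; simp only [normSq]; push_cast; ring

lemma norm_toepForm_heat_le (hG : MemLp G ∞ volume) {τ : ℝ} (hτ : 0 ≤ τ) (hτ1 : τ ≤ 1)
    (A B : Finset Freq) (h f : Freq → ℂ) {t : ℝ} (ht : 0 < t) :
    ‖toepForm G A B (fun n => 1 - Complex.exp (-(t * normSq n : ℝ))) h f‖
      ≤ 72 * toepNorm G * t ^ (τ / 2) * (l2w τ A h * l2w τ B f) := by
  set γ := gaussianReal 0 (2 * t).toNNReal with hγ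
  set D := toepNorm G * (l2w τ A h * l2w τ B f) with hD
  have hD0 : 0 ≤ D :=
    mul_nonneg (toepNorm_nonneg G) (mul_nonneg (l2w_nonneg _ _ _) (l2w_nonneg _ _ _))
  have hint : ∀ n : Freq, Integrable (fun y => Complex.exp (Complex.I * (dotR n y : ℝ)))
      (γ.prod γ) := by
    intro n
    refine Integrable.of_bound (C := 1) (by unfold dotR; fun_prop) (.of_forall fun y => ?_)
    rw [mul_comm, Complex.norm_exp_ofReal_mul_I]
  have e : (fun n : Freq => 1 - Complex.exp (-(t * normSq n : ℝ))) =
      fun n => ∫ y, (1 - Complex.exp (Complex.I * (dotR n y : ℝ))) ∂(γ.prod γ) := by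
    ext n
    rw [integral_sub (integrable_const _) (hint n), integral_exp_dotR_gaussian ht]
    simp
  have hv : (((2 * t).toNNReal : ℝ≥0) : ℝ) = 2 * t := Real.coe_toNNReal _ (by positivity)
  have i1 : Integrable (fun y : ℝ × ℝ => y.1 ^ 2) (γ.prod γ) :=
    (integrable_sq_gaussianReal _).comp_fst γ
  have i2 : Integrable (fun y : ℝ × ℝ => y.2 ^ 2) (γ.prod γ) :=
    (integrable_sq_gaussianReal _).comp_snd γ
  have I1 : ∫ y : ℝ × ℝ, y.1 ^ 2 ∂(γ.prod γ) = 2 * t := by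
    rw [integral_fun_fst (f := fun x : ℝ => x ^ 2), integral_sq_gaussianReal, hv]; simp
  have I2 : ∫ y : ℝ × ℝ, y.2 ^ 2 ∂(γ.prod γ) = 2 * t := by
    rw [integral_fun_snd (f := fun x : ℝ => x ^ 2), integral_sq_gaussianReal, hv]; simp
  rw [e, toepForm_integral (m := fun y n => 1 - Complex.exp (Complex.I * (dotR n y : ℝ)))
    fun n => (integrable_const _).sub (hint n)]
  have hb : ∀ y : ℝ × ℝ, (|y.1| + |y.2|) ^ τ ≤ t ^ (τ / 2) * (1 + 2 * t⁻¹ * (y.1 ^ 2 + y.2 ^ 2)) := by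
    intro y
    have hs : 0 < Real.sqrt t := Real.sqrt_pos.2 ht
    have h1 := rpow_le_one_add_sq (z := (|y.1| + |y.2|) / Real.sqrt t) (by positivity) hτ
      (by linarith)
    rw [Real.div_rpow (by positivity) hs.le, div_pow, Real.sq_sqrt ht.le, Real.sqrt_eq_rpow,
      ← Real.rpow_mul ht.le, div_le_iff₀ (by positivity)] at h1
    calc _ ≤ _ := h1
      _ = t ^ (τ / 2) * (1 + (|y.1| + |y.2|) ^ 2 / t) := by
          rw [mul_comm]; congr 2; ring
      _ ≤ _ := by
          have : (|y.1| + |y.2|) ^ 2 ≤ 2 * (y.1 ^ 2 + y.2 ^ 2) := by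
            nlinarith [sq_abs y.1, sq_abs y.2, sq_nonneg (|y.1| - |y.2|)]
          have h3 : (|y.1| + |y.2|) ^ 2 / t ≤ 2 * t⁻¹ * (y.1 ^ 2 + y.2 ^ 2) := by
            rw [div_eq_mul_inv]
            have := mul_le_mul_of_nonneg_right this (inv_nonneg.2 ht.le)
            linarith
          gcongr
  have i12 : Integrable (fun y : ℝ × ℝ => y.1 ^ 2 + y.2 ^ 2) (γ.prod γ) := i1.add i2
  have hI : Integrable (fun y : ℝ × ℝ =>
      8 * D * (t ^ (τ / 2) * (1 + 2 * t⁻¹ * (y.1 ^ 2 + y.2 ^ 2)))) (γ.prod γ) :=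
    ((((integrable_const (1 : ℝ)).add (i12.const_mul (2 * t⁻¹))).const_mul _).const_mul _)
  calc _ ≤ ∫ y, ‖toepForm G A B (fun n => 1 - Complex.exp (Complex.I * (dotR n y : ℝ))) h f‖
        ∂(γ.prod γ) := norm_integral_le_integral_norm _
    _ ≤ ∫ y : ℝ × ℝ, 8 * D * (t ^ (τ / 2) * (1 + 2 * t⁻¹ * (y.1 ^ 2 + y.2 ^ 2))) ∂(γ.prod γ) := by
        refine integral_mono_of_nonneg (.of_forall fun _ => norm_nonneg _) hI
          (.of_forall fun y => ?_)
        refine (norm_toepForm_one_sub_exp_le hG hτ hτ1 A B h f y).trans ?_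
        calc _ = 8 * D * (|y.1| + |y.2|) ^ τ := by rw [hD]; ring
          _ ≤ _ := mul_le_mul_of_nonneg_left (hb y) (by positivity)
    _ = 8 * D * (t ^ (τ / 2) * (1 + 2 * t⁻¹ * (2 * t + 2 * t))) := by
        rw [integral_const_mul, integral_const_mul, integral_add (integrable_const _)
          (i12.const_mul _), integral_const_mul, integral_add i1 i2, I1, I2]
        simp
    _ = _ := by
        have : t⁻¹ * t = 1 := inv_mul_cancel₀ ht.ne'
        rw [hD]
        linear_combination (64 * (toepNorm G * (l2w τ A h * l2w τ B f)) * t ^ (τ / 2)) * this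

lemma integrableOn_min_rpow {a κ : ℝ} (ha : 0 < a) (hκ : a / 2 < κ) :
    IntegrableOn (fun t : ℝ => min 1 (t ^ κ) * t ^ (-1 - a / 2)) (Ioi 0) := by
  rw [← Ioc_union_Ioi_eq_Ioi zero_le_one, integrableOn_union]
  constructor
  · have h : IntegrableOn (fun t : ℝ => t ^ (κ - 1 - a / 2)) (Ioc 0 1) :=
      (intervalIntegrable_iff_integrableOn_Ioc_of_le zero_le_one).1
        (intervalIntegral.intervalIntegrable_rpow' (by linarith))
    refine h.congr_fun (fun t ht => ?_) measurableSet_Ioc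
    have : t ^ κ ≤ 1 := Real.rpow_le_one ht.1.le ht.2 (by linarith)
    simp only [min_eq_right this]
    rw [← Real.rpow_add ht.1]; congr 1; ring
  · refine (integrableOn_Ioi_rpow_of_lt (a := -1 - a / 2) (by linarith) zero_lt_one).congr_fun
      (fun t ht => ?_) measurableSet_Ioi
    have : 1 ≤ t ^ κ := Real.one_le_rpow (le_of_lt ht) (by linarith)
    simp only [min_eq_left this, one_mul]

/-- The constant in `⟨m⟩^a = c⁻¹ ∫_0^∞ (1 - e^{-t⟨m⟩²}) t^{-1-a/2} dt`. -/
def subordConst (a : ℝ) : ℝ := ∫ u in Ioi (0 : ℝ), (1 - Real.exp (-u)) * u ^ (-1 - a / 2)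

lemma one_sub_exp_le_min {l t : ℝ} (hl : 1 ≤ l) :
    1 - Real.exp (-(t * l)) ≤ l * min 1 t := by
  have h1 : 1 - Real.exp (-(t * l)) ≤ t * l := by have := Real.add_one_le_exp (-(t * l)); linarith
  have h2 : 1 - Real.exp (-(t * l)) ≤ 1 := by have := Real.exp_pos (-(t * l)); linarith
  rcases le_total 1 t with h | h
  · rw [min_eq_left h]; linarith
  · rw [min_eq_right h]; linarith

lemma integrableOn_subord {a l : ℝ} (ha : 0 < a) (ha2 : a < 2) (hl : 1 ≤ l) :
    IntegrableOn (fun t : ℝ => (1 - Real.exp (-(t * l))) * t ^ (-1 - a / 2)) (Ioi 0) := by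
  refine Integrable.mono' ((integrableOn_min_rpow (κ := 1) ha (by linarith)).const_mul l)
    (by fun_prop) ?_
  filter_upwards [ae_restrict_mem measurableSet_Ioi] with t ht
  have ht0 : 0 < t := ht
  have h0 : 0 ≤ 1 - Real.exp (-(t * l)) := by
    have : Real.exp (-(t * l)) ≤ 1 := Real.exp_le_one_iff.2 (by nlinarith)
    linarith
  rw [Real.norm_of_nonneg (by positivity), Real.rpow_one, ← mul_assoc]
  gcongr
  exact one_sub_exp_le_min hl

lemma integral_subord {a l : ℝ} (hl : 1 ≤ l) :
    ∫ t in Ioi (0 : ℝ), (1 - Real.exp (-(t * l))) * t ^ (-1 - a / 2)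
      = l ^ (a / 2) * subordConst a := by
  have hl0 : 0 < l := by linarith
  have h := integral_comp_mul_left_Ioi
    (fun u : ℝ => (1 - Real.exp (-u)) * u ^ (-1 - a / 2)) 0 hl0
  rw [mul_zero, smul_eq_mul] at h
  have e : ∀ t ∈ Ioi (0 : ℝ), (1 - Real.exp (-(t * l))) * t ^ (-1 - a / 2) =
      l ^ (1 + a / 2) * ((1 - Real.exp (-(l * t))) * (l * t) ^ (-1 - a / 2)) := by
    intro t ht
    rw [Real.mul_rpow hl0.le (le_of_lt ht), mul_comm t l]
    have : l ^ (1 + a / 2) * l ^ (-1 - a / 2) = 1 := by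
      rw [← Real.rpow_add hl0]; ring_nf; simp
    linear_combination -((1 - Real.exp (-(l * t))) * t ^ (-1 - a / 2)) * this
  rw [setIntegral_congr_fun measurableSet_Ioi e, integral_const_mul, h, subordConst, ← mul_assoc]
  congr 1
  rw [← Real.rpow_neg_one, ← Real.rpow_add hl0]; ring_nf

lemma subordConst_pos {a : ℝ} (ha : 0 < a) (ha2 : a < 2) : 0 < subordConst a := by
  have hi := integrableOn_subord ha ha2 le_rfl
  simp only [mul_one] at hi
  have hpos : ∀ t ∈ Ioi (0 : ℝ), 0 < (1 - Real.exp (-t)) * t ^ (-1 - a / 2) := by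
    intro t ht
    have : Real.exp (-t) < 1 := Real.exp_lt_one_iff.2 (neg_lt_zero.2 ht)
    exact mul_pos (by linarith) (Real.rpow_pos_of_pos ht _)
  rw [subordConst, setIntegral_pos_iff_support_of_nonneg_ae _ hi]
  · refine lt_of_lt_of_le ?_ (measure_mono (s := Ioi (0 : ℝ)) fun t ht =>
      ⟨(hpos t ht).ne', ht⟩)
    simp
  · filter_upwards [ae_restrict_mem measurableSet_Ioi] with t ht using (hpos t ht).le

lemma exists_norm_toepForm_jb_le {a τ : ℝ} (ha : 0 < a) (haτ : a < τ) (hτ1 : τ ≤ 1) :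
    ∃ K : ℝ, 0 ≤ K ∧ ∀ (G : Torus → ℂ), MemLp G ∞ volume → ∀ (A B : Finset Freq) (h f : Freq → ℂ),
      ‖toepForm G A B (fun n => ((jb n ^ a : ℝ) : ℂ)) h f‖
        ≤ K * (toepNorm G * (l2w τ A h * l2w τ B f)) := by
  have hτ : 0 ≤ τ := by linarith
  have hc := subordConst_pos ha (by linarith)
  have hJ := integrableOn_min_rpow (κ := τ / 2) ha (by linarith)
  set J := ∫ t in Ioi (0 : ℝ), min 1 (t ^ (τ / 2)) * t ^ (-1 - a / 2) with hJdef
  have hJ0 : 0 ≤ J := setIntegral_nonneg measurableSet_Ioi fun t ht => by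
    have ht0 : 0 < t := ht
    positivity
  refine ⟨73 * J / subordConst a, by positivity, fun G hG A B h f => ?_⟩
  set D := toepNorm G * (l2w τ A h * l2w τ B f) with hD
  have hD0 : 0 ≤ D :=
    mul_nonneg (toepNorm_nonneg G) (mul_nonneg (l2w_nonneg _ _ _) (l2w_nonneg _ _ _))
  have hjb : ∀ n : Freq, 1 ≤ jb n ^ 2 := fun n => one_le_pow₀ (one_le_jb n)
  have hint : ∀ n : Freq, Integrable
      (fun t : ℝ => (((1 - Real.exp (-(t * jb n ^ 2))) * t ^ (-1 - a / 2) : ℝ) : ℂ))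
      (volume.restrict (Ioi 0)) := fun n =>
    (integrableOn_subord ha (by linarith) (hjb n)).ofReal
  have e1 : (fun n => ((subordConst a : ℝ) : ℂ) * ((jb n ^ a : ℝ) : ℂ)) = fun n =>
      ∫ t in Ioi (0 : ℝ), (((1 - Real.exp (-(t * jb n ^ 2))) * t ^ (-1 - a / 2) : ℝ) : ℂ) := by
    ext n
    rw [integral_complex_ofReal, integral_subord (hjb n), ← Real.rpow_natCast,
      ← Real.rpow_mul (jb_pos n).le]
    have : ((2 : ℕ) : ℝ) * (a / 2) = a := by push_cast; ring
    rw [this]; push_cast; ring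
  have hb : ∀ t ∈ Ioi (0 : ℝ), ‖toepForm G A B
      (fun n => (((1 - Real.exp (-(t * jb n ^ 2))) * t ^ (-1 - a / 2) : ℝ) : ℂ)) h f‖
      ≤ 73 * D * (min 1 (t ^ (τ / 2)) * t ^ (-1 - a / 2)) := by
    intro t ht
    have ht0 : 0 < t := ht
    have e2 : (fun n => (((1 - Real.exp (-(t * jb n ^ 2))) * t ^ (-1 - a / 2) : ℝ) : ℂ)) =
        fun n => ((t ^ (-1 - a / 2) : ℝ) : ℂ) * (((1 - Real.exp (-t) : ℝ) : ℂ) * 1 +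
          ((Real.exp (-t) : ℝ) : ℂ) * (1 - Complex.exp (-(t * normSq n : ℝ)))) := by
      ext n
      have : Real.exp (-(t * jb n ^ 2)) = Real.exp (-t) * Real.exp (-(t * normSq n)) := by
        rw [← Real.exp_add, jb_sq]; congr 1; ring
      rw [this]; push_cast; ring
    rw [e2, toepForm_const_mul, toepForm_add, toepForm_const_mul, toepForm_const_mul, norm_mul]
    have b1 : ‖toepForm G A B (fun _ => 1) h f‖ ≤ D := by
      refine (norm_toepForm_one_le hG A B h f).trans ?_
      have l : ∀ (S : Finset Freq) (g : Freq → ℂ), l2w 0 S g ≤ l2w τ S g := by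
        intro S g
        have := l2w_mono_of_le (τ := 0) (τ' := τ) (c := 1) zero_le_one (A := S) (h := g) (h' := g)
          fun n _ => by
            rw [one_mul]; exact mul_le_mul_of_nonneg_right (jb_rpow_le n hτ) (norm_nonneg _)
        simpa using this
      rw [hD]
      have := toepNorm_nonneg G
      gcongr
      · exact l2w_nonneg _ _ _
      · exact l2w_nonneg _ _ _
      · exact l _ _
      · exact l _ _
    have b2 := norm_toepForm_heat_le hG hτ hτ1 A B h f ht0
    have x1 : 1 - Real.exp (-t) ≤ min 1 (t ^ (τ / 2)) := by
      have h1 := one_sub_exp_le_min (t := t) le_rfl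
      rw [mul_one, one_mul] at h1
      refine h1.trans (le_min (min_le_left _ _) ?_)
      rcases le_total t 1 with h2 | h2
      · refine (min_le_right _ _).trans ?_
        conv_lhs => rw [← Real.rpow_one t]
        exact Real.rpow_le_rpow_of_exponent_ge ht0 h2 (by linarith)
      · exact (min_le_left _ _).trans (Real.one_le_rpow h2 (by linarith))
    have x0 : 0 ≤ 1 - Real.exp (-t) := by
      have : Real.exp (-t) ≤ 1 := Real.exp_le_one_iff.2 (by linarith)
      linarith
    have x2 : Real.exp (-t) * t ^ (τ / 2) ≤ min 1 (t ^ (τ / 2)) := by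
      have hpos : 0 < t ^ (τ / 2) := Real.rpow_pos_of_pos ht0 _
      refine le_min ?_ ?_
      · have h3 : t ^ (τ / 2) ≤ Real.exp t := by
          refine le_trans ?_ (Real.add_one_le_exp t)
          rcases le_total t 1 with h2 | h2
          · have := Real.rpow_le_one ht0.le h2 (z := τ / 2) (by linarith); linarith
          · have := Real.rpow_le_rpow_of_exponent_le h2 (show τ / 2 ≤ 1 by linarith)
            rw [Real.rpow_one] at this; linarith
        rw [Real.exp_neg, inv_mul_le_iff₀ (Real.exp_pos t)]; linarith
      · have : Real.exp (-t) ≤ 1 := Real.exp_le_one_iff.2 (by linarith)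
        nlinarith
    have n1 : ‖((1 - Real.exp (-t) : ℝ) : ℂ) * toepForm G A B (fun _ => 1) h f‖
        ≤ min 1 (t ^ (τ / 2)) * D := by
      rw [norm_mul, Complex.norm_real, Real.norm_of_nonneg x0]
      exact mul_le_mul x1 b1 (norm_nonneg _) (by positivity)
    have n2 : ‖((Real.exp (-t) : ℝ) : ℂ) *
        toepForm G A B (fun n => 1 - Complex.exp (-(t * normSq n : ℝ))) h f‖
        ≤ 72 * D * min 1 (t ^ (τ / 2)) := by
      rw [norm_mul, Complex.norm_real, Real.norm_of_nonneg (Real.exp_pos _).le]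
      calc _ ≤ Real.exp (-t) * (72 * toepNorm G * t ^ (τ / 2) * (l2w τ A h * l2w τ B f)) :=
            mul_le_mul_of_nonneg_left b2 (Real.exp_pos _).le
        _ = 72 * D * (Real.exp (-t) * t ^ (τ / 2)) := by rw [hD]; ring
        _ ≤ _ := mul_le_mul_of_nonneg_left x2 (by positivity)
    have hp : 0 ≤ t ^ (-1 - a / 2) := Real.rpow_nonneg ht0.le _
    rw [Complex.norm_real, Real.norm_of_nonneg hp]
    calc _ ≤ t ^ (-1 - a / 2) * (min 1 (t ^ (τ / 2)) * D + 72 * D * min 1 (t ^ (τ / 2))) :=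
          mul_le_mul_of_nonneg_left ((norm_add_le _ _).trans (add_le_add n1 n2)) hp
      _ = _ := by ring
  have e3 : ((subordConst a : ℝ) : ℂ) * toepForm G A B (fun n => ((jb n ^ a : ℝ) : ℂ)) h f =
      ∫ t in Ioi (0 : ℝ), toepForm G A B
        (fun n => (((1 - Real.exp (-(t * jb n ^ 2))) * t ^ (-1 - a / 2) : ℝ) : ℂ)) h f := by
    rw [← toepForm_const_mul, e1]
    exact toepForm_integral (m := fun t n =>
      (((1 - Real.exp (-(t * jb n ^ 2))) * t ^ (-1 - a / 2) : ℝ) : ℂ)) hint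
  have e4 : subordConst a * ‖toepForm G A B (fun n => ((jb n ^ a : ℝ) : ℂ)) h f‖ ≤
      73 * D * J := by
    calc _ = ‖((subordConst a : ℝ) : ℂ) * toepForm G A B (fun n => ((jb n ^ a : ℝ) : ℂ)) h f‖ := by
          rw [norm_mul, Complex.norm_real, Real.norm_of_nonneg hc.le]
      _ ≤ ∫ t in Ioi (0 : ℝ), 73 * D * (min 1 (t ^ (τ / 2)) * t ^ (-1 - a / 2)) := by
          rw [e3]
          refine norm_integral_le_of_norm_le (hJ.const_mul _) ?_
          filter_upwards [ae_restrict_mem measurableSet_Ioi] with t ht using hb t ht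
      _ = _ := by rw [integral_const_mul]
  rw [div_mul_eq_mul_div, le_div_iff₀ hc]
  linarith

end WeightedToeplitz

lemma l2w_le_hsNorm {τ : ℝ} {f : Distr} (hf : hsNorm τ f < ∞) (B : Finset Freq) :
    l2w τ B f ≤ (hsNorm τ f).toReal := by
  refine Real.sqrt_le_iff.2 ⟨ENNReal.toReal_nonneg, ?_⟩
  have h : ENNReal.ofReal (∑ n ∈ B, (jb n ^ τ * ‖f n‖) ^ 2) ≤ hsNorm τ f ^ 2 := by
    rw [hsNorm_sq, ENNReal.ofReal_sum_of_nonneg fun _ _ => sq_nonneg _]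
    exact ENNReal.sum_le_tsum B
  rw [← ENNReal.toReal_pow]
  exact (ENNReal.ofReal_le_iff_le_toReal (ENNReal.pow_lt_top hf).ne).1 h

lemma hsNorm_le_ofReal {s R : ℝ} (hR : 0 ≤ R) {f : Distr}
    (h : ∀ A : Finset Freq, ∑ n ∈ A, (jb n ^ s * ‖f n‖) ^ 2 ≤ R ^ 2) :
    hsNorm s f ≤ ENNReal.ofReal R := by
  have h2 : hsNorm s f ^ 2 ≤ ENNReal.ofReal R ^ 2 := by
    rw [hsNorm_sq, ENNReal.tsum_eq_iSup_sum]
    refine iSup_le fun A => ?_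
    rw [← ENNReal.ofReal_sum_of_nonneg fun _ _ => sq_nonneg _, ← ENNReal.ofReal_pow hR]
    exact ENNReal.ofReal_le_ofReal (h A)
  exact (ENNReal.pow_le_pow_left_iff two_ne_zero).1 h2

/-- The product estimate `H^τ · W^{-a,∞} ⊂ H^{-τ}` for `0 < a < τ ≤ 1`. -/
lemma exists_hsNorm_mul_wInf_le {a τ : ℝ} (ha : 0 < a) (haτ : a < τ) (hτ1 : τ ≤ 1) :
    ∃ C : ℝ≥0, ∀ f g : Distr, hsNorm τ f < ∞ → wInfNorm (-a) g < ∞ →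
      hsNorm (-τ) (mul f g) ≤ C * hsNorm τ f * wInfNorm (-a) g := by
  obtain ⟨K, hK0, hK⟩ := exists_norm_toepForm_jb_le ha haτ hτ1
  refine ⟨K.toNNReal, fun f g hf hg => ?_⟩
  have hpi := Real.pi_pos
  have core : ∀ G : Torus → ℂ, MemLp G ∞ volume → (∀ n, torusCoeff G n = wt (-a) g n) →
      hsNorm (-τ) (mul f g) ≤ K.toNNReal * hsNorm τ f * eLpNorm G ∞ volume := by
    intro G hG hGc
    set F := (hsNorm τ f).toReal with hF
    set E := (eLpNorm G ∞ volume).toReal with hE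
    have hgc : ∀ n, ((jb n ^ a : ℝ) : ℂ) * torusCoeff G n = g n := by
      intro n
      rw [hGc, wt, ← mul_assoc, ← Complex.ofReal_mul, ← Real.rpow_add (jb_pos n)]
      simp
    have hR : (K.toNNReal : ℝ≥0∞) * hsNorm τ f * eLpNorm G ∞ volume
        = ENNReal.ofReal (K * F * E) := by
      rw [ENNReal.ofReal_mul (mul_nonneg hK0 ENNReal.toReal_nonneg), ENNReal.ofReal_mul hK0,
        ENNReal.ofReal_toReal hf.ne, ENNReal.ofReal_toReal hG.eLpNorm_ne_top]
      rfl
    rw [hR]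
    have hF0 : 0 ≤ F := ENNReal.toReal_nonneg
    have hE0 : 0 ≤ E := ENNReal.toReal_nonneg
    refine hsNorm_le_ofReal (by positivity) fun A => ?_
    have hsum : ∀ n, Summable fun k => f k * g (n - k) := by
      have h2 : hsNorm (-a) g < ∞ :=
        (hsNorm_le_wInfNorm _ _).trans_lt (ENNReal.mul_lt_top ENNReal.ofReal_lt_top hg)
      exact summable_mul ha.le ((hsNorm_mono haτ.le f).trans_lt hf) h2
    have hB : ∀ B : Finset Freq, ∑ n ∈ A, (jb n ^ (-τ) * ‖∑ k ∈ B, f k * g (n - k)‖) ^ 2 ≤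
        (2 * Real.pi * (K * F * E)) ^ 2 := by
      intro B
      set P : Freq → ℂ := fun n => ∑ k ∈ B, f k * g (n - k) with hP
      set h : Freq → ℂ := fun n => ((jb n ^ (-τ) * jb n ^ (-τ) : ℝ) : ℂ) * (starRingEnd ℂ) (P n)
        with hh
      set S := ∑ n ∈ A, (jb n ^ (-τ) * ‖P n‖) ^ 2 with hS
      have hS0 : 0 ≤ S := Finset.sum_nonneg fun _ _ => sq_nonneg _
      have e : toepForm G A B (fun n => ((jb n ^ a : ℝ) : ℂ)) h f = (S : ℂ) := by
        rw [toepForm, hS, Complex.ofReal_sum]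
        refine Finset.sum_congr rfl fun n _ => ?_
        have : ∀ k, h n * f k * (((jb (n - k) ^ a : ℝ) : ℂ) * torusCoeff G (n - k)) =
            h n * (f k * g (n - k)) := fun k => by rw [hgc, mul_assoc]
        simp_rw [this]
        rw [← Finset.mul_sum]
        change h n * P n = _
        rw [hh]
        have : (starRingEnd ℂ) (P n) * P n = ((‖P n‖ ^ 2 : ℝ) : ℂ) := by
          rw [Complex.ofReal_pow]; exact Complex.conj_mul' _
        rw [mul_assoc, this]; push_cast; ring
      have lh : l2w τ A h = Real.sqrt S := by
        rw [l2w, hS]; congr 1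
        refine Finset.sum_congr rfl fun n _ => ?_
        have hp := jb_rpow_pos n (-τ)
        rw [hh, norm_mul, Complex.norm_real, Real.norm_of_nonneg (by positivity), RCLike.norm_conj]
        have : jb n ^ τ * jb n ^ (-τ) = 1 := by rw [← Real.rpow_add (jb_pos n)]; simp
        congr 1
        linear_combination (jb n ^ (-τ) * ‖P n‖) * this
      have b := hK G hG A B h f
      rw [e, lh, Complex.norm_real, Real.norm_of_nonneg hS0] at b
      have b2 : S ≤ (2 * Real.pi * (K * F * E)) * Real.sqrt S := by
        calc S ≤ _ := b
          _ ≤ K * (toepNorm G * (Real.sqrt S * F)) := by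
              have := toepNorm_nonneg G
              have := l2w_le_hsNorm hf B
              gcongr
          _ = _ := by rw [toepNorm]; ring
      have hq := Real.sq_sqrt hS0
      have hq0 := Real.sqrt_nonneg S
      have hD : 0 ≤ 2 * Real.pi * (K * F * E) := by positivity
      rcases hq0.eq_or_lt with h0 | h0
      · rw [← hq, ← h0]; nlinarith
      · have : Real.sqrt S ≤ 2 * Real.pi * (K * F * E) := by nlinarith
        rw [← hq]; exact pow_le_pow_left₀ hq0 this 2
    have hlim : Tendsto (fun B : Finset Freq =>
        ∑ n ∈ A, (jb n ^ (-τ) * ‖∑ k ∈ B, f k * g (n - k)‖) ^ 2) atTop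
        (𝓝 (∑ n ∈ A, (jb n ^ (-τ) * ‖∑' k, f k * g (n - k)‖) ^ 2)) :=
      tendsto_finsetSum _ fun n _ => (((hsum n).hasSum.norm).const_mul _).pow 2
    have h1 := le_of_tendsto' hlim hB
    have h2 : ∑ n ∈ A, (jb n ^ (-τ) * ‖∑' k, f k * g (n - k)‖) ^ 2 =
        (2 * Real.pi) ^ 2 * ∑ n ∈ A, (jb n ^ (-τ) * ‖mul f g n‖) ^ 2 := by
      rw [Finset.mul_sum]
      refine Finset.sum_congr rfl fun n _ => ?_
      have : ‖mul f g n‖ = (2 * Real.pi)⁻¹ * ‖∑' k, f k * g (n - k)‖ := by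
        rw [mul, norm_mul, norm_inv, norm_mul, Complex.norm_real, Real.norm_of_nonneg hpi.le]; simp
      rw [this]; field_simp
    rw [h2, mul_pow (2 * Real.pi) (K * F * E)] at h1
    exact le_of_mul_le_mul_left h1 (by positivity)
  rcases eq_or_ne ((K.toNNReal : ℝ≥0∞) * hsNorm τ f) 0 with h0 | h0
  · obtain ⟨G, hG, hGc, -⟩ := exists_of_wInfNorm_lt hg
    have := core G hG hGc
    rw [h0, zero_mul] at this
    exact this.trans zero_le
  · have hfin : (K.toNNReal : ℝ≥0∞) * hsNorm τ f ≠ ∞ :=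
      ENNReal.mul_ne_top ENNReal.coe_ne_top hf.ne
    rw [mul_comm ((K.toNNReal : ℝ≥0∞) * hsNorm τ f), ← ENNReal.div_le_iff h0 hfin]
    refine le_wInfNorm fun G hG hGc => ?_
    rw [ENNReal.div_le_iff h0 hfin, mul_comm]
    exact core G hG hGc

/-! ### Paths of distributions -/

/-- The properties of the extended norms on `Distr` that the path spaces need. -/
structure IsDistrNorm (N : Distr → ℝ≥0∞) : Prop where
  zero : N 0 = 0
  add_le : ∀ f g, N (f + g) ≤ N f + N g
  neg : ∀ f, N (-f) = N f

lemma isDistrNorm_hsNorm (s : ℝ) : IsDistrNorm (hsNorm s) :=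
  ⟨hsNorm_zero s, hsNorm_add_le s, hsNorm_neg s⟩

lemma isDistrNorm_wInfNorm (s : ℝ) : IsDistrNorm (wInfNorm s) :=
  ⟨wInfNorm_zero s, wInfNorm_add_le s, wInfNorm_neg s⟩


lemma IsDistrNorm.sub_le {N : Distr → ℝ≥0∞} (hN : IsDistrNorm N) (f g : Distr) :
    N (f - g) ≤ N f + N g := by
  rw [sub_eq_add_neg, ← hN.neg g]; exact hN.add_le _ _

lemma IsDistrNorm.sub_comm {N : Distr → ℝ≥0∞} (hN : IsDistrNorm N) (f g : Distr) :
    N (f - g) = N (g - f) := by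
  rw [← hN.neg, neg_sub]

lemma IsDistrNorm.le_add_sub {N : Distr → ℝ≥0∞} (hN : IsDistrNorm N) (f g : Distr) :
    N f ≤ N g + N (f - g) := by
  simpa using hN.add_le g (f - g)

section Paths

variable {N N' : Distr → ℝ≥0∞} {T : ℝ} {f g : ℝ → Distr}

lemma ContIn.lt_top (hf : ContIn N T f) {t : ℝ} (ht : t ∈ Icc 0 T) : N (f t) < ∞ := (hf t ht).1

lemma tendsto_zero_of_le {l : Filter ℝ} {u v : ℝ → ℝ≥0∞} (hv : Tendsto v l (𝓝 0))
    (h : ∀ t, u t ≤ v t) : Tendsto u l (𝓝 0) :=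
  tendsto_of_tendsto_of_tendsto_of_le_of_le tendsto_const_nhds hv (fun _ => zero_le) h

lemma ContIn.add (hN : IsDistrNorm N) (hf : ContIn N T f) (hg : ContIn N T g) :
    ContIn N T (f + g) := fun t ht => by
  refine ⟨(hN.add_le _ _).trans_lt (ENNReal.add_lt_top.2 ⟨(hf t ht).1, (hg t ht).1⟩), ?_⟩
  have h := (hf t ht).2.add (hg t ht).2
  rw [add_zero] at h
  refine tendsto_zero_of_le h fun t' => ?_
  have : (f + g) t' - (f + g) t = (f t' - f t) + (g t' - g t) := by
    simp only [Pi.add_apply]; abel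
  rw [this]; exact hN.add_le _ _

lemma ContIn.neg (hN : IsDistrNorm N) (hf : ContIn N T f) : ContIn N T (-f) := fun t ht => by
  refine ⟨by rw [Pi.neg_apply, hN.neg]; exact (hf t ht).1, ?_⟩
  refine tendsto_zero_of_le (hf t ht).2 fun t' => ?_
  have : (-f) t' - (-f) t = -(f t' - f t) := by simp only [Pi.neg_apply]; abel
  rw [this, hN.neg]

lemma ContIn.sub (hN : IsDistrNorm N) (hf : ContIn N T f) (hg : ContIn N T g) :
    ContIn N T (f - g) := by
  rw [sub_eq_add_neg]; exact hf.add hN (hg.neg hN)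

lemma ContIn.congr (hf : ContIn N T f) (h : ∀ t ∈ Icc 0 T, g t = f t) : ContIn N T g :=
    fun t ht => by
  refine ⟨by rw [h t ht]; exact (hf t ht).1, ((hf t ht).2).congr' ?_⟩
  filter_upwards [self_mem_nhdsWithin] with t' ht'
  rw [h t ht, h t' ht']

lemma ContIn.mono (hf : ContIn N T f) {T' : ℝ} (hT : T' ≤ T) : ContIn N T' f := fun t ht =>
  have hs : Icc 0 T' ⊆ Icc 0 T := Icc_subset_Icc_right hT
  ⟨(hf t (hs ht)).1, (hf t (hs ht)).2.mono_left (nhdsWithin_mono _ hs)⟩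

lemma ContIn.of_le (hf : ContIn N T f) {c : ℝ≥0∞} (hc : c ≠ ∞) (h : ∀ u, N' u ≤ c * N u) :
    ContIn N' T f := fun t ht => by
  refine ⟨(h _).trans_lt (ENNReal.mul_lt_top hc.lt_top (hf t ht).1), ?_⟩
  have h1 := ENNReal.Tendsto.const_mul (hf t ht).2 (Or.inr hc)
  rw [mul_zero] at h1
  exact tendsto_zero_of_le h1 fun t' => h _

lemma ContIn.exists_bound (hN : IsDistrNorm N) (hf : ContIn N T f) :
    ∃ R : ℝ, 0 ≤ R ∧ ∀ t ∈ Icc 0 T, N (f t) ≤ ENNReal.ofReal R := by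
  have key : ∃ R : ℝ, 0 ≤ R ∧ ∀ t ∈ Icc 0 T, t ∈ Icc 0 T → N (f t) ≤ ENNReal.ofReal R := by
    refine (isCompact_Icc (a := (0 : ℝ)) (b := T)).induction_on
      (p := fun S => ∃ R : ℝ, 0 ≤ R ∧ ∀ t ∈ S, t ∈ Icc 0 T → N (f t) ≤ ENNReal.ofReal R) ?_ ?_ ?_ ?_
    · exact ⟨0, le_rfl, fun t ht => absurd ht (notMem_empty t)⟩
    · rintro S S' h ⟨R, hR, hb⟩
      exact ⟨R, hR, fun t ht => hb t (h ht)⟩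
    · rintro S S' ⟨R, hR, hb⟩ ⟨R', hR', hb'⟩
      refine ⟨max R R', le_max_of_le_left hR, fun t ht htT => ?_⟩
      rcases ht with ht | ht
      · exact (hb t ht htT).trans (ENNReal.ofReal_le_ofReal (le_max_left _ _))
      · exact (hb' t ht htT).trans (ENNReal.ofReal_le_ofReal (le_max_right _ _))
    · intro t ht
      refine ⟨{t' | N (f t' - f t) < 1}, (hf t ht).2.eventually_lt_const one_pos,
        (N (f t)).toReal + 1, by positivity, fun t' ht' _ => ?_⟩
      rw [ENNReal.ofReal_add ENNReal.toReal_nonneg zero_le_one,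
        ENNReal.ofReal_toReal (hf t ht).1.ne, ENNReal.ofReal_one]
      exact (hN.le_add_sub _ (f t)).trans (by gcongr; exact le_of_lt ht')
  obtain ⟨R, hR, hb⟩ := key
  exact ⟨R, hR, fun t ht => hb t ht ht⟩

lemma le_supNorm {t : ℝ} (ht : t ∈ Icc 0 T) : N (f t) ≤ supNorm N T f :=
  le_iSup₂ (f := fun t (_ : t ∈ Icc (0 : ℝ) T) => N (f t)) t ht

lemma contIn_of_uniform_limit (hN : IsDistrNorm N) {w : ℕ → ℝ → Distr} (hw : ∀ k, ContIn N T (w k))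
    {b : ℕ → ℝ≥0∞} (hb : Tendsto b atTop (𝓝 0)) (h : ∀ k, ∀ t ∈ Icc 0 T, N (w k t - f t) ≤ b k) :
    ContIn N T f := fun t ht => by
  constructor
  · obtain ⟨k, hk⟩ := (hb.eventually_lt_const one_pos).exists
    refine (hN.le_add_sub _ (w k t)).trans_lt (ENNReal.add_lt_top.2 ⟨(hw k t ht).1, ?_⟩)
    rw [hN.sub_comm]
    exact ((h k t ht).trans hk.le).trans_lt ENNReal.one_lt_top
  · refine ENNReal.tendsto_nhds_zero.2 fun ε hε => ?_
    have h3 : 0 < ε / 3 := ENNReal.div_pos hε.ne' (by norm_num)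
    obtain ⟨k, hk⟩ := (hb.eventually_lt_const h3).exists
    filter_upwards [(hw k t ht).2.eventually_lt_const h3, self_mem_nhdsWithin] with t' h1 h2
    have e : f t' - f t = -(w k t' - f t') + (w k t' - w k t) + (w k t - f t) := by abel
    rw [e]
    refine (hN.add_le _ _).trans ((add_le_add (hN.add_le _ _) le_rfl).trans ?_)
    rw [hN.neg]
    calc _ ≤ ε / 3 + ε / 3 + ε / 3 :=
          add_le_add (add_le_add ((h k t' h2).trans hk.le) h1.le) ((h k t ht).trans hk.le)
      _ = ε := ENNReal.add_thirds ε

lemma continuousOn_coeff {s : ℝ} (hf : ContIn (hsNorm s) T f) (n : Freq) :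
    ContinuousOn (fun t => f t n) (Icc 0 T) := by
  intro t ht
  have h1 : Tendsto (fun t' => ENNReal.ofReal (jb n ^ s * ‖(f t' - f t) n‖)) (𝓝[Icc 0 T] t) (𝓝 0) :=
    tendsto_zero_of_le (hf t ht).2 fun t' => ofReal_coeff_le_hsNorm s _ n
  have h2 := (ENNReal.tendsto_toReal ENNReal.zero_ne_top).comp h1
  have h3 : Tendsto (fun t' => ‖f t' n - f t n‖) (𝓝[Icc 0 T] t) (𝓝 0) := by
    have := h2.const_mul (jb n ^ s)⁻¹
    simp only [ENNReal.toReal_zero, mul_zero] at this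
    refine this.congr fun t' => ?_
    have hp := jb_rpow_pos n s
    simp only [Function.comp]
    rw [ENNReal.toReal_ofReal (by positivity), ← mul_assoc, inv_mul_cancel₀ hp.ne', one_mul]
    rfl
  exact tendsto_iff_norm_sub_tendsto_zero.2 h3

lemma hsNorm_le_of_tendsto {s R : ℝ} (hR : 0 ≤ R) {u : ℕ → Distr} {v : Distr}
    (hu : ∀ n, Tendsto (fun k => u k n) atTop (𝓝 (v n)))
    (hb : ∀ᶠ k in atTop, hsNorm s (u k) ≤ ENNReal.ofReal R) :
    hsNorm s v ≤ ENNReal.ofReal R := by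
  refine hsNorm_le_ofReal hR fun A => ?_
  refine le_of_tendsto (tendsto_finsetSum A fun n _ => (((hu n).norm).const_mul (jb n ^ s)).pow 2) ?_
  filter_upwards [hb] with k hk
  have h1 : ENNReal.ofReal (∑ n ∈ A, (jb n ^ s * ‖u k n‖) ^ 2) ≤ ENNReal.ofReal (R ^ 2) := by
    rw [ENNReal.ofReal_pow hR, ENNReal.ofReal_sum_of_nonneg fun _ _ => sq_nonneg _]
    refine (ENNReal.sum_le_tsum A).trans ?_
    rw [← hsNorm_sq]
    exact ENNReal.pow_le_pow_left hk
  exact (ENNReal.ofReal_le_ofReal_iff (sq_nonneg R)).1 h1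

lemma eq_of_hsNorm_sub_eq_zero {s : ℝ} {u v : Distr} (h : hsNorm s (u - v) = 0) : u = v := by
  ext n
  have h1 := ofReal_coeff_le_hsNorm s (u - v) n
  rw [h, nonpos_iff_eq_zero, ENNReal.ofReal_eq_zero] at h1
  have hp := jb_rpow_pos n s
  have h2 : ‖(u - v) n‖ ≤ 0 := by
    by_contra hc
    push Not at hc
    exact absurd h1 (not_le.2 (mul_pos hp hc))
  exact sub_eq_zero.1 (norm_le_zero_iff.1 h2)

/-- A path with continuous coefficients and a square summable majorant is continuous in `H^s`. -/
lemma contIn_of_dominated {s : ℝ} (hc : ∀ n, ContinuousOn (fun t => f t n) (Icc 0 T))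
    {b : Freq → ℝ} (hb : Summable fun n => b n ^ 2)
    (h : ∀ n, ∀ t ∈ Icc 0 T, jb n ^ s * ‖f t n‖ ≤ b n) : ContIn (hsNorm s) T f := fun t ht => by
  have hp : ∀ n t, 0 ≤ jb n ^ s * ‖f t n‖ := fun n t =>
    mul_nonneg (jb_rpow_pos n s).le (norm_nonneg _)
  constructor
  · have h1 : hsNorm s (f t) ^ 2 < ∞ := by
      rw [hsNorm_sq]
      refine lt_of_le_of_lt (ENNReal.tsum_le_tsum fun n => ENNReal.ofReal_le_ofReal
        (pow_le_pow_left₀ (hp n t) (h n t ht) 2)) ?_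
      exact hb.tsum_ofReal_lt_top
    by_contra hcon
    rw [not_lt, top_le_iff] at hcon
    rw [hcon] at h1; simp at h1
  · have hS : ∀ t' ∈ Icc 0 T, ∀ n, (jb n ^ s * ‖(f t' - f t) n‖) ^ 2 ≤ 4 * b n ^ 2 := by
      intro t' ht' n
      have h0 : jb n ^ s * ‖(f t' - f t) n‖ ≤ 2 * b n := by
        have h1 := norm_sub_le (f t' n) (f t n)
        have h2 := mul_le_mul_of_nonneg_left h1 (jb_rpow_pos n s).le
        have h3 := h n t ht
        have h4 := h n t' ht'
        rw [mul_add] at h2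
        rw [Pi.sub_apply]
        linarith
      calc _ ≤ (2 * b n) ^ 2 :=
            pow_le_pow_left₀ (mul_nonneg (jb_rpow_pos n s).le (norm_nonneg _)) h0 2
        _ = _ := by ring
    have h1 : Tendsto (fun t' => ∑' n, (jb n ^ s * ‖(f t' - f t) n‖) ^ 2) (𝓝[Icc 0 T] t)
        (𝓝 (∑' n : Freq, (0 : ℝ))) := by
      refine tendsto_tsum_of_dominated_convergence (hb.mul_left 4) (fun n => ?_) ?_
      · have h2 := tendsto_iff_norm_sub_tendsto_zero.1 (hc n t ht)
        have h3 := (h2.const_mul (jb n ^ s)).pow 2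
        simpa using h3
      · filter_upwards [self_mem_nhdsWithin] with t' ht' n
        rw [Real.norm_of_nonneg (sq_nonneg _)]
        exact hS t' ht' n
    rw [tsum_zero] at h1
    have h2 := (ENNReal.continuous_ofReal.tendsto 0).comp h1
    rw [ENNReal.ofReal_zero] at h2
    have h3 := (ENNReal.continuous_rpow_const (y := 1 / 2)).tendsto 0 |>.comp h2
    rw [ENNReal.zero_rpow_of_pos (by norm_num)] at h3
    refine h3.congr' ?_
    filter_upwards [self_mem_nhdsWithin] with t' ht'
    simp only [Function.comp, hsNorm]
    rw [ENNReal.ofReal_tsum_of_nonneg (fun _ => sq_nonneg _)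
      ((hb.mul_left 4).of_nonneg_of_le (fun _ => sq_nonneg _) (hS t' ht'))]

end Paths

/-! ### The Duhamel operator -/

section Duhamel

variable {T : ℝ} {F G : ℝ → Distr}

lemma norm_sin_div_jb_le (x : ℝ) (n : Freq) : ‖((Real.sin x / jb n : ℝ) : ℂ)‖ ≤ jb n ^ (-1 : ℝ) := by
  rw [Complex.norm_real, Real.norm_eq_abs, abs_div, abs_of_pos (jb_pos n), Real.rpow_neg_one,
    div_eq_mul_inv]
  exact mul_le_of_le_one_left (inv_nonneg.2 (jb_pos n).le) (Real.abs_sin_le_one x)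

lemma intervalIntegrable_duhamel (hF : ∀ n, ContinuousOn (fun t => F t n) (Icc 0 T)) {t : ℝ}
    (ht : t ∈ Icc 0 T) (n : Freq) :
    IntervalIntegrable (fun t' => ((Real.sin ((t - t') * jb n) / jb n : ℝ) : ℂ) * F t' n)
      volume 0 t := by
  refine ContinuousOn.intervalIntegrable ?_
  rw [uIcc_of_le ht.1]
  refine ContinuousOn.mul ?_ ((hF n).mono (Icc_subset_Icc_right ht.2))
  fun_prop

lemma duhamel_sub (hF : ∀ n, ContinuousOn (fun t => F t n) (Icc 0 T))
    (hG : ∀ n, ContinuousOn (fun t => G t n) (Icc 0 T)) {t : ℝ} (ht : t ∈ Icc 0 T) :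
    duhamel (F - G) t = duhamel F t - duhamel G t := by
  ext n
  simp only [duhamel, Pi.sub_apply, mul_sub]
  exact intervalIntegral.integral_sub (intervalIntegrable_duhamel hF ht n)
    (intervalIntegrable_duhamel hG ht n)

lemma duhamel_congr {t : ℝ} (ht : 0 ≤ t) (h : ∀ t' ∈ Icc 0 t, F t' = G t') :
    duhamel F t = duhamel G t := by
  ext n
  refine intervalIntegral.integral_congr fun t' ht' => ?_
  rw [uIcc_of_le ht] at ht'
  simp only [h t' ht']

lemma continuousOn_duhamel_coeff (hF : ∀ n, ContinuousOn (fun t => F t n) (Icc 0 T)) (hT : 0 ≤ T)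
    (n : Freq) : ContinuousOn (fun t => duhamel F t n) (Icc 0 T) := by
  have hi : ∀ g : ℝ → ℝ, Continuous g →
      ContinuousOn (fun t => ∫ t' in (0 : ℝ)..t, ((g t' : ℝ) : ℂ) * F t' n) (Icc 0 T) := by
    intro g hg
    have h1 : IntegrableOn (fun t' => ((g t' : ℝ) : ℂ) * F t' n) (uIcc 0 T) := by
      rw [uIcc_of_le hT]
      exact ContinuousOn.integrableOn_Icc (ContinuousOn.mul (by fun_prop) (hF n))
    have := intervalIntegral.continuousOn_primitive_interval h1
    rwa [uIcc_of_le hT] at this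
  have e : ∀ t ∈ Icc 0 T, duhamel F t n = ((Real.sin (t * jb n) / jb n : ℝ) : ℂ) *
        (∫ t' in (0 : ℝ)..t, ((Real.cos (t' * jb n) : ℝ) : ℂ) * F t' n) -
      ((Real.cos (t * jb n) / jb n : ℝ) : ℂ) *
        (∫ t' in (0 : ℝ)..t, ((Real.sin (t' * jb n) : ℝ) : ℂ) * F t' n) := by
    intro t ht
    have hii : ∀ g : ℝ → ℝ, Continuous g →
        IntervalIntegrable (fun t' => ((g t' : ℝ) : ℂ) * F t' n) volume 0 t := by
      intro g hg
      refine ContinuousOn.intervalIntegrable ?_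
      rw [uIcc_of_le ht.1]
      exact ContinuousOn.mul (by fun_prop) ((hF n).mono (Icc_subset_Icc_right ht.2))
    rw [← intervalIntegral.integral_const_mul, ← intervalIntegral.integral_const_mul,
      ← intervalIntegral.integral_sub ((hii _ (by fun_prop)).const_mul _)
        ((hii _ (by fun_prop)).const_mul _), duhamel]
    refine intervalIntegral.integral_congr fun t' _ => ?_
    simp only [sub_mul, Real.sin_sub]
    push_cast; ring
  refine ContinuousOn.congr ?_ e
  exact (ContinuousOn.mul (by fun_prop) (hi _ (by fun_prop))).sub
    (ContinuousOn.mul (by fun_prop) (hi _ (by fun_prop)))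

lemma lintegral_sq_le {X : Type*} [MeasurableSpace X] {μ : Measure X} {g : X → ℝ≥0∞}
    (hg : AEMeasurable g μ) : (∫⁻ x, g x ∂μ) ^ 2 ≤ μ univ * ∫⁻ x, g x ^ 2 ∂μ := by
  have h := ENNReal.lintegral_mul_le_Lp_mul_Lq μ (p := 2) (q := 2)
    (Real.HolderConjugate.two_two) (f := fun _ => 1) aemeasurable_const hg
  simp only [Pi.mul_apply, one_mul, ENNReal.one_rpow, lintegral_const] at h
  calc _ ≤ _ := ENNReal.pow_le_pow_left h
    _ = _ := by
      rw [mul_pow, ← ENNReal.rpow_natCast, ← ENNReal.rpow_natCast, ← ENNReal.rpow_mul,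
        ← ENNReal.rpow_mul]
      norm_num

lemma enorm_wt_duhamel_le {σ t : ℝ} (ht : 0 ≤ t) (n : Freq) :
    ‖wt σ (duhamel F t) n‖ₑ ≤ ∫⁻ t' in Ioc 0 t, ‖wt (σ - 1) (F t') n‖ₑ := by
  rw [wt, duhamel, intervalIntegral.integral_of_le ht, ← integral_const_mul]
  refine (enorm_integral_le_lintegral_enorm _).trans (lintegral_mono fun t' => ?_)
  rw [← mul_assoc, enorm_mul, enorm_mul, enorm_wt, ← ofReal_norm, ← ofReal_norm, Complex.norm_real,
    Real.norm_of_nonneg (jb_rpow_pos n σ).le]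
  gcongr
  rw [← ENNReal.ofReal_mul (jb_rpow_pos n σ).le]
  refine ENNReal.ofReal_le_ofReal ?_
  have e : jb n ^ (σ - 1) = jb n ^ σ * jb n ^ (-1 : ℝ) := by
    rw [← Real.rpow_add (jb_pos n), sub_eq_add_neg]
  rw [e]
  exact mul_le_mul_of_nonneg_left (norm_sin_div_jb_le _ n) (jb_rpow_pos n σ).le

lemma aemeasurable_wt {σ t : ℝ} (hF : ∀ n, ContinuousOn (fun t => F t n) (Icc 0 T))
    (ht : t ≤ T) (n : Freq) :
    AEMeasurable (fun t' => ‖wt σ (F t') n‖ₑ) (volume.restrict (Ioc 0 t)) := by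
  have h1 : ContinuousOn (fun t' => wt σ (F t') n) (Ioc 0 t) :=
    ContinuousOn.mul (by fun_prop) ((hF n).mono (Ioc_subset_Icc_self.trans (Icc_subset_Icc_right ht)))
  exact (h1.aestronglyMeasurable measurableSet_Ioc).enorm

lemma hsNorm_duhamel_sq_le {σ t : ℝ} (hF : ∀ n, ContinuousOn (fun t => F t n) (Icc 0 T))
    (ht : t ∈ Icc 0 T) :
    hsNorm σ (duhamel F t) ^ 2 ≤ ENNReal.ofReal t * ∫⁻ t' in Ioc 0 t, hsNorm (σ - 1) (F t') ^ 2 := by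
  have e : ∀ t', hsNorm (σ - 1) (F t') ^ 2 = ∑' n, ‖wt (σ - 1) (F t') n‖ₑ ^ 2 := fun t' =>
    hsNorm_sq_enorm _ _
  simp_rw [e]
  rw [lintegral_tsum fun n => (aemeasurable_wt hF ht.2 n).pow_const 2, ← ENNReal.tsum_mul_left,
    hsNorm_sq_enorm]
  refine ENNReal.tsum_le_tsum fun n => ?_
  refine (ENNReal.pow_le_pow_left (enorm_wt_duhamel_le ht.1 n)).trans ?_
  refine (lintegral_sq_le (aemeasurable_wt hF ht.2 n)).trans_eq ?_
  simp

lemma lintegral_exp_le {lam t : ℝ} (hl : 0 < lam) (ht : 0 ≤ t) :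
    ∫⁻ t' in Ioc 0 t, ENNReal.ofReal (Real.exp (lam * t')) ≤
      ENNReal.ofReal (Real.exp (lam * t) / lam) := by
  rw [← ofReal_integral_eq_lintegral_ofReal]
  · refine ENNReal.ofReal_le_ofReal ?_
    rw [← intervalIntegral.integral_of_le ht,
      intervalIntegral.integral_comp_mul_left (fun x => Real.exp x) hl.ne', integral_exp,
      mul_zero, Real.exp_zero, smul_eq_mul, ← div_eq_inv_mul]
    gcongr
    linarith
  · exact (Continuous.continuousOn (by fun_prop)).integrableOn_Icc.mono_set Ioc_subset_Icc_self
  · exact .of_forall fun _ => (Real.exp_pos _).le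

/-- The Duhamel operator is small in norms with an exponential weight in time. -/
lemma hsNorm_duhamel_le_exp {σ t lam κ r : ℝ} (hF : ∀ n, ContinuousOn (fun t => F t n) (Icc 0 T))
    (ht : t ∈ Icc 0 T) (hl : 0 < lam) (hr : 0 ≤ r) (hκ : 0 ≤ κ) (hr2 : T / (2 * lam) ≤ r ^ 2)
    (hb : ∀ t' ∈ Icc 0 T, hsNorm (σ - 1) (F t') ≤ ENNReal.ofReal (κ * Real.exp (lam * t'))) :
    hsNorm σ (duhamel F t) ≤ ENNReal.ofReal (r * κ * Real.exp (lam * t)) := by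
  rw [← ENNReal.pow_le_pow_left_iff two_ne_zero]
  refine (hsNorm_duhamel_sq_le hF ht).trans ?_
  have hpos := Real.exp_pos (lam * t)
  have hT : 0 ≤ T := ht.1.trans ht.2
  calc _ ≤ ENNReal.ofReal t * ∫⁻ t' in Ioc 0 t,
        ENNReal.ofReal (κ ^ 2) * ENNReal.ofReal (Real.exp (2 * lam * t')) := by
        gcongr 1
        refine setLIntegral_mono' measurableSet_Ioc fun t' ht' => ?_
        refine (ENNReal.pow_le_pow_left (hb t' ⟨ht'.1.le, ht'.2.trans ht.2⟩)).trans_eq ?_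
        rw [← ENNReal.ofReal_pow (by positivity), ← ENNReal.ofReal_mul (sq_nonneg κ), mul_pow,
          ← Real.exp_nat_mul]
        congr 3; push_cast; ring
    _ ≤ ENNReal.ofReal T * (ENNReal.ofReal (κ ^ 2) *
          ENNReal.ofReal (Real.exp (2 * lam * t) / (2 * lam))) := by
        rw [lintegral_const_mul _ (by fun_prop)]
        gcongr
        · exact ht.2
        · exact lintegral_exp_le (by linarith) ht.1
    _ = ENNReal.ofReal (T / (2 * lam) * κ ^ 2 * Real.exp (lam * t) ^ 2) := by
        rw [← ENNReal.ofReal_mul (sq_nonneg κ), ← ENNReal.ofReal_mul hT, ← Real.exp_nat_mul]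
        congr 1
        have : Real.exp (2 * lam * t) = Real.exp ((2 : ℕ) * (lam * t)) := by
          congr 1; push_cast; ring
        rw [this]; ring
    _ ≤ _ := by
        rw [← ENNReal.ofReal_pow (by positivity)]
        refine ENNReal.ofReal_le_ofReal ?_
        rw [mul_pow, mul_pow]
        gcongr

lemma contIn_duhamel {σ : ℝ} (hT : 0 ≤ T) (hF : ContIn (hsNorm (σ - 1)) T F) :
    ContIn (hsNorm σ) T (duhamel F) := by
  have hc := continuousOn_coeff hF
  obtain ⟨R, hR0, hR⟩ := hF.exists_bound (isDistrNorm_hsNorm _)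
  set B : Freq → ℝ≥0∞ := fun n => ∫⁻ t' in Ioc 0 T, ‖wt (σ - 1) (F t') n‖ₑ with hB
  have hBsum : ∑' n, B n ^ 2 < ∞ := by
    calc _ ≤ ∑' n, ENNReal.ofReal T * ∫⁻ t' in Ioc 0 T, ‖wt (σ - 1) (F t') n‖ₑ ^ 2 := by
          refine ENNReal.tsum_le_tsum fun n =>
            (lintegral_sq_le (aemeasurable_wt hc le_rfl n)).trans_eq ?_
          simp
      _ = ENNReal.ofReal T * ∫⁻ t' in Ioc 0 T, hsNorm (σ - 1) (F t') ^ 2 := by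
          simp_rw [hsNorm_sq_enorm]
          rw [lintegral_tsum fun n => (aemeasurable_wt hc le_rfl n).pow_const 2,
            ENNReal.tsum_mul_left]
      _ ≤ ENNReal.ofReal T * ∫⁻ t' in Ioc 0 T, ENNReal.ofReal R ^ 2 := by
          gcongr 1
          exact setLIntegral_mono' measurableSet_Ioc fun t' ht' =>
            ENNReal.pow_le_pow_left (hR t' ⟨ht'.1.le, ht'.2⟩)
      _ < ∞ := by
          rw [setLIntegral_const]
          exact ENNReal.mul_lt_top ENNReal.ofReal_lt_top (ENNReal.mul_lt_top
            (ENNReal.pow_lt_top ENNReal.ofReal_lt_top) (by simp))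
  have hBfin : ∀ n, B n ≠ ∞ := fun n h => by
    have := ENNReal.le_tsum (f := fun n => B n ^ 2) n
    simp only [h] at this
    simp at this
    exact hBsum.ne this
  refine contIn_of_dominated (continuousOn_duhamel_coeff hc hT) (b := fun n => (B n).toReal)
    ?_ fun n t ht => ?_
  · have := ENNReal.summable_toReal hBsum.ne
    simpa [ENNReal.toReal_pow] using this
  · rw [← norm_wt, ← toReal_enorm]
    refine ENNReal.toReal_mono (hBfin n) ((enorm_wt_duhamel_le ht.1 n).trans ?_)
    exact lintegral_mono_set (Ioc_subset_Ioc_right ht.2)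

end Duhamel

/-! ### Local well-posedness -/

lemma mul_smul_right (c : ℂ) (f g : Distr) : mul f (c • g) = c • mul f g := by
  ext n
  simp only [mul, Pi.smul_apply, smul_eq_mul]
  rw [mul_left_comm, ← tsum_mul_left (a := c)]
  congr 2; ext k; ring

/-- The nonlinearity `w² + 2 w q`. -/
def nlin (w q : Distr) : Distr := mul w w + (2 : ℂ) • mul w q

/-- `Q` is a norm of multipliers from `H^σ` to `H^{σ-1}`. -/
structure IsMultNorm (σ C : ℝ) (Q : Distr → ℝ≥0∞) : Prop where
  isDistrNorm : IsDistrNorm Q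
  nonneg : 0 ≤ C
  le_hsNorm : ∀ g, Q g ≤ hsNorm σ g
  smul_le : ∀ g, Q ((2 : ℂ) • g) ≤ 2 * Q g
  summable : ∀ f g, hsNorm σ f < ∞ → Q g < ∞ → ∀ n, Summable fun k => f k * g (n - k)
  mul_le : ∀ f g, hsNorm σ f < ∞ → Q g < ∞ →
    hsNorm (σ - 1) (mul f g) ≤ ENNReal.ofReal C * hsNorm σ f * Q g

/-- The integral equation `w = φ - ℐ(w² + 2 w q)` on `[0,T]`. -/
def SolvesOn (σ T : ℝ) (φ q w : ℝ → Distr) : Prop :=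
  ContIn (hsNorm σ) T w ∧ ∀ t ∈ Icc (0 : ℝ) T,
    w t = φ t - duhamel (fun t' => nlin (w t') (q t')) t

namespace IsMultNorm

variable {σ C T : ℝ} {Q : Distr → ℝ≥0∞}

lemma mul_sub (hM : IsMultNorm σ C Q) {f g h : Distr} (hf : hsNorm σ f < ∞) (hg : Q g < ∞)
    (hh : Q h < ∞) : mul f (g - h) = mul f g - mul f h :=
  mul_sub_right (hM.summable f g hf hg) (hM.summable f h hf hh)

lemma mul_add (hM : IsMultNorm σ C Q) {f g h : Distr} (hf : hsNorm σ f < ∞) (hg : Q g < ∞)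
    (hh : Q h < ∞) : mul f (g + h) = mul f g + mul f h :=
  mul_add_right (hM.summable f g hf hg) (hM.summable f h hf hh)

lemma summable' (hM : IsMultNorm σ C Q) {f g : Distr} (hf : hsNorm σ f < ∞) (hg : Q g < ∞) (n : Freq) :
    Summable fun k => g k * f (n - k) := by
  have h := (Equiv.subLeft n).summable_iff.2 (hM.summable f g hf hg n)
  refine h.congr fun k => ?_
  simp [mul_comm]

lemma sub_mul (hM : IsMultNorm σ C Q) {f f' g : Distr} (hf : hsNorm σ f < ∞)
    (hf' : hsNorm σ f' < ∞) (hg : Q g < ∞) : mul (f - f') g = mul f g - mul f' g := by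
  rw [mul_comm' (f - f'), mul_comm' f, mul_comm' f']
  exact mul_sub_right (hM.summable' hf hg) (hM.summable' hf' hg)

lemma contIn_mul (hM : IsMultNorm σ C Q) {f g : ℝ → Distr} (hf : ContIn (hsNorm σ) T f)
    (hg : ContIn Q T g) : ContIn (hsNorm (σ - 1)) T (fun t => mul (f t) (g t)) := fun t ht => by
  have hf1 := hf.lt_top ht
  have hg1 := hg.lt_top ht
  refine ⟨(hM.mul_le _ _ hf1 hg1).trans_lt
    (ENNReal.mul_lt_top (ENNReal.mul_lt_top ENNReal.ofReal_lt_top hf1) hg1), ?_⟩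
  have h1 : Tendsto (fun t' => ENNReal.ofReal C * hsNorm σ (f t' - f t) * (Q (g t) + 1) +
      ENNReal.ofReal C * hsNorm σ (f t) * Q (g t' - g t)) (𝓝[Icc 0 T] t) (𝓝 0) := by
    have a1 := ENNReal.Tendsto.mul_const (b := Q (g t) + 1)
      (ENNReal.Tendsto.const_mul (a := ENNReal.ofReal C) (hf t ht).2 (Or.inr ENNReal.ofReal_ne_top))
      (Or.inr (by simp [hg1.ne]))
    have a2 := ENNReal.Tendsto.const_mul (a := ENNReal.ofReal C * hsNorm σ (f t)) (hg t ht).2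
      (Or.inr (ENNReal.mul_ne_top ENNReal.ofReal_ne_top hf1.ne))
    simpa using a1.add a2
  refine tendsto_of_tendsto_of_tendsto_of_le_of_le' tendsto_const_nhds h1
    (.of_forall fun _ => zero_le) ?_
  filter_upwards [self_mem_nhdsWithin, (hg t ht).2.eventually_lt_const one_pos] with t' ht' hlt
  have hf2 := hf.lt_top ht'
  have hg2 := hg.lt_top ht'
  have hfd : hsNorm σ (f t' - f t) < ∞ :=
    ((isDistrNorm_hsNorm σ).sub_le _ _).trans_lt (ENNReal.add_lt_top.2 ⟨hf2, hf1⟩)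
  have e : mul (f t') (g t') - mul (f t) (g t) =
      mul (f t' - f t) (g t') + mul (f t) (g t' - g t) := by
    rw [hM.sub_mul hf2 hf1 hg2, hM.mul_sub hf1 hg2 hg1]; abel
  rw [e]
  refine (hsNorm_add_le _ _ _).trans (add_le_add ?_ ?_)
  · refine (hM.mul_le _ _ hfd hg2).trans ?_
    gcongr
    exact (hM.isDistrNorm.le_add_sub _ (g t)).trans (by gcongr)
  · exact hM.mul_le _ _ hf1 (hlt.trans ENNReal.one_lt_top)

lemma contIn_of_hsNorm (hM : IsMultNorm σ C Q) {f : ℝ → Distr} (hf : ContIn (hsNorm σ) T f) :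
    ContIn Q T f :=
  hf.of_le ENNReal.one_ne_top fun u => by rw [one_mul]; exact hM.le_hsNorm u

lemma contIn_two_smul (hN : IsDistrNorm (hsNorm (σ - 1))) {f : ℝ → Distr}
    (hf : ContIn (hsNorm (σ - 1)) T f) : ContIn (hsNorm (σ - 1)) T (fun t => (2 : ℂ) • f t) := by
  have := hf.add hN hf
  refine this.congr fun t _ => ?_
  simp [two_smul]

lemma contIn_nlin (hM : IsMultNorm σ C Q) {w q : ℝ → Distr} (hw : ContIn (hsNorm σ) T w)
    (hq : ContIn Q T q) : ContIn (hsNorm (σ - 1)) T (fun t => nlin (w t) (q t)) :=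
  (hM.contIn_mul hw (hM.contIn_of_hsNorm hw)).add (isDistrNorm_hsNorm _)
    (contIn_two_smul (isDistrNorm_hsNorm _) (hM.contIn_mul hw hq))

lemma nlin_sub (hM : IsMultNorm σ C Q) {w w' q : Distr} (hw : hsNorm σ w < ∞)
    (hw' : hsNorm σ w' < ∞) (hq : Q q < ∞) :
    nlin w q - nlin w' q = mul (w - w') (w + w' + (2 : ℂ) • q) := by
  have hQw := (hM.le_hsNorm w).trans_lt hw
  have hQw' := (hM.le_hsNorm w').trans_lt hw'
  have hQ1 : Q (w + w') < ∞ :=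
    (hM.isDistrNorm.add_le _ _).trans_lt (ENNReal.add_lt_top.2 ⟨hQw, hQw'⟩)
  have hQ2 : Q ((2 : ℂ) • q) < ∞ := (hM.smul_le q).trans_lt (ENNReal.mul_lt_top (by simp) hq)
  have hQ3 : Q (w + w' + (2 : ℂ) • q) < ∞ :=
    (hM.isDistrNorm.add_le _ _).trans_lt (ENNReal.add_lt_top.2 ⟨hQ1, hQ2⟩)
  rw [hM.sub_mul hw hw' hQ3, hM.mul_add hw hQ1 hQ2, hM.mul_add hw' hQ1 hQ2,
    hM.mul_add hw hQw hQw', hM.mul_add hw' hQw hQw', mul_smul_right, mul_smul_right,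
    mul_comm' w' w, nlin, nlin]
  abel

lemma hsNorm_nlin_sub_le (hM : IsMultNorm σ C Q) {w w' q : Distr} {D R A : ℝ} (hD : 0 ≤ D)
    (hR : 0 ≤ R) (hA : 0 ≤ A) (hw : hsNorm σ w ≤ ENNReal.ofReal R)
    (hw' : hsNorm σ w' ≤ ENNReal.ofReal R) (hq : Q q ≤ ENNReal.ofReal A)
    (hd : hsNorm σ (w - w') ≤ ENNReal.ofReal D) :
    hsNorm (σ - 1) (nlin w q - nlin w' q) ≤ ENNReal.ofReal (C * (2 * R + 2 * A) * D) := by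
  have hQ3 : Q (w + w' + (2 : ℂ) • q) ≤ ENNReal.ofReal (2 * R + 2 * A) := by
    have e : ENNReal.ofReal (2 * R + 2 * A) =
        ENNReal.ofReal R + ENNReal.ofReal R + 2 * ENNReal.ofReal A := by
      rw [ENNReal.ofReal_add (by positivity) (by positivity), two_mul, ENNReal.ofReal_add hR hR,
        ENNReal.ofReal_mul zero_le_two]
      simp
    rw [e]
    refine (hM.isDistrNorm.add_le _ _).trans (add_le_add ((hM.isDistrNorm.add_le _ _).trans
      (add_le_add ((hM.le_hsNorm _).trans hw) ((hM.le_hsNorm _).trans hw'))) ?_)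
    exact (hM.smul_le q).trans (by gcongr)
  rw [hM.nlin_sub (hw.trans_lt ENNReal.ofReal_lt_top) (hw'.trans_lt ENNReal.ofReal_lt_top)
    (hq.trans_lt ENNReal.ofReal_lt_top)]
  refine (hM.mul_le _ _ (hd.trans_lt ENNReal.ofReal_lt_top)
    (hQ3.trans_lt ENNReal.ofReal_lt_top)).trans ?_
  have hC := hM.nonneg
  rw [mul_assoc C, mul_comm (2 * R + 2 * A), ← mul_assoc, ENNReal.ofReal_mul (by positivity),
    ENNReal.ofReal_mul hC]
  gcongr

/-- The contraction estimate in the weighted norm. -/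
lemma hsNorm_duhamel_nlin_sub_le (hM : IsMultNorm σ C Q) {w w' q : ℝ → Distr} {D R A lam r : ℝ}
    (hD : 0 ≤ D) (hR : 0 ≤ R) (hA : 0 ≤ A) (hl : 0 < lam) (hr : 0 ≤ r)
    (hr2 : T / (2 * lam) ≤ r ^ 2) (hc : r * (C * (2 * R + 2 * A)) ≤ 1 / 2)
    (hwc : ContIn (hsNorm σ) T w) (hwc' : ContIn (hsNorm σ) T w') (hqc : ContIn Q T q)
    (hw : ∀ t ∈ Icc 0 T, hsNorm σ (w t) ≤ ENNReal.ofReal R)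
    (hw' : ∀ t ∈ Icc 0 T, hsNorm σ (w' t) ≤ ENNReal.ofReal R)
    (hq : ∀ t ∈ Icc 0 T, Q (q t) ≤ ENNReal.ofReal A)
    (hd : ∀ t ∈ Icc 0 T, hsNorm σ (w t - w' t) ≤ ENNReal.ofReal (D * Real.exp (lam * t)))
    {t : ℝ} (ht : t ∈ Icc 0 T) :
    hsNorm σ (duhamel (fun t' => nlin (w t') (q t')) t - duhamel (fun t' => nlin (w' t') (q t')) t)
      ≤ ENNReal.ofReal (D / 2 * Real.exp (lam * t)) := by
  have c1 := hM.contIn_nlin hwc hqc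
  have c2 := hM.contIn_nlin hwc' hqc
  rw [← duhamel_sub (continuousOn_coeff c1) (continuousOn_coeff c2) ht]
  have hC := hM.nonneg
  refine (hsNorm_duhamel_le_exp (κ := C * (2 * R + 2 * A) * D)
    (continuousOn_coeff (c1.sub (isDistrNorm_hsNorm _) c2)) ht hl hr
    (by positivity) hr2 fun t' ht' => ?_).trans (ENNReal.ofReal_le_ofReal ?_)
  · have hpos := Real.exp_pos (lam * t')
    have := hM.hsNorm_nlin_sub_le (by positivity) hR hA (hw t' ht') (hw' t' ht') (hq t' ht')
      (hd t' ht')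
    refine this.trans_eq ?_
    congr 1; ring
  · have hpos := Real.exp_pos (lam * t)
    have := mul_le_mul_of_nonneg_right hc (by positivity : 0 ≤ D * Real.exp (lam * t))
    linarith

lemma nlin_zero (q : Distr) : nlin 0 q = 0 := by
  ext n; simp [nlin, mul]

lemma duhamel_zero (t : ℝ) : duhamel (fun _ => 0) t = 0 := by
  ext n; simp [duhamel]

/-- The Picard iterates. -/
def picard (φ q : ℝ → Distr) : ℕ → ℝ → Distr
  | 0 => fun _ => 0
  | k + 1 => fun t => φ t - duhamel (fun t' => nlin (picard φ q k t') (q t')) t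

lemma exists_solvesOn (hM : IsMultNorm σ C Q) {φ q : ℝ → Distr} {ρ A lam r : ℝ} (hT : 0 ≤ T)
    (hρ : 0 ≤ ρ) (hA : 0 ≤ A) (hl : 0 < lam) (hr : 0 ≤ r) (hr2 : T / (2 * lam) ≤ r ^ 2)
    (hc : r * (C * (2 * (ρ * Real.exp (lam * T)) + 2 * A)) ≤ 1 / 2)
    (hφc : ContIn (hsNorm σ) T φ) (hqc : ContIn Q T q)
    (hφ : ∀ t ∈ Icc 0 T, hsNorm σ (φ t) ≤ ENNReal.ofReal (ρ / 2))
    (hq : ∀ t ∈ Icc 0 T, Q (q t) ≤ ENNReal.ofReal A) :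
    ∃ w, SolvesOn σ T φ q w ∧
      ∀ t ∈ Icc 0 T, hsNorm σ (w t) ≤ ENNReal.ofReal (ρ * Real.exp (lam * t)) := by
  have hN := isDistrNorm_hsNorm σ
  set w := picard φ q with hwdef
  have hexp : ∀ t ∈ Icc 0 T, 1 ≤ Real.exp (lam * t) := fun t ht =>
    Real.one_le_exp (mul_nonneg hl.le ht.1)
  have hexpT : ∀ t ∈ Icc 0 T, Real.exp (lam * t) ≤ Real.exp (lam * T) := fun t ht =>
    Real.exp_le_exp.2 (mul_le_mul_of_nonneg_left ht.2 hl.le)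
  have hRT : ∀ {c : ℝ}, 0 ≤ c → c ≤ 1 → ∀ t ∈ Icc 0 T, ∀ u : Distr,
      hsNorm σ u ≤ ENNReal.ofReal (ρ * c * Real.exp (lam * t)) →
      hsNorm σ u ≤ ENNReal.ofReal (ρ * Real.exp (lam * T)) := fun {c} hc0 hc1 t ht u hu => by
    refine hu.trans (ENNReal.ofReal_le_ofReal ?_)
    exact mul_le_mul (mul_le_of_le_one_right hρ hc1) (hexpT t ht) (Real.exp_pos _).le hρ
  have hmain : ∀ k, ContIn (hsNorm σ) T (w k) ∧ ContIn (hsNorm σ) T (w (k + 1)) ∧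
      (∀ t ∈ Icc 0 T, hsNorm σ (w k t) ≤
        ENNReal.ofReal (ρ * (1 - (1 / 2) ^ k) * Real.exp (lam * t))) ∧
      ∀ t ∈ Icc 0 T, hsNorm σ (w (k + 1) t - w k t) ≤
        ENNReal.ofReal (ρ / 2 * (1 / 2) ^ k * Real.exp (lam * t)) := by
    intro k
    induction k with
    | zero =>
      have c0 : ContIn (hsNorm σ) T (w 0) := fun t ht => by
        simpa [hwdef, picard, hsNorm_zero] using tendsto_const_nhds
      have e1 : w 1 = φ := by
        ext1 t
        simp only [hwdef, picard, nlin_zero, duhamel_zero, sub_zero]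
      refine ⟨c0, by rw [zero_add, e1]; exact hφc, fun t ht => by simp [hwdef, picard, hsNorm_zero],
        fun t ht => ?_⟩
      rw [zero_add, e1]
      have : φ t - w 0 t = φ t := by simp [hwdef, picard]
      rw [this]
      refine (hφ t ht).trans (ENNReal.ofReal_le_ofReal ?_)
      have := hexp t ht
      nlinarith
    | succ k ih =>
      obtain ⟨i1, i2, i3, i4⟩ := ih
      have hpk : 0 ≤ (1 / 2 : ℝ) ^ k := by positivity
      have hpk1 : (1 / 2 : ℝ) ^ k ≤ 1 := pow_le_one₀ (by norm_num) (by norm_num)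
      have b3 : ∀ t ∈ Icc 0 T, hsNorm σ (w (k + 1) t) ≤
          ENNReal.ofReal (ρ * (1 - (1 / 2) ^ (k + 1)) * Real.exp (lam * t)) := fun t ht => by
        have hp := Real.exp_pos (lam * t)
        refine (hN.le_add_sub _ (w k t)).trans ((add_le_add (i3 t ht) (i4 t ht)).trans_eq ?_)
        rw [← ENNReal.ofReal_add]
        · congr 1; ring
        · have : 0 ≤ 1 - (1 / 2 : ℝ) ^ k := by linarith
          positivity
        · positivity
      refine ⟨i2, hφc.sub hN (contIn_duhamel hT (hM.contIn_nlin i2 hqc)), b3, fun t ht => ?_⟩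
      have e : w (k + 1 + 1) t - w (k + 1) t =
          -(duhamel (fun t' => nlin (w (k + 1) t') (q t')) t -
            duhamel (fun t' => nlin (w k t') (q t')) t) := by
        simp only [hwdef, picard]; abel
      rw [e, hN.neg]
      have := hM.hsNorm_duhamel_nlin_sub_le (D := ρ / 2 * (1 / 2) ^ k)
        (R := ρ * Real.exp (lam * T)) (by positivity) (by positivity) hA hl hr hr2 hc i2 i1 hqc
        (fun t ht => hRT (c := 1 - (1 / 2) ^ (k + 1)) (by
          have : (1 / 2 : ℝ) ^ (k + 1) ≤ 1 := pow_le_one₀ (by norm_num) (by norm_num)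
          linarith) (by have : 0 ≤ (1 / 2 : ℝ) ^ (k + 1) := by positivity
                        linarith) t ht _ (b3 t ht))
        (fun t ht => hRT (c := 1 - (1 / 2) ^ k) (by linarith) (by linarith) t ht _ (i3 t ht))
        hq i4 ht
      refine this.trans_eq ?_
      congr 1; ring
  have hcauchy : ∀ t ∈ Icc 0 T, ∀ k m, k ≤ m →
      hsNorm σ (w m t - w k t) ≤ ENNReal.ofReal (ρ * (1 / 2) ^ k * Real.exp (lam * t)) := by
    intro t ht k m hkm
    have hp := Real.exp_pos (lam * t)
    have h1 : hsNorm σ (w m t - w k t) ≤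
        ENNReal.ofReal (ρ * ((1 / 2) ^ k - (1 / 2) ^ m) * Real.exp (lam * t)) := by
      induction m, hkm using Nat.le_induction with
      | base => simp [hsNorm_zero]
      | succ m hkm ih =>
        have e : w (m + 1) t - w k t = (w m t - w k t) + (w (m + 1) t - w m t) := by abel
        rw [e]
        refine (hN.add_le _ _).trans ((add_le_add ih ((hmain m).2.2.2 t ht)).trans_eq ?_)
        rw [← ENNReal.ofReal_add]
        · congr 1; ring
        · have : (1 / 2 : ℝ) ^ m ≤ (1 / 2) ^ k :=
            pow_le_pow_of_le_one (by norm_num) (by norm_num) hkm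
          have : 0 ≤ (1 / 2 : ℝ) ^ k - (1 / 2) ^ m := by linarith
          positivity
        · positivity
    refine h1.trans (ENNReal.ofReal_le_ofReal ?_)
    have : 0 ≤ (1 / 2 : ℝ) ^ m := by positivity
    gcongr; linarith
  have hlim : ∀ t ∈ Icc 0 T, ∀ n, ∃ l, Tendsto (fun k => w k t n) atTop (𝓝 l) := by
    intro t ht n
    have hp := jb_rpow_pos n σ
    refine cauchySeq_tendsto_of_complete
      (cauchySeq_of_le_geometric (1 / 2) ((jb n ^ σ)⁻¹ * (ρ / 2 * Real.exp (lam * t)))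
        (by norm_num) fun k => ?_)
    have h1 := (ofReal_coeff_le_hsNorm σ _ n).trans ((hmain k).2.2.2 t ht)
    have hpe := Real.exp_pos (lam * t)
    rw [ENNReal.ofReal_le_ofReal_iff (by positivity)] at h1
    rw [dist_comm, dist_eq_norm, mul_assoc, ← div_eq_inv_mul, le_div_iff₀ hp, mul_comm]
    calc _ ≤ _ := h1
      _ = _ := by ring
  choose! l hl' using hlim
  have hd : ∀ k, ∀ t ∈ Icc 0 T,
      hsNorm σ (l t - w k t) ≤ ENNReal.ofReal (ρ * (1 / 2) ^ k * Real.exp (lam * t)) := by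
    intro k t ht
    have hp := Real.exp_pos (lam * t)
    refine hsNorm_le_of_tendsto (by positivity) (u := fun m => w m t - w k t)
      (fun n => (hl' t ht n).sub_const _) ?_
    filter_upwards [eventually_ge_atTop k] with m hm using hcauchy t ht k m hm
  have hb0 : Tendsto (fun k : ℕ => ENNReal.ofReal (ρ * (1 / 2) ^ k * Real.exp (lam * T))) atTop
      (𝓝 0) := by
    have h1 := ((tendsto_pow_atTop_nhds_zero_of_lt_one (r := (1 / 2 : ℝ)) (by norm_num)
      (by norm_num)).const_mul ρ).mul_const (Real.exp (lam * T))
    have := (ENNReal.continuous_ofReal.tendsto _).comp h1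
    simpa [Function.comp_def] using this
  have hcont : ContIn (hsNorm σ) T l := by
    refine contIn_of_uniform_limit hN (fun k => (hmain k).1) hb0 fun k t ht => ?_
    rw [hN.sub_comm]
    refine (hd k t ht).trans (ENNReal.ofReal_le_ofReal ?_)
    have := hexpT t ht
    gcongr
  have hlb : ∀ t ∈ Icc 0 T, hsNorm σ (l t) ≤ ENNReal.ofReal (ρ * Real.exp (lam * t)) := by
    intro t ht
    have := hd 0 t ht
    simpa [hwdef, picard] using this
  refine ⟨l, ⟨hcont, fun t ht => ?_⟩, hlb⟩
  refine eq_of_hsNorm_sub_eq_zero (s := σ) (le_antisymm ?_ zero_le)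
  have hk : ∀ k, hsNorm σ (l t - (φ t - duhamel (fun t' => nlin (l t') (q t')) t)) ≤
      ENNReal.ofReal (ρ * (1 / 2) ^ k * Real.exp (lam * T)) +
        ENNReal.ofReal (ρ * (1 / 2) ^ k * Real.exp (lam * T)) := by
    intro k
    have hpk1 : (1 / 2 : ℝ) ^ k ≤ 1 := pow_le_one₀ (by norm_num) (by norm_num)
    have hpk : 0 ≤ (1 / 2 : ℝ) ^ k := by positivity
    have e : l t - (φ t - duhamel (fun t' => nlin (l t') (q t')) t) = (l t - w (k + 1) t) +
        (duhamel (fun t' => nlin (l t') (q t')) t - duhamel (fun t' => nlin (w k t') (q t')) t) := by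
      simp only [hwdef, picard]; abel
    rw [e]
    have h2 := hM.hsNorm_duhamel_nlin_sub_le (D := ρ * (1 / 2) ^ k) (R := ρ * Real.exp (lam * T))
      (by positivity) (by positivity) hA hl hr hr2 hc hcont (hmain k).1 hqc
      (fun t ht => hRT zero_le_one le_rfl t ht _ (by rw [mul_one]; exact hlb t ht))
      (fun t ht => hRT (c := 1 - (1 / 2) ^ k) (by linarith) (by linarith) t ht _
        ((hmain k).2.2.1 t ht)) hq (hd k) ht
    have hp := Real.exp_pos (lam * t)
    have hpT := hexpT t ht
    refine (hN.add_le _ _).trans (add_le_add ((hd (k + 1) t ht).trans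
      (ENNReal.ofReal_le_ofReal ?_)) (h2.trans (ENNReal.ofReal_le_ofReal ?_)))
    · gcongr ρ * ?_ * ?_
      exact pow_le_pow_of_le_one (by norm_num) (by norm_num) (Nat.le_succ k)
    · have : 0 ≤ ρ * (1 / 2) ^ k := by positivity
      gcongr
      linarith
  have h0 := hb0.add hb0
  rw [add_zero] at h0
  exact ge_of_tendsto' h0 hk

lemma solvesOn_unique (hM : IsMultNorm σ C Q) {φ q w w' : ℝ → Distr} (hT : 0 ≤ T)
    (hqc : ContIn Q T q) (hw : SolvesOn σ T φ q w) (hw' : SolvesOn σ T φ q w') :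
    ∀ t ∈ Icc 0 T, w t = w' t := by
  have hN := isDistrNorm_hsNorm σ
  obtain ⟨R₁, hR₁, b₁⟩ := hw.1.exists_bound hN
  obtain ⟨R₂, hR₂, b₂⟩ := hw'.1.exists_bound hN
  obtain ⟨A, hA, bq⟩ := hqc.exists_bound hM.isDistrNorm
  have hC := hM.nonneg
  set R := R₁ + R₂ with hR
  set K := C * (2 * R + 2 * A) with hK
  have hK0 : 0 ≤ K := by positivity
  set r := 1 / (2 * K + 1) with hr
  have hr0 : 0 < r := by positivity
  set lam := T / (2 * r ^ 2) + 1 with hlam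
  have hl : 0 < lam := by positivity
  have hr2 : T / (2 * lam) ≤ r ^ 2 := by
    rw [div_le_iff₀ (by positivity), hlam]
    have : r ^ 2 * (2 * (T / (2 * r ^ 2) + 1)) = T + 2 * r ^ 2 := by field_simp
    rw [this]
    linarith [sq_nonneg r]
  have hc : r * K ≤ 1 / 2 := by
    rw [hr, one_div, inv_mul_le_iff₀ (by positivity)]; linarith
  have hk : ∀ k : ℕ, ∀ t ∈ Icc 0 T, hsNorm σ (w t - w' t) ≤
      ENNReal.ofReal (2 * R * (1 / 2) ^ k * Real.exp (lam * t)) := by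
    intro k
    induction k with
    | zero =>
      intro t ht
      refine (hN.sub_le _ _).trans ((add_le_add (b₁ t ht) (b₂ t ht)).trans ?_)
      rw [← ENNReal.ofReal_add hR₁ hR₂]
      refine ENNReal.ofReal_le_ofReal ?_
      have := Real.one_le_exp (mul_nonneg hl.le ht.1)
      have hR0 : 0 ≤ R := by positivity
      rw [← hR]; nlinarith
    | succ k ih =>
      intro t ht
      have e : w t - w' t = -(duhamel (fun t' => nlin (w t') (q t')) t -
          duhamel (fun t' => nlin (w' t') (q t')) t) := by
        rw [hw.2 t ht, hw'.2 t ht]; abel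
      rw [e, hN.neg]
      refine (hM.hsNorm_duhamel_nlin_sub_le (D := 2 * R * (1 / 2) ^ k) (R := R) (by positivity)
        (by positivity) hA hl hr0.le hr2 hc hw.1 hw'.1 hqc
        (fun t ht => (b₁ t ht).trans (ENNReal.ofReal_le_ofReal (by linarith)))
        (fun t ht => (b₂ t ht).trans (ENNReal.ofReal_le_ofReal (by linarith))) bq ih ht).trans_eq ?_
      congr 1; ring
  intro t ht
  refine eq_of_hsNorm_sub_eq_zero (s := σ) (le_antisymm ?_ zero_le)
  have h1 := ((tendsto_pow_atTop_nhds_zero_of_lt_one (r := (1 / 2 : ℝ)) (by norm_num)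
      (by norm_num)).const_mul (2 * R)).mul_const (Real.exp (lam * t))
  have h2 := (ENNReal.continuous_ofReal.tendsto _).comp h1
  simp only [mul_zero, zero_mul, ENNReal.ofReal_zero] at h2
  exact ge_of_tendsto' h2 fun k => hk k t ht

end IsMultNorm

/-! ### The sum space `H^σ + W^{-a,∞}` as a space of multipliers -/

/-- The norm of `H^σ + W^{-a,∞}`. -/
def mixNorm (σ a : ℝ) (g : Distr) : ℝ≥0∞ := ⨅ v : Distr, hsNorm σ v + wInfNorm (-a) (g - v)

lemma mixNorm_le (σ a : ℝ) (g v : Distr) : mixNorm σ a g ≤ hsNorm σ v + wInfNorm (-a) (g - v) :=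
  iInf_le _ v

lemma mixNorm_le_hsNorm (σ a : ℝ) (g : Distr) : mixNorm σ a g ≤ hsNorm σ g := by
  simpa [wInfNorm_zero] using mixNorm_le σ a g g

lemma mixNorm_le_wInfNorm (σ a : ℝ) (g : Distr) : mixNorm σ a g ≤ wInfNorm (-a) g := by
  simpa [hsNorm_zero] using mixNorm_le σ a g 0

lemma mixNorm_add_le (σ a : ℝ) (f g : Distr) : mixNorm σ a (f + g) ≤ mixNorm σ a f + mixNorm σ a g := by
  unfold mixNorm
  rw [ENNReal.iInf_add]
  refine le_iInf fun v => ?_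
  rw [ENNReal.add_iInf]
  refine le_iInf fun v' => (iInf_le _ (v + v')).trans ?_
  have e : f + g - (v + v') = (f - v) + (g - v') := by abel
  rw [e]
  calc _ ≤ (hsNorm σ v + hsNorm σ v') + (wInfNorm (-a) (f - v) + wInfNorm (-a) (g - v')) :=
        add_le_add (hsNorm_add_le _ _ _) (wInfNorm_add_le _ _ _)
    _ = _ := by ring

lemma mixNorm_neg_le (σ a : ℝ) (f : Distr) : mixNorm σ a (-f) ≤ mixNorm σ a f := by
  refine le_iInf fun v => (mixNorm_le σ a (-f) (-v)).trans_eq ?_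
  rw [hsNorm_neg, ← wInfNorm_neg]; congr 2; abel

lemma isDistrNorm_mixNorm (σ a : ℝ) : IsDistrNorm (mixNorm σ a) where
  zero := le_antisymm ((mixNorm_le_hsNorm σ a 0).trans_eq (hsNorm_zero σ)) zero_le
  add_le := mixNorm_add_le σ a
  neg f := le_antisymm (mixNorm_neg_le σ a f) (by simpa using mixNorm_neg_le σ a (-f))

lemma exists_isMultNorm {σ a : ℝ} (ha : 0 < a) (haσ : a < σ) (hσ : σ ≤ 1 / 2) :
    ∃ C, IsMultNorm σ C (mixNorm σ a) := by
  obtain ⟨C₁, h₁⟩ := exists_hsNorm_mul_le (ha.trans haσ) (by linarith : σ ≤ 1)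
  obtain ⟨C₂, h₂⟩ := exists_hsNorm_mul_wInf_le ha haσ (by linarith : σ ≤ 1)
  have hsum : ∀ f v w : Distr, hsNorm σ f < ∞ → hsNorm σ v < ∞ → wInfNorm (-a) w < ∞ →
      (∀ n, Summable fun k => f k * v (n - k)) ∧ (∀ n, Summable fun k => f k * w (n - k)) := by
    intro f v w hf hv hw
    have hf' : hsNorm a f < ∞ := (hsNorm_mono haσ.le f).trans_lt hf
    exact ⟨summable_mul ha.le hf' ((hsNorm_mono (by linarith) v).trans_lt hv),
      summable_mul ha.le hf' ((hsNorm_le_wInfNorm _ _).trans_lt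
        (ENNReal.mul_lt_top ENNReal.ofReal_lt_top hw))⟩
  have hdec : ∀ g v : Distr, v + (g - v) = g := fun g v => by abel
  refine ⟨(C₁ + C₂ : ℝ≥0), ⟨isDistrNorm_mixNorm σ a, NNReal.coe_nonneg _, mixNorm_le_hsNorm σ a,
    fun g => ?_, fun f g hf hg n => ?_, fun f g hf hg => ?_⟩⟩
  · rw [two_smul, two_mul]; exact mixNorm_add_le σ a g g
  · simp only [mixNorm, iInf_lt_iff] at hg
    obtain ⟨v, hv⟩ := hg
    obtain ⟨hv1, hv2⟩ := ENNReal.add_lt_top.1 hv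
    obtain ⟨s1, s2⟩ := hsum f v (g - v) hf hv1 hv2
    have := (s1 n).add (s2 n)
    refine this.congr fun k => ?_
    simp only [Pi.sub_apply]; ring
  · rcases eq_or_ne (ENNReal.ofReal (C₁ + C₂ : ℝ≥0) * hsNorm σ f) 0 with h0 | h0
    · simp only [mixNorm, iInf_lt_iff] at hg
      obtain ⟨v, hv⟩ := hg
      obtain ⟨hv1, hv2⟩ := ENNReal.add_lt_top.1 hv
      obtain ⟨s1, s2⟩ := hsum f v (g - v) hf hv1 hv2
      rw [h0, zero_mul]
      rw [ENNReal.ofReal_coe_nnreal, ENNReal.coe_add, add_mul, add_eq_zero] at h0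
      have b1 := h₁ f v
      have b2 := h₂ f (g - v) hf hv2
      rw [h0.1, zero_mul] at b1
      rw [h0.2, zero_mul] at b2
      rw [← hdec g v, mul_add_right s1 s2]
      refine (hsNorm_add_le _ _ _).trans ?_
      calc _ ≤ 0 + 0 := add_le_add b1 ((hsNorm_mono (by linarith) _).trans b2)
        _ = 0 := add_zero 0
    · have hfin : ENNReal.ofReal (C₁ + C₂ : ℝ≥0) * hsNorm σ f ≠ ∞ :=
        ENNReal.mul_ne_top ENNReal.ofReal_ne_top hf.ne
      rw [mul_comm (ENNReal.ofReal (C₁ + C₂ : ℝ≥0) * hsNorm σ f), ← ENNReal.div_le_iff h0 hfin]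
      refine le_iInf fun v => ?_
      rw [ENNReal.div_le_iff h0 hfin]
      rcases eq_top_or_lt_top (hsNorm σ v + wInfNorm (-a) (g - v)) with h | hv
      · rw [h, ENNReal.top_mul h0]; exact le_top
      obtain ⟨hv1, hv2⟩ := ENNReal.add_lt_top.1 hv
      obtain ⟨s1, s2⟩ := hsum f v (g - v) hf hv1 hv2
      conv_lhs => rw [← hdec g v, mul_add_right s1 s2]
      refine (hsNorm_add_le _ _ _).trans ?_
      refine (add_le_add (h₁ f v) ((hsNorm_mono (by linarith) _).trans (h₂ f (g - v) hf hv2))).trans ?_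
      rw [ENNReal.ofReal_coe_nnreal, add_mul, mul_comm (hsNorm σ v), mul_comm (wInfNorm (-a) (g - v))]
      gcongr
      · exact_mod_cast le_self_add
      · exact_mod_cast le_add_self

/-! ### The linear evolution and the equation -/

lemma waveProp_sub (t : ℝ) (u₀ u₁ v₀ v₁ : Distr) :
    waveProp t u₀ u₁ - waveProp t v₀ v₁ = waveProp t (u₀ - v₀) (u₁ - v₁) := by
  ext n; simp only [waveProp, Pi.sub_apply]; ring

lemma jb_mul_norm_waveProp_le {σ s : ℝ} (hs : σ ≤ s) (t : ℝ) (u₀ u₁ : Distr) (n : Freq) :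
    jb n ^ σ * ‖waveProp t u₀ u₁ n‖ ≤ jb n ^ s * ‖u₀ n‖ + jb n ^ (s - 1) * ‖u₁ n‖ := by
  have h1 : ‖waveProp t u₀ u₁ n‖ ≤ ‖u₀ n‖ + jb n ^ (-1 : ℝ) * ‖u₁ n‖ := by
    refine (norm_add_le _ _).trans (add_le_add ?_ ?_)
    · rw [norm_mul, Complex.norm_real, Real.norm_eq_abs]
      exact mul_le_of_le_one_left (norm_nonneg _) (Real.abs_cos_le_one _)
    · rw [norm_mul]
      exact mul_le_mul_of_nonneg_right (norm_sin_div_jb_le _ n) (norm_nonneg _)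
  have e : jb n ^ (s - 1) = jb n ^ s * jb n ^ (-1 : ℝ) := by
    rw [← Real.rpow_add (jb_pos n), sub_eq_add_neg]
  have hp := jb_rpow_pos n s
  have hq := jb_rpow_pos n (-1)
  calc _ ≤ jb n ^ s * (‖u₀ n‖ + jb n ^ (-1 : ℝ) * ‖u₁ n‖) :=
        mul_le_mul (jb_rpow_le n hs) h1 (norm_nonneg _) hp.le
    _ = _ := by rw [e]; ring

lemma hsNorm_waveProp_le {σ s : ℝ} (hs : σ ≤ s) (t : ℝ) (u₀ u₁ : Distr) :
    hsNorm σ (waveProp t u₀ u₁) ≤ hsNorm s u₀ + hsNorm (s - 1) u₁ := by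
  rw [hsNorm_eq_eLpNorm, hsNorm_eq_eLpNorm, hsNorm_eq_eLpNorm, ← eLpNorm_norm (wt s u₀),
    ← eLpNorm_norm (wt (s - 1) u₁)]
  refine le_trans (eLpNorm_mono_real (g := fun n => ‖wt s u₀ n‖ + ‖wt (s - 1) u₁ n‖) fun n => ?_)
    (eLpNorm_add_le .of_discrete .of_discrete (by norm_num))
  simp only [norm_wt]
  exact jb_mul_norm_waveProp_le hs t u₀ u₁ n

lemma summable_sq_of_hsNorm_lt_top {s : ℝ} {f : Distr} (hf : hsNorm s f < ∞) :
    Summable fun n => (jb n ^ s * ‖f n‖) ^ 2 := by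
  have h1 : ∑' n, ENNReal.ofReal ((jb n ^ s * ‖f n‖) ^ 2) < ∞ := by
    rw [← hsNorm_sq]; exact ENNReal.pow_lt_top hf
  have := ENNReal.summable_toReal h1.ne
  refine this.congr fun n => ENNReal.toReal_ofReal (sq_nonneg _)

lemma contIn_waveProp {σ s : ℝ} (hs : σ ≤ s) (T : ℝ) {u₀ u₁ : Distr} (h0 : hsNorm s u₀ < ∞)
    (h1 : hsNorm (s - 1) u₁ < ∞) : ContIn (hsNorm σ) T (fun t => waveProp t u₀ u₁) := by
  refine contIn_of_dominated (fun n => ?_) (b := fun n => jb n ^ s * ‖u₀ n‖ + jb n ^ (s - 1) * ‖u₁ n‖)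
    ?_ fun n t _ => jb_mul_norm_waveProp_le hs t u₀ u₁ n
  · unfold waveProp; fun_prop
  · have := ((summable_sq_of_hsNorm_lt_top h0).mul_left 2).add
      ((summable_sq_of_hsNorm_lt_top h1).mul_left 2)
    refine this.of_nonneg_of_le (fun _ => sq_nonneg _) fun n => ?_
    nlinarith [sq_nonneg (jb n ^ s * ‖u₀ n‖ - jb n ^ (s - 1) * ‖u₁ n‖)]

section Equation

variable {α s σ ε T : ℝ}

/-- The inhomogeneity `S(t)(u₀,u₁) - Y(t)`. -/
def EnhancedData.forcing (Ξ : EnhancedData) (t : ℝ) : Distr := waveProp t Ξ.u₀ Ξ.u₁ - Ξ.Y t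

lemma isSolution_iff {Ξ : EnhancedData} {v : ℝ → Distr} :
    IsSolution σ T Ξ v ↔ SolvesOn σ T Ξ.forcing Ξ.Z v := by
  refine and_congr_right fun _ => forall₂_congr fun t _ => ?_
  have : waveProp t Ξ.u₀ Ξ.u₁ -
      duhamel (fun t' => mul (v t') (v t') + (2 : ℂ) • mul (v t') (Ξ.Z t')) t - Ξ.Y t =
      Ξ.forcing t - duhamel (fun t' => nlin (v t') (Ξ.Z t')) t := by
    simp only [EnhancedData.forcing]
    rw [sub_right_comm]; rfl
  rw [this]

lemma hsNorm_le_of_wInfNorm {b : ℝ} (hb : σ ≤ b) (f : Distr) :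
    hsNorm σ f ≤ ENNReal.ofReal (2 * Real.pi) * wInfNorm b f :=
  (hsNorm_mono hb f).trans (hsNorm_le_wInfNorm b f)

lemma EnhancedData.InClass.contIn_forcing {Ξ : EnhancedData} (h : Ξ.InClass α s ε T) (hs : σ ≤ s)
    (hb : σ ≤ sAlpha α - ε) : ContIn (hsNorm σ) T Ξ.forcing :=
  (contIn_waveProp hs T h.u₀_mem h.u₁_mem).sub (isDistrNorm_hsNorm σ)
    (h.Y_mem.of_le ENNReal.ofReal_ne_top fun _ => hsNorm_le_of_wInfNorm hb _)

lemma EnhancedData.InClass.contIn_mix {Ξ : EnhancedData} (h : Ξ.InClass α s ε T) :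
    ContIn (mixNorm σ (α + ε)) T Ξ.Z := by
  refine h.Z_mem.of_le ENNReal.one_ne_top fun u => ?_
  rw [one_mul, (by ring : -α - ε = -(α + ε))]
  exact mixNorm_le_wInfNorm _ _ _

lemma two_pi_le_seven : 2 * Real.pi ≤ 7 := by have := Real.pi_lt_d2; linarith

lemma IsUniqueSolution.of_isSolution {Ξ : EnhancedData} (ha : 0 < α + ε) (haσ : α + ε < σ)
    (hσ : σ ≤ 1 / 2) (hT : 0 ≤ T) (h : Ξ.InClass α s ε T) {v : ℝ → Distr}
    (hv : IsSolution σ T Ξ v) : IsUniqueSolution σ T Ξ v := by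
  obtain ⟨C, hM⟩ := exists_isMultNorm ha haσ hσ
  exact ⟨hv, fun w hw => hM.solvesOn_unique hT h.contIn_mix (isSolution_iff.1 hw)
    (isSolution_iff.1 hv)⟩

/-- Local existence, with a quantitative lower bound for the time of existence. -/
lemma exists_local_solution (ha : 0 < α + ε) (haσ : α + ε < σ)
    (hσ : σ ≤ 1 / 2) (hs : σ ≤ s) (hb : σ ≤ sAlpha α - ε) :
    ∃ K : ℝ, 0 < K ∧ ∀ (T R : ℝ) (Ξ : EnhancedData), 0 < T → 0 ≤ R → Ξ.InClass α s ε T →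
      hsNorm s Ξ.u₀ + hsNorm (s - 1) Ξ.u₁ ≤ ENNReal.ofReal R →
      (∀ t ∈ Icc 0 T, wInfNorm (-α - ε) (Ξ.Z t) ≤ ENNReal.ofReal R) →
      (∀ t ∈ Icc 0 T, wInfNorm (sAlpha α - ε) (Ξ.Y t) ≤ ENNReal.ofReal R) →
      T * (K * (1 + R)) ≤ 1 → ∃ v, IsUniqueSolution σ T Ξ v := by
  obtain ⟨C, hM⟩ := exists_isMultNorm ha haσ hσ
  have hC := hM.nonneg
  refine ⟨200 * (C + 1), by positivity, fun T R Ξ hT hR hΞ hu hZ hY hTK => ?_⟩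
  have he : Real.exp 1 < 2.7182818286 := Real.exp_one_lt_d9
  obtain ⟨w, hw, -⟩ := hM.exists_solvesOn (φ := Ξ.forcing) (q := Ξ.Z) (ρ := 16 * R) (A := R)
    (lam := 1 / T) (r := T) hT.le (by positivity) hR (by positivity) hT.le (by
      have : T / (2 * (1 / T)) = T ^ 2 / 2 := by field_simp
      rw [this]; linarith [sq_nonneg T]) (by
      have : 1 / T * T = 1 := by field_simp
      rw [this]
      have h1 : C * (2 * (16 * R * Real.exp 1) + 2 * R) ≤ 100 * ((C + 1) * (1 + R)) := by
        have h2 : 2 * (16 * R * Real.exp 1) + 2 * R ≤ 100 * R := by nlinarith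
        have h3 := mul_le_mul_of_nonneg_left h2 hC
        nlinarith [mul_nonneg hC hR]
      have h2 := mul_le_mul_of_nonneg_left h1 hT.le
      nlinarith) (hΞ.contIn_forcing hs hb) hΞ.contIn_mix (fun t ht => by
      refine ((isDistrNorm_hsNorm σ).sub_le _ _).trans ((add_le_add
        ((hsNorm_waveProp_le hs t _ _).trans hu) ((hsNorm_le_of_wInfNorm hb _).trans
          (mul_le_mul_right (hY t ht) _))).trans ?_)
      rw [← ENNReal.ofReal_mul (by positivity), ← ENNReal.ofReal_add hR (by positivity)]
      refine ENNReal.ofReal_le_ofReal ?_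
      have := mul_le_mul_of_nonneg_right two_pi_le_seven hR
      linarith) (fun t ht => by
      refine (mixNorm_le_wInfNorm _ _ _).trans ?_
      rw [← (by ring : -α - ε = -(α + ε))]; exact hZ t ht)
  exact ⟨w, .of_isSolution ha haσ hσ hT.le hΞ (isSolution_iff.2 hw)⟩

lemma nlin_add {C : ℝ} {Q : Distr → ℝ≥0∞} (hM : IsMultNorm σ C Q) {v w z z' : Distr} (hv : hsNorm σ v < ∞)
    (hw : hsNorm σ w < ∞) (hz : Q z < ∞) (hz' : Q z' < ∞) :
    nlin (v + w) z' - nlin v z - (2 : ℂ) • mul v (z' - z) = nlin w (v + z') := by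
  have hQv := (hM.le_hsNorm v).trans_lt hv
  have hQw := (hM.le_hsNorm w).trans_lt hw
  have hvw : hsNorm σ (v + w) < ∞ := (hsNorm_add_le _ _ _).trans_lt (ENNReal.add_lt_top.2 ⟨hv, hw⟩)
  have e : ∀ g, Q g < ∞ → mul (v + w) g = mul v g + mul w g := fun g hg => by
    rw [mul_comm' (v + w), mul_comm' v, mul_comm' w]
    exact mul_add_right (hM.summable' hv hg) (hM.summable' hw hg)
  simp only [nlin]
  rw [hM.mul_add hvw hQv hQw, e v hQv, e w hQw, e z' hz', hM.mul_sub hv hz' hz,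
    hM.mul_add hw hQv hz', mul_comm' v w]
  simp only [two_smul]
  abel

/-- Continuous dependence of the solution on the enhanced data. -/
lemma exists_solution_near (ha : 0 < α + ε) (haσ : α + ε < σ)
    (hσ : σ ≤ 1 / 2) (hs : σ ≤ s) (hb : σ ≤ sAlpha α - ε) (hT : 0 < T) {Ξ : EnhancedData}
    (hΞ : Ξ.InClass α s ε T) {v : ℝ → Distr} (hv : IsSolution σ T Ξ v) {δ : ℝ} (hδ : 0 < δ) :
    ∃ η > 0, ∀ Ξ' : EnhancedData, Ξ'.InClass α s ε T →
      enhancedDist α s ε T Ξ Ξ' < ENNReal.ofReal η →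
      ∃ v', IsUniqueSolution σ T Ξ' v' ∧ supNorm (hsNorm σ) T (v' - v) < ENNReal.ofReal δ := by
  obtain ⟨C, hM⟩ := exists_isMultNorm ha haσ hσ
  have hC := hM.nonneg
  have hN := isDistrNorm_hsNorm σ
  have hN1 := isDistrNorm_hsNorm (σ - 1)
  obtain ⟨V, hV0, hV⟩ := hv.1.exists_bound hN
  obtain ⟨B, hB0, hB⟩ := (hΞ.contIn_mix (σ := σ)).exists_bound hM.isDistrNorm
  set A := V + B + 1 with hA
  set K := C * (2 + 2 * A) with hK
  have hK0 : 0 ≤ K := by positivity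
  set r := 1 / (2 * K + 1) with hr
  have hr0 : 0 < r := by positivity
  set lam := T / (2 * r ^ 2) + 1 with hlam
  have hl : 0 < lam := by positivity
  have hr2 : T / (2 * lam) ≤ r ^ 2 := by
    rw [div_le_iff₀ (by positivity), hlam]
    have : r ^ 2 * (2 * (T / (2 * r ^ 2) + 1)) = T + 2 * r ^ 2 := by field_simp
    rw [this]
    linarith [sq_nonneg r]
  have hc : r * K ≤ 1 / 2 := by
    rw [hr, one_div, inv_mul_le_iff₀ (by positivity)]; linarith
  set m := min 1 (δ / 2) with hm
  have hm0 : 0 < m := lt_min one_pos (half_pos hδ)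
  set ρ := m * Real.exp (-(lam * T)) with hρ
  have hρ0 : 0 < ρ := mul_pos hm0 (Real.exp_pos _)
  have hρe : ρ * Real.exp (lam * T) = m := by
    rw [hρ, mul_assoc, ← Real.exp_add]; simp
  set L := 8 + (T + 1) * (2 * C * V) * Real.exp T with hL
  have hL0 : 0 < L := by positivity
  set η := min 1 (ρ / 2 / L) with hη
  have hη0 : 0 < η := lt_min one_pos (by positivity)
  have hηL : η * L ≤ ρ / 2 := by
    rw [← le_div_iff₀ hL0]; exact min_le_right _ _
  refine ⟨η, hη0, fun Ξ' hΞ' hd => ?_⟩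
  have hd' := hd.le
  have hdu : hsNorm s (Ξ'.u₀ - Ξ.u₀) + hsNorm (s - 1) (Ξ'.u₁ - Ξ.u₁) ≤ ENNReal.ofReal η := by
    rw [(isDistrNorm_hsNorm s).sub_comm, (isDistrNorm_hsNorm (s - 1)).sub_comm]
    exact (le_add_right (le_add_right le_rfl)).trans hd'
  have hdZ : ∀ t ∈ Icc 0 T, mixNorm σ (α + ε) (Ξ'.Z t - Ξ.Z t) ≤ ENNReal.ofReal η := fun t ht => by
    refine (mixNorm_le_wInfNorm _ _ _).trans ?_
    rw [← (by ring : -α - ε = -(α + ε)), (isDistrNorm_wInfNorm _).sub_comm]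
    refine le_trans ?_ hd'
    exact le_trans (le_supNorm (N := wInfNorm (-α - ε)) (f := Ξ.Z - Ξ'.Z) ht)
      (le_add_right (le_add_left le_rfl))
  have hdY : ∀ t ∈ Icc 0 T, wInfNorm (sAlpha α - ε) (Ξ'.Y t - Ξ.Y t) ≤ ENNReal.ofReal η :=
      fun t ht => by
    rw [(isDistrNorm_wInfNorm _).sub_comm]
    refine le_trans ?_ hd'
    exact le_trans (le_supNorm (N := wInfNorm (sAlpha α - ε)) (f := Ξ.Y - Ξ'.Y) ht)
      (le_add_left le_rfl)
  have hZc := hΞ.contIn_mix (σ := σ)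
  have hZc' := hΞ'.contIn_mix (σ := σ)
  set F : ℝ → Distr := fun t => (2 : ℂ) • mul (v t) (Ξ'.Z t - Ξ.Z t) with hF
  have hFc : ContIn (hsNorm (σ - 1)) T F :=
    IsMultNorm.contIn_two_smul hN1 (hM.contIn_mul hv.1 (hZc'.sub hM.isDistrNorm hZc))
  have hFb : ∀ t ∈ Icc 0 T, hsNorm (σ - 1) (F t) ≤
      ENNReal.ofReal (2 * C * V * η * Real.exp (1 * t)) := fun t ht => by
    rw [hF, hsNorm_smul]
    have h1 := hM.mul_le (v t) (Ξ'.Z t - Ξ.Z t) (hv.1.lt_top ht)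
      ((hdZ t ht).trans_lt ENNReal.ofReal_lt_top)
    have h2 : hsNorm (σ - 1) (mul (v t) (Ξ'.Z t - Ξ.Z t)) ≤ ENNReal.ofReal (C * V * η) := by
      rw [ENNReal.ofReal_mul (by positivity), ENNReal.ofReal_mul hC]
      exact h1.trans (by gcongr; exacts [hV t ht, hdZ t ht])
    have e2 : ‖(2 : ℂ)‖ₑ = ENNReal.ofReal 2 := by
      rw [← ofReal_norm]; norm_num
    rw [e2]
    refine (mul_le_mul_right h2 _).trans ?_
    rw [← ENNReal.ofReal_mul zero_le_two]
    refine ENNReal.ofReal_le_ofReal ?_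
    have h3 := Real.one_le_exp (mul_nonneg zero_le_one ht.1)
    have h4 : 0 ≤ 2 * C * V * η := by positivity
    nlinarith
  set φ : ℝ → Distr := (Ξ'.forcing - Ξ.forcing) - duhamel F with hφ
  have hφc : ContIn (hsNorm σ) T φ :=
    ((hΞ'.contIn_forcing hs hb).sub hN (hΞ.contIn_forcing hs hb)).sub hN (contIn_duhamel hT.le hFc)
  have hφb : ∀ t ∈ Icc 0 T, hsNorm σ (φ t) ≤ ENNReal.ofReal (ρ / 2) := fun t ht => by
    have e : φ t = (waveProp t (Ξ'.u₀ - Ξ.u₀) (Ξ'.u₁ - Ξ.u₁) - (Ξ'.Y t - Ξ.Y t)) - duhamel F t := by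
      simp only [hφ, Pi.sub_apply, EnhancedData.forcing, ← waveProp_sub]; abel
    have b3 := hsNorm_duhamel_le_exp (lam := 1) (κ := 2 * C * V * η) (r := T + 1)
      (continuousOn_coeff hFc) ht one_pos (by positivity) (by positivity) (by nlinarith) hFb
    have b2 := (hsNorm_le_of_wInfNorm hb _).trans (mul_le_mul_right (hdY t ht) (ENNReal.ofReal (2 * Real.pi)))
    have b1 := (hsNorm_waveProp_le hs t (Ξ'.u₀ - Ξ.u₀) (Ξ'.u₁ - Ξ.u₁)).trans hdu
    rw [e]
    refine (hN.sub_le _ _).trans ((add_le_add ((hN.sub_le _ _).trans (add_le_add b1 b2)) b3).trans ?_)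
    rw [← ENNReal.ofReal_mul (by positivity), ← ENNReal.ofReal_add (by positivity) (by positivity),
      ← ENNReal.ofReal_add (by positivity) (by positivity)]
    refine ENNReal.ofReal_le_ofReal (le_trans ?_ hηL)
    have h1 := mul_le_mul_of_nonneg_right two_pi_le_seven hη0.le
    have h2 : Real.exp (1 * t) ≤ Real.exp T := Real.exp_le_exp.2 (by linarith [ht.2])
    have h3 : (T + 1) * (2 * C * V * η) * Real.exp (1 * t) ≤
        (T + 1) * (2 * C * V * η) * Real.exp T := by gcongr
    rw [hL]; linarith
  set q : ℝ → Distr := v + Ξ'.Z with hq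
  have hqc : ContIn (mixNorm σ (α + ε)) T q := (hM.contIn_of_hsNorm hv.1).add hM.isDistrNorm hZc'
  have hqb : ∀ t ∈ Icc 0 T, mixNorm σ (α + ε) (q t) ≤ ENNReal.ofReal A := fun t ht => by
    refine (mixNorm_add_le _ _ _ _).trans ((add_le_add ((mixNorm_le_hsNorm _ _ _).trans (hV t ht))
      ((hM.isDistrNorm.le_add_sub _ (Ξ.Z t)).trans (add_le_add (hB t ht) (hdZ t ht)))).trans ?_)
    rw [← ENNReal.ofReal_add hB0 hη0.le, ← ENNReal.ofReal_add hV0 (by positivity)]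
    refine ENNReal.ofReal_le_ofReal ?_
    have : η ≤ 1 := min_le_left _ _
    linarith
  obtain ⟨w, hw, hwb⟩ := hM.exists_solvesOn (φ := φ) (q := q) (ρ := ρ) (A := A) (lam := lam) (r := r)
    hT.le hρ0.le (by positivity) hl hr0.le hr2 (by
      rw [hρe]
      refine le_trans ?_ hc
      have : m ≤ 1 := min_le_left _ _
      rw [hK]
      gcongr r * (C * (?_ + _))
      linarith) hφc hqc hφb hqb
  have hsol : IsSolution σ T Ξ' (v + w) := by
    refine isSolution_iff.2 ⟨hv.1.add hN hw.1, fun t ht => ?_⟩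
    have c1 := hM.contIn_nlin (hv.1.add hN hw.1) hZc'
    have c2 := hM.contIn_nlin hv.1 hZc
    have e : duhamel (fun t' => nlin (w t') (q t')) t =
        duhamel (fun t' => nlin ((v + w) t') (Ξ'.Z t')) t -
          duhamel (fun t' => nlin (v t') (Ξ.Z t')) t - duhamel F t := by
      rw [← duhamel_sub (continuousOn_coeff c1) (continuousOn_coeff c2) ht,
        ← duhamel_sub (continuousOn_coeff (c1.sub hN1 c2)) (continuousOn_coeff hFc) ht]
      refine duhamel_congr ht.1 fun t' ht' => ?_
      have ht'' : t' ∈ Icc 0 T := ⟨ht'.1, ht'.2.trans ht.2⟩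
      exact (nlin_add hM (hv.1.lt_top ht'') (hw.1.lt_top ht'') (hZc.lt_top ht'')
        (hZc'.lt_top ht'')).symm
    have h1 := (isSolution_iff.1 hv).2 t ht
    have h2 := hw.2 t ht
    rw [e] at h2
    simp only [hφ, Pi.sub_apply] at h2
    rw [Pi.add_apply, h2]
    nth_rewrite 1 [h1]
    abel
  refine ⟨v + w, .of_isSolution ha haσ hσ hT.le hΞ' hsol, ?_⟩
  refine lt_of_le_of_lt (iSup₂_le fun t ht => ?_) ((ENNReal.ofReal_lt_ofReal_iff hδ).2
    (half_lt_self hδ))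
  have e : (v + w - v) t = w t := by simp
  rw [e]
  refine (hwb t ht).trans (ENNReal.ofReal_le_ofReal ?_)
  calc ρ * Real.exp (lam * t) ≤ ρ * Real.exp (lam * T) := by
        have := ht.2
        gcongr
    _ ≤ δ / 2 := by rw [hρe]; exact min_le_right _ _

end Equation

/-! ### Moments of linear and quadratic functionals of Gaussian vectors -/

section GaussianMoments

/-- The moments of the standard Gaussian. -/
def gaussMoment (p : ℕ) : ℝ≥0∞ := ∫⁻ x, ‖x‖ₑ ^ (2 * p) ∂(gaussianReal 0 1)

lemma gaussMoment_lt_top (p : ℕ) : gaussMoment p < ∞ := by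
  rcases Nat.eq_zero_or_pos p with rfl | hp
  · simp [gaussMoment]
  · have h := (memLp_id_gaussianReal' (μ := 0) (v := 1) ((2 * p : ℕ) : ℝ≥0∞)
      (ENNReal.natCast_ne_top _)).eLpNorm_lt_top
    rw [eLpNorm_lt_top_iff_lintegral_rpow_enorm_lt_top (by simp; omega)
      (ENNReal.natCast_ne_top _)] at h
    refine lt_of_le_of_lt (lintegral_mono fun x => le_of_eq ?_) h
    rw [ENNReal.toReal_natCast, ENNReal.rpow_natCast]; rfl

lemma lintegral_gaussianReal_pow (v : ℝ≥0) (p : ℕ) :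
    ∫⁻ x, ‖x‖ₑ ^ (2 * p) ∂(gaussianReal 0 v) = gaussMoment p * (v : ℝ≥0∞) ^ p := by
  have h : gaussianReal 0 v = (gaussianReal 0 1).map (Real.sqrt v * ·) := by
    rw [gaussianReal_map_const_mul]
    congr 1
    · simp
    · ext; simp
  have hs : ∀ x : ℝ, ‖Real.sqrt v * x‖ₑ ^ (2 * p) = ‖x‖ₑ ^ (2 * p) * (v : ℝ≥0∞) ^ p := by
    intro x
    rw [enorm_mul, mul_pow, mul_comm, pow_mul ‖Real.sqrt v‖ₑ, ← enorm_pow (Real.sqrt v),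
      Real.sq_sqrt v.coe_nonneg]
    congr 2
    rw [Real.enorm_eq_ofReal v.coe_nonneg, ENNReal.ofReal_coe_nnreal]
  rw [h, lintegral_map (by fun_prop) (by fun_prop)]
  simp_rw [hs]
  rw [lintegral_mul_const _ (by fun_prop)]; rfl

lemma enorm_add_pow_le {E : Type*} [NormedAddCommGroup E] (x y : E) (n : ℕ) :
    ‖x + y‖ₑ ^ n ≤ 2 ^ n * (‖x‖ₑ ^ n + ‖y‖ₑ ^ n) := by
  calc _ ≤ (‖x‖ₑ + ‖y‖ₑ) ^ n := ENNReal.pow_le_pow_left (enorm_add_le x y)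
    _ ≤ (2 * max ‖x‖ₑ ‖y‖ₑ) ^ n := by
        refine ENNReal.pow_le_pow_left ?_
        rw [two_mul]; exact add_le_add (le_max_left _ _) (le_max_right _ _)
    _ ≤ _ := by
        rw [mul_pow]
        gcongr
        rcases le_total ‖x‖ₑ ‖y‖ₑ with h | h
        · rw [max_eq_right h]; exact le_add_self
        · rw [max_eq_left h]; exact le_self_add

variable {Ω : Type*} [MeasurableSpace Ω] {P : Measure Ω}

lemma lintegral_pow_real_gaussian_le {X : Ω → ℝ} (hX : HasGaussianLaw X P) (h0 : ∫ ω, X ω ∂P = 0)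
    (p : ℕ) : ∫⁻ ω, ‖X ω‖ₑ ^ (2 * p) ∂P ≤ gaussMoment p * (∫⁻ ω, ‖X ω‖ₑ ^ 2 ∂P) ^ p := by
  have hm := hX.aemeasurable
  have hlaw : P.map X = gaussianReal 0 Var[X; P].toNNReal := by
    rw [hX.map_eq_gaussianReal, h0]
  have e : ∀ q : ℕ, ∫⁻ ω, ‖X ω‖ₑ ^ (2 * q) ∂P =
      gaussMoment q * (Var[X; P].toNNReal : ℝ≥0∞) ^ q := fun q => by
    rw [← lintegral_gaussianReal_pow, ← hlaw, lintegral_map' (by fun_prop) hm]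
  have e1 : gaussMoment 1 = 1 := by
    have h1 : ∀ x : ℝ, ‖x‖ₑ ^ (2 * 1) = ENNReal.ofReal (x ^ 2) := fun x => by
      rw [mul_one, ← enorm_pow, Real.enorm_eq_ofReal (sq_nonneg x)]
    rw [gaussMoment]
    simp_rw [h1]
    rw [← ofReal_integral_eq_lintegral_ofReal (integrable_sq_gaussianReal 1)
      (.of_forall fun _ => sq_nonneg _), integral_sq_gaussianReal]
    simp
  have e2 := e 1
  rw [e1, one_mul, pow_one, mul_one] at e2
  rw [e p, e2]

/-- A centered complex Gaussian variable has moments controlled by its variance. -/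
lemma lintegral_pow_gaussian_le {X : Ω → ℂ} (hX : HasGaussianLaw X P) (h0 : ∫ ω, X ω ∂P = 0)
    (p : ℕ) : ∫⁻ ω, ‖X ω‖ₑ ^ (2 * p) ∂P ≤
      2 ^ (2 * p) * (2 * gaussMoment p) * (∫⁻ ω, ‖X ω‖ₑ ^ 2 ∂P) ^ p := by
  have hint := hX.integrable
  have hm := hX.aemeasurable
  have hre : HasGaussianLaw (fun ω => (X ω).re) P := hX.map_fun Complex.reCLM
  have him : HasGaussianLaw (fun ω => (X ω).im) P := hX.map_fun Complex.imCLM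
  have hre0 : ∫ ω, (X ω).re ∂P = 0 := by
    have := Complex.reCLM.integral_comp_comm hint
    rw [h0] at this; simpa using this
  have him0 : ∫ ω, (X ω).im ∂P = 0 := by
    have := Complex.imCLM.integral_comp_comm hint
    rw [h0] at this; simpa using this
  have enorm_le : ∀ (x : ℝ) (z : ℂ), |x| ≤ ‖z‖ → ‖x‖ₑ ≤ ‖z‖ₑ := fun x z h => by
    rw [← ofReal_norm, ← ofReal_norm]; exact ENNReal.ofReal_le_ofReal h
  have b1 := lintegral_pow_real_gaussian_le hre hre0 p
  have b2 := lintegral_pow_real_gaussian_le him him0 p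
  have c1 : ∫⁻ ω, ‖(X ω).re‖ₑ ^ 2 ∂P ≤ ∫⁻ ω, ‖X ω‖ₑ ^ 2 ∂P :=
    lintegral_mono fun ω => ENNReal.pow_le_pow_left (enorm_le _ _ (Complex.abs_re_le_norm _))
  have c2 : ∫⁻ ω, ‖(X ω).im‖ₑ ^ 2 ∂P ≤ ∫⁻ ω, ‖X ω‖ₑ ^ 2 ∂P :=
    lintegral_mono fun ω => ENNReal.pow_le_pow_left (enorm_le _ _ (Complex.abs_im_le_norm _))
  have hn : ∀ x : ℝ, ‖(x : ℂ)‖ₑ = ‖x‖ₑ := fun x => by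
    rw [← ofReal_norm, ← ofReal_norm, Complex.norm_real]
  calc ∫⁻ ω, ‖X ω‖ₑ ^ (2 * p) ∂P
      ≤ ∫⁻ ω, 2 ^ (2 * p) * (‖(X ω).re‖ₑ ^ (2 * p) + ‖(X ω).im‖ₑ ^ (2 * p)) ∂P := by
        refine lintegral_mono fun ω => ?_
        have := enorm_add_pow_le ((X ω).re : ℂ) ((X ω).im * Complex.I) (2 * p)
        rw [Complex.re_add_im, enorm_mul, hn, hn] at this
        have hI : ‖Complex.I‖ₑ = 1 := by rw [← ofReal_norm, Complex.norm_I, ENNReal.ofReal_one]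
        rwa [hI, mul_one] at this
    _ = 2 ^ (2 * p) * (∫⁻ ω, ‖(X ω).re‖ₑ ^ (2 * p) ∂P + ∫⁻ ω, ‖(X ω).im‖ₑ ^ (2 * p) ∂P) := by
        rw [lintegral_const_mul' _ _ (by simp),
          lintegral_add_left' ((hre.aemeasurable.enorm).pow_const _)]
    _ ≤ 2 ^ (2 * p) * (gaussMoment p * (∫⁻ ω, ‖X ω‖ₑ ^ 2 ∂P) ^ p +
          gaussMoment p * (∫⁻ ω, ‖X ω‖ₑ ^ 2 ∂P) ^ p) := by
        gcongr
        · exact b1.trans (by gcongr)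
        · exact b2.trans (by gcongr)
    _ = _ := by ring

/-- The constant in the moment bound for linear functionals. -/
def linMoment (p : ℕ) : ℝ≥0∞ := 2 ^ (2 * p) * (2 * gaussMoment p)

lemma linMoment_lt_top (p : ℕ) : linMoment p < ∞ :=
  ENNReal.mul_lt_top (by simp) (ENNReal.mul_lt_top (by simp) (gaussMoment_lt_top p))

lemma lintegral_sum_pow_le {ι : Type*} {g : ι → Ω → ℝ≥0∞} (hg : ∀ a, Measurable (g a)) {p : ℕ}
    (hp : 1 ≤ p) {c : ℝ≥0∞} {k : ι → ℝ≥0∞} (h : ∀ a, ∫⁻ ω, g a ω ^ p ∂P ≤ c * k a ^ p)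
    (s : Finset ι) : ∫⁻ ω, (∑ a ∈ s, g a ω) ^ p ∂P ≤ c * (∑ a ∈ s, k a) ^ p := by
  classical
  have hp0 : (0 : ℝ) < p := by exact_mod_cast hp
  have root : ∀ {a b : ℝ≥0∞}, a ≤ c * b ^ p ↔ a ^ (1 / (p : ℝ)) ≤ c ^ (1 / (p : ℝ)) * b := by
    intro a b
    rw [← ENNReal.rpow_le_rpow_iff (z := 1 / (p : ℝ)) (by positivity),
      ENNReal.mul_rpow_of_nonneg _ _ (by positivity), ← ENNReal.rpow_natCast, ← ENNReal.rpow_mul,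
      mul_one_div_cancel hp0.ne', ENNReal.rpow_one]
  induction s using Finset.induction_on with
  | empty => simp [zero_pow (by omega : p ≠ 0)]
  | insert a s ha ih =>
    simp only [Finset.sum_insert ha]
    rw [root] at ih ⊢
    have h1 := h a
    rw [root] at h1
    have h2 := ENNReal.lintegral_Lp_add_le (μ := P) (p := p) (f := g a)
      (g := fun ω => ∑ a ∈ s, g a ω) (hg a).aemeasurable
      (Finset.measurable_fun_sum s fun a _ => hg a).aemeasurable (by exact_mod_cast hp)
    simp only [ENNReal.rpow_natCast, Pi.add_apply] at h2
    rw [mul_add]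
    exact h2.trans (add_le_add h1 ih)

lemma lintegral_pow_le_of_isProbabilityMeasure [IsProbabilityMeasure P] {f : Ω → ℝ≥0∞}
    (hf : AEMeasurable f P) {n : ℕ} (hn : 1 ≤ n) : (∫⁻ ω, f ω ∂P) ^ n ≤ ∫⁻ ω, f ω ^ n ∂P := by
  have hn0 : (0 : ℝ) < n := by exact_mod_cast hn
  have h := eLpNorm'_le_eLpNorm'_of_exponent_le one_pos (by exact_mod_cast hn : (1 : ℝ) ≤ n) P
    hf.aestronglyMeasurable
  simp only [eLpNorm', enorm_eq_self, ENNReal.rpow_one, div_one, ENNReal.rpow_natCast] at h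
  have h2 := ENNReal.pow_le_pow_left (n := n) h
  rwa [← ENNReal.rpow_natCast (_ ^ _), ← ENNReal.rpow_mul, one_div_mul_cancel hn0.ne',
    ENNReal.rpow_one] at h2

section Quadratic

variable {ι : Type*} [Fintype ι] {μ : Measure (ι → ℂ)} [IsGaussian μ] {Δ : ℝ≥0∞}

/-- The quadratic form `∑ K_{ab} z_a z_b`. -/
def quadForm (K : ι → ι → ℂ) (z : ι → ℂ) : ℂ := ∑ a, ∑ b, K a b * (z a * z b)

lemma measurable_quadForm (K : ι → ι → ℂ) : Measurable (quadForm K) := by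
  unfold quadForm; fun_prop

lemma hasGaussianLaw_linear (w : ι → ℂ) : HasGaussianLaw (fun z : ι → ℂ => ∑ a, w a * z a) μ := by
  have h : HasGaussianLaw (id : (ι → ℂ) → ι → ℂ) μ := IsGaussian.hasGaussianLaw_id
  let L : (ι → ℂ) →L[ℝ] ℂ := ∑ a, ((ContinuousLinearMap.mul ℝ ℂ (w a)).comp
    (ContinuousLinearMap.proj (R := ℝ) a))
  have := h.map_fun L
  refine this.congr (.of_forall fun z => ?_)
  simp [L]

lemma integral_linear_eq_zero (h0 : ∫ z, z ∂μ = 0) (w : ι → ℂ) :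
    ∫ z : ι → ℂ, ∑ a, w a * z a ∂μ = 0 := by
  let L : (ι → ℂ) →L[ℝ] ℂ := ∑ a, ((ContinuousLinearMap.mul ℝ ℂ (w a)).comp
    (ContinuousLinearMap.proj (R := ℝ) a))
  have h1 : Integrable (fun z : ι → ℂ => z) μ := IsGaussian.hasGaussianLaw_id.integrable
  have := L.integral_comp_comm h1
  rw [h0, map_zero] at this
  rw [← this]
  congr 1; ext z; simp [L]

lemma lintegral_linear_pow_le (h0 : ∫ z, z ∂μ = 0)
    (hΔ : ∀ w : ι → ℂ, ∫⁻ z : ι → ℂ, ‖∑ a, w a * z a‖ₑ ^ 2 ∂μ ≤ Δ * ∑ a, ‖w a‖ₑ ^ 2) (p : ℕ)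
    (w : ι → ℂ) :
    ∫⁻ z : ι → ℂ, ‖∑ a, w a * z a‖ₑ ^ (2 * p) ∂μ ≤ linMoment p * (Δ * ∑ a, ‖w a‖ₑ ^ 2) ^ p :=
  (lintegral_pow_gaussian_le (hasGaussianLaw_linear w) (integral_linear_eq_zero h0 w) p).trans
    (by unfold linMoment; gcongr; exact hΔ w)

lemma lintegral_bilinear_pow_le (h0 : ∫ z, z ∂μ = 0)
    (hΔ : ∀ w : ι → ℂ, ∫⁻ z : ι → ℂ, ‖∑ a, w a * z a‖ₑ ^ 2 ∂μ ≤ Δ * ∑ a, ‖w a‖ₑ ^ 2) {p : ℕ}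
    (hp : 1 ≤ p) (K : ι → ι → ℂ) :
    ∫⁻ y, ∫⁻ x, ‖∑ a, ∑ b, K a b * (x a * y b)‖ₑ ^ (2 * p) ∂μ ∂μ ≤
      linMoment p ^ 2 * (Δ ^ 2 * ∑ a, ∑ b, ‖K a b‖ₑ ^ 2) ^ p := by
  have h1 : ∀ x y : ι → ℂ, ∑ a, ∑ b, K a b * (x a * y b) = ∑ a, (∑ b, K a b * y b) * x a := by
    intro x y
    refine Finset.sum_congr rfl fun a _ => ?_
    rw [Finset.sum_mul]
    exact Finset.sum_congr rfl fun b _ => by ring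
  calc _ ≤ ∫⁻ y : ι → ℂ, linMoment p * (Δ * ∑ a, ‖∑ b, K a b * y b‖ₑ ^ 2) ^ p ∂μ := by
        refine lintegral_mono fun y => ?_
        simp_rw [h1]
        exact lintegral_linear_pow_le h0 hΔ p _
    _ = linMoment p * (Δ ^ p * ∫⁻ y : ι → ℂ, (∑ a, ‖∑ b, K a b * y b‖ₑ ^ 2) ^ p ∂μ) := by
        simp_rw [mul_pow]
        rw [lintegral_const_mul _ (by fun_prop), lintegral_const_mul _ (by fun_prop)]
    _ ≤ linMoment p * (Δ ^ p * (linMoment p * (∑ a, Δ * ∑ b, ‖K a b‖ₑ ^ 2) ^ p)) := by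
        gcongr
        refine lintegral_sum_pow_le (fun a => by fun_prop) hp (fun a => ?_) _
        simp_rw [← pow_mul]
        exact lintegral_linear_pow_le h0 hΔ p _
    _ = _ := by
        rw [← Finset.mul_sum]; ring

lemma quadForm_rotation_sub (K : ι → ι → ℂ) (z : (ι → ℂ) × (ι → ℂ)) :
    quadForm K (ContinuousLinearMap.rotation (Real.pi / 4) z).1 -
      quadForm K (ContinuousLinearMap.rotation (Real.pi / 4) z).2 =
    (∑ a, ∑ b, K a b * (z.1 a * z.2 b)) + ∑ a, ∑ b, K b a * (z.1 a * z.2 b) := by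
  have h2 : ∑ a, ∑ b, K b a * (z.1 a * z.2 b) = ∑ a, ∑ b, K a b * (z.1 b * z.2 a) :=
    Finset.sum_comm
  rw [h2, quadForm, quadForm, ← Finset.sum_sub_distrib, ← Finset.sum_add_distrib]
  refine Finset.sum_congr rfl fun a _ => ?_
  rw [← Finset.sum_sub_distrib, ← Finset.sum_add_distrib]
  refine Finset.sum_congr rfl fun b _ => ?_
  simp only [ContinuousLinearMap.rotation_apply, Real.cos_pi_div_four, Real.sin_pi_div_four,
    Pi.add_apply, Pi.smul_apply, Complex.real_smul]
  have hs : ((Real.sqrt 2 / 2 : ℝ) : ℂ) * ((Real.sqrt 2 / 2 : ℝ) : ℂ) = 1 / 2 := by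
    rw [← Complex.ofReal_mul]
    have : Real.sqrt 2 / 2 * (Real.sqrt 2 / 2) = 1 / 2 := by
      have := Real.mul_self_sqrt (show (0 : ℝ) ≤ 2 by norm_num)
      linarith
    rw [this]; push_cast; rfl
  push_cast at hs ⊢
  linear_combination (2 * K a b * (z.1 a * z.2 b + z.1 b * z.2 a)) * hs

lemma lintegral_quadForm_sub_pow_le (h0 : ∫ z, z ∂μ = 0)
    (hΔ : ∀ w : ι → ℂ, ∫⁻ z : ι → ℂ, ‖∑ a, w a * z a‖ₑ ^ 2 ∂μ ≤ Δ * ∑ a, ‖w a‖ₑ ^ 2) {p : ℕ}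
    (hp : 1 ≤ p) (K : ι → ι → ℂ) :
    ∫⁻ x, ∫⁻ y, ‖quadForm K x - quadForm K y‖ₑ ^ (2 * p) ∂μ ∂μ ≤
      2 ^ (2 * p + 1) * linMoment p ^ 2 * (Δ ^ 2 * ∑ a, ∑ b, ‖K a b‖ₑ ^ 2) ^ p := by
  have hq := measurable_quadForm K
  have hmeas : Measurable fun z : (ι → ℂ) × (ι → ℂ) =>
      ‖quadForm K z.1 - quadForm K z.2‖ₑ ^ (2 * p) :=
    (((hq.comp measurable_fst).sub (hq.comp measurable_snd)).enorm).pow_const _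
  have hb : ∀ K' : ι → ι → ℂ, Measurable fun z : (ι → ℂ) × (ι → ℂ) =>
      ‖∑ a, ∑ b, K' a b * (z.1 a * z.2 b)‖ₑ ^ (2 * p) := fun K' => by fun_prop
  have hbil : ∀ K' : ι → ι → ℂ, ∫⁻ z : (ι → ℂ) × (ι → ℂ),
      ‖∑ a, ∑ b, K' a b * (z.1 a * z.2 b)‖ₑ ^ (2 * p) ∂(μ.prod μ) ≤
      linMoment p ^ 2 * (Δ ^ 2 * ∑ a, ∑ b, ‖K' a b‖ₑ ^ 2) ^ p := fun K' => by
    rw [lintegral_prod_symm _ (hb K').aemeasurable]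
    exact lintegral_bilinear_pow_le h0 hΔ hp K'
  calc _ = ∫⁻ z, ‖quadForm K z.1 - quadForm K z.2‖ₑ ^ (2 * p) ∂(μ.prod μ) := by
        rw [lintegral_prod _ hmeas.aemeasurable]
    _ = ∫⁻ z, ‖quadForm K (ContinuousLinearMap.rotation (Real.pi / 4) z).1 -
          quadForm K (ContinuousLinearMap.rotation (Real.pi / 4) z).2‖ₑ ^ (2 * p) ∂(μ.prod μ) := by
        conv_lhs => rw [← IsGaussian.map_rotation_eq_self (μ := μ) h0 (Real.pi / 4)]
        rw [lintegral_map hmeas (ContinuousLinearMap.measurable _)]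
    _ ≤ ∫⁻ z : (ι → ℂ) × (ι → ℂ), 2 ^ (2 * p) * (‖∑ a, ∑ b, K a b * (z.1 a * z.2 b)‖ₑ ^ (2 * p) +
          ‖∑ a, ∑ b, K b a * (z.1 a * z.2 b)‖ₑ ^ (2 * p)) ∂(μ.prod μ) := by
        refine lintegral_mono fun z => ?_
        rw [quadForm_rotation_sub]
        exact enorm_add_pow_le _ _ _
    _ ≤ 2 ^ (2 * p) * (linMoment p ^ 2 * (Δ ^ 2 * ∑ a, ∑ b, ‖K a b‖ₑ ^ 2) ^ p +
          linMoment p ^ 2 * (Δ ^ 2 * ∑ a, ∑ b, ‖K a b‖ₑ ^ 2) ^ p) := by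
        rw [lintegral_const_mul' _ _ (by simp), lintegral_add_left (hb K)]
        gcongr
        · exact hbil K
        · refine (hbil fun a b => K b a).trans_eq ?_
          rw [Finset.sum_comm]
    _ = _ := by rw [pow_succ]; ring

lemma integrable_quadForm (K : ι → ι → ℂ) : Integrable (quadForm K) μ := by
  unfold quadForm
  refine integrable_finsetSum _ fun a _ => integrable_finsetSum _ fun b _ => Integrable.const_mul ?_ _
  have h : ∀ a, MemLp (fun z : ι → ℂ => z a) 2 μ := fun a => by
    have h1 : HasGaussianLaw (id : (ι → ℂ) → ι → ℂ) μ := IsGaussian.hasGaussianLaw_id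
    exact (h1.map_fun (ContinuousLinearMap.proj (R := ℝ) (φ := fun _ => ℂ) a)).memLp_two
  exact (h a).integrable_mul (h b)

/-- Moments of a centered quadratic functional of a Gaussian vector. -/
lemma lintegral_quadForm_centered_pow_le (h0 : ∫ z, z ∂μ = 0)
    (hΔ : ∀ w : ι → ℂ, ∫⁻ z : ι → ℂ, ‖∑ a, w a * z a‖ₑ ^ 2 ∂μ ≤ Δ * ∑ a, ‖w a‖ₑ ^ 2) {p : ℕ}
    (hp : 1 ≤ p) (K : ι → ι → ℂ) :
    ∫⁻ x, ‖quadForm K x - ∫ y, quadForm K y ∂μ‖ₑ ^ (2 * p) ∂μ ≤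
      2 ^ (2 * p + 1) * linMoment p ^ 2 * (Δ ^ 2 * ∑ a, ∑ b, ‖K a b‖ₑ ^ 2) ^ p := by
  refine le_trans (lintegral_mono fun x => ?_) (lintegral_quadForm_sub_pow_le h0 hΔ hp K)
  have hi := integrable_quadForm (μ := μ) K
  have e : quadForm K x - ∫ y, quadForm K y ∂μ = ∫ y, (quadForm K x - quadForm K y) ∂μ := by
    rw [integral_sub (integrable_const _) hi]; simp
  rw [e]
  refine le_trans (ENNReal.pow_le_pow_left (enorm_integral_le_lintegral_enorm _)) ?_
  exact lintegral_pow_le_of_isProbabilityMeasure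
    ((measurable_const.sub (measurable_quadForm K)).enorm).aemeasurable (by omega)

end Quadratic

end GaussianMoments

/-! ### Lattice sums -/

section LatticeSums

lemma tsum_jb_rpow_lt_top {r : ℝ} (hr : r < -2) : ∑' n : Freq, ENNReal.ofReal (jb n ^ r) < ∞ :=
  (summable_jb_rpow hr).tsum_ofReal_lt_top

lemma exists_tsum_int_le {r : ℝ} (hr : 1 < r) : ∃ C : ℝ≥0, ∀ c : ℝ,
    ∑' k : ℤ, ENNReal.ofReal ((1 + |(k : ℝ) - c|) ^ (-r)) ≤ C := by
  have hs : Summable fun j : ℤ => (2 : ℝ) ^ r * (1 + |(j : ℝ)|) ^ (-r) := by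
    refine Summable.mul_left _ ?_
    refine (Real.summable_abs_int_rpow hr).of_norm_bounded_eventually ?_
    rw [eventually_cofinite]
    refine (finite_singleton (0 : ℤ)).subset fun j hj => ?_
    by_contra h0
    refine hj ?_
    have hj0 : 0 < |(j : ℝ)| := abs_pos.2 (by exact_mod_cast h0)
    rw [Real.norm_of_nonneg (by positivity)]
    exact Real.rpow_le_rpow_of_nonpos hj0 (by linarith) (by linarith)
  refine ⟨(∑' j : ℤ, ENNReal.ofReal ((2 : ℝ) ^ r * (1 + |(j : ℝ)|) ^ (-r))).toNNReal, fun c => ?_⟩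
  rw [ENNReal.coe_toNNReal hs.tsum_ofReal_lt_top.ne,
    ← (Equiv.addRight ⌊c⌋).tsum_eq (fun k : ℤ => ENNReal.ofReal ((1 + |(k : ℝ) - c|) ^ (-r)))]
  refine ENNReal.tsum_le_tsum fun j => ENNReal.ofReal_le_ofReal ?_
  have h1 : (1 + |(j : ℝ)|) / 2 ≤ 1 + |((j + ⌊c⌋ : ℤ) : ℝ) - c| := by
    have h2 : |(j : ℝ)| ≤ |((j + ⌊c⌋ : ℤ) : ℝ) - c| + 1 := by
      have h3 := Int.floor_le c
      have h4 := Int.lt_floor_add_one c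
      have : (j : ℝ) = (((j + ⌊c⌋ : ℤ) : ℝ) - c) + (c - ⌊c⌋) := by push_cast; ring
      calc |(j : ℝ)| ≤ |((j + ⌊c⌋ : ℤ) : ℝ) - c| + |c - ⌊c⌋| := by
            conv_lhs => rw [this]
            exact abs_add_le _ _
        _ ≤ _ := by gcongr; rw [abs_le]; constructor <;> linarith
    have := abs_nonneg (((j + ⌊c⌋ : ℤ) : ℝ) - c)
    linarith
  have h2 : 0 < (1 + |(j : ℝ)|) / 2 := by positivity
  calc _ ≤ ((1 + |(j : ℝ)|) / 2) ^ (-r) := Real.rpow_le_rpow_of_nonpos h2 h1 (by linarith)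
    _ = _ := by
      rw [Real.div_rpow (by positivity) (by norm_num), Real.rpow_neg (by norm_num : (0 : ℝ) ≤ 2)]
      field_simp

lemma exists_tsum_int_mul_le {a b : ℝ} (ha : 0 ≤ a) (hb : 0 ≤ b) (hab : 1 < a + b) :
    ∃ C : ℝ≥0, ∀ c : ℝ,
      ∑' k : ℤ, ENNReal.ofReal ((1 + |(k : ℝ)|) ^ (-a) * (1 + |(k : ℝ) - c|) ^ (-b)) ≤ C := by
  obtain ⟨C, hC⟩ := exists_tsum_int_le hab
  refine ⟨C + C, fun c => ?_⟩
  have h : ∀ k : ℤ, (1 + |(k : ℝ)|) ^ (-a) * (1 + |(k : ℝ) - c|) ^ (-b) ≤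
      (1 + |(k : ℝ) - 0|) ^ (-(a + b)) + (1 + |(k : ℝ) - c|) ^ (-(a + b)) := by
    intro k
    rw [sub_zero]
    set x := 1 + |(k : ℝ)|
    set y := 1 + |(k : ℝ) - c|
    have hx : 0 < x := by positivity
    have hy : 0 < y := by positivity
    rcases le_total x y with h | h
    · have h1 : y ^ (-b) ≤ x ^ (-b) := Real.rpow_le_rpow_of_nonpos hx h (by linarith)
      calc _ ≤ x ^ (-a) * x ^ (-b) := by gcongr
        _ = x ^ (-(a + b)) := by rw [← Real.rpow_add hx]; congr 1; ring
        _ ≤ _ := le_add_of_nonneg_right (by positivity)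
    · have h1 : x ^ (-a) ≤ y ^ (-a) := Real.rpow_le_rpow_of_nonpos hy h (by linarith)
      calc _ ≤ y ^ (-a) * y ^ (-b) := by gcongr
        _ = y ^ (-(a + b)) := by rw [← Real.rpow_add hy]; congr 1; ring
        _ ≤ _ := le_add_of_nonneg_left (by positivity)
  calc _ ≤ ∑' k : ℤ, (ENNReal.ofReal ((1 + |(k : ℝ) - (0 : ℝ)|) ^ (-(a + b))) +
        ENNReal.ofReal ((1 + |(k : ℝ) - c|) ^ (-(a + b)))) := by
        refine ENNReal.tsum_le_tsum fun k => ?_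
        rw [← ENNReal.ofReal_add (by positivity) (by positivity)]
        exact ENNReal.ofReal_le_ofReal (h k)
    _ ≤ _ := by
        rw [ENNReal.tsum_add, ENNReal.coe_add]
        exact add_le_add (hC 0) (hC c)

/-- The phase `⟨n⟩ ± ⟨m⟩ ± ⟨n - m⟩`. -/
def phase (σ₁ σ₂ : ℝ) (n m : Freq) : ℝ := jb n + σ₁ * jb m + σ₂ * jb (n - m)

lemma jb_le_of_le {n m : Freq} (h : jb m ≤ jb (n - m)) : jb n ≤ 2 * jb (n - m) := by
  have := jb_add_le m (n - m)
  rw [add_sub_cancel] at this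
  linarith

/-- The lower bound for the phase; the mass excludes resonances. -/
lemma cross_sq_le_phase {σ₁ σ₂ : ℝ} (h₁ : σ₁ = 1 ∨ σ₁ = -1) (h₂ : σ₂ = 1 ∨ σ₂ = -1) {n m : Freq}
    (h : jb m ≤ jb (n - m)) :
    ((n.1 : ℝ) * m.2 - n.2 * m.1) ^ 2 ≤ 4 * jb n * jb m * jb (n - m) * |phase σ₁ σ₂ n m| := by
  set a : ℝ := ((n.1 : ℤ) : ℝ)
  set b : ℝ := ((n.2 : ℤ) : ℝ)
  set c : ℝ := ((m.1 : ℤ) : ℝ)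
  set d : ℝ := ((m.2 : ℤ) : ℝ)
  set A := jb n
  set M := jb m
  set D := jb (n - m)
  have hA : A ^ 2 = 1 + (a ^ 2 + b ^ 2) := jb_sq n
  have hM : M ^ 2 = 1 + (c ^ 2 + d ^ 2) := jb_sq m
  have hD : D ^ 2 = 1 + ((a - c) ^ 2 + (b - d) ^ 2) := by
    have := jb_sq (n - m)
    simpa [normSq, D, a, b, c, d] using this
  have hA1 : 1 ≤ A := one_le_jb n
  have hM1 : 1 ≤ M := one_le_jb m
  have hD1 : 1 ≤ D := one_le_jb _
  have hAD : A ≤ 2 * D := jb_le_of_le h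
  set S := A * M
  set p := a * c + b * d
  have hS0 : 0 < S := by positivity
  have hS2 : S ^ 2 = (1 + (a ^ 2 + b ^ 2)) * (1 + (c ^ 2 + d ^ 2)) := by
    rw [← hA, ← hM]; exact mul_pow A M 2
  have hid : S ^ 2 - p ^ 2 = 1 + (a ^ 2 + b ^ 2) + (c ^ 2 + d ^ 2) + (a * d - b * c) ^ 2 := by
    rw [hS2]; ring
  have hpS : |p| ≤ S := by
    refine abs_le_of_sq_le_sq ?_ hS0.le
    nlinarith [sq_nonneg (a * d - b * c), sq_nonneg a, sq_nonneg b, sq_nonneg c, sq_nonneg d]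
  obtain ⟨hp1, hp2⟩ := abs_le.1 hpS
  have hSle : S ≤ 1 + (a ^ 2 + b ^ 2) + (c ^ 2 + d ^ 2) := by
    nlinarith [sq_nonneg (A - M), sq_nonneg a, sq_nonneg b, sq_nonneg c, sq_nonneg d]
  have key : (a * d - b * c) ^ 2 ≤ |1 + 2 * p + 2 * σ₁ * S| * S := by
    have hX0 := sq_nonneg (a * d - b * c)
    generalize (a * d - b * c) ^ 2 = X at hid hX0 ⊢
    generalize a ^ 2 + b ^ 2 = r₁ at hid hSle
    generalize c ^ 2 + d ^ 2 = r₂ at hid hSle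
    rcases h₁ with rfl | rfl
    · rw [abs_of_nonneg (by linarith)]
      have : 0 ≤ (S + p) ^ 2 := sq_nonneg _
      have e : (1 + 2 * p + 2 * 1 * S) * S = (S + p) ^ 2 + S + (S ^ 2 - p ^ 2) := by ring
      linarith
    · have h3 : 1 + 2 * p + 2 * -1 * S ≤ 0 := by
        by_contra hc
        push Not at hc
        have e1 : (S - p) * (S + p) ≤ (S - p) * (2 * S) :=
          mul_le_mul_of_nonneg_left (by linarith) (by linarith)
        have e2 : (S - p) * (2 * S) < 1 * S := by
          have := mul_lt_mul_of_pos_right (show (S - p) * 2 < 1 by linarith) hS0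
          linarith
        have e3 : (S - p) * (S + p) = S ^ 2 - p ^ 2 := by ring
        linarith
      rw [abs_of_nonpos h3]
      have : 0 ≤ (S - p) ^ 2 := sq_nonneg _
      have e : -(1 + 2 * p + 2 * -1 * S) * S = (S - p) ^ 2 - S + (S ^ 2 - p ^ 2) := by ring
      linarith
  have hprod : 1 + 2 * p + 2 * σ₁ * S = (A + σ₁ * M + σ₂ * D) * (A + σ₁ * M - σ₂ * D) := by
    have e1 : σ₁ ^ 2 = 1 := by rcases h₁ with rfl | rfl <;> norm_num
    have e2 : σ₂ ^ 2 = 1 := by rcases h₂ with rfl | rfl <;> norm_num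
    have : (A + σ₁ * M + σ₂ * D) * (A + σ₁ * M - σ₂ * D) =
        A ^ 2 + σ₁ ^ 2 * M ^ 2 + 2 * σ₁ * (A * M) - σ₂ ^ 2 * D ^ 2 := by ring
    rw [this, e1, e2, hA, hM, hD]
    simp only [p, S]; ring
  have hκ' : |A + σ₁ * M - σ₂ * D| ≤ 4 * D := by
    rcases h₁ with rfl | rfl <;> rcases h₂ with rfl | rfl <;> rw [abs_le] <;> constructor <;>
      linarith
  rw [hprod, abs_mul] at key
  calc _ ≤ _ := key
    _ ≤ |A + σ₁ * M + σ₂ * D| * (4 * D) * S := by gcongr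
    _ = _ := by simp only [phase, S]; ring

lemma one_add_abs_fst_le (m : Freq) : (1 + |(m.1 : ℝ)|) / 2 ≤ jb m := by
  have := abs_fst_le_jb m; have := one_le_jb m; linarith

lemma one_add_abs_snd_le (m : Freq) : (1 + |(m.2 : ℝ)|) / 2 ≤ jb m := by
  have := abs_snd_le_jb m; have := one_le_jb m; linarith

lemma phase_rpow_le {q σ₁ σ₂ : ℝ} (h₁ : σ₁ = 1 ∨ σ₁ = -1) (h₂ : σ₂ = 1 ∨ σ₂ = -1)
    (hq0 : 0 < q) (hq : q ≤ 1 / 2) {n m : Freq} (hn : n ≠ 0) (hn12 : |(n.2 : ℝ)| ≤ |(n.1 : ℝ)|)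
    (h : jb m ≤ jb (n - m)) :
    (1 + |phase σ₁ σ₂ n m|) ^ (-2 : ℝ) ≤
      4 * (1 + |(m.2 : ℝ) - n.2 * m.1 / n.1|) ^ (-2 : ℝ) +
      8 * ((jb m * jb (n - m) / jb n) ^ q * (1 + |(m.2 : ℝ) - n.2 * m.1 / n.1|) ^ (-(2 * q))) := by
  have hX := cross_sq_le_phase h₁ h₂ h
  set κ := |phase σ₁ σ₂ n m|
  have hκ : 0 ≤ κ := abs_nonneg _
  set u := |(m.2 : ℝ) - n.2 * m.1 / n.1| with hu
  have hu0 : 0 ≤ u := abs_nonneg _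
  have hA := jb_pos n
  have hM := jb_pos m
  have hD := jb_pos (n - m)
  have hn1 : n.1 ≠ 0 := by
    intro h0
    rw [h0] at hn12
    simp only [Int.cast_zero, abs_zero, abs_nonpos_iff, Int.cast_eq_zero] at hn12
    exact hn (Prod.ext h0 hn12)
  have hn1' : (n.1 : ℝ) ≠ 0 := by exact_mod_cast hn1
  have hd1 : (1 : ℝ) ≤ |(n.1 : ℝ)| := by
    have : 1 ≤ |n.1| := Int.one_le_abs hn1
    exact_mod_cast this
  have hA2 : jb n ^ 2 ≤ 4 * (n.1 : ℝ) ^ 2 := by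
    rw [jb_sq, normSq, ← sq_abs (n.1 : ℝ), ← sq_abs (n.2 : ℝ)]
    nlinarith [abs_nonneg (n.2 : ℝ)]
  have hXu : ((n.1 : ℝ) * m.2 - n.2 * m.1) ^ 2 = (n.1 : ℝ) ^ 2 * u ^ 2 := by
    rw [hu, sq_abs]; field_simp
  have hmain : jb n * u ^ 2 ≤ 16 * (jb m * jb (n - m)) * κ := by
    rw [hXu] at hX
    have h1 : jb n ^ 2 * u ^ 2 ≤ 4 * (4 * jb n * jb m * jb (n - m) * κ) := by
      nlinarith [sq_nonneg u]
    have h2 : jb n * (jb n * u ^ 2) ≤ jb n * (16 * (jb m * jb (n - m)) * κ) := by linarith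
    exact le_of_mul_le_mul_left h2 hA
  rcases le_or_gt u 1 with h1 | h1
  · have e1 : (1 + κ) ^ (-2 : ℝ) ≤ 1 := Real.rpow_le_one_of_one_le_of_nonpos (by linarith) (by norm_num)
    have e2 : (1 : ℝ) ≤ 4 * (1 + u) ^ (-2 : ℝ) := by
      have h5 : (2 : ℝ) ^ (-2 : ℝ) ≤ (1 + u) ^ (-2 : ℝ) :=
        Real.rpow_le_rpow_of_nonpos (by positivity) (by linarith) (by norm_num)
      have h4 : (2 : ℝ) ^ (-2 : ℝ) = 1 / 4 := by
        rw [Real.rpow_neg (by norm_num), Real.rpow_two]; norm_num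
      rw [h4] at h5
      linarith
    have : 0 ≤ 8 * ((jb m * jb (n - m) / jb n) ^ q * (1 + u) ^ (-(2 * q))) := by positivity
    linarith
  · have hR : 0 < jb m * jb (n - m) / jb n := by positivity
    have e0 : (1 + u) ^ 2 / 64 / (jb m * jb (n - m) / jb n) ≤ 1 + κ := by
      have e3 : (1 + u) ^ 2 ≤ 4 * u ^ 2 := by nlinarith
      rw [div_le_iff₀ hR, ← mul_div_assoc, le_div_iff₀ hA]
      nlinarith
    have e1 : (1 + κ) ^ (-2 : ℝ) ≤ (1 + κ) ^ (-q) :=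
      Real.rpow_le_rpow_of_exponent_le (by linarith) (by linarith)
    have e2 : (1 + κ) ^ (-q) ≤ ((1 + u) ^ 2 / 64 / (jb m * jb (n - m) / jb n)) ^ (-q) :=
      Real.rpow_le_rpow_of_nonpos (by positivity) e0 (by linarith)
    have e3 : ((1 + u) ^ 2 / 64 / (jb m * jb (n - m) / jb n)) ^ (-q) =
        64 ^ q * ((jb m * jb (n - m) / jb n) ^ q * (1 + u) ^ (-(2 * q))) := by
      rw [Real.div_rpow (by positivity) (by positivity), Real.div_rpow (by positivity) (by norm_num),
        ← Real.rpow_natCast, ← Real.rpow_mul (by positivity), Real.rpow_neg (by norm_num : (0:ℝ) ≤ 64),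
        Real.rpow_neg hR.le]
      have : ((2 : ℕ) : ℝ) * -q = -(2 * q) := by push_cast; ring
      rw [this]
      field_simp
    have e4 : (64 : ℝ) ^ q ≤ 8 := by
      calc (64 : ℝ) ^ q ≤ 64 ^ (1 / 2 : ℝ) := Real.rpow_le_rpow_of_exponent_le (by norm_num) hq
        _ = 8 := by
          rw [show (64 : ℝ) = 8 ^ (2 : ℝ) by norm_num, ← Real.rpow_mul (by norm_num)]; norm_num
    have e5 : 0 ≤ (jb m * jb (n - m) / jb n) ^ q * (1 + u) ^ (-(2 * q)) := by positivity
    have e6 : 0 ≤ 4 * (1 + u) ^ (-2 : ℝ) := by positivity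
    calc _ ≤ 64 ^ q * ((jb m * jb (n - m) / jb n) ^ q * (1 + u) ^ (-(2 * q))) :=
          e1.trans (e2.trans_eq e3)
      _ ≤ 8 * ((jb m * jb (n - m) / jb n) ^ q * (1 + u) ^ (-(2 * q))) := by gcongr
      _ ≤ _ := by linarith

lemma exists_tsum_phase_le_aux {B δ : ℝ} (hδ : 0 < δ) (hδ2 : δ < 1 / 2) (hB : 1 + δ ≤ B)
    (hB2 : B ≤ 4 / 3) : ∃ C : ℝ≥0, ∀ σ₁ σ₂ : ℝ, (σ₁ = 1 ∨ σ₁ = -1) → (σ₂ = 1 ∨ σ₂ = -1) →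
      ∀ n : Freq, n ≠ 0 → |(n.2 : ℝ)| ≤ |(n.1 : ℝ)| →
      ∑' m : Freq, (if jb m ≤ jb (n - m) then ENNReal.ofReal (jb m ^ (-B) * jb (n - m) ^ (-B) *
        (1 + |phase σ₁ σ₂ n m|) ^ (-2 : ℝ)) else 0) ≤
      C * ENNReal.ofReal (jb n ^ (3 / 2 - 2 * B + 3 * δ)) := by
  obtain ⟨C₁, hC₁⟩ := exists_tsum_int_le (r := 1 + δ) (by linarith)
  obtain ⟨C₂, hC₂⟩ := exists_tsum_int_le (r := 2) (by norm_num)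
  obtain ⟨C₃, hC₃⟩ := exists_tsum_int_mul_le (a := 3 * δ) (b := 2 * (1 / 2 - δ)) (by linarith)
    (by linarith) (by linarith)
  refine ⟨256 * (C₁ * (C₂ + C₃)), fun σ₁ σ₂ h₁ h₂ n hn hn12 => ?_⟩
  set A := jb n with hA
  have hApos : 0 < A := jb_pos n
  have hA1 : 1 ≤ A := one_le_jb n
  set e := 3 / 2 - 2 * B + 3 * δ with he
  set q := 1 / 2 - δ with hq
  set V : ℤ → ℤ → ℝ := fun i j =>
    (1 + |(j : ℝ) - n.2 * i / n.1|) ^ (-2 : ℝ) +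
      (1 + |(j : ℝ)|) ^ (-(3 * δ)) * (1 + |(j : ℝ) - n.2 * i / n.1|) ^ (-(2 * q)) with hV
  have hV0 : ∀ i j, 0 ≤ V i j := fun i j => by positivity
  have hpt : ∀ m : Freq, jb m ≤ jb (n - m) →
      jb m ^ (-B) * jb (n - m) ^ (-B) * (1 + |phase σ₁ σ₂ n m|) ^ (-2 : ℝ) ≤
      256 * (A ^ e * ((1 + |(m.1 : ℝ) - 0|) ^ (-(1 + δ)) * V m.1 m.2)) := by
    intro m hm
    have hph := phase_rpow_le h₁ h₂ (q := q) (by linarith) (by linarith) hn hn12 hm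
    have hAD : A ≤ 2 * jb (n - m) := jb_le_of_le hm
    have hm1 := one_add_abs_fst_le m
    have hm2 := one_add_abs_snd_le m
    have hMpos := jb_pos m
    have hM1 := one_le_jb m
    set M := jb m
    set D := jb (n - m)
    have hDpos : 0 < D := jb_pos (n - m)
    set x := 1 + |(m.1 : ℝ)| with hx
    set y := 1 + |(m.2 : ℝ)| with hy
    set z := 1 + |(m.2 : ℝ) - n.2 * m.1 / n.1| with hz
    have hx1 : 1 ≤ x := by simp [hx]
    have hy1 : 1 ≤ y := by simp [hy]
    have hz1 : 1 ≤ z := by simp [hz]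
    have half : ∀ {r w v : ℝ}, 0 < w → w / 2 ≤ v → 0 ≤ r → v ^ (-r) ≤ 2 ^ r * w ^ (-r) := by
      intro r w v hw hwv hr
      calc v ^ (-r) ≤ (w / 2) ^ (-r) :=
            Real.rpow_le_rpow_of_nonpos (by positivity) hwv (by linarith)
        _ = 2 ^ r * w ^ (-r) := by
            rw [Real.div_rpow hw.le (by norm_num), Real.rpow_neg (by norm_num : (0:ℝ) ≤ 2)]
            field_simp
    have two : ∀ {r : ℝ} (k : ℕ), r ≤ k → (2 : ℝ) ^ r ≤ 2 ^ k := by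
      intro r k hr
      rw [← Real.rpow_natCast]
      exact Real.rpow_le_rpow_of_exponent_le (by norm_num) hr
    have near : M ^ (-B) * D ^ (-B) ≤ 16 * (A ^ e * x ^ (-(1 + δ))) := by
      have e1 : M ^ (-B) ≤ 4 * x ^ (-(1 + δ)) := by
        calc M ^ (-B) ≤ 2 ^ B * x ^ (-B) := half (by positivity) hm1 (by linarith)
          _ ≤ 2 ^ 2 * x ^ (-(1 + δ)) := by
            gcongr
            · exact two 2 (by push_cast; linarith)
          _ = _ := by norm_num
      have e2 : D ^ (-B) ≤ 4 * A ^ e := by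
        calc D ^ (-B) ≤ 2 ^ B * A ^ (-B) := half hApos (by linarith) (by linarith)
          _ ≤ 2 ^ 2 * A ^ e := by
            gcongr
            · exact two 2 (by push_cast; linarith)
            · linarith
          _ = _ := by norm_num
      calc _ ≤ (4 * x ^ (-(1 + δ))) * (4 * A ^ e) := by gcongr
        _ = _ := by ring
    have far : M ^ (-B) * D ^ (-B) * (M * D / A) ^ q ≤
        32 * (A ^ e * x ^ (-(1 + δ)) * y ^ (-(3 * δ))) := by
      have e1 : M ^ (-B) * D ^ (-B) * (M * D / A) ^ q =
          A ^ (-q) * M ^ (-(B - q)) * (D ^ (-(2 * B - 2 - 2 * δ)) * D ^ (-(3 / 2 + 3 * δ - B))) := by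
        rw [← Real.rpow_add hDpos, Real.div_rpow (by positivity) hApos.le,
          Real.mul_rpow hMpos.le hDpos.le, div_eq_mul_inv, ← Real.rpow_neg hApos.le,
          show -(B - q) = -B + q by ring, Real.rpow_add hMpos,
          show -(2 * B - 2 - 2 * δ) + -(3 / 2 + 3 * δ - B) = -B + q by rw [hq]; ring,
          Real.rpow_add hDpos]
        ring
      have e2 : D ^ (-(2 * B - 2 - 2 * δ)) ≤ 2 * A ^ (-(2 * B - 2 - 2 * δ)) := by
        refine (half hApos (by linarith) (by linarith)).trans ?_
        gcongr
        simpa using two (r := 2 * B - 2 - 2 * δ) 1 (by push_cast; linarith)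
      have e3 : D ^ (-(3 / 2 + 3 * δ - B)) ≤ M ^ (-(3 / 2 + 3 * δ - B)) :=
        Real.rpow_le_rpow_of_nonpos hMpos hm (by linarith)
      have e4 : M ^ (-(B - q)) * M ^ (-(3 / 2 + 3 * δ - B)) = M ^ (-(1 + δ)) * M ^ (-(3 * δ)) := by
        rw [← Real.rpow_add hMpos, ← Real.rpow_add hMpos]; congr 1; rw [hq]; ring
      have e5 : A ^ (-q) * A ^ (-(2 * B - 2 - 2 * δ)) = A ^ e := by
        rw [← Real.rpow_add hApos]; congr 1; rw [hq, he]; ring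
      have e6 : M ^ (-(1 + δ)) ≤ 4 * x ^ (-(1 + δ)) := by
        refine (half (by positivity) hm1 (by linarith)).trans ?_
        gcongr
        calc _ ≤ (2 : ℝ) ^ 2 := two 2 (by push_cast; linarith)
          _ = 4 := by norm_num
      have e7 : M ^ (-(3 * δ)) ≤ 4 * y ^ (-(3 * δ)) := by
        refine (half (by positivity) hm2 (by linarith)).trans ?_
        gcongr
        calc _ ≤ (2 : ℝ) ^ 2 := two 2 (by push_cast; linarith)
          _ = 4 := by norm_num
      calc _ ≤ A ^ (-q) * M ^ (-(B - q)) *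
            ((2 * A ^ (-(2 * B - 2 - 2 * δ))) * M ^ (-(3 / 2 + 3 * δ - B))) := by
            rw [e1]; gcongr
        _ = 2 * (A ^ (-q) * A ^ (-(2 * B - 2 - 2 * δ))) *
            (M ^ (-(B - q)) * M ^ (-(3 / 2 + 3 * δ - B))) := by ring
        _ = 2 * A ^ e * (M ^ (-(1 + δ)) * M ^ (-(3 * δ))) := by rw [e4, e5]
        _ ≤ 2 * A ^ e * ((4 * x ^ (-(1 + δ))) * (4 * y ^ (-(3 * δ)))) := by gcongr
        _ = _ := by ring
    rw [sub_zero]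
    calc M ^ (-B) * D ^ (-B) * (1 + |phase σ₁ σ₂ n m|) ^ (-2 : ℝ)
        ≤ M ^ (-B) * D ^ (-B) * (4 * z ^ (-2 : ℝ) + 8 * ((M * D / A) ^ q * z ^ (-(2 * q)))) := by
          gcongr
      _ = 4 * z ^ (-2 : ℝ) * (M ^ (-B) * D ^ (-B)) +
          8 * z ^ (-(2 * q)) * (M ^ (-B) * D ^ (-B) * (M * D / A) ^ q) := by ring
      _ ≤ 4 * z ^ (-2 : ℝ) * (16 * (A ^ e * x ^ (-(1 + δ)))) +
          8 * z ^ (-(2 * q)) * (32 * (A ^ e * x ^ (-(1 + δ)) * y ^ (-(3 * δ)))) := by gcongr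
      _ ≤ 256 * (A ^ e * (x ^ (-(1 + δ)) * (z ^ (-2 : ℝ) + y ^ (-(3 * δ)) * z ^ (-(2 * q))))) := by
          have : 0 ≤ z ^ (-2 : ℝ) * (A ^ e * x ^ (-(1 + δ))) := by positivity
          nlinarith
  have hVsum : ∀ i : ℤ, ∑' j : ℤ, ENNReal.ofReal (V i j) ≤ C₂ + C₃ := by
    intro i
    calc _ ≤ ∑' j : ℤ, (ENNReal.ofReal ((1 + |(j : ℝ) - n.2 * i / n.1|) ^ (-2 : ℝ)) +
          ENNReal.ofReal ((1 + |(j : ℝ)|) ^ (-(3 * δ)) *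
            (1 + |(j : ℝ) - n.2 * i / n.1|) ^ (-(2 * q)))) := by
          refine ENNReal.tsum_le_tsum fun j => ?_
          rw [← ENNReal.ofReal_add (by positivity) (by positivity)]
      _ ≤ _ := by
          rw [ENNReal.tsum_add]
          exact add_le_add (hC₂ _) (hC₃ _)
  calc _ ≤ ∑' m : Freq, 256 * ENNReal.ofReal (A ^ e) *
        (ENNReal.ofReal ((1 + |(m.1 : ℝ) - 0|) ^ (-(1 + δ))) * ENNReal.ofReal (V m.1 m.2)) := by
        refine ENNReal.tsum_le_tsum fun m => ?_
        split_ifs with hm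
        · refine (ENNReal.ofReal_le_ofReal (hpt m hm)).trans_eq ?_
          rw [ENNReal.ofReal_mul (by norm_num), ENNReal.ofReal_mul (by positivity),
            ENNReal.ofReal_mul (by positivity), mul_assoc]
          norm_num
        · exact zero_le
    _ = 256 * ENNReal.ofReal (A ^ e) * ∑' i : ℤ, ENNReal.ofReal ((1 + |(i : ℝ) - 0|) ^ (-(1 + δ))) *
        ∑' j : ℤ, ENNReal.ofReal (V i j) := by
        rw [ENNReal.tsum_mul_left, ENNReal.tsum_prod']
        simp_rw [ENNReal.tsum_mul_left]
    _ ≤ 256 * ENNReal.ofReal (A ^ e) * ∑' i : ℤ,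
        ENNReal.ofReal ((1 + |(i : ℝ) - 0|) ^ (-(1 + δ))) * (C₂ + C₃) := by
        gcongr with i
        exact hVsum i
    _ ≤ 256 * ENNReal.ofReal (A ^ e) * (C₁ * (C₂ + C₃)) := by
        rw [ENNReal.tsum_mul_right]
        gcongr
        exact hC₁ 0
    _ = _ := by push_cast; ring

lemma jb_swap (n : Freq) : jb n.swap = jb n := by
  simp [jb, normSq, add_comm]

lemma phase_swap (σ₁ σ₂ : ℝ) (n m : Freq) :
    phase σ₁ σ₂ n.swap m.swap = phase σ₁ σ₂ n m := by
  rw [phase, phase, ← Prod.swap_sub, jb_swap, jb_swap, jb_swap]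

lemma exists_tsum_phase_le {B δ : ℝ} (hδ : 0 < δ) (hδ2 : δ < 1 / 2) (hB : 1 + δ ≤ B)
    (hB2 : B ≤ 4 / 3) : ∃ C : ℝ≥0, ∀ σ₁ σ₂ : ℝ, (σ₁ = 1 ∨ σ₁ = -1) → (σ₂ = 1 ∨ σ₂ = -1) →
      ∀ n : Freq,
      ∑' m : Freq, (if jb m ≤ jb (n - m) then ENNReal.ofReal (jb m ^ (-B) * jb (n - m) ^ (-B) *
        (1 + |phase σ₁ σ₂ n m|) ^ (-2 : ℝ)) else 0) ≤
      C * ENNReal.ofReal (jb n ^ (3 / 2 - 2 * B + 3 * δ)) := by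
  obtain ⟨C, hC⟩ := exists_tsum_phase_le_aux hδ hδ2 hB hB2
  have h0 : ∑' n : Freq, ENNReal.ofReal (jb n ^ (-(2 * B))) < ∞ :=
    tsum_jb_rpow_lt_top (by linarith)
  refine ⟨C + (∑' n : Freq, ENNReal.ofReal (jb n ^ (-(2 * B)))).toNNReal,
    fun σ₁ σ₂ h₁ h₂ n => ?_⟩
  rw [ENNReal.coe_add, ENNReal.coe_toNNReal h0.ne, add_mul]
  by_cases hn : n = 0
  · subst hn
    refine le_add_left ?_
    rw [jb_zero, Real.one_rpow, ENNReal.ofReal_one, mul_one]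
    refine ENNReal.tsum_le_tsum fun m => ?_
    split_ifs
    · refine ENNReal.ofReal_le_ofReal ?_
      rw [zero_sub, jb_neg, ← Real.rpow_add (jb_pos m), show -B + -B = -(2 * B) by ring]
      exact mul_le_of_le_one_right (jb_rpow_pos _ _).le
        (Real.rpow_le_one_of_one_le_of_nonpos (by simp) (by norm_num))
    · exact zero_le
  · refine le_add_right ?_
    rcases le_total |(n.2 : ℝ)| |(n.1 : ℝ)| with h | h
    · exact hC σ₁ σ₂ h₁ h₂ n hn h
    · have := hC σ₁ σ₂ h₁ h₂ n.swap (fun h0 => hn (by simpa using congrArg Prod.swap h0)) h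
      rw [← (Equiv.prodComm ℤ ℤ).tsum_eq] at this
      simpa only [Equiv.prodComm_apply, phase_swap, ← Prod.swap_sub, jb_swap] using this

/-- Sums over pairs of frequencies, arranged by the sum of the two. -/
lemma tsum_pair_le (G : Freq → Freq → ℝ≥0∞) :
    ∑' p : Freq × Freq, G p.1 p.2 ≤
      ∑' n : Freq, ∑' m : Freq, (if jb m ≤ jb (n - m) then G m (n - m) else 0) +
      ∑' n : Freq, ∑' m : Freq, (if jb m ≤ jb (n - m) then G (n - m) m else 0) := by
  have key : ∀ H : Freq → Freq → ℝ≥0∞, ∑' n : Freq, ∑' m : Freq,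
      (if jb m ≤ jb (n - m) then H m (n - m) else 0) =
      ∑' p : Freq × Freq, if jb p.1 ≤ jb p.2 then H p.1 p.2 else 0 := by
    intro H
    rw [ENNReal.tsum_comm]
    refine Eq.trans (tsum_congr fun m => ?_) (ENNReal.tsum_prod'
      (f := fun p : Freq × Freq => if jb p.1 ≤ jb p.2 then H p.1 p.2 else 0)).symm
    rw [← (Equiv.subRight m).tsum_eq (fun l : Freq => if jb m ≤ jb l then H m l else 0)]
    rfl
  rw [key G, key fun a b => G b a, ← (Equiv.prodComm Freq Freq).tsum_eq
    (fun p : Freq × Freq => if jb p.1 ≤ jb p.2 then G p.2 p.1 else 0), ← ENNReal.tsum_add]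
  refine ENNReal.tsum_le_tsum fun p => ?_
  change G p.1 p.2 ≤ (if jb p.1 ≤ jb p.2 then G p.1 p.2 else 0) +
    if jb p.2 ≤ jb p.1 then G p.1 p.2 else 0
  rcases le_total (jb p.1) (jb p.2) with h | h
  · rw [if_pos h]; exact le_self_add
  · rw [if_pos h]; exact le_add_self

lemma exists_tsum_pair_phase_le {B δ r : ℝ} (hδ : 0 < δ) (hδ2 : δ < 1 / 2) (hB : 1 + δ ≤ B)
    (hB2 : B ≤ 4 / 3) (hr : r + (3 / 2 - 2 * B + 3 * δ) < -2) :
    ∃ C : ℝ≥0, ∀ σ₁ σ₂ : ℝ, (σ₁ = 1 ∨ σ₁ = -1) → (σ₂ = 1 ∨ σ₂ = -1) →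
      ∑' p : Freq × Freq, ENNReal.ofReal (jb (p.1 + p.2) ^ r * jb p.1 ^ (-B) * jb p.2 ^ (-B) *
        (1 + |jb (p.1 + p.2) + σ₁ * jb p.1 + σ₂ * jb p.2|) ^ (-2 : ℝ)) ≤ C := by
  obtain ⟨C, hC⟩ := exists_tsum_phase_le hδ hδ2 hB hB2
  have h0 := tsum_jb_rpow_lt_top hr
  have half : ∀ σ₁ σ₂ : ℝ, (σ₁ = 1 ∨ σ₁ = -1) → (σ₂ = 1 ∨ σ₂ = -1) →
      ∑' n : Freq, ∑' m : Freq, (if jb m ≤ jb (n - m) then ENNReal.ofReal (jb n ^ r *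
        (jb m ^ (-B) * jb (n - m) ^ (-B) * (1 + |phase σ₁ σ₂ n m|) ^ (-2 : ℝ))) else 0) ≤
      C * ∑' n : Freq, ENNReal.ofReal (jb n ^ (r + (3 / 2 - 2 * B + 3 * δ))) := by
    intro σ₁ σ₂ h₁ h₂
    rw [← ENNReal.tsum_mul_left]
    refine ENNReal.tsum_le_tsum fun n => ?_
    have := mul_le_mul_right (hC σ₁ σ₂ h₁ h₂ n) (ENNReal.ofReal (jb n ^ r))
    rw [← ENNReal.tsum_mul_left, mul_left_comm, ← ENNReal.ofReal_mul (jb_rpow_pos _ _).le,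
      ← Real.rpow_add (jb_pos n)] at this
    refine le_trans (le_of_eq (tsum_congr fun m => ?_)) this
    split_ifs
    · rw [ENNReal.ofReal_mul (jb_rpow_pos _ _).le]
    · simp
  refine ⟨2 * C * (∑' n : Freq, ENNReal.ofReal (jb n ^ (r + (3 / 2 - 2 * B + 3 * δ)))).toNNReal,
    fun σ₁ σ₂ h₁ h₂ => ?_⟩
  rw [ENNReal.coe_mul, ENNReal.coe_toNNReal h0.ne]
  refine (tsum_pair_le fun k l => ENNReal.ofReal (jb (k + l) ^ r * jb k ^ (-B) * jb l ^ (-B) *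
        (1 + |jb (k + l) + σ₁ * jb k + σ₂ * jb l|) ^ (-2 : ℝ))).trans ?_
  refine (add_le_add ((le_of_eq ?_).trans (half σ₁ σ₂ h₁ h₂))
    ((le_of_eq ?_).trans (half σ₂ σ₁ h₂ h₁))).trans_eq ?_
  · refine tsum_congr fun n => tsum_congr fun m => ?_
    rw [add_sub_cancel, phase, mul_assoc, mul_assoc, mul_assoc]
  · refine tsum_congr fun n => tsum_congr fun m => ?_
    rw [sub_add_cancel, phase, add_right_comm, mul_assoc, mul_assoc, mul_left_comm (jb (n - m) ^ (-B)),
      mul_assoc]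
  · push_cast; ring

lemma tsum_pair_lt_top {B δ r : ℝ} (hδ : 0 < δ) (hB : 2 + δ ≤ 2 * B) (hB2 : B ≤ 2)
    (hr : r + (2 - 2 * B + δ) < -2) :
    ∑' p : Freq × Freq, ENNReal.ofReal (jb (p.1 + p.2) ^ r * jb p.1 ^ (-B) * jb p.2 ^ (-B)) < ∞ := by
  have h0 := tsum_jb_rpow_lt_top hr
  have h1 := tsum_jb_rpow_lt_top (show -(2 + δ) < -2 by linarith)
  have half : ∑' n : Freq, ∑' m : Freq, (if jb m ≤ jb (n - m) then ENNReal.ofReal (jb n ^ r *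
        (jb m ^ (-B) * jb (n - m) ^ (-B))) else 0) ≤
      ENNReal.ofReal (2 ^ (2 * B - 2 - δ)) *
      ((∑' n : Freq, ENNReal.ofReal (jb n ^ (r + (2 - 2 * B + δ)))) *
        ∑' m : Freq, ENNReal.ofReal (jb m ^ (-(2 + δ)))) := by
    rw [← ENNReal.tsum_mul_right, ← ENNReal.tsum_mul_left]
    refine ENNReal.tsum_le_tsum fun n => ?_
    rw [← mul_assoc, ← ENNReal.tsum_mul_left]
    refine ENNReal.tsum_le_tsum fun m => ?_
    split_ifs with h
    · rw [← ENNReal.ofReal_mul (by positivity), ← ENNReal.ofReal_mul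
        (mul_nonneg (by positivity) (jb_rpow_pos _ _).le)]
      refine ENNReal.ofReal_le_ofReal ?_
      have hA := jb_pos n
      have hM := jb_pos m
      have hD := jb_pos (n - m)
      have hAD := jb_le_of_le h
      have e1 : jb (n - m) ^ (-B) = jb (n - m) ^ (-(2 * B - 2 - δ)) * jb (n - m) ^ (-(2 - B + δ)) := by
        rw [← Real.rpow_add hD]; congr 1; ring
      have e2 : jb (n - m) ^ (-(2 * B - 2 - δ)) ≤ 2 ^ (2 * B - 2 - δ) * jb n ^ (2 - 2 * B + δ) := by
        calc _ ≤ (jb n / 2) ^ (-(2 * B - 2 - δ)) :=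
              Real.rpow_le_rpow_of_nonpos (by positivity) (by linarith) (by linarith)
          _ = _ := by
            rw [Real.div_rpow hA.le (by norm_num), Real.rpow_neg (by norm_num : (0:ℝ) ≤ 2),
              show -(2 * B - 2 - δ) = 2 - 2 * B + δ by ring]
            field_simp
      have e3 : jb (n - m) ^ (-(2 - B + δ)) ≤ jb m ^ (-(2 - B + δ)) :=
        Real.rpow_le_rpow_of_nonpos hM h (by linarith)
      have e4 : jb m ^ (-B) * jb m ^ (-(2 - B + δ)) = jb m ^ (-(2 + δ)) := by
        rw [← Real.rpow_add hM]; congr 1; ring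
      have e5 : jb n ^ r * jb n ^ (2 - 2 * B + δ) = jb n ^ (r + (2 - 2 * B + δ)) :=
        (Real.rpow_add hA _ _).symm
      calc _ ≤ jb n ^ r * (jb m ^ (-B) *
            ((2 ^ (2 * B - 2 - δ) * jb n ^ (2 - 2 * B + δ)) * jb m ^ (-(2 - B + δ)))) := by
            rw [e1]; gcongr
        _ = 2 ^ (2 * B - 2 - δ) * (jb n ^ r * jb n ^ (2 - 2 * B + δ)) *
            (jb m ^ (-B) * jb m ^ (-(2 - B + δ))) := by ring
        _ = _ := by rw [e4, e5]
    · exact zero_le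
  have hfin := ENNReal.mul_lt_top (ENNReal.ofReal_lt_top (r := (2 : ℝ) ^ (2 * B - 2 - δ)))
    (ENNReal.mul_lt_top h0 h1)
  refine (tsum_pair_le fun k l => ENNReal.ofReal (jb (k + l) ^ r * jb k ^ (-B) *
    jb l ^ (-B))).trans_lt (ENNReal.add_lt_top.2 ⟨?_, ?_⟩)
  · refine lt_of_eq_of_lt (tsum_congr fun n => tsum_congr fun m => ?_) (half.trans_lt hfin)
    rw [add_sub_cancel, mul_assoc]
  · refine lt_of_eq_of_lt (tsum_congr fun n => tsum_congr fun m => ?_) (half.trans_lt hfin)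
    rw [sub_add_cancel, mul_assoc, mul_comm (jb (n - m) ^ (-B))]

end LatticeSums

/-! ### Riemann–Stieltjes approximation of the stochastic convolution -/

section StepApproximation

/-- The grid points `jT/m`. -/
def grid (T : ℝ) (m : ℕ) (j : ℕ) : ℝ := T * j / m

lemma grid_zero (T : ℝ) (m : ℕ) : grid T m 0 = 0 := by simp [grid]

lemma grid_self (T : ℝ) {m : ℕ} (hm : 0 < m) : grid T m m = T := by
  unfold grid; field_simp

lemma grid_succ_sub (T : ℝ) (m j : ℕ) : grid T m (j + 1) - grid T m j = T / m := by
  unfold grid; push_cast; ring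

lemma grid_le_succ {T : ℝ} (hT : 0 ≤ T) (m j : ℕ) : grid T m j ≤ grid T m (j + 1) := by
  have := grid_succ_sub T m j
  have : 0 ≤ T / m := by positivity
  linarith

lemma grid_mem {T : ℝ} (hT : 0 ≤ T) {m j : ℕ} (hm : 0 < m) (hj : j ≤ m) :
    grid T m j ∈ Icc (0 : ℝ) T := by
  refine ⟨by unfold grid; positivity, ?_⟩
  unfold grid
  rw [div_le_iff₀ (by exact_mod_cast hm)]
  exact mul_le_mul_of_nonneg_left (by exact_mod_cast hj) hT

lemma norm_sum_step_sub_le {f G : ℝ → ℂ} {T e : ℝ} {m : ℕ} (hT : 0 ≤ T) (hm : 0 < m)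
    (hf : Continuous f) (hG : ∀ a b, IntervalIntegrable G volume a b) (hG1 : ∀ r, ‖G r‖ ≤ 1)
    (he : ∀ r ∈ Icc 0 T, ∀ r' ∈ Icc 0 T, |r - r'| ≤ T / m → ‖f r - f r'‖ ≤ e)
    {p : ℕ → ℝ} (hp : ∀ j, p j ∈ Icc (grid T m j) (grid T m (j + 1))) :
    ‖∑ j ∈ Finset.range m, f (p j) * (∫ r in grid T m j..grid T m (j + 1), G r) -
      ∫ r in (0 : ℝ)..T, f r * G r‖ ≤ e * T := by
  have hfG : ∀ a b, IntervalIntegrable (fun r => f r * G r) volume a b := fun a b =>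
    (hG a b).continuousOn_mul hf.continuousOn
  have hsum : ∫ r in (0 : ℝ)..T, f r * G r =
      ∑ j ∈ Finset.range m, ∫ r in grid T m j..grid T m (j + 1), f r * G r := by
    rw [intervalIntegral.sum_integral_adjacent_intervals fun j _ => hfG _ _, grid_zero,
      grid_self T hm]
  rw [hsum, ← Finset.sum_sub_distrib]
  have hterm : ∀ j ∈ Finset.range m, ‖f (p j) * (∫ r in grid T m j..grid T m (j + 1), G r) -
      ∫ r in grid T m j..grid T m (j + 1), f r * G r‖ ≤ e * (T / m) := by
    intro j hj
    rw [Finset.mem_range] at hj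
    have hle := grid_le_succ hT m j
    have h0 := grid_mem hT hm hj.le
    have h1 := grid_mem hT hm (Nat.succ_le_of_lt hj)
    have hd := grid_succ_sub T m j
    rw [← intervalIntegral.integral_const_mul, ← intervalIntegral.integral_sub
      ((hG _ _).const_mul _) (hfG _ _)]
    refine (intervalIntegral.norm_integral_le_of_norm_le_const (C := e) fun r hr => ?_).trans_eq ?_
    · rw [uIoc_of_le hle] at hr
      rw [← sub_mul, norm_mul]
      have hpj := hp j
      have : ‖f (p j) - f r‖ ≤ e := he _ ⟨h0.1.trans hpj.1, hpj.2.trans h1.2⟩ _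
        ⟨h0.1.trans hr.1.le, hr.2.trans h1.2⟩
        (by rw [abs_le]; constructor <;> linarith [hpj.1, hpj.2, hr.1, hr.2])
      calc _ ≤ e * 1 := mul_le_mul this (hG1 r) (norm_nonneg _) ((norm_nonneg _).trans this)
        _ = e := mul_one e
    · rw [hd, abs_of_nonneg (by positivity)]
  refine (norm_sum_le_of_le _ hterm).trans_eq ?_
  rw [Finset.sum_const, Finset.card_range, nsmul_eq_mul]
  field_simp

/-- The positive part of the wave kernel. -/
def sinPos (n : Freq) (t r : ℝ) : ℝ := Real.sin (max (t - r) 0 * jb n)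

lemma continuous_sinPos (n : Freq) : Continuous fun p : ℝ × ℝ => sinPos n p.1 p.2 := by
  unfold sinPos; fun_prop

lemma abs_sinPos_le (n : Freq) (t r : ℝ) : |sinPos n t r| ≤ 1 := Real.abs_sin_le_one _

lemma abs_sinPos_sub_le (n : Freq) (t r r' : ℝ) :
    |sinPos n t r - sinPos n t r'| ≤ jb n * |r - r'| := by
  unfold sinPos
  have h1 : ∀ x y : ℝ, |Real.sin x - Real.sin y| ≤ |x - y| := fun x y => by
    have := Real.lipschitzWith_sin.dist_le_mul x y
    simpa [Real.dist_eq] using this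
  refine (h1 _ _).trans ?_
  rw [← sub_mul, abs_mul, abs_of_pos (jb_pos n), mul_comm]
  refine mul_le_mul_of_nonneg_left ?_ (jb_pos n).le
  refine (abs_max_sub_max_le_abs _ _ _).trans_eq ?_
  rw [sub_sub_sub_cancel_left, abs_sub_comm]

/-- The derivative of `-sinPos n t / ⟨n⟩`. -/
def cosPos (n : Freq) (t r : ℝ) : ℝ := (Iio t).indicator (fun r => Real.cos ((t - r) * jb n)) r

lemma abs_cosPos_le (n : Freq) (t r : ℝ) : |cosPos n t r| ≤ 1 := by
  unfold cosPos
  by_cases h : r ∈ Iio t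
  · rw [indicator_of_mem h]; exact Real.abs_cos_le_one _
  · rw [indicator_of_notMem h]; simp

lemma measurable_cosPos (n : Freq) (t : ℝ) : Measurable (cosPos n t) :=
  (by fun_prop : Measurable fun r => Real.cos ((t - r) * jb n)).indicator measurableSet_Iio

lemma intervalIntegrable_cosPos (n : Freq) (t a b : ℝ) :
    IntervalIntegrable (cosPos n t) volume a b := by
  rw [intervalIntegrable_iff]
  exact Measure.integrableOn_of_bounded (M := 1) (by simp) (measurable_cosPos n t).aestronglyMeasurable
    (.of_forall fun r => abs_cosPos_le n t r)

lemma intervalIntegrable_ofReal_cosPos (n : Freq) (t a b : ℝ) :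
    IntervalIntegrable (fun r => (cosPos n t r : ℂ)) volume a b :=
  ⟨(intervalIntegrable_cosPos n t a b).1.ofReal, (intervalIntegrable_cosPos n t a b).2.ofReal⟩

lemma integral_cosPos (n : Freq) (t : ℝ) {a b : ℝ} (hab : a ≤ b) :
    ∫ r in a..b, -(jb n * cosPos n t r) = sinPos n t b - sinPos n t a := by
  refine intervalIntegral.integral_eq_sub_of_hasDeriv_right_of_le hab
    ((continuous_sinPos n).comp (by fun_prop : Continuous fun r => (t, r))).continuousOn
    (fun r _ => ?_) ((intervalIntegrable_cosPos n t a b).const_mul _).neg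
  by_cases h : r < t
  · have h1 : HasDerivAt (fun r => Real.sin ((t - r) * jb n)) (-(jb n * cosPos n t r)) r := by
      have h2 : HasDerivAt (fun r => (t - r) * jb n) (-1 * jb n) r :=
        ((hasDerivAt_id r).const_sub t).mul_const _
      convert h2.sin using 1
      rw [cosPos, indicator_of_mem (show r ∈ Iio t from h)]; ring
    refine (h1.congr_of_eventuallyEq ?_).hasDerivWithinAt
    filter_upwards [Iio_mem_nhds h] with r' hr'
    unfold sinPos
    rw [max_eq_left (by linarith [mem_Iio.1 hr'])]
  · push Not at h
    have h1 : HasDerivWithinAt (fun _ : ℝ => (0 : ℝ)) (-(jb n * cosPos n t r)) (Ioi r) r := by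
      rw [cosPos, indicator_of_notMem (by simpa using h)]
      simpa using hasDerivWithinAt_const r (Ioi r) (0 : ℝ)
    refine h1.congr (fun r' hr' => ?_) ?_
    · unfold sinPos
      rw [max_eq_right (by linarith [mem_Ioi.1 hr'])]; simp
    · unfold sinPos
      rw [max_eq_right (by linarith)]; simp

variable (α : ℝ) (n : Freq) (b : ℝ → ℂ)

/-- The stochastic convolution at frequency `n` along the path `b`. -/
def psi (t : ℝ) : ℂ := wienerInt (fun t' => Real.sin ((t - t') * jb n) / jb n ^ (1 - α)) b t

lemma psi_eq {b : ℝ → ℂ} (h0 : b 0 = 0) (t : ℝ) :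
    psi α n b t = ((jb n ^ α : ℝ) : ℂ) * ∫ r in (0 : ℝ)..t, (Real.cos ((t - r) * jb n) : ℂ) * b r := by
  have hd : ∀ r, deriv (fun t' => Real.sin ((t - t') * jb n) / jb n ^ (1 - α)) r =
      -(jb n ^ α * Real.cos ((t - r) * jb n)) := by
    intro r
    have h2 : HasDerivAt (fun r => (t - r) * jb n) (-1 * jb n) r :=
      ((hasDerivAt_id r).const_sub t).mul_const _
    rw [(h2.sin.div_const _).deriv, Real.rpow_sub (jb_pos n), Real.rpow_one]
    have := jb_pos n
    have := jb_rpow_pos n α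
    field_simp
  simp only [psi, wienerInt, hd, h0]
  rw [← intervalIntegral.integral_const_mul]
  simp only [sub_self, zero_mul, Real.sin_zero, zero_div, Complex.ofReal_zero, mul_zero, zero_sub]
  rw [← intervalIntegral.integral_neg]
  congr 1; funext r; push_cast; ring

lemma psi_eq_cosPos {b : ℝ → ℂ} (h0 : b 0 = 0) {t T : ℝ} (hb : Continuous b) (ht : t ∈ Icc 0 T) :
    psi α n b t = ((jb n ^ α : ℝ) : ℂ) * ∫ r in (0 : ℝ)..T, b r * (cosPos n t r : ℂ) := by
  rw [psi_eq α n h0]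
  congr 1
  have hint : ∀ x y, IntervalIntegrable (fun r => b r * (cosPos n t r : ℂ)) volume x y := fun x y =>
    (intervalIntegrable_ofReal_cosPos n t x y).continuousOn_mul hb.continuousOn
  rw [← intervalIntegral.integral_add_adjacent_intervals (hint 0 t) (hint t T)]
  have e2 : ∫ r in t..T, b r * (cosPos n t r : ℂ) = 0 := by
    refine intervalIntegral.integral_zero_ae (.of_forall fun r hr => ?_)
    rw [uIoc_of_le ht.2] at hr
    rw [cosPos, indicator_of_notMem (by simpa using hr.1.le)]; simp
  rw [e2, add_zero, intervalIntegral.integral_of_le ht.1, intervalIntegral.integral_of_le ht.1,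
    integral_Ioc_eq_integral_Ioo, integral_Ioc_eq_integral_Ioo]
  refine setIntegral_congr_fun measurableSet_Ioo fun r hr => ?_
  simp only [cosPos]
  rw [indicator_of_mem (show r ∈ Iio t from hr.2), mul_comm]

/-- The approximation of `psi` by increments of the path. -/
def psiStep (T : ℝ) (m : ℕ) (z : ℕ → ℂ) (t : ℝ) : ℂ :=
  ((jb n ^ (α - 1) : ℝ) : ℂ) * ∑ j ∈ Finset.range m, z j * (sinPos n t (grid T m (j + 1)) : ℂ)

/-- The increments of a path along the grid. -/
def incr (T : ℝ) (m : ℕ) (j : ℕ) : ℂ := b (grid T m (j + 1)) - b (grid T m j)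

lemma norm_psiStep_sub_psi_le {b : ℝ → ℂ} (hb : Continuous b) (h0 : b 0 = 0) {T e : ℝ} {m : ℕ}
    (hT : 0 ≤ T) (hm : 0 < m)
    (he : ∀ r ∈ Icc 0 T, ∀ r' ∈ Icc 0 T, |r - r'| ≤ T / m → ‖b r - b r'‖ ≤ e) {t : ℝ}
    (ht : t ∈ Icc 0 T) :
    ‖psiStep α n T m (incr b T m) t - psi α n b t‖ ≤ jb n ^ α * (e * T) := by
  have hG : ∀ x y, IntervalIntegrable (fun r => (cosPos n t r : ℂ)) volume x y := fun x y =>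
    intervalIntegrable_ofReal_cosPos n t x y
  have key := norm_sum_step_sub_le (G := fun r => (cosPos n t r : ℂ)) hT hm hb hG
    (fun r => by simpa using abs_cosPos_le n t r) he (p := grid T m)
    (fun j => ⟨le_rfl, grid_le_succ hT m j⟩)
  have habel : ∑ j ∈ Finset.range m, incr b T m j * (sinPos n t (grid T m (j + 1)) : ℂ) =
      jb n * ∑ j ∈ Finset.range m, b (grid T m j) *
        ∫ r in grid T m j..grid T m (j + 1), (cosPos n t r : ℂ) := by
    have h1 : ∀ j, incr b T m j * (sinPos n t (grid T m (j + 1)) : ℂ) -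
        jb n * (b (grid T m j) * ∫ r in grid T m j..grid T m (j + 1), (cosPos n t r : ℂ)) =
        b (grid T m (j + 1)) * (sinPos n t (grid T m (j + 1)) : ℂ) -
          b (grid T m j) * (sinPos n t (grid T m j) : ℂ) := by
      intro j
      have h2 := integral_cosPos n t (grid_le_succ hT m j)
      rw [intervalIntegral.integral_neg, intervalIntegral.integral_const_mul] at h2
      rw [intervalIntegral.integral_ofReal]
      have h3 : (sinPos n t (grid T m j) : ℂ) = sinPos n t (grid T m (j + 1)) +
          jb n * ((∫ r in grid T m j..grid T m (j + 1), cosPos n t r : ℝ) : ℂ) := by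
        have : sinPos n t (grid T m j) = sinPos n t (grid T m (j + 1)) +
          jb n * ∫ r in grid T m j..grid T m (j + 1), cosPos n t r := by linarith
        rw [this]; push_cast; rfl
      rw [h3, incr]; ring
    have h4 := Finset.sum_range_sub (fun j => b (grid T m j) * (sinPos n t (grid T m j) : ℂ)) m
    rw [grid_zero, h0, zero_mul, sub_zero, grid_self T hm] at h4
    have h5 : sinPos n t T = 0 := by
      unfold sinPos; rw [max_eq_right (by linarith [ht.2])]; simp
    rw [h5, Complex.ofReal_zero, mul_zero] at h4
    rw [← sub_eq_zero, Finset.mul_sum, ← Finset.sum_sub_distrib, Finset.sum_congr rfl fun j _ => h1 j,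
      h4]
  have hpow : ((jb n ^ (α - 1) : ℝ) : ℂ) * jb n = ((jb n ^ α : ℝ) : ℂ) := by
    rw [← Complex.ofReal_mul, Real.rpow_sub_one (jb_pos n).ne', div_mul_cancel₀ _ (jb_pos n).ne']
  rw [psiStep, habel, ← mul_assoc, hpow, psi_eq_cosPos α n h0 hb ht, ← mul_sub, norm_mul,
    Complex.norm_real, Real.norm_of_nonneg (jb_rpow_pos n α).le]
  exact mul_le_mul_of_nonneg_left key (jb_rpow_pos n α).le

lemma exists_modulus {b : ℝ → ℂ} (hb : Continuous b) {T : ℝ} (hT : 0 ≤ T) : ∃ e : ℕ → ℝ,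
    Tendsto e atTop (𝓝 0) ∧ ∀ m : ℕ, 0 < m → ∀ r ∈ Icc 0 T, ∀ r' ∈ Icc 0 T,
      |r - r'| ≤ T / m → ‖b r - b r'‖ ≤ e m := by
  have hu := (isCompact_Icc (a := (0 : ℝ)) (b := T)).uniformContinuousOn_of_continuous hb.continuousOn
  obtain ⟨C, hC⟩ := (isCompact_Icc (a := (0 : ℝ)) (b := T)).exists_bound_of_continuousOn hb.continuousOn
  set V : ℕ → Set ℝ := fun m => {x | ∃ r ∈ Icc 0 T, ∃ r' ∈ Icc 0 T, |r - r'| ≤ T / m ∧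
    x = ‖b r - b r'‖} with hV
  have hbdd : ∀ m, BddAbove (V m) := fun m => by
    refine ⟨C + C, ?_⟩
    rintro x ⟨r, hr, r', hr', -, rfl⟩
    exact (norm_sub_le _ _).trans (add_le_add (hC r hr) (hC r' hr'))
  refine ⟨fun m => sSup (V m), ?_, fun m hm r hr r' hr' h => le_csSup (hbdd m) ⟨r, hr, r', hr', h, rfl⟩⟩
  rw [Metric.tendsto_atTop]
  intro ε hε
  obtain ⟨δ, hδ, h⟩ := Metric.uniformContinuousOn_iff.1 hu (ε / 2) (by linarith)
  obtain ⟨M, hM⟩ := exists_nat_gt (T / δ)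
  refine ⟨M + 1, fun m hm => ?_⟩
  have hm0 : (0 : ℝ) < m := by exact_mod_cast (by omega : 0 < m)
  have hlt : T / m < δ := by
    rw [div_lt_iff₀ hm0]
    rw [div_lt_iff₀ hδ] at hM
    have : (M : ℝ) ≤ m := by exact_mod_cast (by omega : M ≤ m)
    nlinarith
  rw [Real.dist_eq, sub_zero, abs_of_nonneg (Real.sSup_nonneg fun x hx => by
    obtain ⟨r, _, r', _, _, rfl⟩ := hx; exact norm_nonneg _)]
  refine lt_of_le_of_lt (csSup_le ⟨_, 0, ⟨le_rfl, hT⟩, 0, ⟨le_rfl, hT⟩, by simp; positivity, rfl⟩ ?_)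
    (by linarith : ε / 2 < ε)
  rintro x ⟨r, hr, r', hr', hrr, rfl⟩
  have := h r hr r' hr' (by rw [Real.dist_eq]; exact hrr.trans_lt hlt)
  rw [dist_eq_norm] at this
  exact this.le

/-- The variance `E|Ψ̂(n,t)|²`. -/
def psiVar (t : ℝ) : ℝ := ∫ r in (0 : ℝ)..t, (Real.sin ((t - r) * jb n) / jb n ^ (1 - α)) ^ 2

/-- The variance of `psiStep`. -/
def psiVarStep (T : ℝ) (m : ℕ) (t : ℝ) : ℝ :=
  jb n ^ (2 * α - 2) * ((T / m) * ∑ j ∈ Finset.range m, sinPos n t (grid T m (j + 1)) ^ 2)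

lemma abs_psiVarStep_sub_le {T : ℝ} {m : ℕ} (hT : 0 ≤ T) (hm : 0 < m) {t : ℝ} (ht : t ∈ Icc 0 T) :
    |psiVarStep α n T m t - psiVar α n t| ≤ jb n ^ (2 * α - 2) * (2 * jb n * (T / m) * T) := by
  have hc : Continuous fun r => ((sinPos n t r ^ 2 : ℝ) : ℂ) := by
    have := (continuous_sinPos n).comp (by fun_prop : Continuous fun r => (t, r))
    exact Complex.continuous_ofReal.comp (this.pow 2)
  have key := norm_sum_step_sub_le (f := fun r => ((sinPos n t r ^ 2 : ℝ) : ℂ)) (G := fun _ => 1)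
    (e := 2 * jb n * (T / m)) hT hm hc (fun _ _ => intervalIntegrable_const) (fun r => by simp)
    (fun r _ r' _ h => ?_) (p := fun j => grid T m (j + 1)) (fun j => ⟨grid_le_succ hT m j, le_rfl⟩)
  · have e1 : psiVar α n t = jb n ^ (2 * α - 2) * ∫ r in (0 : ℝ)..T, sinPos n t r ^ 2 := by
      have hcr : Continuous fun r => sinPos n t r ^ 2 :=
        ((continuous_sinPos n).comp (by fun_prop : Continuous fun r => (t, r))).pow 2
      rw [← intervalIntegral.integral_add_adjacent_intervals (hcr.intervalIntegrable 0 t)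
        (hcr.intervalIntegrable t T)]
      have e2 : ∫ r in t..T, sinPos n t r ^ 2 = 0 := by
        refine intervalIntegral.integral_zero_ae (.of_forall fun r hr => ?_)
        rw [uIoc_of_le ht.2] at hr
        unfold sinPos
        rw [max_eq_right (by linarith [hr.1])]; simp
      rw [e2, add_zero, ← intervalIntegral.integral_const_mul, psiVar]
      refine intervalIntegral.integral_congr fun r hr => ?_
      rw [uIcc_of_le ht.1] at hr
      simp only [sinPos]
      rw [max_eq_left (by linarith [hr.2]), div_pow, ← Real.rpow_natCast (jb n ^ (1 - α)),
        ← Real.rpow_mul (jb_pos n).le, div_eq_mul_inv, ← Real.rpow_neg (jb_pos n).le, mul_comm]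
      congr 2; push_cast; ring
    rw [e1, psiVarStep, ← mul_sub, abs_mul, abs_of_pos (jb_rpow_pos _ _)]
    refine mul_le_mul_of_nonneg_left ?_ (jb_rpow_pos _ _).le
    rw [← Real.norm_eq_abs, ← Complex.norm_real]
    refine le_trans (le_of_eq ?_) key
    congr 1
    simp only [intervalIntegral.integral_const, grid_succ_sub, mul_one]
    rw [Complex.ofReal_sub, ← intervalIntegral.integral_ofReal, Complex.ofReal_mul,
      Complex.ofReal_sum, Finset.mul_sum]
    congr 1
    refine Finset.sum_congr rfl fun j _ => ?_
    simp; ring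
  · rw [← Complex.ofReal_sub, Complex.norm_real, Real.norm_eq_abs]
    have e1 : sinPos n t r ^ 2 - sinPos n t r' ^ 2 =
        (sinPos n t r + sinPos n t r') * (sinPos n t r - sinPos n t r') := by ring
    rw [e1, abs_mul, mul_assoc]
    have h1 := abs_sinPos_le n t r
    have h2 := abs_sinPos_le n t r'
    refine mul_le_mul ((abs_add_le _ _).trans (by linarith)) ((abs_sinPos_sub_le n t r r').trans ?_)
      (abs_nonneg _) (by norm_num)
    exact mul_le_mul_of_nonneg_left h (jb_pos n).le

end StepApproximation

/-! ### The noise -/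

section Noise

variable {Ω : Type*} [MeasurableSpace Ω]

/-- A version of the noise with continuous paths, described by its Gaussian laws. -/
structure IsNoise (P : Measure Ω) (b : Freq → ℝ → Ω → ℂ) : Prop where
  meas : ∀ n t, Measurable (b n t)
  cont : ∀ n ω, Continuous fun t => b n t ω
  zero : ∀ n ω, b n 0 ω = 0
  gauss : ∀ (S : Finset Freq) (M : ℕ) (τ : Fin M → ℝ),
    HasGaussianLaw (fun ω (a : S × Fin M) => b a.1 (τ a.2) ω) P
  mean : ∀ n t, ∫ ω, b n t ω ∂P = 0
  cov : ∀ k l s t, 0 ≤ s → 0 ≤ t →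
    ∫ ω, b k s ω * b l t ω ∂P = if k + l = 0 then ((min s t : ℝ) : ℂ) else 0
  conj : ∀ n t ω, b (-n) t ω = (starRingEnd ℂ) (b n t ω)

/-- The index type of the underlying real processes. -/
abbrev RealIdx : Type := Option (PosFreq × Bool)

lemma freq_cases (n : Freq) : n = 0 ∨ (∃ p : PosFreq, n = p.1) ∨ ∃ p : PosFreq, n = -p.1 := by
  obtain ⟨a, b⟩ := n
  rcases lt_trichotomy a 0 with h | h | h
  · exact Or.inr (Or.inr ⟨⟨(-a, -b), Or.inl (by simpa using h)⟩, by simp⟩)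
  · subst h
    rcases lt_trichotomy b 0 with h | h | h
    · exact Or.inr (Or.inr ⟨⟨(0, -b), Or.inr ⟨rfl, by simpa using h⟩⟩, by simp⟩)
    · exact Or.inl (by rw [h]; rfl)
    · exact Or.inr (Or.inl ⟨⟨(0, b), Or.inr ⟨rfl, h⟩⟩, rfl⟩)
  · exact Or.inr (Or.inl ⟨⟨(a, b), Or.inl h⟩, rfl⟩)

lemma PosFreq.add_ne_zero (p q : PosFreq) : p.1 + q.1 ≠ 0 := by
  obtain ⟨⟨a, b⟩, h⟩ := p
  obtain ⟨⟨c, d⟩, h'⟩ := q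
  simp only [ne_eq, Prod.mk_add_mk, Prod.mk_eq_zero, not_and]
  simp only at h h'
  omega

lemma PosFreq.ne_zero (p : PosFreq) : p.1 ≠ 0 := by
  obtain ⟨⟨a, b⟩, h⟩ := p
  simp only [ne_eq, Prod.mk_eq_zero, not_and]
  simp only at h
  omega

/-- `β_n` in terms of the underlying real processes. -/
structure NoiseRep (n : Freq) where
  i : RealIdx
  j : RealIdx
  c : ℂ
  d : ℂ
  spec : (n = 0 ∧ i = none ∧ j = none ∧ c = 1 ∧ d = 0) ∨
    (∃ p : PosFreq, n = p.1 ∧ i = some (p, false) ∧ j = some (p, true) ∧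
      c = ((Real.sqrt 2)⁻¹ : ℝ) ∧ d = ((Real.sqrt 2)⁻¹ : ℝ) * Complex.I) ∨
    ∃ p : PosFreq, n = -p.1 ∧ i = some (p, false) ∧ j = some (p, true) ∧
      c = ((Real.sqrt 2)⁻¹ : ℝ) ∧ d = -(((Real.sqrt 2)⁻¹ : ℝ) * Complex.I)

lemma nonempty_noiseRep (n : Freq) : Nonempty (NoiseRep n) := by
  rcases freq_cases n with h | ⟨p, h⟩ | ⟨p, h⟩
  · exact ⟨⟨none, none, 1, 0, Or.inl ⟨h, rfl, rfl, rfl, rfl⟩⟩⟩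
  · exact ⟨⟨_, _, _, _, Or.inr (Or.inl ⟨p, h, rfl, rfl, rfl, rfl⟩)⟩⟩
  · exact ⟨⟨_, _, _, _, Or.inr (Or.inr ⟨p, h, rfl, rfl, rfl, rfl⟩)⟩⟩

/-- A choice of representation. -/
def noiseRep (n : Freq) : NoiseRep n := (nonempty_noiseRep n).some

lemma NoiseRep.eq {Ω : Type*} {n : Freq} (R : NoiseRep n) {β : Freq → ℝ≥0 → Ω → ℂ} {ω : Ω}
    (h : ∀ n t, β (-n) t ω = (starRingEnd ℂ) (β n t ω)) (t : ℝ≥0) :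
    β n t ω = R.c * (realProc β R.i t ω : ℂ) + R.d * (realProc β R.j t ω : ℂ) := by
  have h2 : ((Real.sqrt 2)⁻¹ : ℂ) * (Real.sqrt 2 : ℂ) = 1 := by
    rw [← Complex.ofReal_inv, ← Complex.ofReal_mul, inv_mul_cancel₀ (by positivity),
      Complex.ofReal_one]
  obtain ⟨i, j, c, d, spec⟩ := R
  rcases spec with ⟨rfl, rfl, rfl, rfl, rfl⟩ | ⟨p, rfl, rfl, rfl, rfl, rfl⟩ |
    ⟨p, rfl, rfl, rfl, rfl, rfl⟩
  · have h1 := h 0 t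
    rw [neg_zero] at h1
    simp only [realProc, one_mul, zero_mul, add_zero]
    exact (Complex.conj_eq_iff_re.1 h1.symm).symm
  · simp only [realProc, Complex.ofReal_mul, Complex.ofReal_inv]
    calc _ = ((β p.1 t ω).re : ℂ) + (β p.1 t ω).im * Complex.I := (Complex.re_add_im _).symm
      _ = (((Real.sqrt 2)⁻¹ : ℂ) * (Real.sqrt 2 : ℂ)) * ((β p.1 t ω).re : ℂ) +
          (((Real.sqrt 2)⁻¹ : ℂ) * (Real.sqrt 2 : ℂ)) * ((β p.1 t ω).im * Complex.I) := by
          rw [h2, one_mul, one_mul]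
      _ = _ := by ring
  · rw [h]
    simp only [realProc, Complex.ofReal_mul, Complex.ofReal_inv]
    calc _ = ((β p.1 t ω).re : ℂ) - (β p.1 t ω).im * Complex.I := by
          apply Complex.ext <;> simp
      _ = (((Real.sqrt 2)⁻¹ : ℂ) * (Real.sqrt 2 : ℂ)) * ((β p.1 t ω).re : ℂ) -
          (((Real.sqrt 2)⁻¹ : ℂ) * (Real.sqrt 2 : ℂ)) * ((β p.1 t ω).im * Complex.I) := by
          rw [h2, one_mul, one_mul]
      _ = _ := by ring

variable {P : Measure Ω} {β : Freq → ℝ≥0 → Ω → ℂ}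

namespace IsCylindricalWiener

lemma ae_regular (hβ : IsCylindricalWiener P β) : ∀ᵐ ω ∂P,
    (∀ n, Continuous fun t => β n t ω) ∧ (∀ n, β n 0 ω = 0) ∧
      ∀ n t, β (-n) t ω = (starRingEnd ℂ) (β n t ω) := by
  have h1 : ∀ᵐ ω ∂P, ∀ i : RealIdx, Continuous fun t => realProc β i t ω :=
    ae_all_iff.2 fun i => (hβ.brownian i).cont
  have h2 : ∀ᵐ ω ∂P, ∀ i : RealIdx, realProc β i 0 ω = 0 :=
    ae_all_iff.2 fun i => (hβ.brownian i).eval_zero_ae_eq_zero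
  filter_upwards [h1, h2, hβ.conj_symm] with ω g1 g2 g3
  refine ⟨fun n => ?_, fun n => ?_, g3⟩
  · simp_rw [(noiseRep n).eq g3]
    exact (continuous_const.mul (Complex.continuous_ofReal.comp (g1 _))).add
      (continuous_const.mul (Complex.continuous_ofReal.comp (g1 _)))
  · rw [(noiseRep n).eq g3, g2, g2]; simp

lemma memLp_realProc (hβ : IsCylindricalWiener P β) (i : RealIdx) (t : ℝ≥0) :
    MemLp (realProc β i t) 2 P :=
  ((hβ.brownian i).hasLaw_eval t).hasGaussianLaw.memLp_two

lemma isProbabilityMeasure (hβ : IsCylindricalWiener P β) : IsProbabilityMeasure P :=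
  ((hβ.brownian none).hasLaw_eval 0).hasGaussianLaw.isProbabilityMeasure

lemma integral_realProc_mul (hβ : IsCylindricalWiener P β) (i j : RealIdx) (s t : ℝ≥0) :
    ∫ ω, realProc β i s ω * realProc β j t ω ∂P = if i = j then ((min s t : ℝ≥0) : ℝ) else 0 := by
  have := hβ.isProbabilityMeasure
  have hi := hβ.memLp_realProc i s
  have hj := hβ.memLp_realProc j t
  have h0 := (hβ.brownian i).integral_eval s
  split_ifs with h
  · subst h
    have h1 := (hβ.brownian i).covariance_eval s t
    rw [covariance_eq_sub hi hj, h0, zero_mul, sub_zero] at h1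
    exact h1
  · have h1 : IndepFun (realProc β i s) (realProc β j t) P :=
      (hβ.indep.indepFun h).comp (measurable_pi_apply s) (measurable_pi_apply t)
    rw [h1.integral_fun_mul_eq_mul_integral hi.aestronglyMeasurable hj.aestronglyMeasurable, h0,
      zero_mul]

lemma hasGaussianLaw_realProc (hβ : IsCylindricalWiener P β) (I : Finset RealIdx) (M : ℕ)
    (τ : Fin M → ℝ≥0) :
    HasGaussianLaw (fun ω (i : I) (a : Fin M) => realProc β i (τ a) ω) P := by
  have := hβ.isProbabilityMeasure
  refine iIndepFun.hasGaussianLaw (X := fun (i : I) ω (a : Fin M) => realProc β i (τ a) ω)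
    (fun i => ?_) ?_
  · have h1 := ((hβ.brownian i).hasLaw (Finset.univ.image τ)).hasGaussianLaw
    let L : ({t // t ∈ Finset.univ.image τ} → ℝ) →L[ℝ] (Fin M → ℝ) :=
      ContinuousLinearMap.pi fun a =>
        ContinuousLinearMap.proj ⟨τ a, Finset.mem_image_of_mem τ (Finset.mem_univ a)⟩
    exact h1.map_fun L
  · have h1 := hβ.indep.precomp (g := fun i : I => i.1) Subtype.val_injective
    exact h1.comp (fun _ (f : ℝ≥0 → ℝ) (a : Fin M) => f (τ a))
      fun _ => measurable_pi_lambda _ fun a => measurable_pi_apply (τ a)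

lemma hasGaussianLaw (hβ : IsCylindricalWiener P β) (S : Finset Freq) (M : ℕ) (τ : Fin M → ℝ≥0) :
    HasGaussianLaw (fun ω (a : S × Fin M) => β a.1 (τ a.2) ω) P := by
  classical
  set I : Finset RealIdx := S.image (fun n => (noiseRep n).i) ∪ S.image (fun n => (noiseRep n).j)
  have hi : ∀ n : S, (noiseRep n.1).i ∈ I := fun n =>
    Finset.mem_union_left _ (Finset.mem_image_of_mem _ n.2)
  have hj : ∀ n : S, (noiseRep n.1).j ∈ I := fun n =>
    Finset.mem_union_right _ (Finset.mem_image_of_mem _ n.2)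
  let pr : I → Fin M → (I → Fin M → ℝ) →L[ℝ] ℝ := fun i a =>
    (ContinuousLinearMap.proj (R := ℝ) (φ := fun _ : Fin M => ℝ) a).comp
      (ContinuousLinearMap.proj (R := ℝ) (φ := fun _ : I => Fin M → ℝ) i)
  let L : (I → Fin M → ℝ) →L[ℝ] (S × Fin M → ℂ) := ContinuousLinearMap.pi fun a =>
    ((ContinuousLinearMap.mul ℝ ℂ (noiseRep a.1.1).c).comp Complex.ofRealCLM).comp
      (pr ⟨_, hi a.1⟩ a.2) +
    ((ContinuousLinearMap.mul ℝ ℂ (noiseRep a.1.1).d).comp Complex.ofRealCLM).comp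
      (pr ⟨_, hj a.1⟩ a.2)
  refine ((hβ.hasGaussianLaw_realProc I M τ).map_fun L).congr ?_
  filter_upwards [hβ.conj_symm] with ω hω
  funext a
  rw [(noiseRep a.1.1).eq hω]
  simp [L, pr]

lemma integral_eq_zero (hβ : IsCylindricalWiener P β) (n : Freq) (t : ℝ≥0) :
    ∫ ω, β n t ω ∂P = 0 := by
  have := hβ.isProbabilityMeasure
  have hint : ∀ i, Integrable (fun ω => (realProc β i t ω : ℂ)) P := fun i =>
    ((hβ.memLp_realProc i t).integrable one_le_two).ofReal
  have h0 : ∀ i, ∫ ω, (realProc β i t ω : ℂ) ∂P = 0 := fun i => by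
    rw [integral_complex_ofReal, (hβ.brownian i).integral_eval t, Complex.ofReal_zero]
  rw [integral_congr_ae (hβ.conj_symm.mono fun ω hω => (noiseRep n).eq hω t),
    integral_add ((hint _).const_mul _) ((hint _).const_mul _), integral_const_mul,
    integral_const_mul, h0, h0]
  simp

lemma integral_mul (hβ : IsCylindricalWiener P β) (k l : Freq) (s t : ℝ≥0) :
    ∫ ω, β k s ω * β l t ω ∂P = if k + l = 0 then (((min s t : ℝ≥0) : ℝ) : ℂ) else 0 := by
  have := hβ.isProbabilityMeasure
  have hint : ∀ i j, Integrable (fun ω => (realProc β i s ω : ℂ) * (realProc β j t ω : ℂ)) P :=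
    fun i j => by
      have := ((hβ.memLp_realProc i s).integrable_mul (hβ.memLp_realProc j t)).ofReal (𝕜 := ℂ)
      simpa using this
  have hE : ∀ i j, ∫ ω, (realProc β i s ω : ℂ) * (realProc β j t ω : ℂ) ∂P =
      if i = j then (((min s t : ℝ≥0) : ℝ) : ℂ) else 0 := fun i j => by
    have := hβ.integral_realProc_mul i j s t
    simp_rw [← Complex.ofReal_mul]
    rw [integral_complex_ofReal, this]
    split_ifs <;> simp
  have hb : ∀ (i j i' j' : RealIdx) (c d c' d' : ℂ),
      ∫ ω, (c * (realProc β i s ω : ℂ) + d * (realProc β j s ω : ℂ)) *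
        (c' * (realProc β i' t ω : ℂ) + d' * (realProc β j' t ω : ℂ)) ∂P =
      (c * c' * (if i = i' then 1 else 0) + c * d' * (if i = j' then 1 else 0) +
        d * c' * (if j = i' then 1 else 0) + d * d' * (if j = j' then 1 else 0)) *
        (((min s t : ℝ≥0) : ℝ) : ℂ) := by
    intro i j i' j' c d c' d'
    have e : ∀ ω, (c * (realProc β i s ω : ℂ) + d * (realProc β j s ω : ℂ)) *
        (c' * (realProc β i' t ω : ℂ) + d' * (realProc β j' t ω : ℂ)) =
        c * c' * ((realProc β i s ω : ℂ) * (realProc β i' t ω : ℂ)) +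
        c * d' * ((realProc β i s ω : ℂ) * (realProc β j' t ω : ℂ)) +
        d * c' * ((realProc β j s ω : ℂ) * (realProc β i' t ω : ℂ)) +
        d * d' * ((realProc β j s ω : ℂ) * (realProc β j' t ω : ℂ)) := fun ω => by ring
    simp_rw [e]
    rw [integral_add, integral_add, integral_add]
    · simp_rw [integral_const_mul, hE]
      split_ifs <;> ring
    all_goals first
      | exact (hint _ _).const_mul _
      | exact ((hint _ _).const_mul _).add ((hint _ _).const_mul _)
      | exact (((hint _ _).const_mul _).add ((hint _ _).const_mul _)).add ((hint _ _).const_mul _)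
  have hae := hβ.conj_symm
  rcases hk : noiseRep k with ⟨i, j, c, d, hr⟩
  rcases hl : noiseRep l with ⟨i', j', c', d', hr'⟩
  have e1 : ∫ ω, β k s ω * β l t ω ∂P = ∫ ω, (c * (realProc β i s ω : ℂ) +
      d * (realProc β j s ω : ℂ)) * (c' * (realProc β i' t ω : ℂ) + d' * (realProc β j' t ω : ℂ)) ∂P := by
    refine integral_congr_ae (hae.mono fun ω hω => ?_)
    simp only
    rw [(noiseRep k).eq hω s, (noiseRep l).eq hω t, hk, hl]
  rw [e1, hb]
  have h2 : ((Real.sqrt 2 : ℂ))⁻¹ * ((Real.sqrt 2 : ℂ))⁻¹ = 1 / 2 := by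
    rw [← mul_inv, ← Complex.ofReal_mul, Real.mul_self_sqrt (by norm_num)]; norm_num
  have h3 : (Real.sqrt 2 : ℂ)⁻¹ * Complex.I * ((Real.sqrt 2 : ℂ)⁻¹ * Complex.I) = -(1 / 2) := by
    rw [mul_mul_mul_comm, h2, Complex.I_mul_I]; ring
  clear hk hl e1 hb
  rcases hr with ⟨rfl, rfl, rfl, rfl, rfl⟩ | ⟨p, rfl, rfl, rfl, rfl, rfl⟩ |
      ⟨p, rfl, rfl, rfl, rfl, rfl⟩ <;>
    rcases hr' with ⟨rfl, rfl, rfl, rfl, rfl⟩ | ⟨q, rfl, rfl, rfl, rfl, rfl⟩ |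
      ⟨q, rfl, rfl, rfl, rfl, rfl⟩
  · simp
  · simp [q.ne_zero]
  · simp [q.ne_zero]
  · simp [p.ne_zero]
  · simp only [PosFreq.add_ne_zero p q, if_false]
    by_cases hpq : p = q
    · simp [hpq, h2, h3]
    · simp [hpq]
  · have e : p.1 + -q.1 = 0 ↔ p = q := by rw [add_neg_eq_zero, Subtype.ext_iff]
    rw [if_congr e rfl rfl]
    by_cases hpq : p = q
    · simp [hpq, h2, h3]; norm_num
    · simp [hpq]
  · simp [p.ne_zero]
  · have e : -p.1 + q.1 = 0 ↔ p = q := by rw [neg_add_eq_zero, Subtype.ext_iff]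
    rw [if_congr e rfl rfl]
    by_cases hpq : p = q
    · simp [hpq, h2, h3]; norm_num
    · simp [hpq]
  · have e : -p.1 + -q.1 ≠ 0 := by
      rw [← neg_add]; exact neg_ne_zero.2 (PosFreq.add_ne_zero p q)
    simp only [e, if_false]
    by_cases hpq : p = q
    · simp [hpq, h2, h3]
    · simp [hpq]

/-- A continuous version of the noise, obtained by discarding an event of probability zero. -/
lemma exists_isNoise (hβ : IsCylindricalWiener P β) : ∃ Ω₀ : Set Ω, MeasurableSet Ω₀ ∧ P Ω₀ᶜ = 0 ∧
    IsNoise P (fun n t => Ω₀.indicator (β n t.toNNReal)) := by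
  obtain ⟨N, hN, hNm, hN0⟩ := exists_measurable_superset_of_null (ae_iff.1 hβ.ae_regular)
  have hgood : ∀ ω ∈ Nᶜ, (∀ n, Continuous fun t => β n t ω) ∧ (∀ n, β n 0 ω = 0) ∧
      ∀ n t, β (-n) t ω = (starRingEnd ℂ) (β n t ω) := fun ω hω => by
    by_contra h
    exact hω (hN h)
  have hae : ∀ᵐ ω ∂P, ω ∈ Nᶜ := by rw [ae_iff]; simpa using hN0
  have hae' : ∀ n (t : ℝ≥0), Nᶜ.indicator (β n t) =ᵐ[P] β n t := fun n t => by
    filter_upwards [hae] with ω hω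
    rw [indicator_of_mem hω]
  refine ⟨Nᶜ, hNm.compl, by simpa using hN0, ?_⟩
  refine ⟨fun n t => (hβ.measurable n _).indicator hNm.compl, fun n ω => ?_, fun n ω => ?_,
    fun S M τ => ?_, fun n t => ?_, fun k l s t hs ht => ?_, fun n t ω => ?_⟩
  · by_cases h : ω ∈ Nᶜ
    · simp only [indicator_of_mem h]
      exact ((hgood ω h).1 n).comp continuous_real_toNNReal
    · simp only [indicator_of_notMem h]
      exact continuous_const
  · by_cases h : ω ∈ Nᶜ
    · simp only [indicator_of_mem h, Real.toNNReal_zero]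
      exact (hgood ω h).2.1 n
    · simp only [indicator_of_notMem h]
  · refine (hβ.hasGaussianLaw S M fun a => (τ a).toNNReal).congr ?_
    filter_upwards [hae] with ω hω
    funext a
    rw [indicator_of_mem hω]
  · rw [integral_congr_ae (hae' n _), hβ.integral_eq_zero]
  · refine (integral_congr_ae (g := fun ω => β k s.toNNReal ω * β l t.toNNReal ω)
      ((hae' k _).mul (hae' l _))).trans ?_
    rw [hβ.integral_mul, NNReal.coe_min, Real.coe_toNNReal _ hs, Real.coe_toNNReal _ ht]
  · by_cases h : ω ∈ Nᶜ
    · simp only [indicator_of_mem h]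
      exact (hgood ω h).2.2 n _
    · simp only [indicator_of_notMem h, map_zero]

end IsCylindricalWiener

namespace IsNoise

variable {b : Freq → ℝ → Ω → ℂ}

/-- The vector of increments along a grid. -/
def incrVec (b : Freq → ℝ → Ω → ℂ) (S : Finset Freq) (T : ℝ) (m : ℕ) (ω : Ω) (a : S × Fin m) : ℂ :=
  incr (fun t => b a.1 t ω) T m a.2

lemma measurable_incrVec (hb : IsNoise P b) (S : Finset Freq) (T : ℝ) (m : ℕ) :
    Measurable (incrVec b S T m) :=
  measurable_pi_lambda _ fun _ => (hb.meas _ _).sub (hb.meas _ _)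

lemma hasGaussianLaw_incrVec (hb : IsNoise P b) (S : Finset Freq) (T : ℝ) (m : ℕ) :
    HasGaussianLaw (incrVec b S T m) P := by
  have h := hb.gauss S (m + 1) fun j => grid T m j
  let pr : S × Fin (m + 1) → (S × Fin (m + 1) → ℂ) →L[ℝ] ℂ := fun a =>
    ContinuousLinearMap.proj (R := ℝ) (φ := fun _ => ℂ) a
  let L : (S × Fin (m + 1) → ℂ) →L[ℝ] (S × Fin m → ℂ) := ContinuousLinearMap.pi fun a =>
    pr (a.1, a.2.succ) - pr (a.1, a.2.castSucc)
  refine (h.map_fun L).congr (.of_forall fun ω => ?_)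
  funext a
  simp [L, pr, incrVec, incr]

lemma memLp (hb : IsNoise P b) (n : Freq) (t : ℝ) : MemLp (b n t) 2 P := by
  have h := hb.gauss {n} 1 fun _ => t
  have := h.map_fun (ContinuousLinearMap.proj (R := ℝ) (φ := fun _ => ℂ)
    ((⟨n, Finset.mem_singleton_self n⟩, 0) : ({n} : Finset Freq) × Fin 1))
  exact this.memLp_two

lemma integrable_mul (hb : IsNoise P b) (k l : Freq) (s t : ℝ) :
    Integrable (fun ω => b k s ω * b l t ω) P := (hb.memLp k s).integrable_mul (hb.memLp l t)

lemma integrable (hb : IsNoise P b) [IsProbabilityMeasure P] (n : Freq) (t : ℝ) :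
    Integrable (b n t) P := (hb.memLp n t).integrable one_le_two

lemma integral_incr_mul (hb : IsNoise P b) (k l : Freq) {T : ℝ} (hT : 0 ≤ T) (m i j : ℕ) :
    ∫ ω, incr (fun t => b k t ω) T m i * incr (fun t => b l t ω) T m j ∂P =
      if k + l = 0 ∧ i = j then ((T / m : ℝ) : ℂ) else 0 := by
  have e : ∀ ω, incr (fun t => b k t ω) T m i * incr (fun t => b l t ω) T m j =
      b k (grid T m (i + 1)) ω * b l (grid T m (j + 1)) ω -
      b k (grid T m (i + 1)) ω * b l (grid T m j) ω -
      (b k (grid T m i) ω * b l (grid T m (j + 1)) ω - b k (grid T m i) ω * b l (grid T m j) ω) :=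
    fun ω => by simp only [incr]; ring
  have hg : ∀ j, 0 ≤ grid T m j := fun j => by unfold grid; positivity
  simp_rw [e]
  rw [integral_sub, integral_sub, integral_sub,
    hb.cov _ _ _ _ (hg _) (hg _), hb.cov _ _ _ _ (hg _) (hg _), hb.cov _ _ _ _ (hg _) (hg _),
    hb.cov _ _ _ _ (hg _) (hg _)]
  rotate_left
  all_goals first
    | exact hb.integrable_mul _ _ _ _
    | exact (hb.integrable_mul _ _ _ _).sub (hb.integrable_mul _ _ _ _)
    | skip
  by_cases hkl : k + l = 0
  · simp only [hkl, if_true, true_and]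
    have hmono : Monotone (grid T m) := monotone_nat_of_le_succ fun j => grid_le_succ hT m j
    rcases lt_trichotomy i j with h | h | h
    · have h1 := hmono (Nat.succ_le_of_lt h)
      have h2 := grid_le_succ hT m i
      have h3 := grid_le_succ hT m j
      rw [Nat.succ_eq_add_one] at h1
      rw [if_neg h.ne, min_eq_left (h1.trans h3), min_eq_left h1, min_eq_left (h2.trans (h1.trans h3)),
        min_eq_left (h2.trans h1)]
      ring
    · subst h
      have h2 := grid_le_succ hT m i
      rw [if_pos rfl, min_self, min_self, min_eq_right h2, min_eq_left h2, ← grid_succ_sub T m i]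
      push_cast; ring
    · have h1 := hmono (Nat.succ_le_of_lt h)
      have h2 := grid_le_succ hT m i
      have h3 := grid_le_succ hT m j
      rw [Nat.succ_eq_add_one] at h1
      rw [if_neg h.ne', min_eq_right (h1.trans h2), min_eq_right h1,
        min_eq_right (h3.trans (h1.trans h2)), min_eq_right (h3.trans h1)]
      ring
  · simp [hkl]

lemma integral_incrVec_mul (hb : IsNoise P b) (S : Finset Freq) {T : ℝ} (hT : 0 ≤ T) (m : ℕ)
    (x y : S × Fin m) : ∫ ω, incrVec b S T m ω x * incrVec b S T m ω y ∂P =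
      if x.1.1 + y.1.1 = 0 ∧ x.2 = y.2 then ((T / m : ℝ) : ℂ) else 0 := by
  simp only [incrVec]
  rw [hb.integral_incr_mul _ _ hT]
  simp only [Fin.ext_iff]

lemma integral_incrVec (hb : IsNoise P b) [IsProbabilityMeasure P] (S : Finset Freq) (T : ℝ) (m : ℕ) :
    ∫ z, z ∂(P.map (incrVec b S T m)) = 0 := by
  have := (hb.hasGaussianLaw_incrVec S T m).isGaussian_map
  rw [integral_map (hb.measurable_incrVec S T m).aemeasurable (by fun_prop)]
  funext a
  rw [eval_integral (f := incrVec b S T m) fun i => (hb.integrable _ _).sub (hb.integrable _ _)]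
  simp only [incrVec, incr]
  rw [integral_sub (hb.integrable _ _) (hb.integrable _ _), hb.mean, hb.mean, sub_zero]
  rfl

lemma lintegral_incrVec_linear (hb : IsNoise P b) (S : Finset Freq) {T : ℝ} (hT : 0 ≤ T) (m : ℕ)
    (w : S × Fin m → ℂ) :
    ∫⁻ z : S × Fin m → ℂ, ‖∑ a, w a * z a‖ₑ ^ 2 ∂(P.map (incrVec b S T m)) =
      ENNReal.ofReal (T / m) * ∑ a, ‖w a‖ₑ ^ 2 := by
  rw [lintegral_map (by fun_prop) (hb.measurable_incrVec S T m)]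
  have hint : ∀ k l : Freq, ∀ i j, Integrable (fun ω => incr (fun t => b k t ω) T m i *
      incr (fun t => b l t ω) T m j) P := fun k l i j =>
    ((hb.memLp _ _).sub (hb.memLp _ _)).integrable_mul ((hb.memLp _ _).sub (hb.memLp _ _))
  have hconj : ∀ (n : Freq) j ω, (starRingEnd ℂ) (incr (fun t => b n t ω) T m j) =
      incr (fun t => b (-n) t ω) T m j := fun n j ω => by
    simp only [incr, hb.conj, map_sub]
  have hsq : ∀ ω, ((‖∑ a, w a * incrVec b S T m ω a‖ ^ 2 : ℝ) : ℂ) =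
      ∑ x, ∑ y, w x * (starRingEnd ℂ) (w y) *
        (incr (fun t => b x.1 t ω) T m x.2 * incr (fun t => b (-y.1.1) t ω) T m y.2) := by
    intro ω
    rw [Complex.ofReal_pow, ← Complex.mul_conj', map_sum, Finset.sum_mul_sum]
    refine Finset.sum_congr rfl fun x _ => Finset.sum_congr rfl fun y _ => ?_
    rw [map_mul, ← hconj]
    simp only [incrVec]; ring
  have hE : ∫ ω, ‖∑ a, w a * incrVec b S T m ω a‖ ^ 2 ∂P = T / m * ∑ a, ‖w a‖ ^ 2 := by
    have h1 : ((∫ ω, ‖∑ a, w a * incrVec b S T m ω a‖ ^ 2 ∂P : ℝ) : ℂ) =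
        ((T / m * ∑ a, ‖w a‖ ^ 2 : ℝ) : ℂ) := by
      rw [← integral_complex_ofReal]
      simp_rw [hsq]
      rw [integral_finsetSum _ fun x _ => integrable_finsetSum _ fun y _ => (hint _ _ _ _).const_mul _]
      have : ∀ x, ∫ ω, ∑ y, w x * (starRingEnd ℂ) (w y) *
          (incr (fun t => b x.1 t ω) T m x.2 * incr (fun t => b (-y.1.1) t ω) T m y.2) ∂P =
          ((T / m * ‖w x‖ ^ 2 : ℝ) : ℂ) := by
        intro x
        rw [integral_finsetSum _ fun y _ => (hint _ _ _ _).const_mul _]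
        simp_rw [integral_const_mul, hb.integral_incr_mul _ _ hT]
        rw [Finset.sum_eq_single x]
        · rw [if_pos (by simp), Complex.mul_conj']; push_cast; ring
        · intro y _ hy
          rw [if_neg, mul_zero]
          rintro ⟨h1, h2⟩
          rw [add_neg_eq_zero] at h1
          exact hy (Prod.ext (Subtype.ext h1.symm) (Fin.ext h2.symm))
        · simp
      simp_rw [this]
      rw [Finset.mul_sum, Complex.ofReal_sum]
    exact_mod_cast h1
  have hI : Integrable (fun ω => ‖∑ a, w a * incrVec b S T m ω a‖ ^ 2) P := by
    have : MemLp (fun ω => ∑ a, w a * incrVec b S T m ω a) 2 P :=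
      memLp_finsetSum _ fun a _ => ((hb.memLp _ _).sub (hb.memLp _ _)).const_mul _
    exact this.norm.integrable_sq
  have h2 : ∀ ω, ‖∑ a, w a * incrVec b S T m ω a‖ₑ ^ 2 =
      ENNReal.ofReal (‖∑ a, w a * incrVec b S T m ω a‖ ^ 2) := fun ω => by
    rw [ENNReal.ofReal_pow (norm_nonneg _), ofReal_norm]
  simp_rw [h2]
  rw [← ofReal_integral_eq_lintegral_ofReal hI (.of_forall fun ω => by positivity), hE,
    ENNReal.ofReal_mul (by positivity), ENNReal.ofReal_sum_of_nonneg fun _ _ => by positivity]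
  congr 1
  refine Finset.sum_congr rfl fun a _ => ?_
  rw [ENNReal.ofReal_pow (norm_nonneg _), ofReal_norm]

end IsNoise

end Noise

/-! ### Moments of the stochastic objects -/

section Moments

variable {Ω : Type*} [MeasurableSpace Ω] {P : Measure Ω} {b : Freq → ℝ → Ω → ℂ}

lemma lintegral_pow_le_of_tendsto {X : ℕ → Ω → ℂ} {Y : Ω → ℂ} {q : ℕ} {B : ℝ≥0∞}
    (hX : ∀ m, Measurable (X m)) (h : ∀ ω, Tendsto (fun m => X m ω) atTop (𝓝 (Y ω)))
    (hB : ∀ m, ∫⁻ ω, ‖X m ω‖ₑ ^ q ∂P ≤ B) : ∫⁻ ω, ‖Y ω‖ₑ ^ q ∂P ≤ B := by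
  have h1 : ∀ ω, ‖Y ω‖ₑ ^ q = liminf (fun m => ‖X m ω‖ₑ ^ q) atTop := fun ω =>
    (((ENNReal.continuous_pow q).comp continuous_enorm).continuousAt.tendsto.comp
      (h ω)).liminf_eq.symm
  simp_rw [h1]
  refine (lintegral_liminf_le fun m => (hX m).enorm.pow_const q).trans ?_
  exact liminf_le_of_frequently_le' (Frequently.of_forall hB)

lemma exists_norm_psi_le (α : ℝ) (n : Freq) {f : ℝ → ℂ} (hf : Continuous f) (h0 : f 0 = 0) {T : ℝ}
    (hT : 0 ≤ T) : ∃ D : ℝ, 0 ≤ D ∧ ∀ t ∈ Icc 0 T, ‖psi α n f t‖ ≤ D := by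
  obtain ⟨C, hC⟩ := (isCompact_Icc (a := (0 : ℝ)) (b := T)).exists_bound_of_continuousOn hf.continuousOn
  have hC0 : 0 ≤ C := (norm_nonneg _).trans (hC 0 ⟨le_rfl, hT⟩)
  refine ⟨jb n ^ α * (C * T), mul_nonneg (jb_rpow_pos _ _).le (mul_nonneg hC0 hT), fun t ht => ?_⟩
  rw [psi_eq_cosPos α n h0 hf ht, norm_mul, Complex.norm_real,
    Real.norm_of_nonneg (jb_rpow_pos n α).le]
  refine mul_le_mul_of_nonneg_left ?_ (jb_rpow_pos _ _).le
  refine (intervalIntegral.norm_integral_le_of_norm_le_const (C := C) fun r hr => ?_).trans_eq ?_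
  · rw [uIoc_of_le hT] at hr
    rw [norm_mul, Complex.norm_real, Real.norm_eq_abs]
    calc _ ≤ C * 1 := mul_le_mul (hC r ⟨hr.1.le, hr.2⟩) (abs_cosPos_le n t r) (abs_nonneg _) hC0
      _ = C := mul_one C
  · rw [sub_zero, abs_of_nonneg hT]

lemma exists_norm_psiStep_sub_le (α : ℝ) (n : Freq) {f : ℝ → ℂ} (hf : Continuous f) (h0 : f 0 = 0)
    {T : ℝ} (hT : 0 ≤ T) : ∃ e : ℕ → ℝ, Tendsto e atTop (𝓝 0) ∧ ∀ m, ∀ t ∈ Icc 0 T,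
      ‖psiStep α n T (m + 1) (incr f T (m + 1)) t - psi α n f t‖ ≤ e m := by
  obtain ⟨e, he, h⟩ := exists_modulus hf hT
  refine ⟨fun m => jb n ^ α * (e (m + 1) * T), ?_, fun m t ht =>
    norm_psiStep_sub_psi_le α n hf h0 hT m.succ_pos (h _ m.succ_pos) ht⟩
  have := ((he.comp (tendsto_add_atTop_nat 1)).mul_const T).const_mul (jb n ^ α)
  simpa using this

lemma tendsto_psiStep (α : ℝ) (n : Freq) {f : ℝ → ℂ} (hf : Continuous f) (h0 : f 0 = 0)
    {T t : ℝ} (ht : t ∈ Icc 0 T) :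
    Tendsto (fun m => psiStep α n T (m + 1) (incr f T (m + 1)) t) atTop (𝓝 (psi α n f t)) := by
  obtain ⟨e, he, h⟩ := exists_norm_psiStep_sub_le α n hf h0 (ht.1.trans ht.2)
  exact tendsto_iff_norm_sub_tendsto_zero.2 (squeeze_zero (fun _ => norm_nonneg _)
    (fun m => h m t ht) he)

lemma tendsto_psiVarStep (α : ℝ) (n : Freq) {T t : ℝ} (ht : t ∈ Icc 0 T) :
    Tendsto (fun m => psiVarStep α n T (m + 1) t) atTop (𝓝 (psiVar α n t)) := by
  have hT := ht.1.trans ht.2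
  refine tendsto_iff_norm_sub_tendsto_zero.2 (squeeze_zero (fun _ => norm_nonneg _)
    (fun m => abs_psiVarStep_sub_le α n hT m.succ_pos ht) ?_)
  have h1 : Tendsto (fun m : ℕ => T / ((m + 1 : ℕ) : ℝ)) atTop (𝓝 0) :=
    (tendsto_const_div_atTop_nhds_zero_nat T).comp (tendsto_add_atTop_nat 1)
  have := ((h1.const_mul (2 * jb n)).mul_const T).const_mul (jb n ^ (2 * α - 2))
  simpa using this

lemma continuous_sinPos_left (n : Freq) (r : ℝ) : Continuous fun t => sinPos n t r := by
  unfold sinPos; fun_prop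

lemma continuous_psiStep (α : ℝ) (n : Freq) (T : ℝ) (m : ℕ) (z : ℕ → ℂ) :
    Continuous (psiStep α n T m z) := by
  unfold psiStep
  refine continuous_const.mul (continuous_finsetSum _ fun j _ => continuous_const.mul
    (Complex.continuous_ofReal.comp ?_))
  exact continuous_sinPos_left n _

lemma continuous_psiVarStep (α : ℝ) (n : Freq) (T : ℝ) (m : ℕ) :
    Continuous (psiVarStep α n T m) := by
  unfold psiVarStep
  refine continuous_const.mul (continuous_const.mul (continuous_finsetSum _ fun j _ =>
    Continuous.pow ?_ 2))
  exact continuous_sinPos_left n _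

lemma abs_psiVarStep_le (α : ℝ) (n : Freq) {T : ℝ} (hT : 0 ≤ T) {m : ℕ} (hm : 0 < m) (t : ℝ) :
    |psiVarStep α n T m t| ≤ jb n ^ (2 * α - 2) * T := by
  unfold psiVarStep
  have hm' : (0 : ℝ) < m := by exact_mod_cast hm
  rw [abs_mul, abs_of_pos (jb_rpow_pos _ _), abs_of_nonneg (mul_nonneg (by positivity)
    (Finset.sum_nonneg fun _ _ => sq_nonneg _))]
  refine mul_le_mul_of_nonneg_left ?_ (jb_rpow_pos _ _).le
  calc T / m * ∑ j ∈ Finset.range m, sinPos n t (grid T m (j + 1)) ^ 2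
      ≤ T / m * ∑ j ∈ Finset.range m, (1 : ℝ) := by
        gcongr with j _
        rw [← sq_abs]
        exact pow_le_one₀ (abs_nonneg _) (abs_sinPos_le _ _ _)
    _ = T := by rw [Finset.sum_const, Finset.card_range, nsmul_eq_mul, mul_one]; field_simp

/-- The Wick product `:Ψ̂(k) Ψ̂(l):`, along a family of paths. -/
def wickPair (α : ℝ) (f : Freq → ℝ → ℂ) (k l : Freq) (t : ℝ) : ℂ :=
  psi α k (f k) t * psi α l (f l) t - if k + l = 0 then (psiVar α k t : ℂ) else 0

/-- The approximation of `wickPair`. -/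
def wickPairStep (α : ℝ) (f : Freq → ℝ → ℂ) (T : ℝ) (m : ℕ) (k l : Freq) (t : ℝ) : ℂ :=
  psiStep α k T m (incr (f k) T m) t * psiStep α l T m (incr (f l) T m) t -
    if k + l = 0 then (psiVarStep α k T m t : ℂ) else 0

lemma continuous_wickPairStep (α : ℝ) (f : Freq → ℝ → ℂ) (T : ℝ) (m : ℕ) (k l : Freq) :
    Continuous (wickPairStep α f T m k l) := by
  unfold wickPairStep
  refine ((continuous_psiStep _ _ _ _ _).mul (continuous_psiStep _ _ _ _ _)).sub ?_
  split_ifs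
  · exact Complex.continuous_ofReal.comp (continuous_psiVarStep _ _ _ _)
  · exact continuous_const

lemma tendsto_integral_wickPairStep (α : ℝ) {f : Freq → ℝ → ℂ} (hf : ∀ n, Continuous (f n))
    (h0 : ∀ n, f n 0 = 0) {T : ℝ} (hT : 0 ≤ T) {ν : Measure ℝ} (hν : ∀ᵐ t ∂ν, t ∈ Icc 0 T)
    {h : ℝ → ℂ} (hh : Integrable h ν) (k l : Freq) :
    Tendsto (fun m => ∫ t, h t * wickPairStep α f T (m + 1) k l t ∂ν) atTop
      (𝓝 (∫ t, h t * wickPair α f k l t ∂ν)) := by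
  obtain ⟨D, hD0, hD⟩ := exists_norm_psi_le α k (hf k) (h0 k) hT
  obtain ⟨D', hD0', hD'⟩ := exists_norm_psi_le α l (hf l) (h0 l) hT
  obtain ⟨e, he, hke⟩ := exists_norm_psiStep_sub_le α k (hf k) (h0 k) hT
  obtain ⟨e', he', hle⟩ := exists_norm_psiStep_sub_le α l (hf l) (h0 l) hT
  refine tendsto_integral_filter_of_dominated_convergence
    (fun t => ‖h t‖ * ((D + 1) * (D' + 1) + jb k ^ (2 * α - 2) * T)) ?_ ?_ (hh.norm.mul_const _) ?_
  · exact .of_forall fun m => hh.aestronglyMeasurable.mul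
      (continuous_wickPairStep _ _ _ _ _ _).aestronglyMeasurable
  · filter_upwards [he.eventually (gt_mem_nhds one_pos), he'.eventually (gt_mem_nhds one_pos)]
      with m hm hm'
    filter_upwards [hν] with t ht
    rw [norm_mul]
    refine mul_le_mul_of_nonneg_left ?_ (norm_nonneg _)
    unfold wickPairStep
    refine (norm_sub_le _ _).trans (add_le_add ?_ ?_)
    · rw [norm_mul]
      have h1 := hke m t ht
      have h2 := hle m t ht
      have h3 := norm_le_insert' (psiStep α k T (m + 1) (incr (f k) T (m + 1)) t) (psi α k (f k) t)
      have h4 := norm_le_insert' (psiStep α l T (m + 1) (incr (f l) T (m + 1)) t) (psi α l (f l) t)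
      have h5 := hD t ht
      have h6 := hD' t ht
      exact mul_le_mul (by linarith) (by linarith) (norm_nonneg _) (by linarith)
    · split_ifs
      · rw [Complex.norm_real]
        exact abs_psiVarStep_le α k hT m.succ_pos t
      · rw [norm_zero]
        exact mul_nonneg (jb_rpow_pos _ _).le hT
  · filter_upwards [hν] with t ht
    refine Tendsto.const_mul _ ?_
    unfold wickPairStep wickPair
    refine ((tendsto_psiStep α k (hf k) (h0 k) ht).mul
      (tendsto_psiStep α l (hf l) (h0 l) ht)).sub ?_
    split_ifs
    · exact (Complex.continuous_ofReal.tendsto _).comp (tendsto_psiVarStep α k ht)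
    · exact tendsto_const_nhds

lemma integrable_mul_sinPos {ν : Measure ℝ} {h : ℝ → ℂ} (hh : Integrable h ν) (k l : Freq)
    (r r' : ℝ) : Integrable (fun t => h t * ((sinPos k t r : ℂ) * (sinPos l t r' : ℂ))) ν := by
  have hc : ∀ (k : Freq) (r : ℝ), Continuous fun t => (sinPos k t r : ℂ) := fun k r =>
    Complex.continuous_ofReal.comp (continuous_sinPos_left k r)
  refine hh.mul_bdd (c := 1) ((hc k r).mul (hc l r')).aestronglyMeasurable (.of_forall fun t => ?_)
  rw [norm_mul, Complex.norm_real, Complex.norm_real]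
  exact mul_le_one₀ (abs_sinPos_le _ _ _) (norm_nonneg _) (abs_sinPos_le _ _ _)

/-- The kernel of a functional of the Wick products as a quadratic form in the increments. -/
def wickKernel (α : ℝ) (S : Finset Freq) (T : ℝ) (m : ℕ) (ν : Measure ℝ) (h : Freq → Freq → ℝ → ℂ)
    (x y : S × Fin m) : ℂ :=
  ((jb x.1 ^ (α - 1) : ℝ) : ℂ) * ((jb y.1 ^ (α - 1) : ℝ) : ℂ) *
    ∫ t, h x.1 y.1 t * ((sinPos x.1 t (grid T m (x.2 + 1)) : ℂ) *
      (sinPos y.1 t (grid T m (y.2 + 1)) : ℂ)) ∂ν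

lemma integral_psiStep_mul (α : ℝ) (f : Freq → ℝ → ℂ) (T : ℝ) (m : ℕ) {ν : Measure ℝ} {h : ℝ → ℂ}
    (hh : Integrable h ν) (k l : Freq) :
    Integrable (fun t => h t * (psiStep α k T m (incr (f k) T m) t *
      psiStep α l T m (incr (f l) T m) t)) ν ∧
    ∫ t, h t * (psiStep α k T m (incr (f k) T m) t * psiStep α l T m (incr (f l) T m) t) ∂ν =
      ∑ i : Fin m, ∑ j : Fin m, ((jb k ^ (α - 1) : ℝ) : ℂ) * ((jb l ^ (α - 1) : ℝ) : ℂ) *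
        (∫ t, h t * ((sinPos k t (grid T m (i + 1)) : ℂ) *
          (sinPos l t (grid T m (j + 1)) : ℂ)) ∂ν) * (incr (f k) T m i * incr (f l) T m j) := by
  have e : ∀ t, h t * (psiStep α k T m (incr (f k) T m) t * psiStep α l T m (incr (f l) T m) t) =
      ∑ i : Fin m, ∑ j : Fin m, (((jb k ^ (α - 1) : ℝ) : ℂ) * ((jb l ^ (α - 1) : ℝ) : ℂ) *
        (incr (f k) T m i * incr (f l) T m j)) * (h t * ((sinPos k t (grid T m (i + 1)) : ℂ) *
          (sinPos l t (grid T m (j + 1)) : ℂ))) := by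
    intro t
    rw [psiStep, psiStep, mul_mul_mul_comm, Finset.sum_range, Finset.sum_range,
      Finset.sum_mul_sum, ← mul_assoc, Finset.mul_sum]
    refine Finset.sum_congr rfl fun i _ => ?_
    rw [Finset.mul_sum]
    exact Finset.sum_congr rfl fun j _ => by ring
  have hI := fun i j : Fin m => (integrable_mul_sinPos hh k l (grid T m (i + 1))
    (grid T m (j + 1))).const_mul (((jb k ^ (α - 1) : ℝ) : ℂ) * ((jb l ^ (α - 1) : ℝ) : ℂ) *
        (incr (f k) T m i * incr (f l) T m j))
  simp_rw [e]
  refine ⟨integrable_finsetSum _ fun i _ => integrable_finsetSum _ fun j _ => hI i j, ?_⟩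
  rw [integral_finsetSum _ fun i _ => integrable_finsetSum _ fun j _ => hI i j]
  refine Finset.sum_congr rfl fun i _ => ?_
  rw [integral_finsetSum _ fun j _ => hI i j]
  refine Finset.sum_congr rfl fun j _ => ?_
  rw [integral_const_mul]; ring

lemma integral_psiVarStep (α : ℝ) (T : ℝ) (m : ℕ) {ν : Measure ℝ} {h : ℝ → ℂ}
    (hh : Integrable h ν) (k : Freq) :
    Integrable (fun t => h t * (psiVarStep α k T m t : ℂ)) ν ∧
    ∫ t, h t * (psiVarStep α k T m t : ℂ) ∂ν =
      ∑ i : Fin m, ((jb k ^ (α - 1) : ℝ) : ℂ) * ((jb k ^ (α - 1) : ℝ) : ℂ) *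
        (∫ t, h t * ((sinPos k t (grid T m (i + 1)) : ℂ) *
          (sinPos k t (grid T m (i + 1)) : ℂ)) ∂ν) * ((T / m : ℝ) : ℂ) := by
  have hpow : jb k ^ (2 * α - 2) = jb k ^ (α - 1) * jb k ^ (α - 1) := by
    rw [← Real.rpow_add (jb_pos k)]; congr 1; ring
  have e : ∀ t, h t * (psiVarStep α k T m t : ℂ) =
      ∑ i : Fin m, (((jb k ^ (α - 1) : ℝ) : ℂ) * ((jb k ^ (α - 1) : ℝ) : ℂ) * ((T / m : ℝ) : ℂ)) *
        (h t * ((sinPos k t (grid T m (i + 1)) : ℂ) * (sinPos k t (grid T m (i + 1)) : ℂ))) := by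
    intro t
    rw [psiVarStep, Finset.sum_range, Complex.ofReal_mul, Complex.ofReal_mul, Complex.ofReal_sum,
      hpow, ← mul_assoc, ← mul_assoc, Finset.mul_sum]
    exact Finset.sum_congr rfl fun i _ => by push_cast; ring
  have hI := fun i : Fin m => (integrable_mul_sinPos hh k k (grid T m (i + 1))
    (grid T m (i + 1))).const_mul (((jb k ^ (α - 1) : ℝ) : ℂ) * ((jb k ^ (α - 1) : ℝ) : ℂ) *
      ((T / m : ℝ) : ℂ))
  simp_rw [e]
  refine ⟨integrable_finsetSum _ fun i _ => hI i, ?_⟩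
  rw [integral_finsetSum _ fun i _ => hI i]
  refine Finset.sum_congr rfl fun i _ => ?_
  rw [integral_const_mul]; ring

lemma sum_integral_wickPairStep (hb : IsNoise P b) (α : ℝ) (S : Finset Freq) {T : ℝ} (hT : 0 ≤ T)
    (m : ℕ) {ν : Measure ℝ} {h : Freq → Freq → ℝ → ℂ} (hh : ∀ k l, Integrable (h k l) ν) (ω : Ω) :
    ∑ k ∈ S, ∑ l ∈ S, ∫ t, h k l t * wickPairStep α (fun n t => b n t ω) T m k l t ∂ν =
      quadForm (wickKernel α S T m ν h) (IsNoise.incrVec b S T m ω) -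
        ∫ z, quadForm (wickKernel α S T m ν h) z ∂(P.map (IsNoise.incrVec b S T m)) := by
  have hterm : ∀ k l, ∫ t, h k l t * wickPairStep α (fun n t => b n t ω) T m k l t ∂ν =
      (∑ i : Fin m, ∑ j : Fin m, ((jb k ^ (α - 1) : ℝ) : ℂ) * ((jb l ^ (α - 1) : ℝ) : ℂ) *
        (∫ t, h k l t * ((sinPos k t (grid T m (i + 1)) : ℂ) *
          (sinPos l t (grid T m (j + 1)) : ℂ)) ∂ν) *
          (incr (fun t => b k t ω) T m i * incr (fun t => b l t ω) T m j)) -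
      ∑ i : Fin m, ∑ j : Fin m, ((jb k ^ (α - 1) : ℝ) : ℂ) * ((jb l ^ (α - 1) : ℝ) : ℂ) *
        (∫ t, h k l t * ((sinPos k t (grid T m (i + 1)) : ℂ) *
          (sinPos l t (grid T m (j + 1)) : ℂ)) ∂ν) *
          (if k + l = 0 ∧ i = j then ((T / m : ℝ) : ℂ) else 0) := by
    intro k l
    obtain ⟨i1, e1⟩ := integral_psiStep_mul α (fun n t => b n t ω) T m (hh k l) k l
    rw [← e1]
    unfold wickPairStep
    simp_rw [mul_sub]
    by_cases hkl : k + l = 0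
    · obtain ⟨i2, e2⟩ := integral_psiVarStep α T m (hh k l) k
      simp only [hkl, if_true, true_and]
      rw [integral_sub i1 i2, e2]
      congr 1
      refine Finset.sum_congr rfl fun i _ => ?_
      rw [Finset.sum_eq_single i (fun j _ hj => by rw [if_neg hj.symm, mul_zero]) (by simp),
        if_pos rfl]
      have hl : l = -k := (neg_eq_of_add_eq_zero_right hkl).symm
      have hs : ∀ t r, sinPos l t r = sinPos k t r := fun t r => by
        rw [hl, sinPos, sinPos, jb_neg]
      have hj : jb l = jb k := by rw [hl, jb_neg]
      simp_rw [hs, hj]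
    · simp [hkl]
  have hE : ∫ z, quadForm (wickKernel α S T m ν h) z ∂(P.map (IsNoise.incrVec b S T m)) =
      ∑ x, ∑ y, wickKernel α S T m ν h x y *
        (if x.1.1 + y.1.1 = 0 ∧ x.2 = y.2 then ((T / m : ℝ) : ℂ) else 0) := by
    rw [integral_map (hb.measurable_incrVec S T m).aemeasurable
      (measurable_quadForm _).aestronglyMeasurable]
    have hI : ∀ x y, Integrable (fun ω => IsNoise.incrVec b S T m ω x * IsNoise.incrVec b S T m ω y) P :=
      fun x y => ((hb.memLp _ _).sub (hb.memLp _ _)).integrable_mul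
        ((hb.memLp _ _).sub (hb.memLp _ _))
    unfold quadForm
    rw [integral_finsetSum _ fun x _ => integrable_finsetSum _ fun y _ => (hI x y).const_mul _]
    refine Finset.sum_congr rfl fun x _ => ?_
    rw [integral_finsetSum _ fun y _ => (hI x y).const_mul _]
    refine Finset.sum_congr rfl fun y _ => ?_
    rw [integral_const_mul, hb.integral_incrVec_mul S hT]
  have hprod : ∀ F : Freq → Fin m → Freq → Fin m → ℂ, ∑ x : S × Fin m, ∑ y : S × Fin m,
      F x.1 x.2 y.1 y.2 = ∑ k ∈ S, ∑ l ∈ S, ∑ i, ∑ j, F k i l j := by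
    intro F
    rw [← Finset.sum_coe_sort S (fun k => ∑ l ∈ S, ∑ i, ∑ j, F k i l j), Fintype.sum_prod_type]
    refine Fintype.sum_congr _ _ fun k => ?_
    rw [← Finset.sum_coe_sort S (fun l => ∑ i, ∑ j, F k i l j), Finset.sum_comm]
    simp_rw [Fintype.sum_prod_type]
    exact Fintype.sum_congr _ _ fun l => Finset.sum_comm
  rw [hE, quadForm]
  simp_rw [hterm, Finset.sum_sub_distrib]
  congr 1
  · exact (hprod fun k i l j => ((jb k ^ (α - 1) : ℝ) : ℂ) * ((jb l ^ (α - 1) : ℝ) : ℂ) *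
        (∫ t, h k l t * ((sinPos k t (grid T m (i + 1)) : ℂ) *
          (sinPos l t (grid T m (j + 1)) : ℂ)) ∂ν) *
          (incr (fun t => b k t ω) T m i * incr (fun t => b l t ω) T m j)).symm
  · exact (hprod fun k i l j => ((jb k ^ (α - 1) : ℝ) : ℂ) * ((jb l ^ (α - 1) : ℝ) : ℂ) *
        (∫ t, h k l t * ((sinPos k t (grid T m (i + 1)) : ℂ) *
          (sinPos l t (grid T m (j + 1)) : ℂ)) ∂ν) *
          (if k + l = 0 ∧ i = j then ((T / m : ℝ) : ℂ) else 0)).symm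

/-- The size of the kernel of the approximation. -/
lemma sum_enorm_wickKernel_le (α : ℝ) (S : Finset Freq) {T : ℝ} (hT : 0 ≤ T) {m : ℕ} (hm : 0 < m)
    {ν : Measure ℝ} {h : Freq → Freq → ℝ → ℂ} {κ : Freq → Freq → ℝ≥0∞}
    (hκ : ∀ k l, ∀ r ∈ Icc 0 T, ∀ r' ∈ Icc 0 T,
      ‖∫ t, h k l t * ((sinPos k t r : ℂ) * (sinPos l t r' : ℂ)) ∂ν‖ₑ ≤ κ k l) :
    ENNReal.ofReal (T / m) ^ 2 * ∑ x, ∑ y, ‖wickKernel α S T m ν h x y‖ₑ ^ 2 ≤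
      ENNReal.ofReal T ^ 2 * ∑ k ∈ S, ∑ l ∈ S, ENNReal.ofReal (jb k ^ (2 * α - 2)) *
        ENNReal.ofReal (jb l ^ (2 * α - 2)) * κ k l ^ 2 := by
  have hm' : (0 : ℝ) < m := by exact_mod_cast hm
  have hpow : ∀ k, ‖((jb k ^ (α - 1) : ℝ) : ℂ)‖ₑ ^ 2 = ENNReal.ofReal (jb k ^ (2 * α - 2)) := by
    intro k
    rw [← ofReal_norm, ← ENNReal.ofReal_pow (norm_nonneg _), Complex.norm_real,
      Real.norm_of_nonneg (jb_rpow_pos _ _).le, ← Real.rpow_natCast, ← Real.rpow_mul (jb_pos k).le]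
    congr 2; push_cast; ring
  have h1 : ∀ x y : S × Fin m, ‖wickKernel α S T m ν h x y‖ₑ ^ 2 ≤
      ENNReal.ofReal (jb x.1 ^ (2 * α - 2)) * ENNReal.ofReal (jb y.1 ^ (2 * α - 2)) *
        κ x.1 y.1 ^ 2 := by
    intro x y
    rw [wickKernel, enorm_mul, enorm_mul, mul_pow, mul_pow, hpow, hpow]
    gcongr
    exact hκ _ _ _ (grid_mem hT hm x.2.2) _ (grid_mem hT hm y.2.2)
  calc _ ≤ ENNReal.ofReal (T / m) ^ 2 * ∑ x : S × Fin m, ∑ y : S × Fin m,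
        ENNReal.ofReal (jb x.1 ^ (2 * α - 2)) * ENNReal.ofReal (jb y.1 ^ (2 * α - 2)) *
        κ x.1 y.1 ^ 2 := by
        gcongr with x _ y _
        exact h1 x y
    _ = ENNReal.ofReal (T / m) ^ 2 * ((m : ℝ≥0∞) ^ 2 * ∑ k ∈ S, ∑ l ∈ S,
        ENNReal.ofReal (jb k ^ (2 * α - 2)) * ENNReal.ofReal (jb l ^ (2 * α - 2)) * κ k l ^ 2) := by
        congr 1
        simp_rw [Fintype.sum_prod_type, Finset.sum_const, Finset.card_univ, Fintype.card_fin,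
          nsmul_eq_mul]
        rw [← Finset.sum_coe_sort S, Finset.mul_sum]
        refine Finset.sum_congr rfl fun k _ => ?_
        rw [← Finset.mul_sum, sq, mul_assoc, ← Finset.sum_coe_sort S (fun l =>
          ENNReal.ofReal (jb k ^ (2 * α - 2)) * ENNReal.ofReal (jb l ^ (2 * α - 2)) * κ k l ^ 2)]
    _ = _ := by
        rw [← mul_assoc, ← mul_pow]
        congr 2
        rw [ENNReal.ofReal_div_of_pos hm', ENNReal.ofReal_natCast]
        exact ENNReal.div_mul_cancel (by exact_mod_cast hm.ne') (by simp)

variable [IsProbabilityMeasure P]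

/-- Moments of functionals of the Wick products. -/
lemma lintegral_wickPair_pow_le (hb : IsNoise P b) (α : ℝ) (S : Finset Freq) {T : ℝ} (hT : 0 ≤ T)
    {ν : Measure ℝ} (hν : ∀ᵐ t ∂ν, t ∈ Icc 0 T) {h : Freq → Freq → ℝ → ℂ}
    (hh : ∀ k l, Integrable (h k l) ν) {κ : Freq → Freq → ℝ≥0∞}
    (hκ : ∀ k l, ∀ r ∈ Icc 0 T, ∀ r' ∈ Icc 0 T,
      ‖∫ t, h k l t * ((sinPos k t r : ℂ) * (sinPos l t r' : ℂ)) ∂ν‖ₑ ≤ κ k l) {p : ℕ} (hp : 1 ≤ p) :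
    ∫⁻ ω, ‖∑ k ∈ S, ∑ l ∈ S, ∫ t, h k l t * wickPair α (fun n t => b n t ω) k l t ∂ν‖ₑ ^ (2 * p) ∂P ≤
      2 ^ (2 * p + 1) * linMoment p ^ 2 * (ENNReal.ofReal T ^ 2 * ∑ k ∈ S, ∑ l ∈ S,
        ENNReal.ofReal (jb k ^ (2 * α - 2)) * ENNReal.ofReal (jb l ^ (2 * α - 2)) *
          κ k l ^ 2) ^ p := by
  refine lintegral_pow_le_of_tendsto (X := fun m ω => ∑ k ∈ S, ∑ l ∈ S,
    ∫ t, h k l t * wickPairStep α (fun n t => b n t ω) T (m + 1) k l t ∂ν) (fun m => ?_)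
    (fun ω => ?_) fun m => ?_
  · simp_rw [sum_integral_wickPairStep hb α S hT (m + 1) hh]
    exact ((measurable_quadForm _).comp (hb.measurable_incrVec S T (m + 1))).sub_const _
  · exact tendsto_finsetSum _ fun k _ => tendsto_finsetSum _ fun l _ =>
      tendsto_integral_wickPairStep α (fun n => hb.cont n ω) (fun n => hb.zero n ω) hT hν (hh k l) k l
  · have := (hb.hasGaussianLaw_incrVec S T (m + 1)).isGaussian_map
    have key := lintegral_quadForm_centered_pow_le (hb.integral_incrVec S T (m + 1))
      (fun w => (hb.lintegral_incrVec_linear S hT (m + 1) w).le) hp (wickKernel α S T (m + 1) ν h)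
    rw [lintegral_map (((measurable_quadForm _).sub_const _).enorm.pow_const _)
      (hb.measurable_incrVec S T (m + 1))] at key
    simp_rw [sum_integral_wickPairStep hb α S hT (m + 1) hh]
    refine key.trans (mul_le_mul_right (ENNReal.pow_le_pow_left ?_) _)
    exact sum_enorm_wickKernel_le α S hT m.succ_pos hκ

/-- Moments of linear functionals of the stochastic convolution. -/
lemma lintegral_psi_pow_le (hb : IsNoise P b) (α : ℝ) (S : Finset Freq) {T t : ℝ}
    (ht : t ∈ Icc 0 T) (c : Freq → ℂ) (p : ℕ) :
    ∫⁻ ω, ‖∑ k ∈ S, c k * psi α k (fun t => b k t ω) t‖ₑ ^ (2 * p) ∂P ≤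
      linMoment p * (ENNReal.ofReal T * ∑ k ∈ S, ‖c k‖ₑ ^ 2 *
        ENNReal.ofReal (jb k ^ (2 * α - 2))) ^ p := by
  have hT : 0 ≤ T := ht.1.trans ht.2
  set w : ∀ m : ℕ, S × Fin m → ℂ := fun m x =>
    c x.1 * (((jb x.1 ^ (α - 1) : ℝ) : ℂ) * (sinPos x.1 t (grid T m (x.2 + 1)) : ℂ)) with hw
  have hlin : ∀ m ω, ∑ k ∈ S, c k * psiStep α k T m (incr (fun t => b k t ω) T m) t =
      ∑ x, w m x * IsNoise.incrVec b S T m ω x := by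
    intro m ω
    rw [Fintype.sum_prod_type, ← Finset.sum_coe_sort S]
    refine Finset.sum_congr rfl fun k _ => ?_
    rw [psiStep, Finset.sum_range, ← mul_assoc, Finset.mul_sum]
    exact Finset.sum_congr rfl fun j _ => by simp only [hw, IsNoise.incrVec]; ring
  refine lintegral_pow_le_of_tendsto (X := fun m ω => ∑ k ∈ S,
    c k * psiStep α k T (m + 1) (incr (fun t => b k t ω) T (m + 1)) t) (fun m => ?_)
    (fun ω => ?_) fun m => ?_
  · simp_rw [hlin]
    exact Finset.measurable_fun_sum _ fun x _ => (((hb.meas _ _).sub (hb.meas _ _))).const_mul _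
  · exact tendsto_finsetSum _ fun k _ =>
      (tendsto_psiStep α k (hb.cont k ω) (hb.zero k ω) ht).const_mul _
  · have := (hb.hasGaussianLaw_incrVec S T (m + 1)).isGaussian_map
    have key := lintegral_linear_pow_le (hb.integral_incrVec S T (m + 1))
      (fun w => (hb.lintegral_incrVec_linear S hT (m + 1) w).le) p (w (m + 1))
    rw [lintegral_map (by fun_prop) (hb.measurable_incrVec S T (m + 1))] at key
    simp_rw [hlin]
    refine key.trans (mul_le_mul_right (ENNReal.pow_le_pow_left ?_) _)
    have hm' : (0 : ℝ) < (m + 1 : ℕ) := by positivity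
    have hpow : ∀ k, ‖((jb k ^ (α - 1) : ℝ) : ℂ)‖ₑ ^ 2 = ENNReal.ofReal (jb k ^ (2 * α - 2)) := by
      intro k
      rw [← ofReal_norm, ← ENNReal.ofReal_pow (norm_nonneg _), Complex.norm_real,
        Real.norm_of_nonneg (jb_rpow_pos _ _).le, ← Real.rpow_natCast, ← Real.rpow_mul (jb_pos k).le]
      congr 2; push_cast; ring
    calc _ ≤ ENNReal.ofReal (T / (m + 1 : ℕ)) * ∑ x : S × Fin (m + 1), ‖c x.1‖ₑ ^ 2 *
          ENNReal.ofReal (jb x.1 ^ (2 * α - 2)) := by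
          gcongr with x _
          rw [hw, enorm_mul, enorm_mul, mul_pow, mul_pow, hpow]
          gcongr
          refine mul_le_of_le_one_right zero_le (pow_le_one₀ zero_le ?_)
          rw [← ofReal_norm, Complex.norm_real, ENNReal.ofReal_le_one]
          exact abs_sinPos_le _ _ _
      _ = ENNReal.ofReal (T / (m + 1 : ℕ)) * (((m + 1 : ℕ) : ℝ≥0∞) * ∑ k ∈ S, ‖c k‖ₑ ^ 2 *
          ENNReal.ofReal (jb k ^ (2 * α - 2))) := by
          congr 1
          simp_rw [Fintype.sum_prod_type, Finset.sum_const, Finset.card_univ, Fintype.card_fin,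
            nsmul_eq_mul]
          rw [← Finset.sum_coe_sort S, Finset.mul_sum]
      _ = _ := by
          rw [← mul_assoc]
          congr 1
          rw [ENNReal.ofReal_div_of_pos hm', ENNReal.ofReal_natCast]
          exact ENNReal.div_mul_cancel (by simp) (by simp)

end Moments

/-! ### Almost sure convergence of random Fourier series -/

section AlmostSure

/-- The frequencies `|n| ≤ N`. -/
def ball (N : ℕ) : Finset Freq := open Classical in
  (Finset.Icc (-(N : ℤ)) N ×ˢ Finset.Icc (-(N : ℤ)) N).filter fun n => normSq n ≤ (N : ℝ) ^ 2

lemma mem_ball {N : ℕ} {n : Freq} : n ∈ ball N ↔ normSq n ≤ (N : ℝ) ^ 2 := by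
  classical
  unfold ball
  rw [Finset.mem_filter, and_iff_right_iff_imp]
  intro h
  have key : ∀ a : ℤ, (a : ℝ) ^ 2 ≤ (N : ℝ) ^ 2 → a ∈ Finset.Icc (-(N : ℤ)) N := by
    intro a ha
    have h1 := abs_le_of_sq_le_sq' ha (Nat.cast_nonneg N)
    rw [Finset.mem_Icc]
    exact ⟨by exact_mod_cast h1.1, by exact_mod_cast h1.2⟩
  unfold normSq at h
  exact Finset.mem_product.2 ⟨key _ (by nlinarith [sq_nonneg (n.2 : ℝ)]),
    key _ (by nlinarith [sq_nonneg (n.1 : ℝ)])⟩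

lemma ball_mono {M N : ℕ} (h : M ≤ N) : ball M ⊆ ball N := fun n hn => by
  rw [mem_ball] at hn ⊢
  exact hn.trans (by gcongr)

lemma jb_le_of_mem_ball {N : ℕ} {n : Freq} (h : n ∈ ball N) : jb n ≤ N + 1 := by
  rw [mem_ball] at h
  refine abs_le_of_sq_le_sq' ?_ (by positivity) |>.2
  rw [jb_sq]
  have : (0 : ℝ) ≤ N := Nat.cast_nonneg N
  nlinarith

lemma le_jb_of_notMem_ball {N : ℕ} {n : Freq} (h : n ∉ ball N) : (N : ℝ) ≤ jb n := by
  rw [mem_ball, not_le] at h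
  refine abs_le_of_sq_le_sq' ?_ (jb_pos n).le |>.2
  rw [jb_sq]; linarith

lemma card_ball_le (N : ℕ) : ((ball N).card : ℝ) ≤ (2 * N + 1) ^ 2 := by
  classical
  have h : (ball N).card ≤ (2 * N + 1) ^ 2 := by
    refine (Finset.card_filter_le _ _).trans ?_
    rw [Finset.card_product, Int.card_Icc, sq]
    apply le_of_eq
    congr 1 <;> omega
  exact_mod_cast h

lemma add_mem_ball {N : ℕ} {k l : Freq} (hk : k ∈ ball N) (hl : l ∈ ball N) :
    k + l ∈ ball (2 * N) := by
  rw [mem_ball] at hk hl ⊢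
  simp only [normSq, Prod.fst_add, Prod.snd_add, Int.cast_add, Nat.cast_mul, Nat.cast_ofNat] at *
  nlinarith [sq_nonneg ((k.1 : ℝ) - l.1), sq_nonneg ((k.2 : ℝ) - l.2)]

lemma jb_rpow_le_of_mem_ball (s : ℝ) {N : ℕ} {n : Freq} (h : n ∈ ball N) :
    jb n ^ s ≤ ((N : ℝ) + 1) ^ ⌈|s|⌉₊ := by
  calc jb n ^ s ≤ jb n ^ (⌈|s|⌉₊ : ℝ) := jb_rpow_le n ((le_abs_self s).trans (Nat.le_ceil _))
    _ = jb n ^ ⌈|s|⌉₊ := Real.rpow_natCast _ _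
    _ ≤ _ := pow_le_pow_left₀ (jb_pos n).le (jb_le_of_mem_ball h) _

lemma trigSum_eq_of_subset {S S' : Finset Freq} (h : S ⊆ S') {c : Freq → ℂ}
    (hc : ∀ n ∉ S, c n = 0) (x : Torus) : trigSum S' c x = trigSum S c x :=
  (Finset.sum_subset h fun n _ hn => by rw [hc n hn, zero_mul]).symm

lemma trigSum_add (S : Finset Freq) (c d : Freq → ℂ) (x : Torus) :
    trigSum S (c + d) x = trigSum S c x + trigSum S d x := by
  simp only [trigSum, Pi.add_apply, add_mul, Finset.sum_add_distrib]

lemma exists_grid_near {T : ℝ} (hT : 0 < T) {K : ℕ} (hK : 0 < K) {t : ℝ} (ht : t ∈ Icc 0 T) :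
    ∃ i ≤ K, |t - grid T K i| ≤ T / K := by
  have hK' : (0 : ℝ) < K := by exact_mod_cast hK
  refine ⟨⌊t * K / T⌋₊, ?_, ?_⟩
  · refine Nat.floor_le_of_le ?_
    rw [div_le_iff₀ hT, mul_comm]
    exact mul_le_mul_of_nonneg_left ht.2 hK'.le
  · have h1 := Nat.floor_le (show 0 ≤ t * K / T by have := ht.1; positivity)
    have h2 := Nat.lt_floor_add_one (t * K / T)
    rw [le_div_iff₀ hT] at h1
    rw [div_lt_iff₀ hT] at h2
    unfold grid
    rw [abs_le]
    constructor
    · rw [neg_le_iff_add_nonneg, sub_add, sub_nonneg, ← sub_div, div_le_iff₀ hK']; nlinarith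
    · rw [sub_le_iff_le_add, ← add_div, le_div_iff₀ hK']; nlinarith

lemma basisFun_coe (n : Freq) (y z : ℝ) : basisFun n ((y : AddCircle (2 * Real.pi)), (z : AddCircle (2 * Real.pi))) =
    (2 * (Real.pi : ℂ))⁻¹ * Complex.exp (Complex.I * ((n.1 * y + n.2 * z : ℝ) : ℂ)) := by
  have hp : (Real.pi : ℂ) ≠ 0 := by exact_mod_cast Real.pi_ne_zero
  rw [basisFun, fourier_coe_apply, fourier_coe_apply, ← Complex.exp_add]
  congr 2
  push_cast
  field_simp

lemma norm_basisFun_sub_le (n : Freq) (y z y' z' : ℝ) :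
    ‖basisFun n ((y : AddCircle (2 * Real.pi)), (z : AddCircle (2 * Real.pi))) -
      basisFun n ((y' : AddCircle (2 * Real.pi)), (z' : AddCircle (2 * Real.pi)))‖ ≤
      (2 * Real.pi)⁻¹ * (jb n * (|y - y'| + |z - z'|)) := by
  rw [basisFun_coe, basisFun_coe, ← mul_sub, norm_mul]
  have h0 : ‖(2 * (Real.pi : ℂ))⁻¹‖ = (2 * Real.pi)⁻¹ := by
    rw [norm_inv, norm_mul, Complex.norm_real, Real.norm_of_nonneg Real.pi_pos.le]; simp
  rw [h0]
  refine mul_le_mul_of_nonneg_left ?_ (by positivity)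
  set θ : ℝ := n.1 * y + n.2 * z
  set θ' : ℝ := n.1 * y' + n.2 * z'
  have e : Complex.exp (Complex.I * θ) - Complex.exp (Complex.I * θ') =
      Complex.exp (Complex.I * θ') * (Complex.exp (Complex.I * ((θ - θ' : ℝ) : ℂ)) - 1) := by
    rw [mul_sub, ← Complex.exp_add, mul_one]
    congr 2; push_cast; ring
  have e1 : ‖Complex.exp (Complex.I * θ')‖ = 1 := by
    rw [mul_comm]; exact Complex.norm_exp_ofReal_mul_I θ'
  rw [e, norm_mul, e1, one_mul]
  refine (Real.norm_exp_I_mul_ofReal_sub_one_le).trans ?_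
  have e2 : θ - θ' = n.1 * (y - y') + n.2 * (z - z') := by simp only [θ, θ']; ring
  rw [e2, Real.norm_eq_abs]
  refine (abs_add_le _ _).trans ?_
  rw [abs_mul, abs_mul, mul_add]
  gcongr
  · exact abs_fst_le_jb n
  · exact abs_snd_le_jb n

/-- The grid points of the torus. -/
def torusGrid (K i j : ℕ) : Torus :=
  ((grid (2 * Real.pi) K i : ℝ), (grid (2 * Real.pi) K j : ℝ))

lemma exists_torusGrid_near {K : ℕ} (hK : 0 < K) (x : Torus) : ∃ i ≤ K, ∃ j ≤ K, ∀ n,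
    ‖basisFun n x - basisFun n (torusGrid K i j)‖ ≤ 2 * jb n / K := by
  have hc : ∀ x : AddCircle (2 * Real.pi), ∃ y ∈ Icc 0 (2 * Real.pi),
      (y : AddCircle (2 * Real.pi)) = x := fun x => by
    refine ⟨(AddCircle.equivIco (2 * Real.pi) 0 x : ℝ), ?_, AddCircle.coe_equivIco⟩
    have := (AddCircle.equivIco (2 * Real.pi) 0 x).2
    exact ⟨this.1, this.2.le.trans_eq (zero_add _)⟩
  obtain ⟨y, hy, hyx⟩ := hc x.1
  obtain ⟨z, hz, hzx⟩ := hc x.2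
  obtain ⟨i, hi, hiy⟩ := exists_grid_near Real.two_pi_pos hK hy
  obtain ⟨j, hj, hjz⟩ := exists_grid_near Real.two_pi_pos hK hz
  refine ⟨i, hi, j, hj, fun n => ?_⟩
  have hx : x = ((y : AddCircle (2 * Real.pi)), (z : AddCircle (2 * Real.pi))) :=
    Prod.ext hyx.symm hzx.symm
  rw [hx]
  refine (norm_basisFun_sub_le n y z _ _).trans ?_
  have hj0 := jb_pos n
  calc _ ≤ (2 * Real.pi)⁻¹ * (jb n * (2 * Real.pi / K + 2 * Real.pi / K)) := by gcongr
    _ = 2 * jb n / K := by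
      have := Real.pi_pos
      field_simp; ring

variable {Ω : Type*} [MeasurableSpace Ω] {P : Measure Ω}

/-- Random trigonometric polynomials whose increments have small moments in the weighted sense,
and whose coefficients are Hölder continuous in time with polynomially growing constants. -/
structure RandomApprox (P : Measure Ω) (s T δ : ℝ) (a : ℕ → Ω → ℝ → Distr) : Prop where
  meas : ∀ N t n, Measurable fun ω => a N ω t n
  supp : ∀ N ω t, ∀ n ∉ ball (2 * N), a N ω t n = 0
  zero : ∀ N ω n, a N ω 0 n = 0
  mom : ∀ p : ℕ, 1 ≤ p → ∃ C : ℝ≥0, ∀ M N, 1 ≤ M → M ≤ N → ∀ t ∈ Icc 0 T, ∀ x,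
    ∫⁻ ω, ‖trigSum (ball (2 * N)) (wt s (a N ω t - a M ω t)) x‖ₑ ^ (2 * p) ∂P ≤
      C * ENNReal.ofReal ((M : ℝ) ^ (-(2 * p * δ)))
  hol : ∃ A : ℕ, ∀ᵐ ω ∂P, ∃ C : ℝ, 0 ≤ C ∧ ∀ N, ∀ t ∈ Icc 0 T, ∀ t' ∈ Icc 0 T, ∀ n,
    ‖a N ω t n - a N ω t' n‖ ≤ C * (N + 1) ^ A * Real.sqrt |t - t'|

/-- Comparison of a trigonometric polynomial with its values on a grid. -/
lemma exists_grid_trigSum_sub_le {f g : ℝ → Distr} {s T C : ℝ} {A M N : ℕ} (hT : 0 < T) (hC : 0 ≤ C)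
    (hM : 1 ≤ M) (hMN : M ≤ N) (hN : N ≤ 2 * M) (hf0 : ∀ n, f 0 n = 0) (hg0 : ∀ n, g 0 n = 0)
    (hf : ∀ t ∈ Icc 0 T, ∀ t' ∈ Icc 0 T, ∀ n, ‖f t n - f t' n‖ ≤ C * (N + 1) ^ A * Real.sqrt |t - t'|)
    (hg : ∀ t ∈ Icc 0 T, ∀ t' ∈ Icc 0 T, ∀ n, ‖g t n - g t' n‖ ≤ C * (M + 1) ^ A * Real.sqrt |t - t'|)
    {t : ℝ} (ht : t ∈ Icc 0 T) (x : Torus) :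
    ∃ i ≤ M ^ (2 * (4 + A + ⌈|s|⌉₊)), ∃ j ≤ M ^ (2 * (4 + A + ⌈|s|⌉₊)),
      ∃ k ≤ M ^ (2 * (4 + A + ⌈|s|⌉₊)),
      ‖trigSum (ball (2 * N)) (wt s (f t - g t)) x -
        trigSum (ball (2 * N)) (wt s (f (grid T (M ^ (2 * (4 + A + ⌈|s|⌉₊))) i) -
          g (grid T (M ^ (2 * (4 + A + ⌈|s|⌉₊))) i)))
          (torusGrid (M ^ (2 * (4 + A + ⌈|s|⌉₊))) j k)‖ ≤
      (81 * 5 ^ ⌈|s|⌉₊ * (2 * C * 3 ^ A * Real.sqrt T) * 11) / M := by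
  set B := ⌈|s|⌉₊
  set K := M ^ (2 * (4 + A + B)) with hK
  have hK0 : 0 < K := pow_pos (by omega) _
  have hK1 : (1 : ℝ) ≤ K := by exact_mod_cast hK0
  obtain ⟨i, hi, hti⟩ := exists_grid_near hT hK0 ht
  obtain ⟨j, hj, k, hk, hx⟩ := exists_torusGrid_near hK0 x
  refine ⟨i, hi, j, hj, k, hk, ?_⟩
  set t' := grid T K i
  set x' := torusGrid K j k
  have ht' : t' ∈ Icc 0 T := grid_mem hT.le hK0 hi
  have hMR : (1 : ℝ) ≤ M := by exact_mod_cast hM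
  have hMN' : (M : ℝ) ≤ N := by exact_mod_cast hMN
  have hN' : (N : ℝ) ≤ 2 * M := by exact_mod_cast hN
  have hsK : Real.sqrt K = (M : ℝ) ^ (4 + A + B) := by
    rw [hK, Nat.cast_pow, mul_comm 2, pow_mul, Real.sqrt_sq (by positivity)]
  set E := 2 * C * (N + 1) ^ A with hE
  have hE0 : 0 ≤ E := by positivity
  have hd : ∀ n, ∀ r ∈ Icc 0 T, ∀ r' ∈ Icc 0 T,
      ‖(f r - g r) n - (f r' - g r') n‖ ≤ E * Real.sqrt |r - r'| := by
    intro n r hr r' hr'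
    have e : (f r - g r) n - (f r' - g r') n = (f r n - f r' n) - (g r n - g r' n) := by
      simp only [Pi.sub_apply]; ring
    rw [e]
    refine (norm_sub_le _ _).trans ?_
    have h1 := hf r hr r' hr' n
    have h2 := hg r hr r' hr' n
    have h3 : C * ((M : ℝ) + 1) ^ A * Real.sqrt |r - r'| ≤ C * ((N : ℝ) + 1) ^ A * Real.sqrt |r - r'| := by
      gcongr
    calc _ ≤ _ := add_le_add h1 (h2.trans h3)
      _ = _ := by rw [hE]; ring
  have hterm : ∀ n ∈ ball (2 * N),
      ‖wt s (f t - g t) n * basisFun n x - wt s (f t' - g t') n * basisFun n x'‖ ≤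
      (2 * N + 1) ^ B * (E * Real.sqrt T) * (11 * M) / Real.sqrt K := by
    intro n hn
    have hj := jb_rpow_le_of_mem_ball s hn
    have hj1 := jb_le_of_mem_ball hn
    push_cast at hj hj1
    have e : wt s (f t - g t) n * basisFun n x - wt s (f t' - g t') n * basisFun n x' =
        (((jb n ^ s : ℝ) : ℂ) * ((f t - g t) n - (f t' - g t') n)) * basisFun n x +
        (((jb n ^ s : ℝ) : ℂ) * ((f t' - g t') n - (f 0 - g 0) n)) * (basisFun n x - basisFun n x') := by
      simp only [wt, Pi.sub_apply, hf0, hg0]; ring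
    have hπ : (2 * Real.pi)⁻¹ ≤ 1 := inv_le_one_of_one_le₀ (by linarith [Real.pi_gt_three])
    have h1 : Real.sqrt |t - t'| ≤ Real.sqrt T / Real.sqrt K := by
      rw [← Real.sqrt_div hT.le]; exact Real.sqrt_le_sqrt hti
    have h2 : Real.sqrt |t' - 0| ≤ Real.sqrt T := by
      rw [sub_zero, abs_of_nonneg ht'.1]; exact Real.sqrt_le_sqrt ht'.2
    have hsK1 : Real.sqrt K ≤ K := Real.sqrt_le_self_iff.2 (Or.inr hK1)
    have hsKpos : 0 < Real.sqrt K := by positivity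
    have h3 : 2 * jb n / K ≤ 2 * (2 * N + 1) / Real.sqrt K := by gcongr
    rw [e]
    refine (norm_add_le _ _).trans ?_
    rw [norm_mul, norm_mul, norm_mul, norm_mul, Complex.norm_real,
      Real.norm_of_nonneg (jb_rpow_pos _ _).le, norm_basisFun]
    calc _ ≤ (2 * N + 1) ^ B * (E * (Real.sqrt T / Real.sqrt K)) * 1 +
        (2 * N + 1) ^ B * (E * Real.sqrt T) * (2 * (2 * N + 1) / Real.sqrt K) := by
          refine add_le_add ?_ ?_
          · refine mul_le_mul (mul_le_mul hj ((hd n t ht t' ht').trans ?_) (norm_nonneg _)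
              (by positivity)) hπ (by positivity) (by positivity)
            gcongr
          · refine mul_le_mul (mul_le_mul hj ((hd n t' ht' 0 ⟨le_rfl, hT.le⟩).trans ?_) (norm_nonneg _)
              (by positivity)) ((hx n).trans h3) (norm_nonneg _) (by positivity)
            gcongr
      _ = (2 * N + 1) ^ B * (E * Real.sqrt T) * (1 + 2 * (2 * N + 1)) / Real.sqrt K := by ring
      _ ≤ _ := by gcongr; linarith
  rw [trigSum, trigSum, ← Finset.sum_sub_distrib]
  refine (norm_sum_le_of_le _ hterm).trans ?_
  rw [Finset.sum_const, nsmul_eq_mul, hsK]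
  have hc := card_ball_le (2 * N)
  push_cast at hc
  have h9 : (2 * (2 * (N : ℝ)) + 1) ≤ 9 * M := by linarith
  have h5 : (2 * (N : ℝ) + 1) ≤ 5 * M := by linarith
  have h3 : (N : ℝ) + 1 ≤ 3 * M := by linarith
  calc _ ≤ (9 * (M : ℝ)) ^ 2 * ((5 * M) ^ B * (2 * C * (3 * M) ^ A * Real.sqrt T) * (11 * M) /
        (M : ℝ) ^ (4 + A + B)) := by
        rw [hE]
        refine mul_le_mul (hc.trans ?_) ?_ (by positivity) (by positivity)
        · gcongr
        · gcongr
    _ = _ := by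
        have : (M : ℝ) ≠ 0 := by positivity
        rw [mul_pow, mul_pow, mul_pow, pow_add, pow_add]
        field_simp
        ring

lemma le_max_of_pow_le {y r : ℝ} {n : ℕ} (hn : n ≠ 0) (h : y ^ n ≤ r) : y ≤ max 1 r := by
  rcases le_or_gt y 1 with h1 | h1
  · exact h1.trans (le_max_left _ _)
  · exact ((le_self_pow₀ h1.le hn).trans h).trans (le_max_right _ _)

/-- The values on the grid are almost surely small. -/
lemma RandomApprox.ae_grid_bound {s T δ : ℝ} {a : ℕ → Ω → ℝ → Distr} (ha : RandomApprox P s T δ a)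
    (hT : 0 < T) (hδ : 0 < δ) (D : ℕ) :
    ∀ᵐ ω ∂P, ∃ C : ℝ, 0 ≤ C ∧ ∀ M N, 1 ≤ M → M ≤ N → N ≤ 2 * M →
      ∀ i ≤ M ^ D, ∀ j ≤ M ^ D, ∀ k ≤ M ^ D,
      ‖trigSum (ball (2 * N)) (wt s (a N ω (grid T (M ^ D) i) - a M ω (grid T (M ^ D) i)))
        (torusGrid (M ^ D) j k)‖ ≤ C * (M : ℝ) ^ (-(δ / 2)) := by
  obtain ⟨p, hp⟩ := exists_nat_gt ((3 * D + 3) / δ)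
  rw [div_lt_iff₀ hδ] at hp
  have hp1 : 1 ≤ p := by
    rcases Nat.eq_zero_or_pos p with rfl | h
    · simp only [CharP.cast_eq_zero, zero_mul] at hp; linarith [(Nat.cast_nonneg D : (0 : ℝ) ≤ D)]
    · exact h
  obtain ⟨C, hC⟩ := ha.mom p hp1
  set u : ℕ → ℕ → ℕ × ℕ × ℕ → Ω → ℂ := fun M N g ω =>
    trigSum (ball (2 * N)) (wt s (a N ω (grid T (M ^ D) g.1) - a M ω (grid T (M ^ D) g.1)))
      (torusGrid (M ^ D) g.2.1 g.2.2) with hu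
  have hum : ∀ M N g, Measurable (u M N g) := fun M N g => by
    simp only [hu, trigSum, wt, Pi.sub_apply]
    exact Finset.measurable_fun_sum _ fun n _ =>
      ((((ha.meas N _ n).sub (ha.meas M _ n))).const_mul _).mul_const _
  set G : ℕ → Finset (ℕ × ℕ × ℕ) := fun M =>
    Finset.range (M ^ D + 1) ×ˢ Finset.range (M ^ D + 1) ×ˢ Finset.range (M ^ D + 1) with hG
  set R : Ω → ℝ≥0∞ := fun ω => ∑' M : ℕ, ∑ N ∈ Finset.Icc (M + 1) (2 * (M + 1)), ∑ g ∈ G (M + 1),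
    ENNReal.ofReal (((M : ℝ) + 1) ^ (p * δ)) * ‖u (M + 1) N g ω‖ₑ ^ (2 * p) with hR
  have hRm : Measurable R := Measurable.tsum fun M => Finset.measurable_fun_sum _ fun N _ =>
    Finset.measurable_fun_sum _ fun g _ => ((hum _ _ _).enorm.pow_const _).const_mul _
  have hRint : ∫⁻ ω, R ω ∂P < ∞ := by
    have hterm : ∀ M : ℕ, ∫⁻ ω, ∑ N ∈ Finset.Icc (M + 1) (2 * (M + 1)), ∑ g ∈ G (M + 1),
        ENNReal.ofReal (((M : ℝ) + 1) ^ (p * δ)) * ‖u (M + 1) N g ω‖ₑ ^ (2 * p) ∂P ≤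
        C * ENNReal.ofReal (16 * (1 / ((M : ℝ) + 1) ^ 2)) := by
      intro M
      have hM1 : (1 : ℝ) ≤ (M : ℝ) + 1 := by linarith [(Nat.cast_nonneg M : (0 : ℝ) ≤ M)]
      have hM0 : (0 : ℝ) < (M : ℝ) + 1 := by linarith
      rw [lintegral_finsetSum _ fun N _ => Finset.measurable_fun_sum _ fun g _ =>
        ((hum _ _ _).enorm.pow_const _).const_mul _]
      have h1 : ∀ N ∈ Finset.Icc (M + 1) (2 * (M + 1)), ∫⁻ ω, ∑ g ∈ G (M + 1),
          ENNReal.ofReal (((M : ℝ) + 1) ^ (p * δ)) * ‖u (M + 1) N g ω‖ₑ ^ (2 * p) ∂P ≤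
          (G (M + 1)).card • (C * ENNReal.ofReal (((M : ℝ) + 1) ^ (-(p * δ)))) := by
        intro N hN
        rw [Finset.mem_Icc] at hN
        rw [lintegral_finsetSum _ fun g _ => ((hum _ _ _).enorm.pow_const _).const_mul _]
        refine Finset.sum_le_card_nsmul _ _ _ fun g hg => ?_
        rw [lintegral_const_mul _ ((hum _ _ _).enorm.pow_const _)]
        simp only [hG, Finset.mem_product, Finset.mem_range] at hg
        have h2 := hC (M + 1) N (by omega) hN.1 (grid T ((M + 1) ^ D) g.1)
          (grid_mem hT.le (pow_pos (by omega) _) (by omega)) (torusGrid ((M + 1) ^ D) g.2.1 g.2.2)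
        refine (mul_le_mul_right h2 _).trans_eq ?_
        rw [mul_left_comm, ← ENNReal.ofReal_mul (by positivity)]
        congr 2
        push_cast
        rw [← Real.rpow_add hM0]
        congr 1; ring
      refine (Finset.sum_le_card_nsmul _ _ _ h1).trans ?_
      rw [Nat.card_Icc, nsmul_eq_mul, nsmul_eq_mul, mul_left_comm _ (C : ℝ≥0∞), mul_left_comm _ (C : ℝ≥0∞)]
      refine mul_le_mul_right ?_ _
      rw [← ENNReal.ofReal_natCast, ← ENNReal.ofReal_natCast, ← ENNReal.ofReal_mul (by positivity),
        ← ENNReal.ofReal_mul (by positivity)]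
      refine ENNReal.ofReal_le_ofReal ?_
      have e1 : ((2 * (M + 1) + 1 - (M + 1) : ℕ) : ℝ) ≤ 2 * ((M : ℝ) + 1) := by
        rw [show 2 * (M + 1) + 1 - (M + 1) = M + 2 by omega]; push_cast; linarith
      have e2 : ((G (M + 1)).card : ℝ) ≤ (2 * ((M : ℝ) + 1) ^ D) ^ 3 := by
        simp only [hG, Finset.card_product, Finset.card_range]
        push_cast
        have : (1 : ℝ) ≤ ((M : ℝ) + 1) ^ D := one_le_pow₀ hM1
        calc _ = (((M : ℝ) + 1) ^ D + 1) ^ 3 := by ring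
          _ ≤ _ := by gcongr; linarith
      have e3 : ((M : ℝ) + 1) ^ (-(p * δ)) ≤ (((M : ℝ) + 1) ^ (3 * D + 3))⁻¹ := by
        rw [← Real.rpow_natCast, ← Real.rpow_neg hM0.le]
        refine Real.rpow_le_rpow_of_exponent_le hM1 ?_
        push_cast; linarith
      calc _ ≤ 2 * ((M : ℝ) + 1) * ((2 * ((M : ℝ) + 1) ^ D) ^ 3 * (((M : ℝ) + 1) ^ (3 * D + 3))⁻¹) := by
            gcongr
        _ = _ := by
            rw [mul_pow, pow_add, pow_mul']
            field_simp
            norm_num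
    rw [hR, lintegral_tsum fun M => (Finset.measurable_fun_sum _ fun N _ =>
      Finset.measurable_fun_sum _ fun g _ => ((hum _ _ _).enorm.pow_const _).const_mul _).aemeasurable]
    refine (ENNReal.tsum_le_tsum hterm).trans_lt ?_
    rw [ENNReal.tsum_mul_left]
    refine ENNReal.mul_lt_top ENNReal.coe_lt_top (Summable.tsum_ofReal_lt_top ?_)
    refine Summable.mul_left _ ?_
    have := (summable_nat_add_iff 1).2 (Real.summable_one_div_nat_pow.2 (one_lt_two))
    simpa using this
  filter_upwards [ae_lt_top hRm hRint.ne] with ω hω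
  refine ⟨max 1 (R ω).toReal, le_max_of_le_left zero_le_one, fun M N hM hMN hN i hi j hj k hk => ?_⟩
  obtain ⟨M, rfl⟩ : ∃ M', M = M' + 1 := ⟨M - 1, by omega⟩
  have hM0 : (0 : ℝ) < (M : ℝ) + 1 := by positivity
  have hle : ENNReal.ofReal (((M : ℝ) + 1) ^ (p * δ)) * ‖u (M + 1) N (i, j, k) ω‖ₑ ^ (2 * p) ≤ R ω := by
    refine le_trans ?_ (ENNReal.le_tsum M)
    refine le_trans ?_ (Finset.single_le_sum (f := fun N => ∑ g ∈ G (M + 1),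
      ENNReal.ofReal (((M : ℝ) + 1) ^ (p * δ)) * ‖u (M + 1) N g ω‖ₑ ^ (2 * p))
      (fun _ _ => zero_le) (Finset.mem_Icc.2 ⟨hMN, hN⟩))
    exact Finset.single_le_sum (f := fun g =>
      ENNReal.ofReal (((M : ℝ) + 1) ^ (p * δ)) * ‖u (M + 1) N g ω‖ₑ ^ (2 * p)) (fun _ _ => zero_le)
      (by simp only [hG, Finset.mem_product, Finset.mem_range]; omega)
  have hle' : (((M : ℝ) + 1) ^ (δ / 2) * ‖u (M + 1) N (i, j, k) ω‖) ^ (2 * p) ≤ (R ω).toReal := by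
    have h1 := ENNReal.toReal_mono hω.ne hle
    rw [ENNReal.toReal_mul, ENNReal.toReal_ofReal (by positivity), ENNReal.toReal_pow, toReal_enorm] at h1
    refine le_trans (le_of_eq ?_) h1
    rw [mul_pow, ← Real.rpow_natCast (((M : ℝ) + 1) ^ (δ / 2)), ← Real.rpow_mul hM0.le]
    congr 2; push_cast; ring
  have h2 := le_max_of_pow_le (by omega) hle'
  push_cast
  rw [Real.rpow_neg hM0.le, ← div_eq_mul_inv, le_div_iff₀ (by positivity), mul_comm]
  simpa [hu] using h2

lemma RandomApprox.ae_dyadic_bound {s T δ : ℝ} {a : ℕ → Ω → ℝ → Distr} (ha : RandomApprox P s T δ a)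
    (hT : 0 < T) (hδ : 0 < δ) (hδ1 : δ ≤ 1) :
    ∀ᵐ ω ∂P, ∃ C : ℝ, 0 ≤ C ∧ ∀ M N, 1 ≤ M → M ≤ N → N ≤ 2 * M → ∀ t ∈ Icc 0 T, ∀ x,
      ‖trigSum (ball (2 * N)) (wt s (a N ω t - a M ω t)) x‖ ≤ C * (M : ℝ) ^ (-(δ / 2)) := by
  obtain ⟨A, hA⟩ := ha.hol
  filter_upwards [hA, ha.ae_grid_bound hT hδ (2 * (4 + A + ⌈|s|⌉₊))] with ω ⟨C₁, hC₁0, hC₁⟩ ⟨C₂, hC₂0, hC₂⟩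
  refine ⟨81 * 5 ^ ⌈|s|⌉₊ * (2 * C₁ * 3 ^ A * Real.sqrt T) * 11 + C₂, by positivity,
    fun M N hM hMN hN t ht x => ?_⟩
  obtain ⟨i, hi, j, hj, k, hk, h⟩ := exists_grid_trigSum_sub_le (s := s) hT hC₁0 hM hMN hN
    (ha.zero N ω) (ha.zero M ω) (hC₁ N) (hC₁ M) ht x
  have h2 := hC₂ M N hM hMN hN i hi j hj k hk
  have hM0 : (1 : ℝ) ≤ M := by exact_mod_cast hM
  have h3 : (M : ℝ)⁻¹ ≤ (M : ℝ) ^ (-(δ / 2)) := by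
    rw [← Real.rpow_neg_one]
    exact Real.rpow_le_rpow_of_exponent_le hM0 (by linarith)
  refine (norm_le_norm_add_norm_sub' _ _).trans ((add_le_add h2 (h.trans ?_)).trans_eq
    ((add_comm _ _).trans (add_mul _ _ _).symm))
  rw [div_eq_mul_inv]
  gcongr

/-- The increments of the approximation are almost surely small. -/
lemma RandomApprox.ae_bound {s T δ : ℝ} {a : ℕ → Ω → ℝ → Distr} (ha : RandomApprox P s T δ a)
    (hT : 0 < T) (hδ : 0 < δ) (hδ1 : δ ≤ 1) :
    ∀ᵐ ω ∂P, ∃ C : ℝ, 0 ≤ C ∧ ∀ M N, 1 ≤ M → M ≤ N → ∀ t ∈ Icc 0 T, ∀ x,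
      ‖trigSum (ball (2 * N)) (wt s (a N ω t - a M ω t)) x‖ ≤ C * (M : ℝ) ^ (-(δ / 2)) := by
  filter_upwards [ha.ae_dyadic_bound hT hδ hδ1] with ω ⟨C, hC0, hC⟩
  have hq : (2 : ℝ) ^ (-(δ / 2)) < 1 := Real.rpow_lt_one_of_one_lt_of_neg one_lt_two (by linarith)
  have hq0 : 0 < (2 : ℝ) ^ (-(δ / 2)) := by positivity
  set q := (2 : ℝ) ^ (-(δ / 2))
  have hsupp : ∀ M N t, M ≤ N → ∀ n ∉ ball (2 * N), wt s (a N ω t - a M ω t) n = 0 := by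
    intro M N t h n hn
    rw [wt, Pi.sub_apply, ha.supp N ω t n hn,
      ha.supp M ω t n fun h' => hn (ball_mono (by omega) h'), sub_zero, mul_zero]
  have key : ∀ d M N, N - M = d → 1 ≤ M → M ≤ N → ∀ t ∈ Icc 0 T, ∀ x,
      ‖trigSum (ball (2 * N)) (wt s (a N ω t - a M ω t)) x‖ ≤ C / (1 - q) * (M : ℝ) ^ (-(δ / 2)) := by
    intro d
    induction d using Nat.strong_induction_on with
    | _ d ih =>
      intro M N hd hM hMN t ht x
      have hM0 : (0 : ℝ) < M := by exact_mod_cast hM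
      rcases le_or_gt N (2 * M) with h | h
      · refine (hC M N hM hMN h t ht x).trans ?_
        gcongr
        rw [le_div_iff₀ (by linarith)]
        nlinarith
      · have e : wt s (a N ω t - a M ω t) =
            wt s (a N ω t - a (2 * M) ω t) + wt s (a (2 * M) ω t - a M ω t) := by
          rw [← wt_add]; congr 1; abel
        rw [e, trigSum_add, trigSum_eq_of_subset (ball_mono (by omega : 2 * (2 * M) ≤ 2 * N))
          (hsupp M (2 * M) t (by omega))]
        refine (norm_add_le _ _).trans ((add_le_add
          (ih (N - 2 * M) (by omega) (2 * M) N rfl (by omega) h.le t ht x)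
          (hC M (2 * M) hM (by omega) le_rfl t ht x)).trans_eq ?_)
        push_cast
        rw [Real.mul_rpow (by norm_num) hM0.le]
        change C / (1 - q) * (q * _) + _ = _
        have : 1 - q ≠ 0 := by linarith
        field_simp
        ring
  exact ⟨C / (1 - q), div_nonneg hC0 (by linarith), fun M N hM hMN t ht x =>
    key _ M N rfl hM hMN t ht x⟩

/-- Passage to the limit: the limiting distributions exist and the convergence is uniform in time. -/
lemma wInfNorm_sub_le_of_trigSum {s T C δ : ℝ} (hδ : 0 < δ) {a : ℕ → ℝ → Distr}
    (hsupp : ∀ N t, ∀ n ∉ ball (2 * N), a N t n = 0)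
    (h : ∀ M N, 1 ≤ M → M ≤ N → ∀ t ∈ Icc 0 T, ∀ x,
      ‖trigSum (ball (2 * N)) (wt s (a N t - a M t)) x‖ ≤ C * (M : ℝ) ^ (-δ))
    {f : ℝ → Distr} (hf : ∀ t ∈ Icc 0 T, ∀ n, (∃ l, Tendsto (fun N => a N t n) atTop (𝓝 l)) →
      Tendsto (fun N => a N t n) atTop (𝓝 (f t n))) :
    (∀ t ∈ Icc 0 T, ∀ n, Tendsto (fun N => a N t n) atTop (𝓝 (f t n))) ∧
    ∀ M, 1 ≤ M → ∀ t ∈ Icc 0 T, wInfNorm s (a M t - f t) ≤ ENNReal.ofReal (C * (M : ℝ) ^ (-δ)) := by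
  have hb : Tendsto (fun M : ℕ => C * (M : ℝ) ^ (-δ)) atTop (𝓝 0) := by
    simpa using ((tendsto_rpow_neg_atTop hδ).comp tendsto_natCast_atTop_atTop).const_mul C
  have hs0 : ∀ M N t, M ≤ N → ∀ n ∉ ball (2 * N), (a N t - a M t) n = 0 := by
    intro M N t hMN n hn
    rw [Pi.sub_apply, hsupp N t n hn,
      hsupp M t n fun h' => hn (ball_mono (by omega) h'), sub_zero]
  have hw : ∀ M N, 1 ≤ M → M ≤ N → ∀ t ∈ Icc 0 T,
      wInfNorm s (a N t - a M t) ≤ ENNReal.ofReal (C * (M : ℝ) ^ (-δ)) := fun M N hM hMN t ht =>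
    wInfNorm_le_of_trigSum (hs0 M N t hMN) (h M N hM hMN t ht)
  have hpos : ∀ M : ℕ, 1 ≤ M → ∀ t ∈ Icc 0 T, 0 ≤ C * (M : ℝ) ^ (-δ) := fun M hM t ht =>
    (norm_nonneg _).trans (h M M hM le_rfl t ht 0)
  have hconv : ∀ t ∈ Icc 0 T, ∀ n, Tendsto (fun N => a N t n) atTop (𝓝 (f t n)) := by
    intro t ht n
    refine hf t ht n ?_
    have hcau : CauchySeq fun N => a (N + 1) t n := by
      refine cauchySeq_of_le_tendsto_0' (fun M : ℕ =>
        (jb n ^ s)⁻¹ * (2 * Real.pi * (C * ((M + 1 : ℕ) : ℝ) ^ (-δ)))) (fun M N hMN => ?_) ?_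
      · have h1 := (ofReal_coeff_le_wInfNorm s (a (N + 1) t - a (M + 1) t) n).trans
          (mul_le_mul_right (hw (M + 1) (N + 1) (by omega) (by omega) t ht) _)
        have h0 := hpos (M + 1) (by omega) t ht
        rw [← ENNReal.ofReal_mul (by positivity), ENNReal.ofReal_le_ofReal_iff (by positivity)] at h1
        rw [dist_comm, dist_eq_norm, inv_mul_eq_div, le_div_iff₀ (jb_rpow_pos _ _), mul_comm]
        exact h1
      · have := ((hb.comp (tendsto_add_atTop_nat 1)).const_mul (2 * Real.pi)).const_mul (jb n ^ s)⁻¹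
        simpa using this
    obtain ⟨l, hl⟩ := cauchySeq_tendsto_of_complete hcau
    exact ⟨l, (tendsto_add_atTop_iff_nat 1).1 hl⟩
  refine ⟨hconv, fun M hM t ht => ?_⟩
  rw [← neg_sub, wInfNorm_neg]
  refine wInfNorm_le_of_tendsto (F := fun j => trigSum (ball (2 * (M + j))) (wt s (a (M + j) t - a M t)))
    (fun j => continuous_trigSum _ _) (fun j x => h M (M + j) hM (by omega) t ht x) (fun x => ?_)
    fun n => ?_
  · refine cauchySeq_tendsto_of_complete (cauchySeq_of_le_tendsto_0'
      (fun i : ℕ => C * ((M + i : ℕ) : ℝ) ^ (-δ)) (fun i j hij => ?_) ?_)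
    · have e : wt s (a (M + j) t - a M t) =
          wt s (a (M + j) t - a (M + i) t) + wt s (a (M + i) t - a M t) := by
        rw [← wt_add]; congr 1; abel
      rw [dist_comm, dist_eq_norm, e, trigSum_add,
        trigSum_eq_of_subset (S := ball (2 * (M + i))) (c := wt s (a (M + i) t - a M t))
          (ball_mono (by omega)) (fun n hn => by rw [wt, hs0 M _ t (by omega) n hn, mul_zero]),
        add_sub_cancel_right]
      exact h (M + i) (M + j) (by omega) (by omega) t ht x
    · exact hb.comp (tendsto_add_atTop_nat M |>.congr fun i => add_comm i M)
  · simp_rw [torusCoeff_trigSum]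
    have h1 : Tendsto (fun j => wt s (a (M + j) t - a M t) n) atTop (𝓝 (wt s (f t - a M t) n)) := by
      unfold wt
      refine Tendsto.const_mul _ (Tendsto.sub_const ?_ _)
      exact (hconv t ht n).comp (tendsto_add_atTop_nat M |>.congr fun i => add_comm i M)
    refine h1.congr fun j => ?_
    split_ifs with hn
    · rfl
    · rw [wt, hs0 M _ t (by omega) n hn, mul_zero]

end AlmostSure

/-! ### Crude path bounds and measurability -/

section PathBounds

/-- Hölder continuity of exponent `1/2` on `[0,T]`. -/
def HolBound (T C : ℝ) (f : ℝ → ℂ) : Prop :=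
  ∀ t ∈ Icc 0 T, ∀ t' ∈ Icc 0 T, ‖f t - f t'‖ ≤ C * Real.sqrt |t - t'|

lemma HolBound.mono {T C C' : ℝ} {f : ℝ → ℂ} (h : HolBound T C f) (hC : C ≤ C') :
    HolBound T C' f := fun t ht t' ht' =>
  (h t ht t' ht').trans (mul_le_mul_of_nonneg_right hC (Real.sqrt_nonneg _))

lemma HolBound.of_le {T C : ℝ} {f : ℝ → ℂ} (h : ∀ t ∈ Icc 0 T, ∀ t' ∈ Icc 0 T, t' ≤ t →
    ‖f t - f t'‖ ≤ C * Real.sqrt (t - t')) : HolBound T C f := fun t ht t' ht' => by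
  rcases le_total t' t with h' | h'
  · rw [abs_of_nonneg (by linarith)]; exact h t ht t' ht' h'
  · rw [norm_sub_rev, abs_sub_comm, abs_of_nonneg (by linarith)]; exact h t' ht' t ht h'

lemma le_sqrt_mul_sqrt {T t t' : ℝ} (ht : t ≤ T) (ht' : 0 ≤ t') (h : t' ≤ t) :
    t - t' ≤ Real.sqrt T * Real.sqrt (t - t') := by
  calc t - t' = Real.sqrt (t - t') * Real.sqrt (t - t') := (Real.mul_self_sqrt (by linarith)).symm
    _ ≤ _ := by gcongr; linarith

lemma HolBound.of_lipschitz {T L : ℝ} {f : ℝ → ℂ} (hL : 0 ≤ L)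
    (h : ∀ t ∈ Icc 0 T, ∀ t' ∈ Icc 0 T, t' ≤ t → ‖f t - f t'‖ ≤ L * (t - t')) :
    HolBound T (L * Real.sqrt T) f :=
  HolBound.of_le fun t ht t' ht' htt => (h t ht t' ht' htt).trans <| by
    rw [mul_assoc]
    exact mul_le_mul_of_nonneg_left (le_sqrt_mul_sqrt ht.2 ht'.1 htt) hL

lemma HolBound.nonneg {T C : ℝ} {f : ℝ → ℂ} (h : HolBound T C f) (hT : 0 < T) : 0 ≤ C := by
  have h1 := (norm_nonneg _).trans (h T ⟨hT.le, le_rfl⟩ 0 ⟨le_rfl, hT.le⟩)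
  rw [sub_zero, abs_of_pos hT] at h1
  exact nonneg_of_mul_nonneg_left h1 (Real.sqrt_pos.2 hT)

lemma HolBound.norm_le {T C : ℝ} {f : ℝ → ℂ} (h : HolBound T C f) (hT : 0 < T) (h0 : f 0 = 0) {t : ℝ}
    (ht : t ∈ Icc 0 T) : ‖f t‖ ≤ C * Real.sqrt T := by
  have h1 := h t ht 0 ⟨le_rfl, hT.le⟩
  rw [h0, sub_zero, sub_zero, abs_of_nonneg ht.1] at h1
  exact h1.trans (mul_le_mul_of_nonneg_left (Real.sqrt_le_sqrt ht.2) (h.nonneg hT))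

lemma HolBound.mul {T C D : ℝ} {f g : ℝ → ℂ} (hf : HolBound T C f) (hg : HolBound T D g)
    (hT : 0 < T) (hf0 : f 0 = 0) (hg0 : g 0 = 0) :
    HolBound T (2 * (C * D) * Real.sqrt T) (fun t => f t * g t) := fun t ht t' ht' => by
  have e : f t * g t - f t' * g t' = f t * (g t - g t') + (f t - f t') * g t' := by ring
  rw [e]
  refine (norm_add_le _ _).trans ?_
  rw [norm_mul, norm_mul]
  have h1 := hf.norm_le hT hf0 ht
  have h2 := hg.norm_le hT hg0 ht'
  calc _ ≤ (C * Real.sqrt T) * (D * Real.sqrt |t - t'|) + (C * Real.sqrt |t - t'|) * (D * Real.sqrt T) :=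
        add_le_add (mul_le_mul h1 (hg t ht t' ht') (norm_nonneg _) ((norm_nonneg _).trans h1))
          (mul_le_mul (hf t ht t' ht') h2 (norm_nonneg _) ((norm_nonneg _).trans (hf t ht t' ht')))
    _ = _ := by ring

lemma HolBound.sub {T C D : ℝ} {f g : ℝ → ℂ} (hf : HolBound T C f) (hg : HolBound T D g) :
    HolBound T (C + D) (fun t => f t - g t) := fun t ht t' ht' => by
  have e : f t - g t - (f t' - g t') = (f t - f t') - (g t - g t') := by ring
  rw [e, add_mul]
  exact (norm_sub_le _ _).trans (add_le_add (hf t ht t' ht') (hg t ht t' ht'))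

lemma HolBound.const_mul {T C : ℝ} {f : ℝ → ℂ} (hf : HolBound T C f) (c : ℂ) :
    HolBound T (‖c‖ * C) (fun t => c * f t) := fun t ht t' ht' => by
  rw [← mul_sub, norm_mul, mul_assoc]
  exact mul_le_mul_of_nonneg_left (hf t ht t' ht') (norm_nonneg _)

lemma HolBound.zero (T : ℝ) : HolBound T 0 (fun _ => 0) := fun t _ t' _ => by simp

lemma HolBound.sum {ι : Type*} {T C : ℝ} {S : Finset ι} {f : ι → ℝ → ℂ}
    (hf : ∀ i ∈ S, HolBound T C (f i)) : HolBound T (S.card * C) (fun t => ∑ i ∈ S, f i t) :=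
  fun t ht t' ht' => by
    rw [← Finset.sum_sub_distrib]
    refine (norm_sum_le_of_le _ fun i hi => hf i hi t ht t' ht').trans_eq ?_
    rw [Finset.sum_const, nsmul_eq_mul, mul_assoc]

/-- The Duhamel integral of a bounded function is Hölder continuous. -/
lemma HolBound.duhamel {T C : ℝ} {F : ℝ → Distr} {n : Freq} (hT : 0 < T)
    (hc : Continuous fun t => F t n) (h0 : F 0 n = 0) (h : HolBound T C fun t => F t n) :
    HolBound T ((1 + T) * (C * Real.sqrt T) * Real.sqrt T) (fun t => RoughWave.duhamel F t n) := by
  have hC := h.nonneg hT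
  refine HolBound.of_lipschitz (by positivity) fun t ht t' ht' htt => ?_
  have hI : ∀ t x y, IntervalIntegrable
      (fun r => ((Real.sin ((t - r) * jb n) / jb n : ℝ) : ℂ) * F r n) volume x y := fun t x y =>
    (Continuous.mul (by fun_prop) hc).intervalIntegrable _ _
  have e : RoughWave.duhamel F t n - RoughWave.duhamel F t' n =
      (∫ r in (0 : ℝ)..t', (((Real.sin ((t - r) * jb n) - Real.sin ((t' - r) * jb n)) / jb n : ℝ) : ℂ) *
        F r n) + ∫ r in t'..t, ((Real.sin ((t - r) * jb n) / jb n : ℝ) : ℂ) * F r n := by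
    simp only [RoughWave.duhamel]
    rw [← intervalIntegral.integral_add_adjacent_intervals (hI t 0 t') (hI t t' t), add_sub_right_comm,
      ← intervalIntegral.integral_sub (hI t 0 t') (hI t' 0 t')]
    congr 2
    funext r; push_cast; ring
  have hj := jb_pos n
  have hj1 := one_le_jb n
  have hb : ∀ r ∈ Icc 0 T, ‖F r n‖ ≤ C * Real.sqrt T := fun r hr => h.norm_le hT h0 hr
  have hsin : ∀ x y : ℝ, |Real.sin x - Real.sin y| ≤ |x - y| := fun x y => by
    have := Real.lipschitzWith_sin.dist_le_mul x y
    simpa [Real.dist_eq] using this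
  have b1 : ‖∫ r in (0 : ℝ)..t', (((Real.sin ((t - r) * jb n) - Real.sin ((t' - r) * jb n)) / jb n : ℝ) : ℂ) *
        F r n‖ ≤ (t - t') * (C * Real.sqrt T) * |t' - 0| := by
    refine intervalIntegral.norm_integral_le_of_norm_le_const fun r hr => ?_
    rw [uIoc_of_le ht'.1] at hr
    rw [norm_mul, Complex.norm_real, Real.norm_eq_abs]
    refine mul_le_mul ?_ (hb r ⟨hr.1.le, hr.2.trans ht'.2⟩) (norm_nonneg _) (by linarith)
    rw [abs_div, abs_of_pos hj, div_le_iff₀ hj]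
    refine (hsin _ _).trans_eq ?_
    rw [← sub_mul, sub_sub_sub_cancel_right, abs_mul, abs_of_pos hj, abs_of_nonneg (by linarith)]
  have b2 : ‖∫ r in t'..t, ((Real.sin ((t - r) * jb n) / jb n : ℝ) : ℂ) * F r n‖ ≤
      1 * (C * Real.sqrt T) * |t - t'| := by
    refine intervalIntegral.norm_integral_le_of_norm_le_const fun r hr => ?_
    rw [uIoc_of_le htt] at hr
    rw [norm_mul, Complex.norm_real, Real.norm_eq_abs]
    refine mul_le_mul ?_ (hb r ⟨ht'.1.trans hr.1.le, hr.2.trans ht.2⟩) (norm_nonneg _) zero_le_one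
    rw [abs_div, abs_of_pos hj]
    exact div_le_one_of_le₀ ((Real.abs_sin_le_one _).trans hj1) hj.le
  rw [e]
  refine (norm_add_le _ _).trans ((add_le_add b1 b2).trans ?_)
  rw [sub_zero, abs_of_nonneg ht'.1, abs_of_nonneg (by linarith)]
  have h1 : 0 ≤ C * Real.sqrt T := by positivity
  have h2 : (t - t') * (C * Real.sqrt T) * t' ≤ (t - t') * (C * Real.sqrt T) * T :=
    mul_le_mul_of_nonneg_left ht'.2 (mul_nonneg (by linarith) h1)
  nlinarith

lemma continuous_psi (α : ℝ) (n : Freq) {f : ℝ → ℂ} (hf : Continuous f) (h0 : f 0 = 0) :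
    Continuous (psi α n f) := by
  have e : psi α n f = fun t => ((jb n ^ α : ℝ) : ℂ) *
      ((Real.cos (t * jb n) : ℂ) * (∫ r in (0 : ℝ)..t, (Real.cos (r * jb n) : ℂ) * f r) +
        (Real.sin (t * jb n) : ℂ) * ∫ r in (0 : ℝ)..t, (Real.sin (r * jb n) : ℂ) * f r) := by
    funext t
    have h1 : Continuous fun r => (Real.cos (r * jb n) : ℂ) * f r := Continuous.mul (by fun_prop) hf
    have h2 : Continuous fun r => (Real.sin (r * jb n) : ℂ) * f r := Continuous.mul (by fun_prop) hf
    rw [psi_eq α n h0]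
    congr 1
    rw [← intervalIntegral.integral_const_mul, ← intervalIntegral.integral_const_mul,
      ← intervalIntegral.integral_add ((h1.intervalIntegrable _ _).const_mul _)
        ((h2.intervalIntegrable _ _).const_mul _)]
    congr 1
    funext r
    rw [sub_mul, Real.cos_sub]
    push_cast; ring
  rw [e]
  have h1 : Continuous fun t : ℝ => ∫ r in (0 : ℝ)..t, (Real.cos (r * jb n) : ℂ) * f r :=
    intervalIntegral.continuous_primitive
      (fun a b => (Continuous.mul (by fun_prop) hf).intervalIntegrable _ _) 0
  have h2 : Continuous fun t : ℝ => ∫ r in (0 : ℝ)..t, (Real.sin (r * jb n) : ℂ) * f r :=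
    intervalIntegral.continuous_primitive
      (fun a b => (Continuous.mul (by fun_prop) hf).intervalIntegrable _ _) 0
  exact continuous_const.mul (((by fun_prop : Continuous fun t : ℝ => (Real.cos (t * jb n) : ℂ)).mul h1).add
    ((by fun_prop : Continuous fun t : ℝ => (Real.sin (t * jb n) : ℂ)).mul h2))

lemma psi_zero_time (α : ℝ) (n : Freq) {f : ℝ → ℂ} (h0 : f 0 = 0) : psi α n f 0 = 0 := by
  rw [psi_eq α n h0]; simp

lemma psiVar_eq (α : ℝ) (n : Freq) (t : ℝ) :
    psiVar α n t = ∫ r in (0 : ℝ)..t, (Real.sin (r * jb n) / jb n ^ (1 - α)) ^ 2 := by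
  have := intervalIntegral.integral_comp_sub_left (a := 0) (b := t)
    (fun r => (Real.sin (r * jb n) / jb n ^ (1 - α)) ^ 2) t
  rw [sub_self, sub_zero] at this
  exact this

lemma continuous_psiVar (α : ℝ) (n : Freq) : Continuous (psiVar α n) := by
  have e : psiVar α n = fun t => ∫ r in (0 : ℝ)..t, (Real.sin (r * jb n) / jb n ^ (1 - α)) ^ 2 :=
    funext (psiVar_eq α n)
  rw [e]
  exact intervalIntegral.continuous_primitive
    (fun a b => (by fun_prop : Continuous fun r => (Real.sin (r * jb n) / jb n ^ (1 - α)) ^ 2).intervalIntegrable _ _) 0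

lemma holBound_psiVar {α : ℝ} (hα : α ≤ 1) (n : Freq) (T : ℝ) :
    HolBound T (Real.sqrt T) (fun t => (psiVar α n t : ℂ)) := by
  have h := HolBound.of_lipschitz (T := T) (L := 1) (f := fun t => (psiVar α n t : ℂ)) zero_le_one
    fun t ht t' ht' htt => ?_
  · rwa [one_mul] at h
  have hc : Continuous fun r => (Real.sin (r * jb n) / jb n ^ (1 - α)) ^ 2 := by fun_prop
  rw [psiVar_eq, psiVar_eq, ← Complex.ofReal_sub, Complex.norm_real,
    intervalIntegral.integral_interval_sub_left (hc.intervalIntegrable _ _) (hc.intervalIntegrable _ _)]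
  refine (intervalIntegral.norm_integral_le_of_norm_le_const (C := 1) fun r hr => ?_).trans_eq
    (by rw [abs_of_nonneg (by linarith)])
  rw [Real.norm_eq_abs, abs_pow, abs_div, abs_of_pos (jb_rpow_pos _ _)]
  refine pow_le_one₀ (div_nonneg (abs_nonneg _) (jb_rpow_pos _ _).le)
    (div_le_one_of_le₀ ((Real.abs_sin_le_one _).trans ?_)
    (jb_rpow_pos _ _).le)
  exact Real.one_le_rpow (one_le_jb n) (by linarith)

lemma integral_norm_le_sqrt {f : ℝ → ℂ} (hf : Continuous f) {T L : ℝ}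
    (hL : ∫ r in (0 : ℝ)..T, ‖f r‖ ^ 2 ≤ L) {x y : ℝ} (hx : 0 ≤ x) (hxy : x ≤ y) (hy : y ≤ T) :
    ∫ r in x..y, ‖f r‖ ≤ (1 + L) * Real.sqrt (y - x) := by
  have hsq : ∀ a b, IntervalIntegrable (fun r => ‖f r‖ ^ 2) volume a b := fun a b =>
    (hf.norm.pow 2).intervalIntegrable _ _
  have hL1 : ∫ r in x..y, ‖f r‖ ^ 2 ≤ L := by
    refine le_trans ?_ hL
    refine intervalIntegral.integral_mono_interval hx hxy hy (.of_forall fun r => by positivity) (hsq _ _)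
  have hL0 : 0 ≤ ∫ r in x..y, ‖f r‖ ^ 2 :=
    intervalIntegral.integral_nonneg hxy fun r _ => by positivity
  rcases hxy.eq_or_lt with rfl | hlt
  · simp
  set q := Real.sqrt (y - x) with hq
  have hq0 : 0 < q := Real.sqrt_pos.2 (by linarith)
  have hqq : q * q = y - x := Real.mul_self_sqrt (by linarith)
  calc ∫ r in x..y, ‖f r‖ ≤ ∫ r in x..y, (q⁻¹ + q * ‖f r‖ ^ 2) := by
        refine intervalIntegral.integral_mono_on hxy (hf.norm.intervalIntegrable _ _)
          ((intervalIntegrable_const).add ((hsq _ _).const_mul _)) fun r _ => ?_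
        have h1 : q⁻¹ + q * ‖f r‖ ^ 2 - ‖f r‖ = q⁻¹ * ((1 - q * ‖f r‖) ^ 2 + q * ‖f r‖) := by
          field_simp; ring
        have h2 : 0 ≤ q⁻¹ * ((1 - q * ‖f r‖) ^ 2 + q * ‖f r‖) := by positivity
        linarith
    _ = (y - x) * q⁻¹ + q * ∫ r in x..y, ‖f r‖ ^ 2 := by
        rw [intervalIntegral.integral_add intervalIntegrable_const ((hsq _ _).const_mul _),
          intervalIntegral.integral_const, intervalIntegral.integral_const_mul, smul_eq_mul]
    _ ≤ q + q * L := by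
        rw [← hqq, mul_inv_cancel_right₀ hq0.ne']
        gcongr
    _ = _ := by ring

lemma holBound_psi {α : ℝ} (hα : α ≤ 1) (n : Freq) {f : ℝ → ℂ} (hf : Continuous f) (h0 : f 0 = 0)
    {T L : ℝ} (hT : 0 < T) (hL : ∫ r in (0 : ℝ)..T, ‖f r‖ ^ 2 ≤ L) :
    HolBound T ((1 + T) * (1 + L) * jb n ^ 2) (psi α n f) := by
  have hL0 : 0 ≤ L := (intervalIntegral.integral_nonneg hT.le fun r _ => by positivity).trans hL
  refine HolBound.of_le fun t ht t' ht' htt => ?_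
  have hj := jb_pos n
  have hj1 := one_le_jb n
  have hI : ∀ t x y, IntervalIntegrable
      (fun r => (Real.cos ((t - r) * jb n) : ℂ) * f r) volume x y := fun t x y =>
    (Continuous.mul (by fun_prop) hf).intervalIntegrable _ _
  have e : (∫ r in (0 : ℝ)..t, (Real.cos ((t - r) * jb n) : ℂ) * f r) -
      ∫ r in (0 : ℝ)..t', (Real.cos ((t' - r) * jb n) : ℂ) * f r =
      (∫ r in (0 : ℝ)..t', ((Real.cos ((t - r) * jb n) - Real.cos ((t' - r) * jb n) : ℝ) : ℂ) *
        f r) + ∫ r in t'..t, (Real.cos ((t - r) * jb n) : ℂ) * f r := by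
    rw [← intervalIntegral.integral_add_adjacent_intervals (hI t 0 t') (hI t t' t), add_sub_right_comm,
      ← intervalIntegral.integral_sub (hI t 0 t') (hI t' 0 t')]
    congr 2
    funext r; push_cast; ring
  have hcos : ∀ x y : ℝ, |Real.cos x - Real.cos y| ≤ |x - y| := fun x y => by
    have := Real.lipschitzWith_cos.dist_le_mul x y
    simpa [Real.dist_eq] using this
  have b1 : ‖∫ r in (0 : ℝ)..t', ((Real.cos ((t - r) * jb n) - Real.cos ((t' - r) * jb n) : ℝ) : ℂ) *
      f r‖ ≤ (t - t') * jb n * ((1 + L) * Real.sqrt T) := by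
    calc _ ≤ ∫ r in (0 : ℝ)..t', (t - t') * jb n * ‖f r‖ := by
          refine intervalIntegral.norm_integral_le_of_norm_le ht'.1 (.of_forall fun r hr => ?_)
            ((hf.norm.const_mul _).intervalIntegrable _ _)
          rw [norm_mul, Complex.norm_real, Real.norm_eq_abs]
          refine mul_le_mul_of_nonneg_right ((hcos _ _).trans_eq ?_) (norm_nonneg _)
          rw [← sub_mul, sub_sub_sub_cancel_right, abs_mul, abs_of_pos hj, abs_of_nonneg (by linarith)]
      _ ≤ _ := by
          rw [intervalIntegral.integral_const_mul]
          refine mul_le_mul_of_nonneg_left ?_ (mul_nonneg (by linarith) hj.le)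
          refine (integral_norm_le_sqrt hf hL le_rfl ht'.1 ht'.2).trans ?_
          rw [sub_zero]
          gcongr
          exact ht'.2
  have b2 : ‖∫ r in t'..t, (Real.cos ((t - r) * jb n) : ℂ) * f r‖ ≤ (1 + L) * Real.sqrt (t - t') := by
    refine le_trans ?_ (integral_norm_le_sqrt hf hL ht'.1 htt ht.2)
    refine intervalIntegral.norm_integral_le_of_norm_le htt (.of_forall fun r hr => ?_)
      (hf.norm.intervalIntegrable _ _)
    rw [norm_mul, Complex.norm_real, Real.norm_eq_abs]
    exact mul_le_of_le_one_left (norm_nonneg _) (Real.abs_cos_le_one _)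
  rw [psi_eq α n h0, psi_eq α n h0, ← mul_sub, e, norm_mul, Complex.norm_real,
    Real.norm_of_nonneg (jb_rpow_pos _ _).le]
  set q := Real.sqrt (t - t')
  have h3 : (t - t') * Real.sqrt T ≤ T * q := by
    calc _ ≤ (Real.sqrt T * q) * Real.sqrt T :=
          mul_le_mul_of_nonneg_right (le_sqrt_mul_sqrt ht.2 ht'.1 htt) (Real.sqrt_nonneg _)
      _ = (Real.sqrt T * Real.sqrt T) * q := by ring
      _ = _ := by rw [Real.mul_self_sqrt hT.le]
  calc _ ≤ jb n ^ (1 : ℝ) * ((t - t') * jb n * ((1 + L) * Real.sqrt T) + (1 + L) * q) := by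
        refine mul_le_mul (jb_rpow_le n hα) ((norm_add_le _ _).trans (add_le_add b1 b2))
          (norm_nonneg _) (jb_rpow_pos _ _).le
    _ = jb n * ((1 + L) * (((t - t') * Real.sqrt T) * jb n + q * 1)) := by rw [Real.rpow_one]; ring
    _ ≤ jb n * ((1 + L) * ((T * q) * jb n + q * jb n)) := by gcongr
    _ = _ := by ring

variable {Ω : Type*}

lemma measurable_intervalIntegral {m : MeasurableSpace Ω} {F : ℝ → Ω → ℂ}
    (hc : ∀ ω, Continuous fun r => F r ω) {t T : ℝ} (hT : 0 ≤ T) (ht : t ≤ T)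
    (hm : ∀ r ≤ T, Measurable (F r)) : Measurable fun ω => ∫ r in (0 : ℝ)..t, F r ω := by
  have e : ∀ ω, ∫ r in (0 : ℝ)..t, F r ω = ∫ r in (0 : ℝ)..t, F (min r T) ω := fun ω => by
    refine intervalIntegral.integral_congr fun r hr => ?_
    have : r ≤ T := by
      rw [mem_uIcc] at hr
      rcases hr with h | h <;> linarith
    simp only [min_eq_left this]
  have hu : Measurable (Function.uncurry fun r ω => F (min r T) ω) :=
    measurable_uncurry_of_continuous_of_measurable
      (fun ω => (hc ω).comp (by fun_prop : Continuous fun r : ℝ => min r T))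
      fun r => hm _ (min_le_right _ _)
  simp_rw [e, intervalIntegral]
  exact (hu.stronglyMeasurable.integral_prod_left' (μ := volume.restrict (Ioc 0 t))).measurable.sub
    (hu.stronglyMeasurable.integral_prod_left' (μ := volume.restrict (Ioc t 0))).measurable

lemma measurable_psi {m : MeasurableSpace Ω} (α : ℝ) (n : Freq) {p : ℝ → Ω → ℂ}
    (hc : ∀ ω, Continuous fun r => p r ω) (h0 : ∀ ω, p 0 ω = 0) {t T : ℝ} (hT : 0 ≤ T) (ht : t ≤ T)
    (hm : ∀ r ≤ T, Measurable (p r)) : Measurable fun ω => psi α n (fun r => p r ω) t := by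
  simp_rw [fun ω => psi_eq α n (b := fun r => p r ω) (h0 ω) t]
  exact (measurable_intervalIntegral (F := fun r ω => (Real.cos ((t - r) * jb n) : ℂ) * p r ω)
    (fun ω => Continuous.mul (by fun_prop) (hc ω)) hT ht fun r hr => (hm r hr).const_mul _).const_mul _

variable [MeasurableSpace Ω] {P : Measure Ω} {b : Freq → ℝ → Ω → ℂ}

/-- Almost surely, the noise at different frequencies is polynomially bounded. -/
lemma IsNoise.ae_integral_sq_le (hb : IsNoise P b) [IsProbabilityMeasure P] {T : ℝ} (hT : 0 ≤ T) :
    ∀ᵐ ω ∂P, ∃ C : ℝ, 0 ≤ C ∧ ∀ n, ∫ r in (0 : ℝ)..T, ‖b n r ω‖ ^ 2 ≤ C * jb n ^ 4 := by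
  have hu : ∀ n, Measurable (Function.uncurry fun r ω => b n r ω) := fun n =>
    measurable_uncurry_of_continuous_of_measurable (hb.cont n) (hb.meas n)
  set X : Freq → Ω → ℝ≥0∞ := fun n ω => ∫⁻ r in Ioc 0 T, ‖b n r ω‖ₑ ^ 2 with hX
  have hXm : ∀ n, Measurable (X n) := fun n =>
    ((hu n).enorm.pow_const 2).lintegral_prod_left' (μ := volume.restrict (Ioc 0 T))
  have hE : ∀ n r, 0 ≤ r → ∫⁻ ω, ‖b n r ω‖ₑ ^ 2 ∂P = ENNReal.ofReal r := by
    intro n r hr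
    have h1 : ((∫ ω, ‖b n r ω‖ ^ 2 ∂P : ℝ) : ℂ) = (r : ℂ) := by
      rw [← integral_complex_ofReal]
      have h2 := hb.cov n (-n) r r hr hr
      rw [add_neg_cancel, if_pos rfl, min_self] at h2
      rw [← h2]
      congr 1; funext ω
      rw [Complex.ofReal_pow, ← Complex.mul_conj', hb.conj]
    have h3 : ∫ ω, ‖b n r ω‖ ^ 2 ∂P = r := by exact_mod_cast h1
    have h2 : ∀ ω, ‖b n r ω‖ₑ ^ 2 = ENNReal.ofReal (‖b n r ω‖ ^ 2) := fun ω => by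
      rw [ENNReal.ofReal_pow (norm_nonneg _), ofReal_norm]
    simp_rw [h2]
    rw [← ofReal_integral_eq_lintegral_ofReal (hb.memLp n r).norm.integrable_sq
      (.of_forall fun ω => by positivity), h3]
  have hXE : ∀ n, ∫⁻ ω, X n ω ∂P ≤ ENNReal.ofReal T * ENNReal.ofReal T := by
    intro n
    rw [hX, lintegral_lintegral_swap]
    · calc _ ≤ ∫⁻ r in Ioc 0 T, ENNReal.ofReal T := by
            refine setLIntegral_mono measurable_const fun r hr => ?_
            rw [hE n r hr.1.le]
            exact ENNReal.ofReal_le_ofReal hr.2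
        _ = _ := by simp
    · exact (((hu n).comp measurable_swap).enorm.pow_const 2).aemeasurable
  set R : Ω → ℝ≥0∞ := fun ω => ∑' n, ENNReal.ofReal (jb n ^ (-4 : ℝ)) * X n ω with hR
  have hRm : Measurable R := Measurable.tsum fun n => (hXm n).const_mul _
  have hRint : ∫⁻ ω, R ω ∂P < ∞ := by
    rw [hR, lintegral_tsum fun n => ((hXm n).const_mul _).aemeasurable]
    refine (ENNReal.tsum_le_tsum (g := fun n => ENNReal.ofReal (jb n ^ (-4 : ℝ)) *
      (ENNReal.ofReal T * ENNReal.ofReal T)) fun n => ?_).trans_lt ?_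
    · rw [lintegral_const_mul _ (hXm n)]
      exact mul_le_mul_right (hXE n) _
    · rw [ENNReal.tsum_mul_right]
      exact ENNReal.mul_lt_top (tsum_jb_rpow_lt_top (by norm_num))
        (ENNReal.mul_lt_top ENNReal.ofReal_lt_top ENNReal.ofReal_lt_top)
  filter_upwards [ae_lt_top hRm hRint.ne] with ω hω
  refine ⟨(R ω).toReal, ENNReal.toReal_nonneg, fun n => ?_⟩
  have h1 : ENNReal.ofReal (jb n ^ (-4 : ℝ)) * X n ω ≤ R ω := ENNReal.le_tsum n
  have hXr : X n ω = ENNReal.ofReal (∫ r in (0 : ℝ)..T, ‖b n r ω‖ ^ 2) := by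
    rw [intervalIntegral.integral_of_le hT, ofReal_integral_eq_lintegral_ofReal]
    · refine lintegral_congr fun r => ?_
      rw [ENNReal.ofReal_pow (norm_nonneg _), ofReal_norm]
    · exact (((hb.cont n ω).norm.pow 2).intervalIntegrable 0 T).1
    · exact .of_forall fun r => by positivity
  have h2 := ENNReal.toReal_mono hω.ne h1
  rw [ENNReal.toReal_mul, ENNReal.toReal_ofReal (jb_rpow_pos _ _).le, hXr, ENNReal.toReal_ofReal
    (intervalIntegral.integral_nonneg hT fun r _ => by positivity), Real.rpow_neg (jb_pos n).le,
    inv_mul_le_iff₀ (jb_rpow_pos _ _)] at h2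
  rw [mul_comm]
  exact_mod_cast h2

end PathBounds

/-! ### The stochastic objects as random Fourier series -/

section Approximations

/-- The truncated stochastic convolution along a family of paths. -/
def convT (α : ℝ) (f : Freq → ℝ → ℂ) (N : ℕ) (t : ℝ) : Distr :=
  fun n => if n ∈ ball N then psi α n (f n) t else 0

/-- The truncated Wick power along a family of paths. -/
def wickT (α : ℝ) (f : Freq → ℝ → ℂ) (N : ℕ) (t : ℝ) : Distr :=
  fun n => (2 * (Real.pi : ℂ))⁻¹ *
    ∑ k ∈ ball N, if n - k ∈ ball N then wickPair α f k (n - k) t else 0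

lemma neg_mem_ball {N : ℕ} {n : Freq} : -n ∈ ball N ↔ n ∈ ball N := by
  simp [mem_ball, normSq]

lemma stochConvTrunc_eq {Ω : Type*} (α : ℝ) (β : Freq → ℝ≥0 → Ω → ℂ) (N : ℕ) (ω : Ω) (t : ℝ) :
    stochConvTrunc α β N ω t = convT α (fun n t => β n t.toNNReal ω) N t := by
  classical
  funext n
  simp only [stochConvTrunc, proj, convT, mem_ball]
  split_ifs <;> rfl

lemma wickTrunc_eq {Ω : Type*} (α : ℝ) (β : Freq → ℝ≥0 → Ω → ℂ) (N : ℕ) (ω : Ω) (t : ℝ) :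
    wickTrunc α β N ω t = wickT α (fun n t => β n t.toNNReal ω) N t := by
  classical
  set f : Freq → ℝ → ℂ := fun n t => β n t.toNNReal ω
  funext n
  have h1 : mul (convT α f N t) (convT α f N t) n = (2 * (Real.pi : ℂ))⁻¹ * ∑ k ∈ ball N,
      if n - k ∈ ball N then psi α k (f k) t * psi α (n - k) (f (n - k)) t else 0 := by
    rw [mul, tsum_eq_sum (s := ball N) fun k hk => by rw [convT, if_neg hk, zero_mul]]
    congr 1
    refine Finset.sum_congr rfl fun k hk => ?_
    simp only [convT, if_pos hk, mul_ite, mul_zero]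
  have h2 : constDistr (sigmaN α N t) n = (2 * (Real.pi : ℂ))⁻¹ * ∑ k ∈ ball N,
      if n - k ∈ ball N then (if k + (n - k) = 0 then (psiVar α k t : ℂ) else 0) else 0 := by
    rw [constDistr]
    split_ifs with hn
    · subst hn
      have hσ : sigmaN α N t = (4 * Real.pi ^ 2)⁻¹ * ∑ k ∈ ball N, psiVar α k t := by
        rw [sigmaN, tsum_eq_sum (s := ball N) fun k hk => by rw [if_neg (by rwa [mem_ball] at hk)]]
        congr 1
        exact Finset.sum_congr rfl fun k hk => if_pos (mem_ball.1 hk)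
      have hs : ∑ k ∈ ball N, (if (0 : Freq) - k ∈ ball N then
          (if k + (0 - k) = 0 then (psiVar α k t : ℂ) else 0) else 0) =
          ((∑ k ∈ ball N, psiVar α k t : ℝ) : ℂ) := by
        rw [Complex.ofReal_sum]
        refine Finset.sum_congr rfl fun k hk => ?_
        rw [if_pos (by rw [zero_sub, neg_mem_ball]; exact hk), if_pos (by simp)]
      have hπ : (Real.pi : ℂ) ≠ 0 := by exact_mod_cast Real.pi_ne_zero
      rw [hs, hσ]
      push_cast
      field_simp
      norm_num
    · rw [Finset.sum_eq_zero, mul_zero]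
      intro k _
      rw [add_sub_cancel, if_neg hn, ite_self]
  rw [wickTrunc, Pi.sub_apply, stochConvTrunc_eq, h1, h2, ← mul_sub, ← Finset.sum_sub_distrib]
  rw [wickT]
  congr 1
  refine Finset.sum_congr rfl fun k _ => ?_
  by_cases hk : n - k ∈ ball N
  · simp only [if_pos hk, wickPair]
  · simp only [if_neg hk, sub_zero]

lemma secondOrderTrunc_eq {Ω : Type*} (α : ℝ) (β : Freq → ℝ≥0 → Ω → ℂ) (N : ℕ) (ω : Ω) (t : ℝ) :
    secondOrderTrunc α β N ω t = duhamel (wickT α (fun n t => β n t.toNNReal ω) N) t := by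
  rw [secondOrderTrunc]
  congr 1
  funext t
  exact wickTrunc_eq α β N ω t

section Paths

variable (α : ℝ) {f : Freq → ℝ → ℂ}

lemma continuous_wickPair (hf : ∀ n, Continuous (f n)) (h0 : ∀ n, f n 0 = 0) (k l : Freq) :
    Continuous (wickPair α f k l) := by
  unfold wickPair
  refine ((continuous_psi α k (hf k) (h0 k)).mul (continuous_psi α l (hf l) (h0 l))).sub ?_
  split_ifs
  · exact Complex.continuous_ofReal.comp (continuous_psiVar α k)
  · exact continuous_const

lemma continuous_wickT (hf : ∀ n, Continuous (f n)) (h0 : ∀ n, f n 0 = 0) (N : ℕ) (n : Freq) :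
    Continuous fun t => wickT α f N t n := by
  unfold wickT
  refine continuous_const.mul (continuous_finsetSum _ fun k _ => ?_)
  split_ifs
  · exact continuous_wickPair α hf h0 _ _
  · exact continuous_const

lemma continuous_convT (hf : ∀ n, Continuous (f n)) (h0 : ∀ n, f n 0 = 0) (N : ℕ) (n : Freq) :
    Continuous fun t => convT α f N t n := by
  unfold convT
  split_ifs
  · exact continuous_psi α n (hf n) (h0 n)
  · exact continuous_const

lemma wickPair_zero (h0 : ∀ n, f n 0 = 0) (k l : Freq) : wickPair α f k l 0 = 0 := by
  simp [wickPair, psi_zero_time α k (h0 k), psiVar]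

lemma wickT_zero (h0 : ∀ n, f n 0 = 0) (N : ℕ) (n : Freq) : wickT α f N 0 n = 0 := by
  simp [wickT, wickPair_zero α h0]

lemma convT_zero (h0 : ∀ n, f n 0 = 0) (N : ℕ) (n : Freq) : convT α f N 0 n = 0 := by
  simp [convT, psi_zero_time α n (h0 n)]

lemma wickT_of_notMem (N : ℕ) (t : ℝ) {n : Freq} (hn : n ∉ ball (2 * N)) : wickT α f N t n = 0 := by
  rw [wickT, Finset.sum_eq_zero, mul_zero]
  intro k hk
  rw [if_neg]
  intro h
  exact hn (by simpa using add_mem_ball hk h)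

lemma convT_of_notMem (N : ℕ) (t : ℝ) {n : Freq} (hn : n ∉ ball (2 * N)) : convT α f N t n = 0 := by
  rw [convT, if_neg fun h => hn (ball_mono (by omega) h)]

lemma duhamel_eq_zero {F : ℝ → Distr} {n : Freq} (h : ∀ t, F t n = 0) (t : ℝ) :
    duhamel F t n = 0 := by
  simp [duhamel, h]

variable {α} {T C : ℝ}

lemma holBound_psi_of_sq (hα : α ≤ 1) (hf : ∀ n, Continuous (f n)) (h0 : ∀ n, f n 0 = 0) (hT : 0 < T)
    (hC : 0 ≤ C) (hL : ∀ n, ∫ r in (0 : ℝ)..T, ‖f n r‖ ^ 2 ≤ C * jb n ^ 4) {N : ℕ} {n : Freq}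
    (hn : n ∈ ball N) : HolBound T ((1 + T) * (1 + C) * ((N : ℝ) + 1) ^ 6) (psi α n (f n)) := by
  refine (holBound_psi hα n (hf n) (h0 n) hT (hL n)).mono ?_
  have hj := jb_le_of_mem_ball hn
  have hj1 := one_le_jb n
  have hN : (1 : ℝ) ≤ (N : ℝ) + 1 := hj1.trans hj
  calc _ ≤ (1 + T) * ((1 + C) * ((N : ℝ) + 1) ^ 4) * ((N : ℝ) + 1) ^ 2 := by
        gcongr
        have : (1 : ℝ) ≤ ((N : ℝ) + 1) ^ 4 := one_le_pow₀ hN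
        have h2 : jb n ^ 4 ≤ ((N : ℝ) + 1) ^ 4 := pow_le_pow_left₀ (jb_pos n).le hj 4
        nlinarith
    _ = _ := by ring

lemma holBound_convT (hα : α ≤ 1) (hf : ∀ n, Continuous (f n)) (h0 : ∀ n, f n 0 = 0) (hT : 0 < T)
    (hC : 0 ≤ C) (hL : ∀ n, ∫ r in (0 : ℝ)..T, ‖f n r‖ ^ 2 ≤ C * jb n ^ 4) (N : ℕ) (n : Freq) :
    HolBound T ((1 + T) * (1 + C) * ((N : ℝ) + 1) ^ 6) (fun t => convT α f N t n) := by
  by_cases hn : n ∈ ball N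
  · simp only [convT, if_pos hn]
    exact holBound_psi_of_sq hα hf h0 hT hC hL hn
  · simp only [convT, if_neg hn]
    exact (HolBound.zero T).mono (by positivity)

lemma holBound_wickT (hα : α ≤ 1) (hf : ∀ n, Continuous (f n)) (h0 : ∀ n, f n 0 = 0) (hT : 0 < T)
    (hC : 0 ≤ C) (hL : ∀ n, ∫ r in (0 : ℝ)..T, ‖f n r‖ ^ 2 ≤ C * jb n ^ 4) (N : ℕ) (n : Freq) :
    HolBound T (4 * (2 * ((1 + T) * (1 + C)) ^ 2 * Real.sqrt T + Real.sqrt T) * ((N : ℝ) + 1) ^ 14)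
      (fun t => wickT α f N t n) := by
  have hN : (1 : ℝ) ≤ (N : ℝ) + 1 := by linarith [(Nat.cast_nonneg N : (0 : ℝ) ≤ N)]
  set E := (2 * ((1 + T) * (1 + C)) ^ 2 * Real.sqrt T + Real.sqrt T) with hE
  have hE0 : 0 ≤ E := by positivity
  have hterm : ∀ k ∈ ball N, HolBound T (E * ((N : ℝ) + 1) ^ 12)
      (fun t => if n - k ∈ ball N then wickPair α f k (n - k) t else 0) := by
    intro k hk
    by_cases hl : n - k ∈ ball N
    · simp only [if_pos hl, wickPair]
      have h1 := (holBound_psi_of_sq hα hf h0 hT hC hL hk).mul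
        (holBound_psi_of_sq hα hf h0 hT hC hL hl) hT (psi_zero_time α _ (h0 _))
        (psi_zero_time α _ (h0 _))
      have h2 : HolBound T (Real.sqrt T)
          (fun t => if k + (n - k) = 0 then (psiVar α k t : ℂ) else 0) := by
        split_ifs
        · exact holBound_psiVar hα k T
        · exact (HolBound.zero T).mono (Real.sqrt_nonneg _)
      refine (h1.sub h2).mono ?_
      have h3 : Real.sqrt T ≤ Real.sqrt T * ((N : ℝ) + 1) ^ 12 :=
        le_mul_of_one_le_right (Real.sqrt_nonneg _) (one_le_pow₀ hN)
      rw [hE]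
      nlinarith
    · simp only [if_neg hl]
      exact (HolBound.zero T).mono (by positivity)
  refine ((HolBound.sum hterm).const_mul (2 * (Real.pi : ℂ))⁻¹).mono ?_
  have h0 : ‖(2 * (Real.pi : ℂ))⁻¹‖ ≤ 1 := by
    rw [norm_inv, norm_mul, Complex.norm_real, Real.norm_of_nonneg Real.pi_pos.le]
    refine inv_le_one_of_one_le₀ ?_
    simp only [Complex.norm_ofNat]
    linarith [Real.pi_gt_three]
  have hc := card_ball_le N
  calc _ ≤ 1 * ((2 * ((N : ℝ) + 1)) ^ 2 * (E * ((N : ℝ) + 1) ^ 12)) := by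
        gcongr
        refine hc.trans ?_
        gcongr
        linarith
    _ = _ := by ring

lemma holBound_duhamel_wickT (hα : α ≤ 1) (hf : ∀ n, Continuous (f n)) (h0 : ∀ n, f n 0 = 0)
    (hT : 0 < T) (hC : 0 ≤ C) (hL : ∀ n, ∫ r in (0 : ℝ)..T, ‖f n r‖ ^ 2 ≤ C * jb n ^ 4) (N : ℕ)
    (n : Freq) :
    HolBound T ((1 + T) * (4 * (2 * ((1 + T) * (1 + C)) ^ 2 * Real.sqrt T + Real.sqrt T) *
      ((N : ℝ) + 1) ^ 14 * Real.sqrt T) * Real.sqrt T) (fun t => duhamel (wickT α f N) t n) :=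
  HolBound.duhamel hT (continuous_wickT α hf h0 N n) (wickT_zero α h0 N n)
    (holBound_wickT hα hf h0 hT hC hL N n)

end Paths

section Measurability

variable {Ω : Type*} {m : MeasurableSpace Ω} {p : Freq → ℝ → Ω → ℂ} {T : ℝ}

lemma measurable_convT (α : ℝ) (hc : ∀ n ω, Continuous fun r => p n r ω) (h0 : ∀ n ω, p n 0 ω = 0)
    (hT : 0 ≤ T) (hm : ∀ n, ∀ r ≤ T, Measurable (p n r)) {t : ℝ} (ht : t ≤ T) (N : ℕ) (n : Freq) :
    Measurable fun ω => convT α (fun n r => p n r ω) N t n := by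
  unfold convT
  split_ifs
  · exact measurable_psi α n (hc n) (h0 n) hT ht (hm n)
  · exact measurable_const

lemma measurable_wickT (α : ℝ) (hc : ∀ n ω, Continuous fun r => p n r ω) (h0 : ∀ n ω, p n 0 ω = 0)
    (hT : 0 ≤ T) (hm : ∀ n, ∀ r ≤ T, Measurable (p n r)) {t : ℝ} (ht : t ≤ T) (N : ℕ) (n : Freq) :
    Measurable fun ω => wickT α (fun n r => p n r ω) N t n := by
  unfold wickT
  refine (Finset.measurable_fun_sum _ fun k _ => ?_).const_mul _
  split_ifs
  · exact ((measurable_psi α _ (hc _) (h0 _) hT ht (hm _)).mul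
      (measurable_psi α _ (hc _) (h0 _) hT ht (hm _))).sub_const _
  · exact measurable_const

lemma measurable_duhamel_wickT (α : ℝ) (hc : ∀ n ω, Continuous fun r => p n r ω)
    (h0 : ∀ n ω, p n 0 ω = 0) (hT : 0 ≤ T) (hm : ∀ n, ∀ r ≤ T, Measurable (p n r)) {t : ℝ} (ht : t ≤ T)
    (N : ℕ) (n : Freq) :
    Measurable fun ω => duhamel (wickT α (fun n r => p n r ω) N) t n :=
  measurable_intervalIntegral
    (F := fun r ω => ((Real.sin ((t - r) * jb n) / jb n : ℝ) : ℂ) * wickT α (fun n r => p n r ω) N r n)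
    (fun ω => Continuous.mul (by fun_prop) (continuous_wickT α (fun n => hc n ω) (fun n => h0 n ω) N n))
    hT ht fun r hr => (measurable_wickT α hc h0 hT hm hr N n).const_mul _

end Measurability

/-! ### Moments of the increments of the approximations -/

lemma sum_ball_wick (c : Freq → ℂ) (I : Freq → Freq → ℂ) {M N : ℕ} (hMN : M ≤ N) :
    ∑ n ∈ ball (2 * N), c n * ((2 * (Real.pi : ℂ))⁻¹ *
      ∑ k ∈ ball M, if n - k ∈ ball M then I k (n - k) else 0) =
    ∑ k ∈ ball N, ∑ l ∈ ball N,
      (if k ∈ ball M ∧ l ∈ ball M then c (k + l) * (2 * (Real.pi : ℂ))⁻¹ else 0) * I k l := by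
  have hsub := ball_mono hMN
  have hR : ∑ k ∈ ball N, ∑ l ∈ ball N,
      (if k ∈ ball M ∧ l ∈ ball M then c (k + l) * (2 * (Real.pi : ℂ))⁻¹ else 0) * I k l =
      ∑ k ∈ ball M, ∑ l ∈ ball M, c (k + l) * (2 * (Real.pi : ℂ))⁻¹ * I k l := by
    rw [← Finset.sum_subset hsub]
    · refine Finset.sum_congr rfl fun k hk => ?_
      rw [← Finset.sum_subset hsub]
      · exact Finset.sum_congr rfl fun l hl => by rw [if_pos ⟨hk, hl⟩]
      · intro l _ hl
        rw [if_neg fun h => hl h.2, zero_mul]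
    · intro k _ hk
      exact Finset.sum_eq_zero fun l _ => by rw [if_neg fun h => hk h.1, zero_mul]
  rw [hR]
  simp_rw [Finset.mul_sum]
  rw [Finset.sum_comm]
  refine Finset.sum_congr rfl fun k hk => ?_
  simp_rw [mul_ite, mul_zero]
  rw [← Finset.sum_filter]
  refine Finset.sum_nbij' (fun n => n - k) (fun l => l + k) (fun n hn => (Finset.mem_filter.1 hn).2)
    (fun l hl => Finset.mem_filter.2 ⟨?_, by simpa using hl⟩) (by simp) (by simp) fun n _ => ?_
  · exact ball_mono (by omega : 2 * M ≤ 2 * N) (add_mem_ball hl hk)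
  · rw [add_sub_cancel, mul_assoc]

variable {Ω : Type*} [MeasurableSpace Ω] {P : Measure Ω} {b : Freq → ℝ → Ω → ℂ}

/-- Functionals, in time, of the increments of the Wick powers. -/
lemma trigSum_wick_eq (α s : ℝ) {f : Freq → ℝ → ℂ} (hf : ∀ n, Continuous (f n)) (h0 : ∀ n, f n 0 = 0)
    {T : ℝ} {ν : Measure ℝ} (hν : ∀ᵐ t ∂ν, t ∈ Icc 0 T) {g : Freq → ℝ → ℂ}
    (hg : ∀ n, Integrable (g n) ν) {M N : ℕ} (hMN : M ≤ N) (x : Torus) :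
    trigSum (ball (2 * N)) (wt s fun n => ∫ t, g n t * (wickT α f N t n - wickT α f M t n) ∂ν) x =
      ∑ k ∈ ball N, ∑ l ∈ ball N, ∫ t,
        (((if k ∈ ball N ∧ l ∈ ball N then
          ((jb (k + l) ^ s : ℝ) : ℂ) * basisFun (k + l) x * (2 * (Real.pi : ℂ))⁻¹ else 0) -
        (if k ∈ ball M ∧ l ∈ ball M then
          ((jb (k + l) ^ s : ℝ) : ℂ) * basisFun (k + l) x * (2 * (Real.pi : ℂ))⁻¹ else 0)) *
          g (k + l) t) * wickPair α f k l t ∂ν := by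
  have hint : ∀ n k l, Integrable (fun t => g n t * wickPair α f k l t) ν := by
    intro n k l
    have hc := continuous_wickPair α hf h0 k l
    obtain ⟨C, hC⟩ := (isCompact_Icc (a := (0 : ℝ)) (b := T)).exists_bound_of_continuousOn hc.continuousOn
    exact (hg n).mul_bdd (c := C) hc.aestronglyMeasurable (hν.mono fun t ht => hC t ht)
  set I : Freq → Freq → ℂ := fun k l => ∫ t, g (k + l) t * wickPair α f k l t ∂ν with hI
  have hite : ∀ (n k l : Freq) (M : ℕ), Integrable (fun t => g n t *
      if l ∈ ball M then wickPair α f k l t else 0) ν := by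
    intro n k l M
    split_ifs
    · exact hint n k l
    · simp
  have hwI : ∀ M n, Integrable (fun t => g n t * wickT α f M t n) ν ∧
      ∫ t, g n t * wickT α f M t n ∂ν = (2 * (Real.pi : ℂ))⁻¹ *
        ∑ k ∈ ball M, if n - k ∈ ball M then I k (n - k) else 0 := by
    intro M n
    have e : ∀ t, g n t * wickT α f M t n = (2 * (Real.pi : ℂ))⁻¹ *
        ∑ k ∈ ball M, g n t * if n - k ∈ ball M then wickPair α f k (n - k) t else 0 := fun t => by
      rw [wickT, mul_left_comm, Finset.mul_sum]
    simp_rw [e]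
    refine ⟨(integrable_finsetSum _ fun k _ => hite n k (n - k) M).const_mul _, ?_⟩
    rw [integral_const_mul, integral_finsetSum _ fun k _ => hite n k (n - k) M]
    congr 1
    refine Finset.sum_congr rfl fun k _ => ?_
    split_ifs
    · rw [hI]; simp only [add_sub_cancel]
    · simp
  have hdiff : ∀ n, ∫ t, g n t * (wickT α f N t n - wickT α f M t n) ∂ν =
      (2 * (Real.pi : ℂ))⁻¹ * (∑ k ∈ ball N, if n - k ∈ ball N then I k (n - k) else 0) -
      (2 * (Real.pi : ℂ))⁻¹ * ∑ k ∈ ball M, if n - k ∈ ball M then I k (n - k) else 0 := by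
    intro n
    simp_rw [mul_sub]
    rw [integral_sub (hwI N n).1 (hwI M n).1, (hwI N n).2, (hwI M n).2]
  have e1 : trigSum (ball (2 * N)) (wt s fun n => ∫ t, g n t * (wickT α f N t n - wickT α f M t n) ∂ν) x =
      ∑ n ∈ ball (2 * N), ((jb n ^ s : ℝ) : ℂ) * basisFun n x * ((2 * (Real.pi : ℂ))⁻¹ *
        (∑ k ∈ ball N, if n - k ∈ ball N then I k (n - k) else 0)) -
      ∑ n ∈ ball (2 * N), ((jb n ^ s : ℝ) : ℂ) * basisFun n x * ((2 * (Real.pi : ℂ))⁻¹ *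
        ∑ k ∈ ball M, if n - k ∈ ball M then I k (n - k) else 0) := by
    rw [trigSum, ← Finset.sum_sub_distrib]
    refine Finset.sum_congr rfl fun n _ => ?_
    rw [wt, hdiff]; ring
  rw [e1, sum_ball_wick (fun n => ((jb n ^ s : ℝ) : ℂ) * basisFun n x) I le_rfl,
    sum_ball_wick (fun n => ((jb n ^ s : ℝ) : ℂ) * basisFun n x) I hMN, ← Finset.sum_sub_distrib]
  refine Finset.sum_congr rfl fun k _ => ?_
  rw [← Finset.sum_sub_distrib]
  refine Finset.sum_congr rfl fun l _ => ?_
  simp_rw [mul_assoc]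
  rw [integral_const_mul, ← sub_mul]

lemma tail_rpow_le {δ : ℝ} (hδ : 0 ≤ δ) {M : ℕ} (hM : 1 ≤ M) {k l : Freq}
    (h : ¬(k ∈ ball M ∧ l ∈ ball M)) :
    jb k ^ (-(2 * δ)) * jb l ^ (-(2 * δ)) ≤ (M : ℝ) ^ (-(2 * δ)) := by
  have hM0 : (0 : ℝ) < M := by exact_mod_cast hM
  have h1 : ∀ k, jb k ^ (-(2 * δ)) ≤ 1 := fun k =>
    Real.rpow_le_one_of_one_le_of_nonpos (one_le_jb k) (by linarith)
  have h2 : ∀ k, k ∉ ball M → jb k ^ (-(2 * δ)) ≤ (M : ℝ) ^ (-(2 * δ)) := fun k hk =>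
    Real.rpow_le_rpow_of_nonpos hM0 (le_jb_of_notMem_ball hk) (by linarith)
  rcases not_and_or.1 h with h | h
  · exact (mul_le_of_le_one_right (jb_rpow_pos _ _).le (h1 l)).trans (h2 k h)
  · exact (mul_le_of_le_one_left (jb_rpow_pos _ _).le (h1 k)).trans (h2 l h)

/-- Moments of functionals, in time, of the increments of the Wick powers. -/
lemma lintegral_trigSum_wick_le [IsProbabilityMeasure P] (hb : IsNoise P b) {α s B δ T : ℝ} (hδ : 0 ≤ δ)
    (hB : 2 * α - 2 = -B + -(2 * δ)) (hT : 0 ≤ T) {ν : Measure ℝ} (hν : ∀ᵐ t ∂ν, t ∈ Icc 0 T)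
    {g : Freq → ℝ → ℂ} (hg : ∀ n, Integrable (g n) ν) {G : Freq → Freq → ℝ≥0∞}
    (hG : ∀ k l, ∀ r ∈ Icc 0 T, ∀ r' ∈ Icc 0 T,
      ‖∫ t, g (k + l) t * ((sinPos k t r : ℂ) * (sinPos l t r' : ℂ)) ∂ν‖ₑ ≤ G k l) {C : ℝ≥0∞}
    (hC : ∑' p : Freq × Freq, ENNReal.ofReal (jb (p.1 + p.2) ^ (2 * s) * jb p.1 ^ (-B) * jb p.2 ^ (-B)) *
      G p.1 p.2 ^ 2 ≤ C) {p : ℕ} (hp : 1 ≤ p) {M N : ℕ} (hM : 1 ≤ M) (hMN : M ≤ N) (x : Torus) :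
    ∫⁻ ω, ‖trigSum (ball (2 * N)) (wt s fun n => ∫ t, g n t *
      (wickT α (fun n t => b n t ω) N t n - wickT α (fun n t => b n t ω) M t n) ∂ν) x‖ₑ ^ (2 * p) ∂P ≤
      2 ^ (2 * p + 1) * linMoment p ^ 2 * (ENNReal.ofReal T ^ 2 * C) ^ p *
        ENNReal.ofReal ((M : ℝ) ^ (-(2 * p * δ))) := by
  have hM0 : (0 : ℝ) < M := by exact_mod_cast hM
  set θ : Freq → Freq → ℂ := fun k l => (if k ∈ ball N ∧ l ∈ ball N then
      ((jb (k + l) ^ s : ℝ) : ℂ) * basisFun (k + l) x * (2 * (Real.pi : ℂ))⁻¹ else 0) -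
    (if k ∈ ball M ∧ l ∈ ball M then
      ((jb (k + l) ^ s : ℝ) : ℂ) * basisFun (k + l) x * (2 * (Real.pi : ℂ))⁻¹ else 0) with hθ
  have hsub := ball_mono hMN
  have hπ : (2 * Real.pi)⁻¹ ≤ 1 := inv_le_one_of_one_le₀ (by linarith [Real.pi_gt_three])
  have hθ0 : ∀ k l, (k ∈ ball M ∧ l ∈ ball M) → θ k l = 0 := by
    intro k l h
    simp only [hθ]
    rw [if_pos ⟨hsub h.1, hsub h.2⟩, if_pos h, sub_self]
  have hθ1 : ∀ k l, ¬(k ∈ ball M ∧ l ∈ ball M) → ‖θ k l‖ ≤ jb (k + l) ^ s := by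
    intro k l h
    simp only [hθ]
    rw [if_neg h, sub_zero]
    split_ifs
    · have h0 : ‖(2 * (Real.pi : ℂ))⁻¹‖ ≤ 1 := by
        rw [norm_inv, norm_mul, Complex.norm_real, Real.norm_of_nonneg Real.pi_pos.le]
        simpa using hπ
      rw [norm_mul, norm_mul, Complex.norm_real, Real.norm_of_nonneg (jb_rpow_pos _ _).le,
        norm_basisFun]
      have hj := (jb_rpow_pos (k + l) s).le
      calc _ ≤ jb (k + l) ^ s * 1 * 1 := by gcongr
        _ = _ := by ring
    · rw [norm_zero]; exact (jb_rpow_pos _ _).le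
  have hκ : ∀ k l, ∀ r ∈ Icc 0 T, ∀ r' ∈ Icc 0 T,
      ‖∫ t, (θ k l * g (k + l) t) * ((sinPos k t r : ℂ) * (sinPos l t r' : ℂ)) ∂ν‖ₑ ≤
        ‖θ k l‖ₑ * G k l := by
    intro k l r hr r' hr'
    simp_rw [mul_assoc (θ k l)]
    rw [integral_const_mul, enorm_mul]
    exact mul_le_mul_right (hG k l r hr r' hr') _
  have key := lintegral_wickPair_pow_le hb α (ball N) hT hν
    (h := fun k l t => θ k l * g (k + l) t) (fun k l => (hg (k + l)).const_mul _) hκ hp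
  have hsum : ∑ k ∈ ball N, ∑ l ∈ ball N, ENNReal.ofReal (jb k ^ (2 * α - 2)) *
      ENNReal.ofReal (jb l ^ (2 * α - 2)) * (‖θ k l‖ₑ * G k l) ^ 2 ≤
      C * ENNReal.ofReal ((M : ℝ) ^ (-(2 * δ))) := by
    have hpt : ∀ k l, ENNReal.ofReal (jb k ^ (2 * α - 2)) *
        ENNReal.ofReal (jb l ^ (2 * α - 2)) * (‖θ k l‖ₑ * G k l) ^ 2 ≤
        ENNReal.ofReal (jb (k + l) ^ (2 * s) * jb k ^ (-B) * jb l ^ (-B)) * G k l ^ 2 *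
          ENNReal.ofReal ((M : ℝ) ^ (-(2 * δ))) := by
      intro k l
      by_cases h : k ∈ ball M ∧ l ∈ ball M
      · rw [hθ0 k l h]; simp
      · have h1 : ‖θ k l‖ₑ ^ 2 ≤ ENNReal.ofReal (jb (k + l) ^ (2 * s)) := by
          rw [← ofReal_norm, ← ENNReal.ofReal_pow (norm_nonneg _)]
          refine ENNReal.ofReal_le_ofReal ?_
          calc _ ≤ (jb (k + l) ^ s) ^ 2 := pow_le_pow_left₀ (norm_nonneg _) (hθ1 k l h) 2
            _ = _ := by
              rw [← Real.rpow_natCast, ← Real.rpow_mul (jb_pos _).le]; congr 1; push_cast; ring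
        have h2 : jb k ^ (2 * α - 2) * jb l ^ (2 * α - 2) * jb (k + l) ^ (2 * s) ≤
            jb (k + l) ^ (2 * s) * jb k ^ (-B) * jb l ^ (-B) * (M : ℝ) ^ (-(2 * δ)) := by
          rw [hB, Real.rpow_add (jb_pos k), Real.rpow_add (jb_pos l)]
          have h3 := tail_rpow_le hδ hM h
          have h4 : 0 ≤ jb (k + l) ^ (2 * s) * jb k ^ (-B) * jb l ^ (-B) :=
            mul_nonneg (mul_nonneg (jb_rpow_pos _ _).le (jb_rpow_pos _ _).le) (jb_rpow_pos _ _).le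
          calc _ = jb (k + l) ^ (2 * s) * jb k ^ (-B) * jb l ^ (-B) *
                (jb k ^ (-(2 * δ)) * jb l ^ (-(2 * δ))) := by ring
            _ ≤ _ := mul_le_mul_of_nonneg_left h3 h4
        calc _ ≤ ENNReal.ofReal (jb k ^ (2 * α - 2)) * ENNReal.ofReal (jb l ^ (2 * α - 2)) *
              (ENNReal.ofReal (jb (k + l) ^ (2 * s)) * G k l ^ 2) := by
              rw [mul_pow]; gcongr
          _ = ENNReal.ofReal (jb k ^ (2 * α - 2) * jb l ^ (2 * α - 2) * jb (k + l) ^ (2 * s)) *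
              G k l ^ 2 := by
              rw [ENNReal.ofReal_mul (mul_nonneg (jb_rpow_pos _ _).le (jb_rpow_pos _ _).le),
                ENNReal.ofReal_mul (jb_rpow_pos _ _).le]
              ring
          _ ≤ ENNReal.ofReal (jb (k + l) ^ (2 * s) * jb k ^ (-B) * jb l ^ (-B) *
              (M : ℝ) ^ (-(2 * δ))) * G k l ^ 2 := by gcongr
          _ = _ := by
              rw [ENNReal.ofReal_mul (mul_nonneg (mul_nonneg (jb_rpow_pos _ _).le
                (jb_rpow_pos _ _).le) (jb_rpow_pos _ _).le)]
              ring
    calc _ ≤ ∑ k ∈ ball N, ∑ l ∈ ball N,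
          ENNReal.ofReal (jb (k + l) ^ (2 * s) * jb k ^ (-B) * jb l ^ (-B)) * G k l ^ 2 *
          ENNReal.ofReal ((M : ℝ) ^ (-(2 * δ))) :=
          Finset.sum_le_sum fun k _ => Finset.sum_le_sum fun l _ => hpt k l
      _ = (∑ q ∈ ball N ×ˢ ball N, ENNReal.ofReal (jb (q.1 + q.2) ^ (2 * s) * jb q.1 ^ (-B) *
          jb q.2 ^ (-B)) * G q.1 q.2 ^ 2) * ENNReal.ofReal ((M : ℝ) ^ (-(2 * δ))) := by
          rw [Finset.sum_product, Finset.sum_mul]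
          exact Finset.sum_congr rfl fun k _ => (Finset.sum_mul _ _ _).symm
      _ ≤ _ := by
          gcongr
          exact (ENNReal.sum_le_tsum _).trans hC
  have hpowM : ENNReal.ofReal ((M : ℝ) ^ (-(2 * δ))) ^ p = ENNReal.ofReal ((M : ℝ) ^ (-(2 * p * δ))) := by
    rw [← ENNReal.ofReal_pow (by positivity), ← Real.rpow_natCast, ← Real.rpow_mul hM0.le]
    congr 2; ring
  calc _ ≤ 2 ^ (2 * p + 1) * linMoment p ^ 2 *
        (ENNReal.ofReal T ^ 2 * (C * ENNReal.ofReal ((M : ℝ) ^ (-(2 * δ))))) ^ p := by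
        refine le_trans (le_of_eq (lintegral_congr fun ω => ?_))
          (key.trans (mul_le_mul_right (ENNReal.pow_le_pow_left (mul_le_mul_right hsum _)) _))
        rw [trigSum_wick_eq α s (fun n => hb.cont n ω) (fun n => hb.zero n ω) hν hg hMN x]
    _ = _ := by rw [← mul_assoc (ENNReal.ofReal T ^ 2), mul_pow, hpowM]; ring

end Approximations

/-! ### The three approximations -/

section Instances

/-- An oscillatory integral. -/
lemma abs_integral_sin_le {a t T : ℝ} (ha : 0 ≤ a) (hat : a ≤ t) (ht : t ≤ T) (φ μ : ℝ) :
    |∫ x in a..t, Real.sin (φ + μ * x)| ≤ (T + 2) * (1 + |μ|)⁻¹ := by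
  rw [← div_eq_mul_inv, le_div_iff₀ (by positivity), mul_add, mul_one]
  refine add_le_add ?_ ?_
  · refine (intervalIntegral.norm_integral_le_of_norm_le_const (C := 1)
      fun x _ => (Real.norm_eq_abs _).trans_le (Real.abs_sin_le_one _)).trans ?_
    rw [abs_of_nonneg (by linarith)]; linarith
  · rw [← abs_mul, mul_comm, intervalIntegral.mul_integral_comp_add_mul, integral_sin]
    refine (abs_sub _ _).trans ?_
    linarith [Real.abs_cos_le_one (φ + μ * a), Real.abs_cos_le_one (φ + μ * t)]

/-- The sum over the four resonance functions. -/
def resSum (k l : Freq) (q : ℝ) : ℝ :=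
  (1 + |jb (k + l) + 1 * jb k + 1 * jb l|) ^ q + (1 + |jb (k + l) + 1 * jb k + -1 * jb l|) ^ q +
    (1 + |jb (k + l) + -1 * jb k + 1 * jb l|) ^ q + (1 + |jb (k + l) + -1 * jb k + -1 * jb l|) ^ q

lemma resSum_nonneg (k l : Freq) (q : ℝ) : 0 ≤ resSum k l q := by unfold resSum; positivity

lemma resSum_sq_le (k l : Freq) : resSum k l (-1) ^ 2 ≤ 4 * resSum k l (-2) := by
  have h : ∀ y : ℝ, (1 + |y|) ^ (-2 : ℝ) = ((1 + |y|) ^ (-1 : ℝ)) ^ 2 := fun y => by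
    rw [← Real.rpow_natCast, ← Real.rpow_mul (by positivity)]; norm_num
  unfold resSum
  simp_rw [h]
  generalize (1 + |jb (k + l) + 1 * jb k + 1 * jb l|) ^ (-1 : ℝ) = a
  generalize (1 + |jb (k + l) + 1 * jb k + -1 * jb l|) ^ (-1 : ℝ) = b
  generalize (1 + |jb (k + l) + -1 * jb k + 1 * jb l|) ^ (-1 : ℝ) = c
  generalize (1 + |jb (k + l) + -1 * jb k + -1 * jb l|) ^ (-1 : ℝ) = d
  nlinarith [sq_nonneg (a - b), sq_nonneg (a - c), sq_nonneg (a - d), sq_nonneg (b - c),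
    sq_nonneg (b - d), sq_nonneg (c - d)]

lemma sinPos_of_le {n : Freq} {t r : ℝ} (h : t ≤ r) : sinPos n t r = 0 := by
  simp [sinPos, max_eq_right (sub_nonpos.2 h)]

lemma sinPos_of_ge {n : Freq} {t r : ℝ} (h : r ≤ t) : sinPos n t r = Real.sin ((t - r) * jb n) := by
  simp [sinPos, max_eq_left (sub_nonneg.2 h)]

lemma abs_integral_sin_mul_sinPos_le {t T r r' : ℝ} (ht : t ≤ T) (hT : 0 ≤ T) (hr : 0 ≤ r) (k l : Freq) :
    |∫ x in Ioc 0 t, Real.sin ((t - x) * jb (k + l)) / jb (k + l) * (sinPos k x r * sinPos l x r')| ≤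
      (T + 2) * jb (k + l) ^ (-1 : ℝ) * resSum k l (-1) := by
  set j := jb (k + l)
  have hj : 0 < j := jb_pos _
  have hnn : 0 ≤ (T + 2) * j ^ (-1 : ℝ) * resSum k l (-1) :=
    mul_nonneg (by positivity) (resSum_nonneg _ _ _)
  have hz : ∀ x, x ∉ Ioc (max r r') t → x ∈ Ioc 0 t →
      Real.sin ((t - x) * j) / j * (sinPos k x r * sinPos l x r') = 0 := by
    intro x hx hx'
    have : x ≤ max r r' := by by_contra h; exact hx ⟨not_le.1 h, hx'.2⟩
    rcases le_max_iff.1 this with h | h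
    · rw [sinPos_of_le h, zero_mul, mul_zero]
    · rw [sinPos_of_le h, mul_zero, mul_zero]
  have ha : 0 ≤ max r r' := hr.trans (le_max_left _ _)
  rw [setIntegral_eq_of_subset_of_forall_sdiff_eq_zero measurableSet_Ioc
    (Ioc_subset_Ioc_left ha : Ioc (max r r') t ⊆ Ioc 0 t) fun x hx => hz x hx.2 hx.1]
  set a := max r r' with ha'
  rcases le_or_gt t a with hta | hta
  · rw [Ioc_eq_empty (not_lt.2 hta), setIntegral_empty, abs_zero]; exact hnn
  have e : ∀ x ∈ Ioc a t, Real.sin ((t - x) * j) / j * (sinPos k x r * sinPos l x r') =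
      (4 * j)⁻¹ * (Real.sin ((t * j - r * jb k + r' * jb l) + (-j + jb k - jb l) * x) +
        Real.sin ((t * j + r * jb k - r' * jb l) + (-j - jb k + jb l) * x) +
        Real.sin ((-t * j - r * jb k - r' * jb l) + (j + jb k + jb l) * x) -
        Real.sin ((t * j - r * jb k - r' * jb l) + (-j + jb k + jb l) * x)) := by
    intro x hx
    rw [sinPos_of_ge ((le_max_left r r').trans hx.1.le), sinPos_of_ge ((le_max_right r r').trans hx.1.le)]
    have id : ∀ A B C : ℝ, Real.sin A * (Real.sin B * Real.sin C) = 4⁻¹ * (Real.sin (A + B - C) +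
        Real.sin (A - B + C) + Real.sin (-A + B + C) - Real.sin (A + B + C)) := by
      intro A B C
      simp only [Real.sin_add, Real.sin_sub, Real.cos_add, Real.cos_sub, Real.sin_neg, Real.cos_neg]
      ring
    rw [div_mul_eq_mul_div, id, mul_inv, div_eq_mul_inv]
    ring_nf
  rw [setIntegral_congr_fun measurableSet_Ioc e, integral_const_mul, abs_mul,
    ← intervalIntegral.integral_of_le hta.le]
  have hI : ∀ φ μ : ℝ, IntervalIntegrable (fun x => Real.sin (φ + μ * x)) volume a t :=
    fun φ μ => (by fun_prop : Continuous fun x => Real.sin (φ + μ * x)).intervalIntegrable _ _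
  rw [intervalIntegral.integral_sub (((hI _ _).add (hI _ _)).add (hI _ _)) (hI _ _),
    intervalIntegral.integral_add ((hI _ _).add (hI _ _)) (hI _ _),
    intervalIntegral.integral_add (hI _ _) (hI _ _)]
  have b := fun φ μ => abs_integral_sin_le ha hta.le ht φ μ
  have hp : ∀ y z : ℝ, |y| = |z| → (1 + |y|)⁻¹ = (1 + |z|) ^ (-1 : ℝ) := fun y z h => by
    rw [h, Real.rpow_neg_one]
  have b1 := b (t * j - r * jb k + r' * jb l) (-j + jb k - jb l)
  have b2 := b (t * j + r * jb k - r' * jb l) (-j - jb k + jb l)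
  have b3 := b (-t * j - r * jb k - r' * jb l) (j + jb k + jb l)
  have b4 := b (t * j - r * jb k - r' * jb l) (-j + jb k + jb l)
  rw [hp _ (j + -1 * jb k + 1 * jb l) (by rw [← abs_neg]; congr 1; ring)] at b1
  rw [hp _ (j + 1 * jb k + -1 * jb l) (by rw [← abs_neg]; congr 1; ring)] at b2
  rw [hp _ (j + 1 * jb k + 1 * jb l) (by congr 1; ring)] at b3
  rw [hp _ (j + -1 * jb k + -1 * jb l) (by rw [← abs_neg]; congr 1; ring)] at b4
  have hs := (abs_sub _ _).trans (add_le_add ((abs_add_le _ _).trans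
    (add_le_add ((abs_add_le _ _).trans (add_le_add b1 b2)) b3)) b4)
  have hj4 : |(4 * j)⁻¹| ≤ j ^ (-1 : ℝ) := by
    rw [abs_of_pos (by positivity), Real.rpow_neg_one]
    exact inv_anti₀ hj (by linarith)
  calc _ ≤ j ^ (-1 : ℝ) * _ := mul_le_mul hj4 hs (abs_nonneg _) (by positivity)
    _ = _ := by rw [resSum]; ring

variable {Ω : Type*} [MeasurableSpace Ω] {P : Measure Ω} [IsProbabilityMeasure P]
  {b : Freq → ℝ → Ω → ℂ} {α ε T : ℝ}

lemma randomApprox_convT (hb : IsNoise P b) (hα : α ≤ 1) (hε : 0 < ε) (hT : 0 < T) :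
    RandomApprox P (-α - ε) T (ε / 2) (fun N ω => convT α (fun n t => b n t ω) N) where
  meas N t n := measurable_convT α hb.cont hb.zero (le_max_right t 0) (fun n r _ => hb.meas n r)
    (le_max_left t 0) N n
  supp N ω t n hn := convT_of_notMem α N t hn
  zero N ω n := convT_zero α (fun n => hb.zero n ω) N n
  hol := by
    refine ⟨6, ?_⟩
    filter_upwards [hb.ae_integral_sq_le hT.le] with ω ⟨C, hC, h⟩
    exact ⟨(1 + T) * (1 + C), by positivity, fun N t ht t' ht' n =>
      holBound_convT hα (fun n => hb.cont n ω) (fun n => hb.zero n ω) hT hC h N n t ht t' ht'⟩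
  mom p hp := by
    set S := ∑' n, ENNReal.ofReal (jb n ^ (-2 - ε)) with hS
    have hS' : S < ∞ := tsum_jb_rpow_lt_top (by linarith)
    have hfin : linMoment p * (ENNReal.ofReal T * S) ^ p < ∞ :=
      ENNReal.mul_lt_top (linMoment_lt_top p) (ENNReal.pow_lt_top (ENNReal.mul_lt_top ENNReal.ofReal_lt_top hS'))
    refine ⟨(linMoment p * (ENNReal.ofReal T * S) ^ p).toNNReal, fun M N hM hMN t ht x => ?_⟩
    rw [ENNReal.coe_toNNReal hfin.ne]
    have hM0 : (0 : ℝ) < M := by exact_mod_cast hM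
    set c : Freq → ℂ := fun k => (((if k ∈ ball N then 1 else 0) - (if k ∈ ball M then 1 else 0) : ℂ) *
      ((jb k ^ (-α - ε) : ℝ) : ℂ)) * basisFun k x with hc
    have hcb : ∀ k, ‖c k‖ₑ ^ 2 * ENNReal.ofReal (jb k ^ (2 * α - 2)) ≤
        ENNReal.ofReal (jb k ^ (-2 - ε)) * ENNReal.ofReal ((M : ℝ) ^ (-ε)) := by
      intro k
      by_cases hk : k ∈ ball M
      · simp [hc, if_pos hk, if_pos (ball_mono hMN hk)]
      · have h1 : ‖c k‖ ≤ jb k ^ (-α - ε) := by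
          have h2 : ‖((if k ∈ ball N then 1 else 0) - (if k ∈ ball M then 1 else 0) : ℂ)‖ ≤ 1 := by
            rw [if_neg hk, sub_zero]; split_ifs <;> simp
          have hπ : (2 * Real.pi)⁻¹ ≤ 1 := inv_le_one_of_one_le₀ (by linarith [Real.pi_gt_three])
          have hj := (jb_rpow_pos k (-α - ε)).le
          rw [hc, norm_mul, norm_mul, norm_basisFun, Complex.norm_real, Real.norm_of_nonneg hj]
          calc _ ≤ 1 * jb k ^ (-α - ε) * 1 := by gcongr
            _ = _ := by ring
        have h3 : jb k ^ (-ε) ≤ (M : ℝ) ^ (-ε) :=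
          Real.rpow_le_rpow_of_nonpos hM0 (le_jb_of_notMem_ball hk) (by linarith)
        rw [← ofReal_norm, ← ENNReal.ofReal_pow (norm_nonneg _), ← ENNReal.ofReal_mul (by positivity),
          ← ENNReal.ofReal_mul (jb_rpow_pos _ _).le]
        refine ENNReal.ofReal_le_ofReal ?_
        calc _ ≤ (jb k ^ (-α - ε)) ^ 2 * jb k ^ (2 * α - 2) :=
              mul_le_mul_of_nonneg_right (pow_le_pow_left₀ (norm_nonneg _) h1 2) (jb_rpow_pos _ _).le
          _ = jb k ^ (-2 - ε) * jb k ^ (-ε) := by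
              rw [← Real.rpow_natCast, ← Real.rpow_mul (jb_pos _).le, ← Real.rpow_add (jb_pos _),
                ← Real.rpow_add (jb_pos _)]
              congr 1; push_cast; ring
          _ ≤ _ := mul_le_mul_of_nonneg_left h3 (jb_rpow_pos _ _).le
    have e : ∀ ω, trigSum (ball (2 * N)) (wt (-α - ε) (convT α (fun n t => b n t ω) N t -
        convT α (fun n t => b n t ω) M t)) x = ∑ k ∈ ball (2 * N), c k * psi α k (fun t => b k t ω) t := by
      intro ω
      refine Finset.sum_congr rfl fun k _ => ?_
      simp only [wt, Pi.sub_apply, convT, hc]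
      split_ifs <;> ring
    simp_rw [e]
    refine (lintegral_psi_pow_le hb α _ ht c p).trans ?_
    have hsum : ∑ k ∈ ball (2 * N), ‖c k‖ₑ ^ 2 * ENNReal.ofReal (jb k ^ (2 * α - 2)) ≤
        S * ENNReal.ofReal ((M : ℝ) ^ (-ε)) := by
      refine (Finset.sum_le_sum fun k _ => hcb k).trans ?_
      rw [← Finset.sum_mul]
      gcongr
      exact ENNReal.sum_le_tsum _
    have hpowM : ENNReal.ofReal ((M : ℝ) ^ (-ε)) ^ p = ENNReal.ofReal ((M : ℝ) ^ (-(2 * p * (ε / 2)))) := by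
      rw [← ENNReal.ofReal_pow (by positivity), ← Real.rpow_natCast, ← Real.rpow_mul hM0.le]
      congr 2; ring
    calc _ ≤ linMoment p * (ENNReal.ofReal T * (S * ENNReal.ofReal ((M : ℝ) ^ (-ε)))) ^ p :=
          mul_le_mul_right (ENNReal.pow_le_pow_left (mul_le_mul_right hsum _)) _
      _ = _ := by rw [← mul_assoc (ENNReal.ofReal T), mul_pow, hpowM]; ring

lemma exists_momentConst (T : ℝ) (p : ℕ) {S : ℝ≥0∞} (hS : S < ∞) :
    ∃ D : ℝ≥0, 2 ^ (2 * p + 1) * linMoment p ^ 2 * (ENNReal.ofReal T ^ 2 * S) ^ p = D :=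
  ⟨_, (ENNReal.coe_toNNReal (ENNReal.mul_lt_top (ENNReal.mul_lt_top (ENNReal.pow_lt_top (by simp))
    (ENNReal.pow_lt_top (linMoment_lt_top p))) (ENNReal.pow_lt_top (ENNReal.mul_lt_top
      (ENNReal.pow_lt_top ENNReal.ofReal_lt_top) hS))).ne).symm⟩

lemma randomApprox_wickT (hb : IsNoise P b) (hα : 1 / 3 ≤ α) (hα' : α < 5 / 12) (hε : 0 < ε) (hε1 : ε < 1 / 2)
    (hT : 0 < T) :
    RandomApprox P (-2 * α - ε) T (ε / 16) (fun N ω => wickT α (fun n t => b n t ω) N) where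
  meas N t n := measurable_wickT α hb.cont hb.zero (le_max_right t 0) (fun n r _ => hb.meas n r)
    (le_max_left t 0) N n
  supp N ω t n hn := wickT_of_notMem α N t hn
  zero N ω n := wickT_zero α (fun n => hb.zero n ω) N n
  hol := by
    refine ⟨14, ?_⟩
    filter_upwards [hb.ae_integral_sq_le hT.le] with ω ⟨C, hC, h⟩
    exact ⟨_, by positivity, fun N t ht t' ht' n => holBound_wickT (by linarith) (fun n => hb.cont n ω)
      (fun n => hb.zero n ω) hT hC h N n t ht t' ht'⟩
  mom p hp := by
    set B := 2 - 2 * α - ε / 8 with hB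
    set S := ∑' p : Freq × Freq, ENNReal.ofReal (jb (p.1 + p.2) ^ (2 * (-2 * α - ε)) * jb p.1 ^ (-B) *
      jb p.2 ^ (-B)) with hS
    have hS' : S < ∞ := tsum_pair_lt_top (δ := ε / 16) (by positivity) (by linarith) (by linarith)
      (by linarith)
    obtain ⟨D, hD⟩ := exists_momentConst T p hS'
    refine ⟨D, fun M N hM hMN t ht x => ?_⟩
    rw [← hD]
    refine le_trans (le_of_eq (lintegral_congr fun ω => ?_)) (lintegral_trigSum_wick_le hb
      (α := α) (s := -2 * α - ε) (B := B) (δ := ε / 16)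
      (ν := Measure.dirac t) (g := fun _ _ => 1) (G := fun _ _ => 1) (by positivity) (by rw [hB]; ring)
      hT.le ((ae_dirac_iff (p := fun r => r ∈ Icc 0 T) measurableSet_Icc).2 ht) (fun n => integrable_const _)
      (fun k l r _ r' _ => ?_) (by simp [hS]) hp hM hMN x)
    · congr 4
      funext n
      simp
    · rw [integral_dirac, one_mul, enorm_mul, ← mul_one (1 : ℝ≥0∞)]
      have h1 : ∀ k r, ‖(sinPos k t r : ℂ)‖ₑ ≤ 1 := fun k r => by
        rw [← ofReal_norm, Complex.norm_real, ← ENNReal.ofReal_one]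
        exact ENNReal.ofReal_le_ofReal (abs_sinPos_le k t r)
      exact mul_le_mul' (h1 k r) (h1 l r')

lemma continuous_duhamelKernel (t : ℝ) (n : Freq) :
    Continuous fun r => ((Real.sin ((t - r) * jb n) / jb n : ℝ) : ℂ) := by fun_prop

lemma duhamel_wickT_sub (α : ℝ) {f : Freq → ℝ → ℂ} (hf : ∀ n, Continuous (f n)) (h0 : ∀ n, f n 0 = 0)
    {t : ℝ} (ht : 0 ≤ t) (M N : ℕ) : duhamel (wickT α f N) t - duhamel (wickT α f M) t =
      fun n => ∫ r in Ioc 0 t, ((Real.sin ((t - r) * jb n) / jb n : ℝ) : ℂ) *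
        (wickT α f N r n - wickT α f M r n) := by
  funext n
  have hc : ∀ N, IntervalIntegrable (fun r => ((Real.sin ((t - r) * jb n) / jb n : ℝ) : ℂ) *
      wickT α f N r n) volume 0 t := fun N =>
    ((continuous_duhamelKernel t n).mul (continuous_wickT α hf h0 N n)).intervalIntegrable _ _
  rw [Pi.sub_apply, duhamel, duhamel, ← intervalIntegral.integral_sub (hc N) (hc M),
    intervalIntegral.integral_of_le ht]
  simp_rw [mul_sub]

lemma exists_duhamel_sum_le {T s B δ : ℝ} (hT : 0 ≤ T) (hδ : 0 < δ) (hδ2 : δ < 1 / 2) (hB : 1 + δ ≤ B)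
    (hB2 : B ≤ 4 / 3) (hr : 2 * s - 2 + (3 / 2 - 2 * B + 3 * δ) < -2) : ∃ C : ℝ≥0,
    ∑' p : Freq × Freq, ENNReal.ofReal (jb (p.1 + p.2) ^ (2 * s) * jb p.1 ^ (-B) * jb p.2 ^ (-B)) *
      ENNReal.ofReal ((T + 2) * jb (p.1 + p.2) ^ (-1 : ℝ) * resSum p.1 p.2 (-1)) ^ 2 ≤ C := by
  obtain ⟨C, hC⟩ := exists_tsum_pair_phase_le hδ hδ2 hB hB2 hr
  set F : ℝ → ℝ → Freq × Freq → ℝ := fun σ₁ σ₂ p => jb (p.1 + p.2) ^ (2 * s - 2) * jb p.1 ^ (-B) *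
    jb p.2 ^ (-B) * (1 + |jb (p.1 + p.2) + σ₁ * jb p.1 + σ₂ * jb p.2|) ^ (-2 : ℝ) with hF
  have hF0 : ∀ σ₁ σ₂ p, 0 ≤ F σ₁ σ₂ p := fun σ₁ σ₂ p => by
    have := jb_pos (p.1 + p.2); have := jb_pos p.1; have := jb_pos p.2
    positivity
  refine ⟨(4 * (T + 2) ^ 2).toNNReal * (C + C + C + C), ?_⟩
  have hpt : ∀ p : Freq × Freq, ENNReal.ofReal (jb (p.1 + p.2) ^ (2 * s) * jb p.1 ^ (-B) *
      jb p.2 ^ (-B)) * ENNReal.ofReal ((T + 2) * jb (p.1 + p.2) ^ (-1 : ℝ) * resSum p.1 p.2 (-1)) ^ 2 ≤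
      ENNReal.ofReal (4 * (T + 2) ^ 2) * (ENNReal.ofReal (F 1 1 p) + ENNReal.ofReal (F 1 (-1) p) +
        ENNReal.ofReal (F (-1) 1 p) + ENNReal.ofReal (F (-1) (-1) p)) := by
    intro p
    have h0 := jb_pos (p.1 + p.2); have h1 := jb_pos p.1; have h2 := jb_pos p.2
    rw [← ENNReal.ofReal_add (hF0 _ _ _) (hF0 _ _ _),
      ← ENNReal.ofReal_add (add_nonneg (hF0 _ _ _) (hF0 _ _ _)) (hF0 _ _ _),
      ← ENNReal.ofReal_add (add_nonneg (add_nonneg (hF0 _ _ _) (hF0 _ _ _)) (hF0 _ _ _)) (hF0 _ _ _),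
      ← ENNReal.ofReal_mul (by positivity)]
    refine (mul_le_mul_right (ENNReal.ofReal_pow (mul_nonneg (by positivity) (resSum_nonneg _ _ _)) 2).ge _).trans ?_
    rw [← ENNReal.ofReal_mul (by positivity)]
    refine ENNReal.ofReal_le_ofReal ?_
    have e : jb (p.1 + p.2) ^ (2 * s - 2) = jb (p.1 + p.2) ^ (2 * s) * (jb (p.1 + p.2) ^ (-1 : ℝ)) ^ 2 := by
      rw [← Real.rpow_natCast, ← Real.rpow_mul h0.le, ← Real.rpow_add h0]; norm_num; ring_nf
    calc _ = (jb (p.1 + p.2) ^ (2 * s) * jb p.1 ^ (-B) * jb p.2 ^ (-B)) * (T + 2) ^ 2 *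
          (jb (p.1 + p.2) ^ (-1 : ℝ)) ^ 2 * resSum p.1 p.2 (-1) ^ 2 := by ring
      _ ≤ (jb (p.1 + p.2) ^ (2 * s) * jb p.1 ^ (-B) * jb p.2 ^ (-B)) * (T + 2) ^ 2 *
          (jb (p.1 + p.2) ^ (-1 : ℝ)) ^ 2 * (4 * resSum p.1 p.2 (-2)) := by
          gcongr; exact resSum_sq_le _ _
      _ = _ := by simp only [hF, resSum, e]; ring
  refine (ENNReal.tsum_le_tsum hpt).trans ?_
  rw [ENNReal.tsum_mul_left, ENNReal.tsum_add, ENNReal.tsum_add, ENNReal.tsum_add]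
  push_cast
  refine mul_le_mul_right (add_le_add (add_le_add (add_le_add ?_ ?_) ?_) ?_) _
  · exact hC 1 1 (Or.inl rfl) (Or.inl rfl)
  · exact hC 1 (-1) (Or.inl rfl) (Or.inr rfl)
  · exact hC (-1) 1 (Or.inr rfl) (Or.inl rfl)
  · exact hC (-1) (-1) (Or.inr rfl) (Or.inr rfl)

lemma randomApprox_duhamel_wickT (hb : IsNoise P b) (hα : 1 / 3 ≤ α) (hα' : α < 5 / 12) (hε : 0 < ε)
    (hε1 : ε < 1 / 2) (hT : 0 < T) :
    RandomApprox P (sAlpha α - ε) T (ε / 16) (fun N ω => duhamel (wickT α (fun n t => b n t ω) N)) where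
  meas N t n := measurable_duhamel_wickT α hb.cont hb.zero (le_max_right t 0) (fun n r _ => hb.meas n r)
    (le_max_left t 0) N n
  supp N ω t n hn := duhamel_eq_zero (fun t => wickT_of_notMem α N t hn) t
  zero N ω n := by simp [duhamel]
  hol := by
    refine ⟨14, ?_⟩
    filter_upwards [hb.ae_integral_sq_le hT.le] with ω ⟨C, hC, h⟩
    refine ⟨(1 + T) * (4 * (2 * ((1 + T) * (1 + C)) ^ 2 * Real.sqrt T + Real.sqrt T)) * Real.sqrt T *
      Real.sqrt T, by positivity, fun N t ht t' ht' n => ?_⟩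
    refine (holBound_duhamel_wickT (by linarith) (fun n => hb.cont n ω)
      (fun n => hb.zero n ω) hT hC h N n t ht t' ht').trans (le_of_eq ?_)
    ring
  mom p hp := by
    have hs : sAlpha α = 5 / 4 - 2 * α := by rw [sAlpha, min_eq_right (by linarith)]; ring
    obtain ⟨S, hS⟩ := exists_duhamel_sum_le hT.le (s := sAlpha α - ε) (B := 2 - 2 * α - ε / 8) (δ := ε / 16)
      (by positivity) (by linarith) (by linarith) (by linarith) (by rw [hs]; linarith)
    obtain ⟨D, hD⟩ := exists_momentConst T p (ENNReal.coe_lt_top (r := S))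
    refine ⟨D, fun M N hM hMN t ht x => ?_⟩
    rw [← hD]
    refine le_trans (le_of_eq (lintegral_congr fun ω => ?_)) (lintegral_trigSum_wick_le hb
      (α := α) (s := sAlpha α - ε) (B := 2 - 2 * α - ε / 8) (δ := ε / 16) (ν := volume.restrict (Ioc 0 t))
      (g := fun n r => ((Real.sin ((t - r) * jb n) / jb n : ℝ) : ℂ))
      (G := fun k l => ENNReal.ofReal ((T + 2) * jb (k + l) ^ (-1 : ℝ) * resSum k l (-1)))
      (by positivity) (by ring)
      hT.le (ae_restrict_of_forall_mem measurableSet_Ioc fun r hr => ⟨hr.1.le, hr.2.trans ht.2⟩)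
      (fun n => ((continuous_duhamelKernel t n).integrableOn_Icc).mono_set Ioc_subset_Icc_self)
      (fun k l r hr r' _ => ?_) hS hp hM hMN x)
    · rw [duhamel_wickT_sub α (fun n => hb.cont n ω) (fun n => hb.zero n ω) ht.1]
    · rw [← ofReal_norm]
      refine ENNReal.ofReal_le_ofReal ?_
      simp_rw [← Complex.ofReal_mul]
      rw [integral_complex_ofReal, Complex.norm_real]
      exact abs_integral_sin_mul_sinPos_le ht.2 hT.le hr.1 k l

end Instances

/-! ### Convergence of the approximations -/

section Convergence

lemma wInfNorm_le_sum (s : ℝ) {S : Finset Freq} {f : Distr} (hf : ∀ n ∉ S, f n = 0) :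
    wInfNorm s f ≤ ENNReal.ofReal (∑ n ∈ S, jb n ^ s * ‖f n‖) := by
  refine wInfNorm_le_of_trigSum hf fun x => (norm_sum_le _ _).trans (Finset.sum_le_sum fun n _ => ?_)
  have hj := (jb_rpow_pos n s).le
  rw [norm_mul, wt, norm_mul, Complex.norm_real, Real.norm_of_nonneg hj, norm_basisFun]
  exact mul_le_of_le_one_right (by positivity) (inv_le_one_of_one_le₀ (by linarith [Real.pi_gt_three]))

lemma tendsto_wInfNorm_sub (s : ℝ) {S : Finset Freq} {X : Type*} {l : Filter X} {f : X → Distr} {g : Distr}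
    (hf : ∀ x, ∀ n ∉ S, f x n = 0) (hg : ∀ n ∉ S, g n = 0)
    (h : ∀ n ∈ S, Tendsto (fun x => f x n) l (𝓝 (g n))) :
    Tendsto (fun x => wInfNorm s (f x - g)) l (𝓝 0) := by
  have h1 : Tendsto (fun x => ∑ n ∈ S, jb n ^ s * ‖(f x - g) n‖) l (𝓝 (∑ n ∈ S, jb n ^ s * 0)) :=
    tendsto_finsetSum _ fun n hn => Tendsto.const_mul _ (by
      simpa using ((h n hn).sub_const (g n)).norm)
  have h2 := ENNReal.tendsto_ofReal h1
  simp only [mul_zero, Finset.sum_const_zero, ENNReal.ofReal_zero] at h2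
  exact tendsto_of_tendsto_of_tendsto_of_le_of_le tendsto_const_nhds h2 (fun x => zero_le)
    fun x => wInfNorm_le_sum s fun n hn => by simp [hf x n hn, hg n hn]

lemma IsDistrNorm.tendsto_of_sub {N : Distr → ℝ≥0∞} (hN : IsDistrNorm N) {X : Type*} {l : Filter X}
    {f : X → Distr} {g : Distr} (hg : N g < ∞) (h : Tendsto (fun x => N (f x - g)) l (𝓝 0)) :
    Tendsto (fun x => N (f x)) l (𝓝 (N g)) := by
  have h1 : Tendsto (fun x => N g - N (f x - g)) l (𝓝 (N g)) := by
    simpa using ENNReal.Tendsto.sub tendsto_const_nhds h (Or.inl hg.ne)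
  have h2 : Tendsto (fun x => N g + N (f x - g)) l (𝓝 (N g)) := by
    simpa using h.const_add (N g)
  refine tendsto_of_tendsto_of_tendsto_of_le_of_le h1 h2 (fun x => ?_) fun x => hN.le_add_sub _ _
  rw [tsub_le_iff_right, hN.sub_comm]
  exact hN.le_add_sub _ _

lemma wInfNorm_lt_top_of_support (s : ℝ) {S : Finset Freq} {f : Distr} (hf : ∀ n ∉ S, f n = 0) :
    wInfNorm s f < ∞ := (wInfNorm_le_sum s hf).trans_lt ENNReal.ofReal_lt_top

lemma contIn_of_support (s T : ℝ) {S : Finset Freq} {f : ℝ → Distr} (hf : ∀ t, ∀ n ∉ S, f t n = 0)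
    (hc : ∀ n, Continuous fun t => f t n) : ContIn (wInfNorm s) T f := fun t _ =>
  ⟨wInfNorm_lt_top_of_support s (hf t), tendsto_wInfNorm_sub s hf (hf t) fun n _ =>
    (hc n).continuousAt.tendsto.mono_left nhdsWithin_le_nhds⟩

/-- Convergence in `C([0,T]; W^{s,∞})`. -/
def UnifLim (s T : ℝ) (a : ℕ → ℝ → Distr) (f : ℝ → Distr) : Prop :=
  ContIn (wInfNorm s) T f ∧ Tendsto (fun N => supNorm (wInfNorm s) T (a N - f)) atTop (𝓝 0)

lemma UnifLim.mono {s T T' : ℝ} {a : ℕ → ℝ → Distr} {f : ℝ → Distr} (h : UnifLim s T a f) (hT : T' ≤ T) :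
    UnifLim s T' a f :=
  ⟨h.1.mono hT, tendsto_of_tendsto_of_tendsto_of_le_of_le tendsto_const_nhds h.2 (fun _ => zero_le)
    fun _ => biSup_mono fun _ ht => ⟨ht.1, ht.2.trans hT⟩⟩

lemma UnifLim.tendsto_wInfNorm {s T : ℝ} {a : ℕ → ℝ → Distr} {f : ℝ → Distr} (h : UnifLim s T a f) {t : ℝ}
    (ht : t ∈ Icc 0 T) : Tendsto (fun N => wInfNorm s (a N t)) atTop (𝓝 (wInfNorm s (f t))) :=
  (isDistrNorm_wInfNorm s).tendsto_of_sub (h.1.lt_top ht)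
    (tendsto_of_tendsto_of_tendsto_of_le_of_le tendsto_const_nhds h.2 (fun _ => zero_le)
      fun N => le_supNorm (f := a N - f) ht)

lemma UnifLim.continuousOn {s T : ℝ} {a : ℕ → ℝ → Distr} {f : ℝ → Distr} (h : UnifLim s T a f) :
    ContinuousOn (fun t => wInfNorm s (f t)) (Icc 0 T) := fun t ht =>
  (isDistrNorm_wInfNorm s).tendsto_of_sub (h.1.lt_top ht) (h.1 t ht).2

lemma unifLim_of_trigSum {s T C δ : ℝ} (hδ : 0 < δ) {a : ℕ → ℝ → Distr}
    (hsupp : ∀ N t, ∀ n ∉ ball (2 * N), a N t n = 0) (hc : ∀ N n, Continuous fun t => a N t n)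
    (h : ∀ M N, 1 ≤ M → M ≤ N → ∀ t ∈ Icc 0 T, ∀ x,
      ‖trigSum (ball (2 * N)) (wt s (a N t - a M t)) x‖ ≤ C * (M : ℝ) ^ (-δ))
    {f : ℝ → Distr} (hf : ∀ t ∈ Icc 0 T, ∀ n, (∃ l, Tendsto (fun N => a N t n) atTop (𝓝 l)) →
      Tendsto (fun N => a N t n) atTop (𝓝 (f t n))) : UnifLim s T a f := by
  have hw := (wInfNorm_sub_le_of_trigSum hδ hsupp h hf).2
  have hb : Tendsto (fun M : ℕ => ENNReal.ofReal (C * (M : ℝ) ^ (-δ))) atTop (𝓝 0) := by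
    simpa using ENNReal.tendsto_ofReal
      (((tendsto_rpow_neg_atTop hδ).comp tendsto_natCast_atTop_atTop).const_mul C)
  refine ⟨contIn_of_uniform_limit (isDistrNorm_wInfNorm s) (w := fun k => a (k + 1))
    (fun k => contIn_of_support s T (hsupp (k + 1)) (hc (k + 1))) (hb.comp (tendsto_add_atTop_nat 1))
    fun k => hw (k + 1) (by omega), ?_⟩
  refine tendsto_of_tendsto_of_tendsto_of_le_of_le' tendsto_const_nhds hb
    (Eventually.of_forall fun _ => zero_le) ?_
  filter_upwards [eventually_ge_atTop 1] with N hN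
  exact iSup₂_le fun t ht => hw N hN t ht

lemma UnifLim.tendsto_duhamel {s T : ℝ} {a : ℕ → ℝ → Distr} {f : ℝ → Distr} (h : UnifLim s T a f)
    (hc : ∀ N n, Continuous fun t => a N t n) {t : ℝ} (ht : t ∈ Icc 0 T) (n : Freq) :
    Tendsto (fun N => duhamel (a N) t n) atTop (𝓝 (duhamel f t n)) := by
  have hfc : ∀ n, ContinuousOn (fun t => f t n) (Icc 0 T) := fun n =>
    continuousOn_coeff (h.1.of_le ENNReal.ofReal_ne_top (hsNorm_le_wInfNorm s)) n
  rw [tendsto_iff_norm_sub_tendsto_zero]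
  have hd := (ENNReal.tendsto_toReal ENNReal.zero_ne_top).comp h.2
  have hd2 := ((hd.const_mul (2 * Real.pi)).const_mul (jb n ^ s)⁻¹).mul_const |t - 0|
  simp only [ENNReal.toReal_zero, mul_zero, zero_mul] at hd2
  refine tendsto_of_tendsto_of_tendsto_of_le_of_le' tendsto_const_nhds hd2
    (Eventually.of_forall fun _ => norm_nonneg _) ?_
  filter_upwards [h.2.eventually_lt_const ENNReal.zero_lt_top] with N hN
  have e := congrFun (duhamel_sub (F := a N) (G := f) (fun n => (hc N n).continuousOn) hfc ht) n
  rw [Pi.sub_apply] at e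
  rw [← e]
  refine intervalIntegral.norm_integral_le_of_norm_le_const fun r hr => ?_
  rw [uIoc_of_le ht.1] at hr
  have h1 := (ofReal_coeff_le_wInfNorm s ((a N - f) r) n).trans
    (mul_le_mul_right (le_supNorm ⟨hr.1.le, hr.2.trans ht.2⟩) _)
  rw [← ENNReal.ofReal_toReal hN.ne, ← ENNReal.ofReal_mul (by positivity),
    ENNReal.ofReal_le_ofReal_iff (by positivity)] at h1
  have h2 : ‖((Real.sin ((t - r) * jb n) / jb n : ℝ) : ℂ)‖ ≤ 1 :=
    (norm_sin_div_jb_le _ n).trans (Real.rpow_le_one_of_one_le_of_nonpos (one_le_jb n) (by norm_num))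
  rw [norm_mul]
  refine (mul_le_of_le_one_left (norm_nonneg _) h2).trans ?_
  rwa [inv_mul_eq_div, le_div_iff₀ (jb_rpow_pos _ _), mul_comm]

/-- The stochastic convolution along a family of paths. -/
def convL (α : ℝ) (f : Freq → ℝ → ℂ) (t : ℝ) : Distr := fun n => psi α n (f n) t

/-- The Wick power along a family of paths. -/
def wickL (α : ℝ) (f : Freq → ℝ → ℂ) (t : ℝ) : Distr :=
  fun n => limUnder atTop fun N => wickT α f N t n

/-- The three limits that define the enhanced data set. -/
def GoodPath (α ε T : ℝ) (f : Freq → ℝ → ℂ) : Prop :=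
  UnifLim (-α - ε) T (convT α f) (convL α f) ∧ UnifLim (-2 * α - ε) T (wickT α f) (wickL α f) ∧
    UnifLim (sAlpha α - ε) T (fun N => duhamel (wickT α f N)) (duhamel (wickL α f))

lemma continuous_duhamel_wickT (α : ℝ) {f : Freq → ℝ → ℂ} (hf : ∀ n, Continuous (f n))
    (h0 : ∀ n, f n 0 = 0) (N : ℕ) (n : Freq) : Continuous fun t => duhamel (wickT α f N) t n := by
  refine intervalIntegral.continuous_parametric_intervalIntegral_of_continuous
    (f := fun t r => ((Real.sin ((t - r) * jb n) / jb n : ℝ) : ℂ) * wickT α f N r n) ?_ continuous_id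
  exact Continuous.mul (by fun_prop) ((continuous_wickT α hf h0 N n).comp continuous_snd)

lemma tendsto_convT (α : ℝ) (f : Freq → ℝ → ℂ) (t : ℝ) (n : Freq) :
    Tendsto (fun N => convT α f N t n) atTop (𝓝 (convL α f t n)) := by
  refine tendsto_const_nhds.congr' ?_
  obtain ⟨K, hK⟩ := exists_nat_ge (jb n)
  filter_upwards [eventually_ge_atTop K] with N hN
  rw [convT, if_pos, convL]
  have h1 : jb n ≤ N := hK.trans (by exact_mod_cast hN)
  have h2 := pow_le_pow_left₀ (jb_pos n).le h1 2
  rw [jb_sq] at h2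
  rw [mem_ball]; linarith

variable {Ω : Type*} [MeasurableSpace Ω] {P : Measure Ω} [IsProbabilityMeasure P]
  {b : Freq → ℝ → Ω → ℂ} {α ε : ℝ}

lemma ae_goodPath (hb : IsNoise P b) (hα : 1 / 3 ≤ α) (hα' : α < 5 / 12) (hε : 0 < ε) (hε1 : ε < 1 / 2) :
    ∀ᵐ ω ∂P, ∀ T, GoodPath α ε T fun n t => b n t ω := by
  have key : ∀ K : ℕ, ∀ᵐ ω ∂P, GoodPath α ε (K + 1) fun n t => b n t ω := by
    intro K
    have hT : (0 : ℝ) < K + 1 := by positivity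
    have e : ε / 2 ≤ 1 ∧ 0 < ε / 16 ∧ ε / 16 ≤ 1 := ⟨by linarith, by linarith, by linarith⟩
    filter_upwards [(randomApprox_convT (α := α) hb (by linarith) hε hT).ae_bound hT (half_pos hε) e.1,
      (randomApprox_wickT hb hα hα' hε hε1 hT).ae_bound hT e.2.1 e.2.2,
      (randomApprox_duhamel_wickT hb hα hα' hε hε1 hT).ae_bound hT e.2.1 e.2.2]
      with ω ⟨C₁, _, h1⟩ ⟨C₂, _, h2⟩ ⟨C₃, _, h3⟩
    have hc := fun n => hb.cont n ω
    have h0 := fun n => hb.zero n ω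
    have hw : UnifLim (-2 * α - ε) (K + 1) (wickT α fun n t => b n t ω) (wickL α fun n t => b n t ω) :=
      unifLim_of_trigSum (half_pos e.2.1) (fun N t n hn => wickT_of_notMem α N t hn)
        (continuous_wickT α hc h0) h2 fun t _ n h => tendsto_nhds_limUnder h
    have hz : UnifLim (-α - ε) (K + 1) (convT α fun n t => b n t ω) (convL α fun n t => b n t ω) :=
      unifLim_of_trigSum (δ := ε / 2 / 2) (by linarith) (fun N t n hn => convT_of_notMem α N t hn)
        (continuous_convT α hc h0) h1 fun t _ n _ => tendsto_convT α _ t n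
    have hd : ∀ t ∈ Icc (0 : ℝ) (K + 1), ∀ n, Tendsto (fun N => duhamel (wickT α (fun n t => b n t ω) N) t n)
        atTop (𝓝 (duhamel (wickL α fun n t => b n t ω) t n)) :=
      fun t ht n => hw.tendsto_duhamel (continuous_wickT α hc h0) ht n
    refine ⟨hz, hw, ?_⟩
    exact unifLim_of_trigSum (a := fun N => duhamel (wickT α (fun n t => b n t ω) N)) (half_pos e.2.1)
      (fun N t n hn => duhamel_eq_zero (fun t => wickT_of_notMem α N t hn) t)
      (continuous_duhamel_wickT α hc h0) h3 fun t ht n _ => hd t ht n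
  filter_upwards [ae_all_iff.2 key] with ω h T
  obtain ⟨K, hK⟩ := exists_nat_ge T
  have hK' : T ≤ (K : ℝ) + 1 := by linarith
  exact ⟨(h K).1.mono hK', (h K).2.1.mono hK', (h K).2.2.mono hK'⟩

end Convergence

/-! ### The stopping time -/

section Stopping

variable {Ω : Type*}

lemma measurable_wInfNorm {m : MeasurableSpace Ω} (s : ℝ) {S : Finset Freq} {a : Ω → Distr}
    (hm : ∀ n, Measurable fun ω => a ω n) (hs : ∀ ω, ∀ n ∉ S, a ω n = 0) :
    Measurable fun ω => wInfNorm s (a ω) := by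
  classical
  obtain ⟨E, hE⟩ : ∃ E : (S → ℂ) → Distr, E = fun z n => if h : n ∈ S then z ⟨n, h⟩ else 0 := ⟨_, rfl⟩
  have hE0 : ∀ z, ∀ n ∉ S, E z n = 0 := fun z n hn => by rw [hE]; exact dif_neg hn
  have hc : Continuous fun z => wInfNorm s (E z) := continuous_iff_continuousAt.2 fun z =>
    (isDistrNorm_wInfNorm s).tendsto_of_sub (wInfNorm_lt_top_of_support s (hE0 z))
      (tendsto_wInfNorm_sub s hE0 (hE0 z) fun n hn => by
        simp only [hE, dif_pos hn]; exact (continuous_apply _).tendsto z)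
  have e : ∀ ω, a ω = E fun n => a ω n := fun ω => by
    funext n
    by_cases hn : n ∈ S
    · simp [hE, hn]
    · exact (hs ω n hn).trans (hE0 (fun n => a ω n) n hn).symm
  have e2 : (fun ω => wInfNorm s (a ω)) = fun ω => wInfNorm s (E fun n => a ω n) :=
    funext fun ω => congrArg _ (e ω)
  rw [e2]
  exact hc.measurable.comp (measurable_pi_lambda (fun ω (n : S) => a ω n) fun n => hm n)

/-- The first time at which a continuous process reaches the level one. -/
lemma exists_isStoppingTime {m : MeasurableSpace Ω} {F : Filtration ℝ≥0 m} {h : ℝ → Ω → ℝ≥0∞} {T₀ : ℝ}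
    (hT₀ : 0 < T₀) {G : Set Ω} (hG : ∀ i, MeasurableSet[F i] G)
    (hm : ∀ i : ℝ≥0, ∀ r : ℝ, r ≤ i → Measurable[F i] (h r))
    (hc : ∀ ω ∈ G, ContinuousOn (fun t => h t ω) (Icc 0 T₀)) (h0 : ∀ ω ∈ G, h 0 ω = 0) :
    ∃ T : Ω → ℝ≥0, IsStoppingTime F (fun ω => (T ω : WithTop ℝ≥0)) ∧
      ∀ ω ∈ G, 0 < T ω ∧ (T ω : ℝ) ≤ T₀ ∧ ∀ t ∈ Icc (0 : ℝ) (T ω), h t ω ≤ 1 := by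
  classical
  set S : Ω → Set ℝ := fun ω => (Icc 0 T₀ ∩ {t | 1 ≤ h t ω}) ∪ {T₀} with hS
  have hS0 : ∀ ω, ∀ t ∈ S ω, t ∈ Icc 0 T₀ := fun ω t ht => by
    rcases ht with ht | rfl
    · exact ht.1
    · exact ⟨hT₀.le, le_rfl⟩
  have hbd : ∀ ω, BddBelow (S ω) := fun ω => ⟨0, fun t ht => (hS0 ω t ht).1⟩
  have hTmem : ∀ ω, T₀ ∈ S ω := fun ω => Or.inr rfl
  have hnn : ∀ ω, 0 ≤ sInf (S ω) := fun ω => le_csInf ⟨_, hTmem ω⟩ fun t ht => (hS0 ω t ht).1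
  have hcl : ∀ ω ∈ G, sInf (S ω) ∈ S ω := fun ω hω => by
    refine IsClosed.csInf_mem ?_ ⟨_, hTmem ω⟩ (hbd ω)
    exact ((hc ω hω).preimage_isClosed_of_isClosed isClosed_Icc isClosed_Ici).union isClosed_singleton
  obtain ⟨c, -, hc1, hclim⟩ := exists_seq_strictMono_tendsto' (zero_lt_one : (0 : ℝ≥0∞) < 1)
  refine ⟨fun ω => if ω ∈ G then (sInf (S ω)).toNNReal else T₀.toNNReal, fun i => ?_, fun ω hω => ?_⟩
  · rcases le_or_gt T₀ i with hi | hi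
    · convert MeasurableSet.univ
      refine eq_univ_of_forall fun ω => ?_
      rw [mem_ofPred_eq, WithTop.coe_le_coe]
      refine le_trans ?_ (Real.toNNReal_le_iff_le_coe.2 hi)
      beta_reduce
      split_ifs
      · exact Real.toNNReal_le_toNNReal (csInf_le (hbd ω) (hTmem ω))
      · exact le_rfl
    · have e : {ω | (((if ω ∈ G then (sInf (S ω)).toNNReal else T₀.toNNReal : ℝ≥0)) : WithTop ℝ≥0) ≤ i} =
          G ∩ ⋂ k, ⋃ p : ℕ, ⋃ j : Fin (p + 2), {ω | c k < h (grid i (p + 1) j) ω} := by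
        ext ω
        have hi0 : (0 : ℝ) ≤ i := i.2
        simp only [mem_ofPred_eq, WithTop.coe_le_coe, mem_inter_iff, mem_iInter, mem_iUnion]
        by_cases hω : ω ∈ G
        · rw [if_pos hω, Real.toNNReal_le_iff_le_coe]
          have hsub : Icc (0 : ℝ) i ⊆ Icc 0 T₀ := Icc_subset_Icc_right hi.le
          constructor
          · refine fun hle => ⟨hω, fun k => ?_⟩
            have hmem : 1 ≤ h (sInf (S ω)) ω := by
              rcases hcl ω hω with h' | h'
              · exact h'.2
              · rw [mem_singleton_iff] at h'; linarith
            have ht : sInf (S ω) ∈ Icc (0 : ℝ) i := ⟨hnn ω, hle⟩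
            rcases hi0.eq_or_lt with h00 | hpos
            · refine ⟨0, 0, ?_⟩
              have : grid i (0 + 1) ((0 : Fin (0 + 2)) : ℕ) = sInf (S ω) := by
                rw [← h00] at ht
                simp [grid, le_antisymm ht.2 ht.1]
              rw [this]
              exact (hc1 k).2.trans_le hmem
            · have hev := ((hc ω hω).mono hsub (sInf (S ω)) ht).eventually
                (lt_mem_nhds ((hc1 k).2.trans_le hmem))
              obtain ⟨δ, hδ, hball⟩ := Metric.mem_nhdsWithin_iff.1 hev
              obtain ⟨K, hK⟩ := exists_nat_gt ((i : ℝ) / δ)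
              obtain ⟨j, hj, hd⟩ := exists_grid_near hpos K.succ_pos ht
              refine ⟨K, ⟨j, by omega⟩, hball ⟨?_, grid_mem hi0 K.succ_pos hj⟩⟩
              rw [Metric.mem_ball', Real.dist_eq]
              refine hd.trans_lt ?_
              rw [div_lt_iff₀ hδ] at hK
              rw [div_lt_iff₀ (by positivity)]
              push_cast
              nlinarith
          · rintro ⟨-, hk⟩
            obtain ⟨t, ht, hmax⟩ := isCompact_Icc.exists_isMaxOn ⟨0, left_mem_Icc.2 hi0⟩ ((hc ω hω).mono hsub)
            refine (csInf_le (hbd ω) (Or.inl ⟨hsub ht, ?_⟩)).trans ht.2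
            refine le_of_tendsto' hclim fun k => ?_
            obtain ⟨p, j, hpj⟩ := hk k
            exact hpj.le.trans (hmax (grid_mem hi0 p.succ_pos (by omega)))
        · rw [if_neg hω, Real.toNNReal_le_iff_le_coe]
          exact iff_of_false (by linarith) fun h => hω h.1
      rw [e]
      refine (hG i).inter (MeasurableSet.iInter fun k => MeasurableSet.iUnion fun p =>
        MeasurableSet.iUnion fun j => ?_)
      exact hm i _ (grid_mem i.2 p.succ_pos (by omega)).2 measurableSet_Ioi
  · have hpos : 0 < sInf (S ω) := by
      refine (hnn ω).lt_of_ne fun h' => ?_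
      have := hcl ω hω
      rw [← h'] at this
      rcases this with h2 | h2
      · have h3 := h2.2
        rw [mem_ofPred_eq, h0 ω hω] at h3
        exact absurd h3 (by simp)
      · exact hT₀.ne h2
    have hle : sInf (S ω) ≤ T₀ := csInf_le (hbd ω) (hTmem ω)
    simp only [if_pos hω]
    rw [Real.coe_toNNReal _ (hnn ω)]
    refine ⟨Real.toNNReal_pos.2 hpos, hle, fun t ht => ?_⟩
    have hcl2 : IsClosed (Icc 0 T₀ ∩ {t | h t ω ≤ 1}) :=
      (hc ω hω).preimage_isClosed_of_isClosed isClosed_Icc isClosed_Iic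
    have hsub : Ico 0 (sInf (S ω)) ⊆ Icc 0 T₀ ∩ {t | h t ω ≤ 1} := fun r hr => by
      have hr' : r ∈ Icc 0 T₀ := ⟨hr.1, hr.2.le.trans hle⟩
      refine ⟨hr', not_lt.1 fun h1 : 1 < h r ω => ?_⟩
      exact absurd (csInf_le (hbd ω) (Or.inl ⟨hr', h1.le⟩)) (not_le.2 hr.2)
    have := hcl2.closure_subset_iff.2 hsub
    rw [closure_Ico hpos.ne] at this
    exact (this ht).2

variable [m : MeasurableSpace Ω] {P : Measure Ω} {β : Freq → ℝ≥0 → Ω → ℂ}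

lemma measurable_noiseFiltration (hβ : ∀ n t, Measurable (β n t)) (n : Freq) {r i : ℝ≥0} (hr : r ≤ i) :
    Measurable[noiseFiltration P β hβ i] (β n r) :=
  Measurable.of_comap_le (le_sup_of_le_left (le_iSup_of_le r (le_iSup_of_le hr (le_iSup_of_le n le_rfl))))

lemma measurableSet_noiseFiltration (hβ : ∀ n t, Measurable (β n t)) (i : ℝ≥0) {A : Set Ω}
    (hA : MeasurableSet A) (hA0 : P Aᶜ = 0) : MeasurableSet[noiseFiltration P β hβ i] A := by
  rw [← MeasurableSet.compl_iff]
  exact (le_sup_right : _ ≤ noiseFiltration P β hβ i) _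
    (MeasurableSpace.measurableSet_generateFrom ⟨hA.compl, hA0⟩)

end Stopping

/-! ### The random enhanced data set -/

section RandomData

variable {Ω : Type*} {β : Freq → ℝ≥0 → Ω → ℂ} {α ε s σ : ℝ}

lemma wick_eq {Ω : Type*} (α : ℝ) (β : Freq → ℝ≥0 → Ω → ℂ) (ω : Ω) :
    wick α β ω = wickL α fun n t => β n t.toNNReal ω := by
  funext t n
  simp only [wick, wickL, wickTrunc_eq]

lemma secondOrder_eq {Ω : Type*} (α : ℝ) (β : Freq → ℝ≥0 → Ω → ℂ) (ω : Ω) :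
    secondOrder α β ω = duhamel (wickL α fun n t => β n t.toNNReal ω) := by
  rw [secondOrder, wick_eq]

lemma inClass_randomData {u₀ u₁ : Distr} (h0 : hsNorm s u₀ < ∞) (h1 : hsNorm (s - 1) u₁ < ∞) {ω : Ω} {T : ℝ}
    (hg : GoodPath α ε T fun n t => β n t.toNNReal ω) : (randomData α β u₀ u₁ ω).InClass α s ε T :=
  ⟨h0, h1, hg.1.1, by
    have := hg.2.2.1
    rw [← secondOrder_eq] at this
    exact this⟩

lemma tendsto_of_goodPath {ω : Ω} {T : ℝ} (hg : GoodPath α ε T fun n t => β n t.toNNReal ω) :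
    Tendsto (fun N : ℕ => supNorm (wInfNorm (-α - ε)) T
      (stochConvTrunc α β N ω - stochConv α β ω)) atTop (𝓝 0) ∧
    Tendsto (fun N : ℕ => supNorm (wInfNorm (-2 * α - ε)) T
      (wickTrunc α β N ω - wick α β ω)) atTop (𝓝 0) ∧
    Tendsto (fun N : ℕ => supNorm (wInfNorm (sAlpha α - ε)) T
      (secondOrderTrunc α β N ω - secondOrder α β ω)) atTop (𝓝 0) := by
  have e1 : ∀ N, stochConvTrunc α β N ω = convT α (fun n t => β n t.toNNReal ω) N := fun N =>
    funext fun t => stochConvTrunc_eq α β N ω t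
  have e2 : ∀ N, wickTrunc α β N ω = wickT α (fun n t => β n t.toNNReal ω) N := fun N =>
    funext fun t => wickTrunc_eq α β N ω t
  have e3 : ∀ N, secondOrderTrunc α β N ω = duhamel (wickT α (fun n t => β n t.toNNReal ω) N) := fun N =>
    funext fun t => secondOrderTrunc_eq α β N ω t
  simp_rw [e1, e2, e3, wick_eq, secondOrder_eq]
  exact ⟨hg.1.2, hg.2.1.2, hg.2.2.2⟩

variable [MeasurableSpace Ω] {P : Measure Ω}

lemma exists_good_event [IsProbabilityMeasure P] (hβ : IsCylindricalWiener P β) (hα : 1 / 3 ≤ α)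
    (hα' : α < 5 / 12) (hε : 0 < ε) (hε1 : ε < 1 / 2) : ∃ Ω₀ G : Set Ω, MeasurableSet Ω₀ ∧ P Ω₀ᶜ = 0 ∧
      IsNoise P (fun n t => Ω₀.indicator (β n t.toNNReal)) ∧ MeasurableSet G ∧ P Gᶜ = 0 ∧ G ⊆ Ω₀ ∧
      ∀ ω ∈ G, ∀ T, GoodPath α ε T fun n t => β n t.toNNReal ω := by
  obtain ⟨Ω₀, hm, h0, hb⟩ := hβ.exists_isNoise
  have hae : ∀ᵐ ω ∂P, ω ∈ Ω₀ ∧ ∀ T, GoodPath α ε T fun n t => Ω₀.indicator (β n t.toNNReal) ω :=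
    (ae_iff.2 h0 : ∀ᵐ ω ∂P, ω ∈ Ω₀).and (ae_goodPath hb hα hα' hε hε1)
  obtain ⟨B, hB, hBm, hB0⟩ := exists_measurable_superset_of_null (ae_iff.1 hae)
  have hgood : ∀ ω ∈ Bᶜ, ω ∈ Ω₀ ∧ ∀ T, GoodPath α ε T fun n t => Ω₀.indicator (β n t.toNNReal) ω :=
    fun ω hω => by_contra fun h => hω (hB h)
  refine ⟨Ω₀, Bᶜ, hm, h0, hb, hBm.compl, by rwa [compl_compl], fun ω hω => (hgood ω hω).1, fun ω hω T => ?_⟩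
  have := (hgood ω hω).2 T
  simpa only [indicator_of_mem (hgood ω hω).1] using this

lemma exists_stopping_solution [IsProbabilityMeasure P] (hβ : IsCylindricalWiener P β) (hα : 1 / 3 ≤ α)
    (hα' : α < 5 / 12) (hε : 0 < ε) (hε1 : ε < 1 / 2) (haσ : α + ε < σ) (hσ : σ ≤ 1 / 2) (hs : σ ≤ s)
    (hsα : σ ≤ sAlpha α - ε) {u₀ u₁ : Distr} (h0 : hsNorm s u₀ < ∞) (h1 : hsNorm (s - 1) u₁ < ∞) :
    ∃ T : Ω → ℝ≥0, IsStoppingTime (noiseFiltration P β hβ.measurable) (fun ω => (T ω : WithTop ℝ≥0)) ∧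
      ∀ᵐ ω ∂P, 0 < T ω ∧ ∃ v, IsUniqueSolution σ (T ω) (randomData α β u₀ u₁ ω) v := by
  obtain ⟨Ω₀, G, hΩm, hΩ0, hb, hGm, hG0, hGΩ, hgood⟩ := exists_good_event hβ hα hα' hε hε1
  obtain ⟨K, hK, hsol⟩ := exists_local_solution (α := α) (s := s) (ε := ε) (by linarith) haσ hσ hs hsα
  set R := (hsNorm s u₀ + hsNorm (s - 1) u₁).toReal + 1 with hR
  have hR1 : 1 ≤ R := by rw [hR]; linarith [ENNReal.toReal_nonneg (a := hsNorm s u₀ + hsNorm (s - 1) u₁)]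
  set F := noiseFiltration P β hβ.measurable
  set b : Freq → ℝ → Ω → ℂ := fun n t => Ω₀.indicator (β n t.toNNReal) with hbdef
  set h : ℝ → Ω → ℝ≥0∞ := fun r ω => limsup (fun N =>
    wInfNorm (-α - ε) (convT α (fun n t => b n t ω) N r) +
      wInfNorm (sAlpha α - ε) (duhamel (wickT α (fun n t => b n t ω) N) r)) atTop with hh
  have hbβ : ∀ ω ∈ G, (fun n t => b n t ω) = fun n t => β n t.toNNReal ω := fun ω hω => by
    simp only [hbdef, indicator_of_mem (hGΩ hω)]
  have hlim : ∀ ω ∈ G, ∀ r, 0 ≤ r → h r ω = wInfNorm (-α - ε) (stochConv α β ω r) +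
      wInfNorm (sAlpha α - ε) (secondOrder α β ω r) := fun ω hω r hr => by
    have hg := hgood ω hω r
    have hr' : r ∈ Icc 0 r := ⟨hr, le_rfl⟩
    rw [secondOrder_eq]
    simp only [hh]
    rw [hbβ ω hω]
    exact ((hg.1.tendsto_wInfNorm hr').add (hg.2.2.tendsto_wInfNorm hr')).limsup_eq
  have hm : ∀ i : ℝ≥0, ∀ r : ℝ, r ≤ i → Measurable[F i] (h r) := by
    intro i r hr
    have hbm : ∀ n, ∀ r : ℝ, r ≤ i → Measurable[F i] (b n r) := fun n r hr =>
      (measurable_noiseFiltration hβ.measurable n (Real.toNNReal_le_iff_le_coe.2 hr)).indicator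
        (measurableSet_noiseFiltration hβ.measurable i hΩm hΩ0)
    refine Measurable.limsup fun N => Measurable.add ?_ ?_
    · exact measurable_wInfNorm (m := F i) _ (S := ball (2 * N))
        (fun n => measurable_convT α hb.cont hb.zero i.2 hbm hr N n)
        fun ω n hn => convT_of_notMem α N r hn
    · exact measurable_wInfNorm (m := F i) _ (S := ball (2 * N))
        (fun n => measurable_duhamel_wickT α hb.cont hb.zero i.2 hbm hr N n)
        fun ω n hn => duhamel_eq_zero (fun t => wickT_of_notMem α N t hn) r
  set T₀ := 1 / (K * (1 + R)) with hT₀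
  have hT₀0 : 0 < T₀ := by positivity
  obtain ⟨T, hT, hTG⟩ := exists_isStoppingTime (F := F) (h := h) hT₀0
    (fun i => measurableSet_noiseFiltration hβ.measurable i hGm hG0) hm
    (fun ω hω => by
      have hg := hgood ω hω T₀
      refine (hg.1.continuousOn.add hg.2.2.continuousOn).congr fun t ht => ?_
      rw [hlim ω hω t ht.1, secondOrder_eq]
      rfl)
    (fun ω hω => by
      have e1 : stochConv α β ω 0 = 0 := by
        funext n
        refine psi_zero_time α n (f := fun t => β n t.toNNReal ω) ?_
        rw [← hb.zero n ω, ← congrFun (congrFun (hbβ ω hω) n) 0]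
      have e2 : secondOrder α β ω 0 = 0 := by
        funext n
        simp [secondOrder, duhamel]
      rw [hlim ω hω 0 le_rfl, e1, e2, wInfNorm_zero, wInfNorm_zero, add_zero])
  refine ⟨T, hT, ?_⟩
  filter_upwards [(ae_iff.2 hG0 : ∀ᵐ ω ∂P, ω ∈ G)] with ω hω
  obtain ⟨hpos, hle, hbd⟩ := hTG ω hω
  refine ⟨hpos, hsol (T ω) R _ hpos (by linarith) (inClass_randomData h0 h1 (hgood ω hω _)) ?_ ?_ ?_ ?_⟩
  · rw [hR, ENNReal.ofReal_add ENNReal.toReal_nonneg zero_le_one,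
      ENNReal.ofReal_toReal (ENNReal.add_lt_top.2 ⟨h0, h1⟩).ne]
    exact le_self_add
  all_goals have hRe : 1 ≤ ENNReal.ofReal R := by simpa using hR1
  · intro t ht
    have := hbd t ht
    rw [hlim ω hω t ht.1] at this
    exact le_self_add.trans (this.trans hRe)
  · intro t ht
    have := hbd t ht
    rw [hlim ω hω t ht.1] at this
    exact le_add_self.trans (this.trans hRe)
  · rw [hT₀, le_div_iff₀ (by positivity)] at hle
    exact hle

end RandomData

end RoughWave

end

theorem mainTheorem8 (α s : ℝ) (hα : 1 / 3 ≤ α) (hα' : α < 5 / 12) (hs : α < s) :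
    ∃ σ₀ > α, ∀ σ : ℝ, α < σ → σ < σ₀ → ∃ ε₀ > 0, ∀ ε : ℝ, 0 < ε → ε < ε₀ →
      -- the stochastic part
      (∀ (Ω : Type*) [MeasurableSpace Ω] (P : Measure Ω) [IsProbabilityMeasure P]
        (β : RoughWave.Freq → ℝ≥0 → Ω → ℂ) (hβ : RoughWave.IsCylindricalWiener P β)
        (u₀ u₁ : RoughWave.Distr),
        RoughWave.hsNorm s u₀ < ∞ → RoughWave.hsNorm (s - 1) u₁ < ∞ →
        -- the limits defining the stochastic terms exist, and the enhanced data set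
        -- almost surely belongs to its class
        (∀ᵐ ω ∂P, ∀ T : ℝ, 0 < T →
          (RoughWave.randomData α β u₀ u₁ ω).InClass α s ε T ∧
          Tendsto (fun N : ℕ => RoughWave.supNorm (RoughWave.wInfNorm (-α - ε)) T
            (RoughWave.stochConvTrunc α β N ω - RoughWave.stochConv α β ω)) atTop (𝓝 0) ∧
          Tendsto (fun N : ℕ => RoughWave.supNorm (RoughWave.wInfNorm (-2 * α - ε)) T
            (RoughWave.wickTrunc α β N ω - RoughWave.wick α β ω)) atTop (𝓝 0) ∧
          Tendsto (fun N : ℕ => RoughWave.supNorm (RoughWave.wInfNorm (RoughWave.sAlpha α - ε)) T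
            (RoughWave.secondOrderTrunc α β N ω - RoughWave.secondOrder α β ω)) atTop (𝓝 0)) ∧
        -- local existence and uniqueness up to an almost surely positive stopping time
        (∃ T : Ω → ℝ≥0,
          IsStoppingTime (RoughWave.noiseFiltration P β hβ.measurable)
            (fun ω => (T ω : WithTop ℝ≥0)) ∧
          ∀ᵐ ω ∂P, 0 < T ω ∧
            ∃ v, RoughWave.IsUniqueSolution σ (T ω) (RoughWave.randomData α β u₀ u₁ ω) v)) ∧
      -- continuous dependence of the solution on the enhanced data set
      (∀ T : ℝ, 0 < T → ∀ Ξ : RoughWave.EnhancedData, Ξ.InClass α s ε T →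
        ∀ v, RoughWave.IsSolution σ T Ξ v → ∀ δ : ℝ, 0 < δ → ∃ η > 0,
          ∀ Ξ' : RoughWave.EnhancedData, Ξ'.InClass α s ε T →
            RoughWave.enhancedDist α s ε T Ξ Ξ' < ENNReal.ofReal η →
            ∃ v', RoughWave.IsUniqueSolution σ T Ξ' v' ∧
              RoughWave.supNorm (RoughWave.hsNorm σ) T (v' - v) < ENNReal.ofReal δ) := by
  have hsα : RoughWave.sAlpha α = 5 / 4 - 2 * α := by
    rw [RoughWave.sAlpha, min_eq_right (by linarith)]; ring
  refine ⟨min s (min (5 / 4 - 2 * α) (1 / 2)), lt_min hs (lt_min (by linarith) (by linarith)),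
    fun σ hασ hσ => ?_⟩
  obtain ⟨hσs, hσ2, hσ3⟩ : σ < s ∧ σ < 5 / 4 - 2 * α ∧ σ < 1 / 2 := by
    simpa only [lt_min_iff] using hσ
  refine ⟨min (1 / 2) (min (σ - α) (5 / 4 - 2 * α - σ)),
    lt_min (by norm_num) (lt_min (by linarith) (by linarith)), fun ε hε hε0 => ?_⟩
  obtain ⟨hε1, hε2, hε3⟩ : ε < 1 / 2 ∧ ε < σ - α ∧ ε < 5 / 4 - 2 * α - σ := by
    simpa only [lt_min_iff] using hε0
  have hb : σ ≤ RoughWave.sAlpha α - ε := by rw [hsα]; linarith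
  refine ⟨fun Ω _ P _ β hβ u₀ u₁ h0 h1 => ⟨?_, ?_⟩, fun T hT Ξ hΞ v hv δ hδ => ?_⟩
  · obtain ⟨Ω₀, G, -, -, -, -, hG0, -, hgood⟩ := RoughWave.exists_good_event hβ hα hα' hε hε1
    filter_upwards [(ae_iff.2 hG0 : ∀ᵐ ω ∂P, ω ∈ G)] with ω hω T _
    exact ⟨RoughWave.inClass_randomData h0 h1 (hgood ω hω T),
      RoughWave.tendsto_of_goodPath (hgood ω hω T)⟩
  · exact RoughWave.exists_stopping_solution hβ hα hα' hε hε1 (by linarith) hσ3.le hσs.le hb h0 h1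
  · exact RoughWave.exists_solution_near (by linarith) (by linarith) hσ3.le hσs.le hb hT hΞ hv hδ
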